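/- Let $F$ be Thompson's group of orientation-preserving piecewise linear homeomorphisms of $[0,1]$ with finitely many break points, all dyadic, and all slopes integer powers of $2$; let $F$ act on the set $S$ of dyadic rationals in the open interval $(0,1)$ by $f\cdot s=f(s)$. Let $\mathrm{Mat}_S(\mathbb Z)$ be the ring of $S\times S$ integer matrices with finitely many non-zero entries in each row and each column, $\mathrm{Mat}^0_S(\mathbb Z)$ its two-sided ideal of matrices with only finitely many non-zero entries, $E_{s,t}$ the elementary matrices, and $\varphi_0:\mathbb Z[F]\to\mathrm{Mat}_S(\mathbb Z)$ the ring homomorphism sending $f\in F$ to its permutation matrix $\sum_{s\in S}E_{f(s),s}$. Let $R=\mathbb Z[F]\ltimes\mathrm{Mat}^0_S(\mathbb Z)$, that is, the abelian group $\mathbb Z[F]\oplus\mathrm{Mat}^0_S(\mathbb Z)$ with the multiplication $$(a,m)(a',m')=(aa',\ \varphi_0(a)m'+m\varphi_0(a')+mm').$$ Let $\mathrm{St}_4(R)$ be the Steinberg group, generated by $e_{ij}(r)$ ($1\le i\ne j\le 4$, $r\in R$) subject to $e_{ij}(r)e_{ij}(r')=e_{ij}(r+r')$, $[e_{ij}(r),e_{jk}(r')]=e_{ik}(rr')$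 for $i,j,k$ distinct, and $[e_{ij}(r),e_{pq}(r')]=1$ for $j\ne p$, $i\ne q$. Fix $s_0,s\in S$, put $E=E_{s_0,s_0}$ and $$\Gamma_0=\mathrm{St}_4(R)/\langle\langle \tilde r(E)\rangle\rangle,\qquad \tilde r(E)=\bigl(e_{12}(-E)\,e_{21}(E)\,e_{12}(-E)\bigr)^4,$$ where $\langle\langle\cdot\rangle\rangle$ denotes the normal closure. Let $g=e_{12}(1)$ and $h=e_{34}(E_{s,s})$ in $\Gamma_0$, let $\Delta_0\le\Gamma_0$ be the subgroup generated by all $e_{ij}(x)$ with $x\in\mathrm{Mat}^0_S(\mathbb Z)$, and let $\Gamma$ be the quotient of the free product $\Gamma_0*\Gamma_0$ by the two relations $\rho_1(g)=\rho_2(h)$ and $\rho_2(g)=\rho_1(h)$, where $\rho_1,\rho_2:\Gamma_0\to\Gamma$ are the maps induced by the inclusions of the two free factors. Let $\mathrm{SL}_\infty(\mathbb Z)$ be the group of invertible $\mathbb N\times\mathbb N$ integer matrices that differ from the identity in finitely many places and have determinant $1$. Then: 1. $\Gamma$ is finitely presented. 2. $g$ and $h$ commute and freely generate a subgroup $\mathbb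 Z^2$ of $\Gamma_0$, and $\Gamma$ is the amalgamated product (with structure maps $\rho_1,\rho_2$) of two copies of $\Gamma_0$ over $\mathbb Z^2$, where the standard basis of $\mathbb Z^2$ is sent to $(g,h)$ in the first copy and to $(h,g)$ in the second; in particular $\rho_1$ and $\rho_2$ are injective. 3. $\Gamma$ contains $\mathrm{SL}_\infty(\mathbb Z)$ and is normally generated by it: there is an injective homomorphism $\mathrm{SL}_\infty(\mathbb Z)\to\Gamma$ with image $\rho_1(\Delta_0)$, and the normal closure of this image is $\Gamma$. -/

import Mathlib

noncomputable section

namespace CrazyGroup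

/-! ### Infinite integer matrices -/

theorem exists_ne_zero_of_finsum {ι : Type*} {f : ι → ℤ} (h : ∑ᶠ j, f j ≠ 0) :
    ∃ j, f j ≠ 0 := by
  by_contra! hf
  exact h (by simp [hf])

/-- `Mat_S(ℤ)`: matrices indexed by `S` with finitely many non-zero entries in each row and
each column. -/
@[ext]
structure RCMatrix (S : Type*) where
  entry : Matrix S S ℤ
  row_finite : ∀ i, {j | entry i j ≠ 0}.Finite
  col_finite : ∀ j, {i | entry i j ≠ 0}.Finite

namespace RCMatrix

variable {S : Type*}

instance : Zero (RCMatrix S) := ⟨⟨0, by simp, by simp⟩⟩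

open Classical in
instance : One (RCMatrix S) where
  one :=
    { entry := 1
      row_finite := fun i => (Set.finite_singleton i).subset fun j hj => by
        by_contra h
        exact hj (Matrix.one_apply_ne fun e => h e.symm)
      col_finite := fun j => (Set.finite_singleton j).subset fun i hi => by
        by_contra h
        exact hi (Matrix.one_apply_ne h) }

instance : Add (RCMatrix S) where
  add A B :=
    { entry := A.entry + B.entry
      row_finite := fun i => ((A.row_finite i).union (B.row_finite i)).subset fun j hj => by
        by_contra h
        simp only [Set.mem_union, Set.mem_ofPred_eq, not_or, not_not] at h
        exact hj (by simp [h.1, h.2])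
      col_finite := fun j => ((A.col_finite j).union (B.col_finite j)).subset fun i hi => by
        by_contra h
        simp only [Set.mem_union, Set.mem_ofPred_eq, not_or, not_not] at h
        exact hi (by simp [h.1, h.2]) }

instance : Neg (RCMatrix S) where
  neg A :=
    { entry := -A.entry
      row_finite := fun i => by simpa using A.row_finite i
      col_finite := fun j => by simpa using A.col_finite j }

/-- The usual matrix product; for every `i` and `k` only finitely many `j` contribute. -/
instance : Mul (RCMatrix S) where
  mul A B :=
    { entry := fun i k => ∑ᶠ j, A.entry i j * B.entry j k
      row_finite := fun i =>
        ((A.row_finite i).biUnion fun j _ => B.row_finite j).subset fun k hk => by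
          obtain ⟨j, hj⟩ := exists_ne_zero_of_finsum hk
          exact Set.mem_biUnion (left_ne_zero_of_mul hj) (right_ne_zero_of_mul hj)
      col_finite := fun k =>
        ((B.col_finite k).biUnion fun j _ => A.col_finite j).subset fun i hi => by
          obtain ⟨j, hj⟩ := exists_ne_zero_of_finsum hi
          exact Set.mem_biUnion (right_ne_zero_of_mul hj) (left_ne_zero_of_mul hj) }

@[simp] theorem zero_entry (i j : S) : (0 : RCMatrix S).entry i j = 0 := rfl

open Classical in
theorem one_entry (i j : S) : (1 : RCMatrix S).entry i j = if i = j then 1 else 0 :=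
  Matrix.one_apply

@[simp] theorem add_entry (A B : RCMatrix S) (i j : S) :
    (A + B).entry i j = A.entry i j + B.entry i j := rfl

@[simp] theorem neg_entry (A : RCMatrix S) (i j : S) : (-A).entry i j = -A.entry i j := rfl

theorem mul_entry (A B : RCMatrix S) (i k : S) :
    (A * B).entry i k = ∑ᶠ j, A.entry i j * B.entry j k := rfl

/-- The `j`-th column of a matrix, as an element of `ℤ^{⊕S}`. -/
def col (A : RCMatrix S) (j : S) : S →₀ ℤ :=
  Finsupp.onFinset (A.col_finite j).toFinset (fun i => A.entry i j) (by simp)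

@[simp] theorem col_apply (A : RCMatrix S) (i j : S) : A.col j i = A.entry i j := rfl

/-- The natural action of a matrix on `ℤ^{⊕S}`. -/
def toEnd (A : RCMatrix S) : Module.End ℤ (S →₀ ℤ) := Finsupp.linearCombination ℤ A.col

theorem toEnd_single (A : RCMatrix S) (i j : S) :
    A.toEnd (Finsupp.single j 1) i = A.entry i j := by
  simp [toEnd]

theorem toEnd_injective : Function.Injective (toEnd : RCMatrix S → _) := fun A B h => by
  ext i j
  rw [← toEnd_single, ← toEnd_single, h]

theorem end_ext {f g : Module.End ℤ (S →₀ ℤ)}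
    (h : ∀ i j, f (Finsupp.single j 1) i = g (Finsupp.single j 1) i) : f = g := by
  ext j i
  simpa using h i j

theorem toEnd_add (A B : RCMatrix S) : (A + B).toEnd = A.toEnd + B.toEnd :=
  end_ext fun i j => by simp [toEnd_single]

theorem toEnd_one : (1 : RCMatrix S).toEnd = 1 := by
  classical
  exact end_ext fun i j => by
    simp [toEnd_single, one_entry, Finsupp.single_apply, eq_comm]

theorem toEnd_mul (A B : RCMatrix S) : (A * B).toEnd = A.toEnd * B.toEnd := by
  refine end_ext fun i k => ?_
  have h : B.toEnd (Finsupp.single k 1) = B.col k := by simp [toEnd]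
  rw [toEnd_single, mul_entry, Module.End.mul_apply, h, toEnd, Finsupp.linearCombination_apply,
    Finsupp.sum, Finsupp.finsetSum_apply, finsum_eq_sum_of_support_subset]
  · exact Finset.sum_congr rfl fun j _ => by simp [mul_comm]
  · intro j hj
    simpa using right_ne_zero_of_mul hj

instance : Ring (RCMatrix S) where
  add_assoc A B C := by ext; simp [add_assoc]
  zero_add A := by ext; simp
  add_zero A := by ext; simp
  add_comm A B := by ext; simp [add_comm]
  neg_add_cancel A := by ext; simp
  mul_assoc A B C := toEnd_injective (by simp only [toEnd_mul, mul_assoc])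
  one_mul A := toEnd_injective (by simp only [toEnd_mul, toEnd_one, one_mul])
  mul_one A := toEnd_injective (by simp only [toEnd_mul, toEnd_one, mul_one])
  left_distrib A B C := toEnd_injective (by simp only [toEnd_mul, toEnd_add, mul_add])
  right_distrib A B C := toEnd_injective (by simp only [toEnd_mul, toEnd_add, add_mul])
  zero_mul A := by ext; simp [mul_entry]
  mul_zero A := by ext; simp [mul_entry]
  nsmul := nsmulRec
  zsmul := zsmulRec

open Classical in
/-- The elementary matrix `E_{s,t}`. -/
def E (s t : S) : RCMatrix S where
  entry i j := if i = s ∧ j = t then 1 else 0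
  row_finite i := (Set.finite_singleton t).subset fun j hj => by
    by_contra h
    exact hj (if_neg fun e => h e.2)
  col_finite j := (Set.finite_singleton s).subset fun i hi => by
    by_contra h
    exact hi (if_neg fun e => h e.1)

variable (S) in
/-- `Mat⁰_S(ℤ)`: the two-sided ideal of matrices with finitely many non-zero entries. -/
def finitary : TwoSidedIdeal (RCMatrix S) :=
  TwoSidedIdeal.mk' {A | {p : S × S | A.entry p.1 p.2 ≠ 0}.Finite} (by simp)
    (fun {A B} hA hB => (Set.Finite.union hA hB).subset fun p hp => by
      by_contra h
      simp only [Set.mem_union, Set.mem_ofPred_eq, not_or, not_not] at h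
      exact hp (by simp [h.1, h.2]))
    (fun {A} hA => by simpa using hA)
    (fun {A B} hB => by
      refine (Set.Finite.biUnion (t := fun p : S × S => {i | A.entry i p.1 ≠ 0} ×ˢ {p.2}) hB
        fun p _ => (A.col_finite p.1).prod (Set.finite_singleton p.2)).subset ?_
      rintro ⟨i, k⟩ hik
      obtain ⟨j, hj⟩ := exists_ne_zero_of_finsum hik
      exact Set.mem_biUnion (x := (j, k)) (right_ne_zero_of_mul hj)
        ⟨left_ne_zero_of_mul hj, rfl⟩)
    (fun {A B} hA => by
      refine (Set.Finite.biUnion (t := fun p : S × S => {p.1} ×ˢ {k | B.entry p.2 k ≠ 0}) hA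
        fun p _ => (Set.finite_singleton p.1).prod (B.row_finite p.2)).subset ?_
      rintro ⟨i, k⟩ hik
      obtain ⟨j, hj⟩ := exists_ne_zero_of_finsum hik
      exact Set.mem_biUnion (x := (i, j)) (left_ne_zero_of_mul hj)
        ⟨rfl, right_ne_zero_of_mul hj⟩)

theorem mem_finitary {A : RCMatrix S} :
    A ∈ finitary S ↔ {p : S × S | A.entry p.1 p.2 ≠ 0}.Finite :=
  TwoSidedIdeal.mem_mk' _ _ _ _ _ _ _

theorem E_mem_finitary (s t : S) : E s t ∈ finitary S :=
  mem_finitary.2 <| (Set.finite_singleton (s, t)).subset fun p hp => by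
    by_contra h
    exact hp (if_neg fun e => h (Prod.ext e.1 e.2))

section Action

variable {G : Type*} [Group G] [MulAction G S]

open Classical in
/-- The permutation matrix `∑_s E_{gs,s}` of `g`. -/
def perm (g : G) : RCMatrix S where
  entry i j := if i = g • j then 1 else 0
  row_finite i := (Set.finite_singleton (g⁻¹ • i)).subset fun j hj => by
    by_contra h
    exact hj (if_neg fun e => h (by simp [e]))
  col_finite j := (Set.finite_singleton (g • j)).subset fun i hi => by
    by_contra h
    exact hi (if_neg h)

theorem toEnd_perm (g : G) (j : S) :
    (perm g : RCMatrix S).toEnd (Finsupp.single j 1) = Finsupp.single (g • j) 1 := by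
  classical
  ext i
  rw [toEnd_single]
  simp [perm, Finsupp.single_apply, eq_comm]

end Action

/-- The permutation matrices form a representation of `G`. -/
def permHom (G S : Type*) [Group G] [MulAction G S] : G →* RCMatrix S where
  toFun := perm
  map_one' := toEnd_injective <| end_ext fun i j => by rw [toEnd_perm, toEnd_one]; simp
  map_mul' g h := toEnd_injective <| end_ext fun i j => by
    rw [toEnd_perm, toEnd_mul, Module.End.mul_apply, toEnd_perm, toEnd_perm, mul_smul]

/-- The ring homomorphism `φ₀ : ℤ[G] → Mat_S(ℤ)` associated with the action of `G` on `S`. -/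
def phi (G S : Type*) [Group G] [MulAction G S] : MonoidAlgebra ℤ G →+* RCMatrix S :=
  MonoidAlgebra.liftNCRingHom (Int.castRingHom (RCMatrix S)) (permHom G S)
    fun n _ => Int.cast_commute n _

end RCMatrix

/-! ### The ring `R_{G,S} = ℤ[G] ⋉ Mat⁰_S(ℤ)` -/

/-- The underlying set `ℤ[G] ⊕ Mat⁰_S(ℤ)` of the semi-direct product. -/
@[ext]
structure CrazyRing (G S : Type*) [Group G] [MulAction G S] where
  grp : MonoidAlgebra ℤ G
  mat : RCMatrix S
  mat_mem : mat ∈ RCMatrix.finitary S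

namespace CrazyRing

variable {G S : Type*} [Group G] [MulAction G S]

instance : Zero (CrazyRing G S) := ⟨⟨0, 0, zero_mem _⟩⟩

instance : One (CrazyRing G S) := ⟨⟨1, 0, zero_mem _⟩⟩

instance : Add (CrazyRing G S) :=
  ⟨fun a b => ⟨a.grp + b.grp, a.mat + b.mat, add_mem a.mat_mem b.mat_mem⟩⟩

instance : Neg (CrazyRing G S) := ⟨fun a => ⟨-a.grp, -a.mat, neg_mem a.mat_mem⟩⟩

/-- `(f, m) (f', m') = (f f', φ₀(f) m' + m φ₀(f') + m m')`. -/
instance : Mul (CrazyRing G S) where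
  mul a b :=
    { grp := a.grp * b.grp
      mat := RCMatrix.phi G S a.grp * b.mat + a.mat * RCMatrix.phi G S b.grp + a.mat * b.mat
      mat_mem := add_mem (add_mem (TwoSidedIdeal.mul_mem_left _ _ _ b.mat_mem)
        (TwoSidedIdeal.mul_mem_right _ _ _ a.mat_mem))
        (TwoSidedIdeal.mul_mem_left _ _ _ b.mat_mem) }

@[simp] theorem zero_grp : (0 : CrazyRing G S).grp = 0 := rfl
@[simp] theorem zero_mat : (0 : CrazyRing G S).mat = 0 := rfl
@[simp] theorem one_grp : (1 : CrazyRing G S).grp = 1 := rfl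
@[simp] theorem one_mat : (1 : CrazyRing G S).mat = 0 := rfl
@[simp] theorem add_grp (a b : CrazyRing G S) : (a + b).grp = a.grp + b.grp := rfl
@[simp] theorem add_mat (a b : CrazyRing G S) : (a + b).mat = a.mat + b.mat := rfl
@[simp] theorem neg_grp (a : CrazyRing G S) : (-a).grp = -a.grp := rfl
@[simp] theorem neg_mat (a : CrazyRing G S) : (-a).mat = -a.mat := rfl
@[simp] theorem mul_grp (a b : CrazyRing G S) : (a * b).grp = a.grp * b.grp := rfl
@[simp] theorem mul_mat (a b : CrazyRing G S) :
    (a * b).mat = RCMatrix.phi G S a.grp * b.mat + a.mat * RCMatrix.phi G S b.grp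
      + a.mat * b.mat := rfl

instance : Ring (CrazyRing G S) where
  add_assoc a b c := by ext1 <;> simp [add_assoc]
  zero_add a := by ext1 <;> simp
  add_zero a := by ext1 <;> simp
  add_comm a b := by ext1 <;> simp [add_comm]
  neg_add_cancel a := by ext1 <;> simp
  mul_assoc a b c := by
    ext1
    · simp [mul_assoc]
    · simp only [mul_mat, mul_grp, map_mul]
      noncomm_ring
  one_mul a := by ext1 <;> simp
  mul_one a := by ext1 <;> simp
  left_distrib a b c := by
    ext1
    · simp [mul_add]
    · simp only [mul_mat, add_mat, add_grp, map_add]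
      noncomm_ring
  right_distrib a b c := by
    ext1
    · simp [add_mul]
    · simp only [mul_mat, add_mat, add_grp, map_add]
      noncomm_ring
  zero_mul a := by ext1 <;> simp
  mul_zero a := by ext1 <;> simp
  nsmul := nsmulRec
  zsmul := zsmulRec

variable (G) in
/-- The elementary matrix `E_{s,t}` as an element of `R_{G,S}`. -/
def E (s t : S) : CrazyRing G S := ⟨0, RCMatrix.E s t, RCMatrix.E_mem_finitary s t⟩

end CrazyRing

/-! ### Steinberg groups -/

/-- The symbols `e_{ij}(r)` with `i ≠ j`. -/
structure SteinbergSymbol (n : ℕ) (R : Type*) where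
  i : Fin n
  j : Fin n
  ne : i ≠ j
  r : R

/-- The symbol `e_{ij}(r)` as an element of the free group. -/
def SteinbergSymbol.w {n : ℕ} {R : Type*} (i j : Fin n) (hij : i ≠ j) (r : R) :
    FreeGroup (SteinbergSymbol n R) :=
  FreeGroup.of ⟨i, j, hij, r⟩

open SteinbergSymbol commutatorElement in
/-- The Steinberg relations, written as relators. -/
inductive SteinbergRel (n : ℕ) (R : Type*) [Ring R] : FreeGroup (SteinbergSymbol n R) → Prop
  | add (i j : Fin n) (hij : i ≠ j) (r₁ r₂ : R) :
      SteinbergRel n R (w i j hij r₁ * w i j hij r₂ * (w i j hij (r₁ + r₂))⁻¹)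
  | mul (i j k : Fin n) (hij : i ≠ j) (hjk : j ≠ k) (hik : i ≠ k) (r₁ r₂ : R) :
      SteinbergRel n R (⁅w i j hij r₁, w j k hjk r₂⁆ * (w i k hik (r₁ * r₂))⁻¹)
  | comm (i j p q : Fin n) (hij : i ≠ j) (hpq : p ≠ q) (hjp : j ≠ p) (hiq : i ≠ q) (r₁ r₂ : R) :
      SteinbergRel n R ⁅w i j hij r₁, w p q hpq r₂⁆

/-- The Steinberg group `St_n(R)`. -/
abbrev Steinberg (n : ℕ) (R : Type*) [Ring R] : Type _ :=
  PresentedGroup {w : FreeGroup (SteinbergSymbol n R) | SteinbergRel n R w}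

/-- The generator `e_{ij}(r)` of `St_n(R)`, with indices running from `0` to `n - 1`. -/
def Steinberg.e {n : ℕ} {R : Type*} [Ring R] (i j : Fin n) (hij : i ≠ j) (r : R) :
    Steinberg n R :=
  PresentedGroup.of ⟨i, j, hij, r⟩

/-- `r̃(x) = (e₁₂(-x) e₂₁(x) e₁₂(-x))⁴` in `St_4(R)`. -/
def Steinberg.rTilde {R : Type*} [Ring R] (x : R) : Steinberg 4 R :=
  (Steinberg.e 0 1 (by decide) (-x) * Steinberg.e 1 0 (by decide) x
    * Steinberg.e 0 1 (by decide) (-x)) ^ 4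

/-! ### The groups `Γ₀`, `Δ₀` and `Γ` -/

section Groups

variable (G : Type*) {S : Type*} [Group G] [MulAction G S]

/-- `Γ₀ = St_4(R_{G,S}) / ⟨r̃(E)⟩` with `E = E_{s₀,s₀}`. -/
abbrev Gamma0 (s₀ : S) : Type _ :=
  Steinberg 4 (CrazyRing G S) ⧸
    Subgroup.normalClosure {Steinberg.rTilde (CrazyRing.E G s₀ s₀)}

/-- The image of `e_{ij}(r)` in `Γ₀`. -/
def Gamma0.e (s₀ : S) (i j : Fin 4) (hij : i ≠ j) (r : CrazyRing G S) : Gamma0 G s₀ :=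
  QuotientGroup.mk (Steinberg.e i j hij r)

/-- `g = e₁₂(1)`. -/
def Gamma0.g (s₀ : S) : Gamma0 G s₀ := Gamma0.e G s₀ 0 1 (by decide) 1

/-- `h = e₃₄(E_{s,s})`. -/
def Gamma0.h (s₀ s : S) : Gamma0 G s₀ := Gamma0.e G s₀ 2 3 (by decide) (CrazyRing.E G s s)

/-- `Δ₀`, generated by the `e_{ij}(x)` with `x` in the copy of `Mat⁰_S(ℤ)` in `R_{G,S}`. -/
def Delta0 (s₀ : S) : Subgroup (Gamma0 G s₀) :=
  Subgroup.closure {y | ∃ (i j : Fin 4) (hij : i ≠ j) (x : CrazyRing G S),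
    x.grp = 0 ∧ y = Gamma0.e G s₀ i j hij x}

/-- `Γ = Γ₀ * Γ₀ / ⟨ρ₁(g) = ρ₂(h), ρ₂(g) = ρ₁(h)⟩`. -/
abbrev Gamma (s₀ s : S) : Type _ :=
  Monoid.Coprod (Gamma0 G s₀) (Gamma0 G s₀) ⧸ Subgroup.normalClosure
    ({Monoid.Coprod.inl (Gamma0.g G s₀) * (Monoid.Coprod.inr (Gamma0.h G s₀ s))⁻¹,
      Monoid.Coprod.inr (Gamma0.g G s₀) * (Monoid.Coprod.inl (Gamma0.h G s₀ s))⁻¹} :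
      Set (Monoid.Coprod (Gamma0 G s₀) (Gamma0 G s₀)))

/-- The map `ρ₁ : Γ₀ → Γ`. -/
def rho₁ (s₀ s : S) : Gamma0 G s₀ →* Gamma G s₀ s :=
  (QuotientGroup.mk' _).comp Monoid.Coprod.inl

/-- The map `ρ₂ : Γ₀ → Γ`. -/
def rho₂ (s₀ s : S) : Gamma0 G s₀ →* Gamma G s₀ s :=
  (QuotientGroup.mk' _).comp Monoid.Coprod.inr

end Groups

/-! ### The group `SL_∞(ℤ)` -/

/-- The upper left `n × n` block of an infinite matrix. -/
def block (n : ℕ) (A : RCMatrix ℕ) : Matrix (Fin n) (Fin n) ℤ :=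
  Matrix.of fun i j => A.entry i j

/-- The matrix agrees with the identity outside its upper left `n × n` block. -/
def IsOneOutside (n : ℕ) (A : RCMatrix ℕ) : Prop :=
  ∀ i j, n ≤ i ∨ n ≤ j → A.entry i j = (1 : RCMatrix ℕ).entry i j

theorem IsOneOutside.mono {m n : ℕ} {A : RCMatrix ℕ} (h : IsOneOutside m A) (hmn : m ≤ n) :
    IsOneOutside n A :=
  fun i j hij => h i j (hij.imp hmn.trans hmn.trans)

theorem IsOneOutside.one_mul_row {n : ℕ} {A : RCMatrix ℕ} (h : IsOneOutside n A) (B : RCMatrix ℕ)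
    {i : ℕ} (hi : n ≤ i) (k : ℕ) : (A * B).entry i k = B.entry i k := by
  conv_rhs => rw [← one_mul B]
  simp only [RCMatrix.mul_entry, h i _ (Or.inl hi)]

theorem IsOneOutside.mul_one_col {n : ℕ} {B : RCMatrix ℕ} (h : IsOneOutside n B) (A : RCMatrix ℕ)
    {k : ℕ} (hk : n ≤ k) (i : ℕ) : (A * B).entry i k = A.entry i k := by
  conv_rhs => rw [← mul_one A]
  simp only [RCMatrix.mul_entry, h _ k (Or.inr hk)]

theorem IsOneOutside.mul {n : ℕ} {A B : RCMatrix ℕ} (hA : IsOneOutside n A)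
    (hB : IsOneOutside n B) : IsOneOutside n (A * B) := by
  rintro i j (h | h)
  · rw [hA.one_mul_row B h, hB i j (Or.inl h)]
  · rw [hB.mul_one_col A h, hA i j (Or.inr h)]

theorem IsOneOutside.inv {n : ℕ} {u : (RCMatrix ℕ)ˣ} (h : IsOneOutside n u) :
    IsOneOutside n ↑u⁻¹ := by
  rintro i j (hi | hj)
  · rw [← h.one_mul_row _ hi, Units.mul_inv]
  · rw [← h.mul_one_col _ hj, Units.inv_mul]

theorem block_one (n : ℕ) : block n 1 = 1 := by
  ext i j
  simp [block, RCMatrix.one_entry, Matrix.one_apply, Fin.ext_iff]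

theorem block_mul {n : ℕ} {A : RCMatrix ℕ} (hA : IsOneOutside n A) (B : RCMatrix ℕ) :
    block n (A * B) = block n A * block n B := by
  ext i k
  rw [Matrix.mul_apply]
  simp only [block, Matrix.of_apply, RCMatrix.mul_entry]
  rw [finsum_eq_sum_of_support_subset (s := Finset.range n), Finset.sum_range]
  intro j hj
  by_contra hjn
  simp only [Finset.coe_range, Set.mem_Iio, not_lt] at hjn
  refine left_ne_zero_of_mul hj ?_
  rw [hA _ _ (Or.inr hjn), RCMatrix.one_entry, if_neg]
  have := i.2
  omega

/-- `SL_∞(ℤ)`: the invertible `ℕ × ℕ` matrices over `ℤ` that differ from the identity matrix only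
at finitely many places and have determinant one. The determinant of such a matrix is that of any
sufficiently large upper left block. -/
def SLInf : Subgroup (RCMatrix ℕ)ˣ where
  carrier := {u | (∃ n, IsOneOutside n u) ∧ ∀ᶠ n in Filter.atTop, (block n u).det = 1}
  one_mem' := ⟨⟨0, fun _ _ _ => rfl⟩, by simp [block_one]⟩
  mul_mem' := by
    rintro u v ⟨⟨m, hm⟩, hu⟩ ⟨⟨n, hn⟩, hv⟩
    refine ⟨⟨max m n, by
      simpa using (hm.mono (le_max_left m n)).mul (hn.mono (le_max_right m n))⟩, ?_⟩
    filter_upwards [hu, hv, Filter.eventually_ge_atTop m] with k hu hv hk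
    rw [Units.val_mul, block_mul (hm.mono hk), Matrix.det_mul, hu, hv, one_mul]
  inv_mem' := by
    rintro u ⟨⟨m, hm⟩, hu⟩
    refine ⟨⟨m, hm.inv⟩, ?_⟩
    filter_upwards [hu, Filter.eventually_ge_atTop m] with k hu hk
    have h := congrArg Matrix.det (block_mul (hm.mono hk) ↑u⁻¹)
    rw [Units.mul_inv, block_one, Matrix.det_mul, hu, Matrix.det_one, one_mul] at h
    exact h.symm

/-! ### Thompson's group `F` and the dyadic points of `(0,1)` -/

/-- Dyadic rational numbers, as a subset of the reals. -/
def IsDyadic (x : ℝ) : Prop := ∃ (a : ℤ) (k : ℕ), x = a / 2 ^ k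

theorem IsDyadic.add {x y : ℝ} (hx : IsDyadic x) (hy : IsDyadic y) : IsDyadic (x + y) := by
  obtain ⟨a, k, rfl⟩ := hx
  obtain ⟨b, l, rfl⟩ := hy
  refine ⟨a * 2 ^ l + b * 2 ^ k, k + l, ?_⟩
  push_cast
  rw [pow_add]
  field_simp

theorem IsDyadic.neg {x : ℝ} (hx : IsDyadic x) : IsDyadic (-x) := by
  obtain ⟨a, k, rfl⟩ := hx
  exact ⟨-a, k, by push_cast; ring⟩

theorem IsDyadic.zpow_mul {x : ℝ} (hx : IsDyadic x) (n : ℤ) : IsDyadic (2 ^ n * x) := by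
  obtain ⟨a, k, rfl⟩ := hx
  obtain ⟨m, rfl | rfl⟩ := n.eq_nat_or_neg
  · exact ⟨2 ^ m * a, k, by push_cast; rw [zpow_natCast]; ring⟩
  · refine ⟨a, m + k, ?_⟩
    rw [zpow_neg, zpow_natCast, pow_add]
    field_simp

/-- `f` is piecewise linear, with finitely many break points, all of them dyadic, and with all
slopes powers of two: on each subinterval of `[0,1]` without break points in its interior,
`f` is affine with slope `2 ^ k` for some integer `k`. -/
def IsThompson (f : unitInterval ≃o unitInterval) : Prop :=
  ∃ B : Set unitInterval, B.Finite ∧ (∀ b ∈ B, IsDyadic b) ∧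
    ∀ a b : unitInterval, a < b → Disjoint B (Set.Ioo a b) →
      ∃ k : ℤ, ∀ x ∈ Set.Icc a b, (f x : ℝ) = f a + 2 ^ k * ((x : ℝ) - a)

theorem IsThompson.isDyadic {f : unitInterval ≃o unitInterval} (hf : IsThompson f)
    {x : unitInterval} (hx : IsDyadic x) : IsDyadic (f x) := by
  obtain ⟨B, hB, hBd, h⟩ := hf
  induction hn : (B ∩ Set.Ioo 0 x).ncard using Nat.strong_induction_on generalizing x with
  | _ n ih =>
    have hfin (y : unitInterval) : (B ∩ Set.Ioo 0 y).Finite := hB.subset Set.inter_subset_left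
    have step (y : unitInterval) (hy : IsDyadic y) (hfy : IsDyadic (f y)) (hyx : y < x)
        (hd : Disjoint B (Set.Ioo y x)) : IsDyadic (f x) := by
      obtain ⟨k, hk⟩ := h y x hyx hd
      rw [hk x ⟨hyx.le, le_rfl⟩, sub_eq_add_neg]
      exact hfy.add ((hx.add hy.neg).zpow_mul k)
    have f0 : f 0 = 0 := map_bot f
    have d0 : IsDyadic ((0 : unitInterval) : ℝ) := ⟨0, 0, by simp⟩
    by_cases hne : (B ∩ Set.Ioo 0 x).Nonempty
    · obtain ⟨y, hy, hmax⟩ := Set.exists_max_image _ id (hfin x) hne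
      refine step y (hBd y hy.1) (ih _ ?_ (hBd y hy.1) rfl) hy.2.2 ?_
      · rw [← hn]
        refine Set.ncard_lt_ncard ⟨fun z hz => ⟨hz.1, hz.2.1, hz.2.2.trans hy.2.2⟩, fun hs => ?_⟩
          (hfin x)
        exact lt_irrefl y (hs hy).2.2
      · exact Set.disjoint_left.2 fun z hz hzx =>
          not_lt_of_ge (hmax z ⟨hz, hy.2.1.trans hzx.1, hzx.2⟩) hzx.1
    · rcases eq_or_lt_of_le (show (0 : unitInterval) ≤ x from bot_le) with h0 | h0
      · rw [← h0, f0]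
        exact d0
      · exact step 0 d0 (by rw [f0]; exact d0) h0 (Set.disjoint_iff_inter_eq_empty.2
          (Set.not_nonempty_iff_eq_empty.1 hne))

theorem IsThompson.inv {f : unitInterval ≃o unitInterval} (hf : IsThompson f) :
    IsThompson f⁻¹ := by
  have hd := @IsThompson.isDyadic f hf
  obtain ⟨B, hB, hBd, h⟩ := hf
  have e (y : unitInterval) : f (f⁻¹ y) = y := RelIso.apply_inv_self f y
  have lt {x y : unitInterval} (hxy : x < y) : f⁻¹ x < f⁻¹ y := (f⁻¹).strictMono hxy
  refine ⟨f '' B, hB.image f, ?_, fun a b hab hdis => ?_⟩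
  · rintro _ ⟨b, hb, rfl⟩
    exact hd (hBd b hb)
  · obtain ⟨k, hk⟩ := h (f⁻¹ a) (f⁻¹ b) (lt hab) (Set.disjoint_left.2 fun z hz hzab =>
      Set.disjoint_left.1 hdis (Set.mem_image_of_mem f hz)
        ⟨by simpa [e] using f.strictMono hzab.1, by simpa [e] using f.strictMono hzab.2⟩)
    refine ⟨-k, fun x hx => ?_⟩
    have := hk (f⁻¹ x) ⟨(f⁻¹).monotone hx.1, (f⁻¹).monotone hx.2⟩
    rw [e, e] at this
    rw [this, zpow_neg]
    field_simp
    ring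

theorem IsThompson.mul {f g : unitInterval ≃o unitInterval} (hf : IsThompson f)
    (hg : IsThompson g) : IsThompson (f * g) := by
  have hd := @IsThompson.isDyadic _ hg.inv
  obtain ⟨B, hB, hBd, h⟩ := hf
  obtain ⟨C, hC, hCd, h'⟩ := hg
  refine ⟨C ∪ (g⁻¹ : unitInterval ≃o unitInterval) '' B, hC.union (hB.image _), ?_,
    fun a b hab hdis => ?_⟩
  · rintro _ (hb | ⟨b, hb, rfl⟩)
    · exact hCd _ hb
    · exact hd (hBd b hb)
  · rw [Set.disjoint_union_left] at hdis
    obtain ⟨l, hl⟩ := h' a b hab hdis.1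
    obtain ⟨k, hk⟩ := h (g a) (g b) (g.strictMono hab) (Set.disjoint_left.2 fun z hz hzab =>
      Set.disjoint_left.1 hdis.2 (Set.mem_image_of_mem (g⁻¹ : unitInterval ≃o unitInterval) hz)
        ⟨by simpa using (g⁻¹ : unitInterval ≃o unitInterval).strictMono hzab.1,
          by simpa using (g⁻¹ : unitInterval ≃o unitInterval).strictMono hzab.2⟩)
    refine ⟨k + l, fun x hx => ?_⟩
    rw [RelIso.mul_apply, RelIso.mul_apply, hk (g x) ⟨g.monotone hx.1, g.monotone hx.2⟩, hl x hx,
      zpow_add₀ two_ne_zero]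
    ring

/-- Thompson's group `F`: the orientation preserving piecewise linear homeomorphisms of `[0,1]`
with dyadic break points and slopes powers of two. -/
def ThompsonF : Subgroup (unitInterval ≃o unitInterval) where
  carrier := {f | IsThompson f}
  one_mem' := ⟨∅, Set.finite_empty, by simp, fun a b _ _ => ⟨0, fun x _ => by simp⟩⟩
  mul_mem' := IsThompson.mul
  inv_mem' := IsThompson.inv

/-- The dyadic points of the open interval `(0,1)`. -/
def DyadicPoint : Type := {x : unitInterval // 0 < x ∧ x < 1 ∧ IsDyadic x}

/-- `F` acts on the dyadic points of `(0,1)` by evaluation. -/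
instance : MulAction ThompsonF DyadicPoint where
  smul f x := ⟨(f : unitInterval ≃o unitInterval) x.1,
    by
      have h := (f : unitInterval ≃o unitInterval).strictMono x.2.1
      rwa [show (f : unitInterval ≃o unitInterval) 0 = 0 from
        map_bot (f : unitInterval ≃o unitInterval)] at h,
    by
      have h := (f : unitInterval ≃o unitInterval).strictMono x.2.2.1
      rwa [show (f : unitInterval ≃o unitInterval) 1 = 1 from
        map_top (f : unitInterval ≃o unitInterval)] at h,
    IsThompson.isDyadic f.2 x.2.2.2⟩
  one_smul _ := rfl
  mul_smul _ _ _ := rfl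

end CrazyGroup

end

noncomputable section

namespace CrazyGroup

/-! ### Commutator identities -/

section Commutators

open commutatorElement

variable {P : Type*} [Group P]

/-! Three facts carry the theorem.

Finite presentability. `Γ` arises from two copies of `St_4(R)` by finitely many relations, so it is
enough that `St_4` of a finitely presented ring is a finitely presented group
(`Steinberg.isFinitelyPresented`) and that `R` is a finitely presented ring. For the first, impose
the Steinberg relations over the free ring on a finite set `X` only for words of length at most `N`,
with `N` larger than the size of `X`, and derive all others by induction on the length
(`WordSteinberg.succ`). The hard relation is that `e_ij(p)` and `e_kl(q)` commute for four distinct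
indices and words of total length `N + 2`, because no fifth index is available. Whether they commute
depends only on the cyclic word formed by `p` and the reverse of `q`. Polarizing a conjugation
identity shows that it does not depend on the order of the letters either. By the pigeonhole
principle the letters can be arranged so that `p` and `q` overlap in two letters, and then
commutation follows from the conjugation identity. For the ring, Thompson's group has two generators
and two relations and acts transitively on the dyadic points; the stabilizer of `1/2` is `F × F`,
and outside it there are at most two double cosets of it. So `R` is presented by `F`, an idempotent
`e = E_{1/2,1/2}` and finitely many relations (`ThompsonRing.exists_hom_of_ringRelators`).

The subgroup `SL_∞(ℤ)`. The elements `e_ij(E_st)` extend to elements `x_ab` with `a`, `b` in `S ×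
{1,2,3,4}` that satisfy all integral Steinberg relations, and the single relation `r̃(E) = 1` makes
every Weyl element have fourth power one. A group with such generators acts faithfully on `ℤ^{⊕I}`
as soon as the generators act as elementary matrices (`IntSteinberg.eq_one_of_smul_eq`). This is
proved by peak reduction: the stabilizer of a basis vector is computed by constructing an
equivariant map from primitive vectors to cosets. Hence the natural representation of `Γ₀` is
faithful on `Δ₀`, and after an enumeration of `S × {1,2,3,4}` its image there is that of `SL_∞(ℤ)`,
which is generated by elementary matrices.

The amalgam. The same representation shows `g ^ a * h ^ b ≠ 1` unless `a = b = 0`, so `Γ` is an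
amalgam along injective maps and both copies of `Γ₀` embed. As `g = e_12(1)` normally generates
`Γ₀`, the normal closure of `ρ₁(Δ₀)`, which contains `ρ₁(h) = ρ₂(g)`, contains `ρ₂(Γ₀)`, hence
`ρ₂(h) = ρ₁(g)`, hence everything. -/

theorem _root_.Commute.commutator_right {a b c : P} (hb : Commute a b) (hc : Commute a c) :
    Commute a ⁅b, c⁆ := by
  rw [commutatorElement_def]
  exact ((hb.mul_right hc).mul_right hb.inv_right).mul_right hc.inv_right

theorem _root_.Commute.commutator_left {a b c : P} (ha : Commute a c) (hb : Commute b c) :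
    Commute ⁅a, b⁆ c :=
  (Commute.commutator_right ha.symm hb.symm).symm

theorem conj_eq_commutator_mul (a b : P) : a * b * a⁻¹ = ⁅a, b⁆ * b := by
  simp [commutatorElement_def]

theorem mul_eq_commutator_mul (a b : P) : a * b = ⁅a, b⁆ * b * a := by
  simp [commutatorElement_def]

theorem commutator_conj (g a b : P) : g * ⁅a, b⁆ * g⁻¹ = ⁅g * a * g⁻¹, g * b * g⁻¹⁆ := by
  simp [commutatorElement_def, mul_assoc]

theorem commutator_mul_left' (a b c : P) : ⁅a * b, c⁆ = a * ⁅b, c⁆ * a⁻¹ * ⁅a, c⁆ := by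
  simp [commutatorElement_def, mul_assoc]

theorem commutator_mul_right' (a b c : P) : ⁅a, b * c⁆ = ⁅a, b⁆ * (b * ⁅a, c⁆ * b⁻¹) := by
  simp [commutatorElement_def, mul_assoc]

theorem _root_.Commute.mul_mul_inv_cancel {a b : P} (h : Commute a b) : a * b * a⁻¹ = b := by
  rw [h.eq, mul_inv_cancel_right]

/-- Conjugation by `a` fixes `d` and turns `b` into `⁅a, b⁆ * b`, so it turns `⁅d, b⁆` into `⁅d, ⁅a,
b⁆⁆ * ⁅d, b⁆`. For Steinberg generators this moves a subword from one entry of a commutator to the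
other. -/
theorem commutator_commutator_swap {a b d : P} (h : Commute a d)
    (h' : Commute ⁅a, b⁆ ⁅d, b⁆) : ⁅a, ⁅d, b⁆⁆ = ⁅d, ⁅a, b⁆⁆ := by
  have h1 : a * ⁅d, b⁆ * a⁻¹ = ⁅d, ⁅a, b⁆⁆ * ⁅d, b⁆ := by
    rw [commutator_conj, h.mul_mul_inv_cancel, conj_eq_commutator_mul, commutator_mul_right', h'.mul_mul_inv_cancel]
  rw [conj_eq_commutator_mul] at h1
  exact mul_right_cancel h1

theorem inv_commutator_commutator_swap {a b d : P} (h : Commute a d)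
    (h' : Commute ⁅b, a⁆ ⁅b, d⁆) : ⁅⁅b, d⁆⁻¹, a⁆ = ⁅⁅b, a⁆⁻¹, d⁆ := by
  have h0 : a * b * a⁻¹ = ⁅b, a⁆⁻¹ * b := by simp [commutatorElement_def, mul_assoc]
  have h1 : a * ⁅b, d⁆ * a⁻¹ = ⁅b, d⁆ * ⁅⁅b, a⁆⁻¹, d⁆ := by
    rw [commutator_conj, h0, h.mul_mul_inv_cancel, commutator_mul_left', h'.inv_left.mul_mul_inv_cancel]
  rw [commutatorElement_def ⁅b, d⁆⁻¹ a, inv_inv, mul_assoc, mul_assoc, ← mul_assoc a, h1,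
    inv_mul_cancel_left]

/-- Conjugating two commuting elements `a` and `c` by `g` produces commuting elements. -/
theorem commutator_conj_relation {a c g : P} (h : Commute a c) :
    ⁅a, g⁆⁻¹ * ⁅a, ⁅g, c⁆⁆ * ⁅g, c⁆ = ⁅g, c⁆ * ⁅a, g⁆⁻¹ * ⁅⁅a, g⁆, c⁆ := by
  have h1 : (⁅a, g⁆⁻¹ * a) * (⁅g, c⁆ * c) = (⁅g, c⁆ * c) * (⁅a, g⁆⁻¹ * a) := by
    have e1 : ⁅a, g⁆⁻¹ * a = g * a * g⁻¹ := by simp [commutatorElement_def, mul_assoc]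
    rw [e1, ← conj_eq_commutator_mul]
    have := h.eq
    simp only [mul_assoc, inv_mul_cancel_left]
    rw [← mul_assoc a, this, mul_assoc]
  apply mul_right_cancel (b := a * c)
  calc ⁅a, g⁆⁻¹ * ⁅a, ⁅g, c⁆⁆ * ⁅g, c⁆ * (a * c)
      = ⁅a, g⁆⁻¹ * (⁅a, ⁅g, c⁆⁆ * ⁅g, c⁆ * a) * c := by simp only [mul_assoc]
    _ = (⁅a, g⁆⁻¹ * a) * (⁅g, c⁆ * c) := by rw [← mul_eq_commutator_mul]; simp only [mul_assoc]
    _ = _ := by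
      rw [h1, h.eq]
      simp only [commutatorElement_def ⁅a, g⁆ c, mul_assoc, inv_mul_cancel_left]

/-- Polarization of `commutator_conj_relation`. -/
theorem commutator_mul_commutator_eq_one {a c m₁ m₂ d₁ d₂ : P} (ac : Commute a c)
    (mm : Commute m₁ m₂) (dd : Commute d₁ d₂)
    (am₁ : Commute a m₁) (am₂ : Commute a m₂) (cd₁ : Commute c d₁) (cd₂ : Commute c d₂)
    (k : ∀ m ∈ ({m₁, m₂} : Set P), ∀ d ∈ ({d₁, d₂} : Set P), ∀ z ∈ ({a, c, m₁, m₂, d₁, d₂} : Set P),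
      Commute ⁅m, d⁆ z)
    (h₁ : m₁⁻¹ * ⁅a, d₁⁆ * d₁ = d₁ * m₁⁻¹ * ⁅m₁, c⁆)
    (h₂ : m₂⁻¹ * ⁅a, d₂⁆ * d₂ = d₂ * m₂⁻¹ * ⁅m₂, c⁆)
    (h₃ : (m₁ * m₂)⁻¹ * ⁅a, d₁ * d₂⁆ * (d₁ * d₂) = (d₁ * d₂) * (m₁ * m₂)⁻¹ * ⁅m₁ * m₂, c⁆) :
    ⁅m₁, d₂⁆ * ⁅m₂, d₁⁆ = 1 := by
  -- By `k` each `⁅m, d⁆` is central among the six elements. Conjugating `⁅a, d⁆` by `m` therefore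
  -- changes it only through `⁅m, d⁆`, which has no effect; `F'` is the mirror image.
  have F {m d : P} (hm : m ∈ ({m₁, m₂} : Set P)) (hd : d ∈ ({d₁, d₂} : Set P))
      (am : Commute a m) : Commute ⁅a, d⁆ m := by
    have : m * ⁅a, d⁆ * m⁻¹ = ⁅a, d⁆ := by
      rw [commutator_conj, am.symm.mul_mul_inv_cancel, conj_eq_commutator_mul, commutator_mul_right',
        (k m hm d hd a (by simp)).symm.commutator_eq, one_mul]
      refine Commute.mul_mul_inv_cancel (Commute.commutator_right (k m hm d hd a (by simp)) ?_)
      rcases hd with rfl | rfl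
      · exact k m hm _ (by simp) _ (by simp)
      · exact k m hm _ (by simp) _ (by simp)
    exact (eq_mul_of_mul_inv_eq this).symm
  have F' {m d : P} (hm : m ∈ ({m₁, m₂} : Set P)) (hd : d ∈ ({d₁, d₂} : Set P))
      (cd : Commute c d) : Commute ⁅m, c⁆ d := by
    have e : d * m * d⁻¹ = ⁅m, d⁆⁻¹ * m := by simp [commutatorElement_def, mul_assoc]
    have : d * ⁅m, c⁆ * d⁻¹ = ⁅m, c⁆ := by
      rw [commutator_conj, cd.symm.mul_mul_inv_cancel, e, commutator_mul_left',
        (k m hm d hd c (by simp)).inv_left.commutator_eq, mul_one]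
      refine Commute.mul_mul_inv_cancel (Commute.inv_left (Commute.commutator_right ?_ (k m hm d hd c (by simp))))
      rcases hm with rfl | rfl
      · exact k _ (by simp) d hd _ (by simp)
      · exact k _ (by simp) d hd _ (by simp)
    exact (eq_mul_of_mul_inv_eq this).symm
  -- The three conjugation relations now read `⁅m, d⁆ * ⁅m, c⁆ = ⁅a, d⁆`. The terms with `a` and `c`
  -- are additive while `⁅m, d⁆` is quadratic, so comparing the relation for the products with the
  -- other two leaves exactly the cross terms.
  have G {m d : P} (hF : Commute ⁅a, d⁆ m) (hF' : Commute ⁅m, c⁆ d)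
      (h : m⁻¹ * ⁅a, d⁆ * d = d * m⁻¹ * ⁅m, c⁆) : ⁅m, d⁆ * ⁅m, c⁆ = ⁅a, d⁆ := by
    rw [← hF.inv_right.eq] at h
    have h2 : ⁅a, d⁆ = d * m⁻¹ * ⁅m, c⁆ * d⁻¹ * m := by
      rw [← h]; simp [mul_assoc]
    have h3 : ⁅a, d⁆ * m⁻¹ = d * m⁻¹ * d⁻¹ * ⁅m, c⁆ := by
      rw [h2, mul_inv_cancel_right, mul_assoc _ ⁅m, c⁆, hF'.inv_right.eq]
      simp only [mul_assoc]
    rw [hF.inv_right.eq] at h3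
    rw [eq_mul_of_inv_mul_eq h3, commutatorElement_def m d]
    simp only [mul_assoc]
  have F11 := F (m := m₁) (d := d₁) (by simp) (by simp) am₁
  have F12 := F (m := m₁) (d := d₂) (by simp) (by simp) am₁
  have F21 := F (m := m₂) (d := d₁) (by simp) (by simp) am₂
  have F22 := F (m := m₂) (d := d₂) (by simp) (by simp) am₂
  have F'11 := F' (m := m₁) (d := d₁) (by simp) (by simp) cd₁
  have F'12 := F' (m := m₁) (d := d₂) (by simp) (by simp) cd₂
  have F'21 := F' (m := m₂) (d := d₁) (by simp) (by simp) cd₁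
  have F'22 := F' (m := m₂) (d := d₂) (by simp) (by simp) cd₂
  have G1 := G F11 F'11 h₁
  have G2 := G F22 F'22 h₂
  have k11 := k m₁ (by simp) d₁ (by simp)
  have k12 := k m₁ (by simp) d₂ (by simp)
  have k21 := k m₂ (by simp) d₁ (by simp)
  have k22 := k m₂ (by simp) d₂ (by simp)
  have F2d1 : Commute ⁅a, d₂⁆ d₁ := by
    rw [← G2]; exact (k22 _ (by simp)).mul_left F'21
  have F1d2 : Commute ⁅a, d₁⁆ d₂ := by
    rw [← G1]; exact (k11 _ (by simp)).mul_left F'12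
  have F1a : Commute ⁅a, d₁⁆ a := by
    rw [← G1]; exact (k11 _ (by simp)).mul_left (Commute.commutator_left am₁.symm ac.symm)
  have FF : Commute ⁅a, d₁⁆ ⁅a, d₂⁆ := Commute.commutator_right F1a F1d2
  have F'2m1 : Commute ⁅m₂, c⁆ m₁ := by
    have : ⁅m₂, c⁆ = ⁅m₂, d₂⁆⁻¹ * ⁅a, d₂⁆ := by rw [← G2, inv_mul_cancel_left]
    rw [this]
    exact (k22 _ (by simp)).inv_left.mul_left F12
  have eF : ⁅a, d₁ * d₂⁆ = ⁅a, d₁⁆ * ⁅a, d₂⁆ := by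
    rw [commutator_mul_right', F2d1.symm.mul_mul_inv_cancel]
  have eF' : ⁅m₁ * m₂, c⁆ = ⁅m₂, c⁆ * ⁅m₁, c⁆ := by
    rw [commutator_mul_left', F'2m1.symm.mul_mul_inv_cancel]
  have G3 := G (m := m₁ * m₂) (d := d₁ * d₂)
    (by rw [eF]; exact (F11.mul_right F21).mul_left (F12.mul_right F22))
    (by rw [eF']; exact (F'21.mul_right F'22).mul_left (F'11.mul_right F'12)) h₃
  have eκ : ⁅m₁ * m₂, d₁ * d₂⁆ = ⁅m₂, d₁⁆ * ⁅m₂, d₂⁆ * (⁅m₁, d₁⁆ * ⁅m₁, d₂⁆) := by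
    rw [commutator_mul_left', commutator_mul_right', commutator_mul_right',
      (k22 d₁ (by simp)).symm.mul_mul_inv_cancel, (k12 d₁ (by simp)).symm.mul_mul_inv_cancel,
      ((k21 m₁ (by simp)).mul_left (k22 m₁ (by simp))).symm.mul_mul_inv_cancel]
  rw [eF, eF', eκ, FF.eq, ← G1, ← G2] at G3
  have c1 : Commute ⁅m₁, d₁⁆ ⁅m₂, c⁆ := Commute.commutator_right (k11 _ (by simp)) (k11 _ (by simp))
  have c2 : Commute ⁅m₂, d₂⁆ ⁅m₁, d₁⁆ := Commute.commutator_right (k22 _ (by simp)) (k22 _ (by simp))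
  have c3 : Commute ⁅m₁, d₂⁆ ⁅m₂, d₁⁆ := Commute.commutator_right (k12 _ (by simp)) (k12 _ (by simp))
  have c4 : Commute ⁅m₂, d₂⁆ ⁅m₁, d₂⁆ := Commute.commutator_right (k22 _ (by simp)) (k22 _ (by simp))
  have c5 : Commute ⁅m₁, d₁⁆ ⁅m₁, d₂⁆ := Commute.commutator_right (k11 _ (by simp)) (k11 _ (by simp))
  have h5 : ⁅m₂, d₁⁆ * ⁅m₂, d₂⁆ * (⁅m₁, d₁⁆ * ⁅m₁, d₂⁆) = ⁅m₂, d₂⁆ * ⁅m₁, d₁⁆ := by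
    apply mul_right_cancel (b := ⁅m₂, c⁆ * ⁅m₁, c⁆)
    rw [G3]
    calc ⁅m₂, d₂⁆ * ⁅m₂, c⁆ * (⁅m₁, d₁⁆ * ⁅m₁, c⁆) = ⁅m₂, d₂⁆ * (⁅m₂, c⁆ * ⁅m₁, d₁⁆) * ⁅m₁, c⁆ := by
          simp only [mul_assoc]
      _ = _ := by rw [← c1.eq]; simp only [mul_assoc]
  have h6 : ⁅m₂, d₁⁆ * ⁅m₂, d₂⁆ * (⁅m₁, d₁⁆ * ⁅m₁, d₂⁆)
      = ⁅m₁, d₂⁆ * ⁅m₂, d₁⁆ * (⁅m₂, d₂⁆ * ⁅m₁, d₁⁆) := by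
    rw [c5.eq, c3.eq]
    simp only [mul_assoc]
    rw [← mul_assoc ⁅m₂, d₂⁆ ⁅m₁, d₂⁆, c4.eq]
    simp only [mul_assoc]
  rw [h6] at h5
  exact mul_eq_right.mp h5

theorem commutator_inv_left {a b : P} (h : Commute ⁅a, b⁆ a) : ⁅a⁻¹, b⁆ = ⁅a, b⁆⁻¹ := by
  rw [← h.inv_left.symm.inv_left.mul_mul_inv_cancel]
  simp [commutatorElement_def, mul_assoc]

/-- Associativity of commutators. -/
theorem commutator_assoc {a b c : P} (ac : Commute a c) (h : Commute ⁅a, b⁆ ⁅b, c⁆)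
    (h' : Commute c ⁅b, c⁆) : ⁅a, ⁅b, c⁆⁆ = ⁅⁅a, b⁆, c⁆ := by
  have h1 := commutator_conj_relation (g := b) ac
  have h2 : Commute ⁅⁅a, b⁆, c⁆ ⁅b, c⁆ := Commute.commutator_left h h'
  rw [h.symm.inv_right.eq, mul_assoc, mul_assoc, ← h2.eq] at h1
  exact mul_right_cancel (mul_left_cancel h1)

end Commutators

end CrazyGroup

end

noncomputable section

namespace CrazyGroup

/-! ### Steinberg relations for words of bounded length -/

open commutatorElement

variable {X P : Type*} [Group P]

theorem exists_fin_four_ne (i j k : Fin 4) : ∃ q, q ≠ i ∧ q ≠ j ∧ q ≠ k := by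
  revert i j k; decide

/-- The elements `e i j w`, for `w` a word of length at most `N`, satisfy the Steinberg relations
as far as these do not involve longer words. -/
structure WordSteinberg (N : ℕ) (e : Fin 4 → Fin 4 → List X → P) : Prop where
  mul : ∀ {i j k : Fin 4}, i ≠ j → j ≠ k → i ≠ k → ∀ {u v : List X},
    u.length + v.length ≤ N → ⁅e i j u, e j k v⁆ = e i k (u ++ v)
  comm : ∀ {i j k l : Fin 4}, i ≠ j → k ≠ l → j ≠ k → i ≠ l → ∀ {u v : List X},
    u.length ≤ N → v.length ≤ N → u.length + v.length ≤ N + 1 → Commute (e i j u) (e k l v)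

/-- The elements `e i j p` and `e k l q` commute for all distinct `i`, `j`, `k`, `l`. -/
def DisjointComm (e : Fin 4 → Fin 4 → List X → P) (p q : List X) : Prop :=
  ∀ i j k l : Fin 4, i ≠ j → i ≠ k → i ≠ l → j ≠ k → j ≠ l → k ≠ l → Commute (e i j p) (e k l q)

theorem DisjointComm.symm {e : Fin 4 → Fin 4 → List X → P} {p q : List X}
    (h : DisjointComm e p q) : DisjointComm e q p :=
  fun _ _ _ _ hij hik hil hjk hjl hkl => (h _ _ _ _ hkl hik.symm hjk.symm hil.symm hjl.symm hij).symm

namespace WordSteinberg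

variable {N : ℕ} {e : Fin 4 → Fin 4 → List X → P}

/-- The gain over `comm` is that both words may have length `N`. The last letter of `v` is split off
through the fourth index; it commutes with `u` because `comm` allows total length `N + 1`, and the
rest of `v` is handled by induction. -/
theorem comm_row (h : WordSteinberg N e) (hN : 1 ≤ N) {i j l : Fin 4} (hij : i ≠ j) (hil : i ≠ l)
    (hjl : j ≠ l) {u v : List X} (hu : u.length ≤ N) (hv : v.length ≤ N) :
    Commute (e i j u) (e i l v) := by
  induction v using List.reverseRecOn generalizing l with
  | nil => exact h.comm hij hil hij.symm hil hu hv (by simp; omega)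
  | append_singleton v x ih =>
    obtain ⟨q, hqi, hqj, hql⟩ := exists_fin_four_ne i j l
    simp only [List.length_append, List.length_singleton] at hv
    rw [← h.mul hqi.symm hql hil (by simpa using hv)]
    exact Commute.commutator_right (ih hqi.symm hqj.symm (by omega))
      (h.comm hij hql hqj.symm hil hu (by simpa using hN) (by simp; omega))

theorem comm_col (h : WordSteinberg N e) (hN : 1 ≤ N) {i j k : Fin 4} (hij : i ≠ j) (hkj : k ≠ j)
    (hik : i ≠ k) {u v : List X} (hu : u.length ≤ N) (hv : v.length ≤ N) :
    Commute (e i j u) (e k j v) := by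
  induction v generalizing k with
  | nil => exact h.comm hij hkj hkj.symm hij hu hv (by simp; omega)
  | cons x v ih =>
    obtain ⟨q, hqi, hqj, hqk⟩ := exists_fin_four_ne i j k
    simp only [List.length_cons] at hv
    rw [← List.singleton_append, ← h.mul hqk.symm hqj hkj (by simp; omega)]
    exact Commute.commutator_right (h.comm hij hqk.symm hkj.symm hqi.symm hu (by simpa using hN)
      (by simp; omega)) (ih hqj hqi.symm (by omega))

theorem comm_root (h : WordSteinberg N e) (hN : 1 ≤ N) {i j : Fin 4} (hij : i ≠ j)
    {u v : List X} (hu : u.length ≤ N) (hv : v.length ≤ N) : Commute (e i j u) (e i j v) := by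
  obtain ⟨q, hqi, hqj, -⟩ := exists_fin_four_ne i j j
  rw [← List.nil_append v, ← h.mul hqi.symm hqj hij (by simpa using hv)]
  exact Commute.commutator_right (h.comm_row hN hij hqi.symm hqj.symm hu (by simp))
    (h.comm_col hN hij hqj hqi.symm hu hv)

/-- The longer entry on either side is itself a commutator with `e j l r`, so this is
`commutator_commutator_swap`. Already for empty `r` it says something: the column indices `j` and
`l` may be exchanged. -/
theorem commutator_suffix (h : WordSteinberg N e) (hN : 1 ≤ N) {i j k l : Fin 4} (hij : i ≠ j)
    (hil : i ≠ l) (hik : i ≠ k) (hjk : j ≠ k) (hjl : j ≠ l) (hkl : k ≠ l)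
    {p q r : List X} (hq : (q ++ r).length ≤ N) (hp : (p ++ r).length ≤ N) :
    ⁅e i j p, e k l (q ++ r)⁆ = ⁅e k j q, e i l (p ++ r)⁆ := by
  have hq' := hq
  have hp' := hp
  rw [List.length_append] at hq' hp'
  rw [← h.mul hjk.symm hjl hkl hq', ← h.mul hij hjl hil hp']
  refine commutator_commutator_swap (h.comm_col hN hij hjk.symm hik (by omega) (by omega)) ?_
  rw [h.mul hjk.symm hjl hkl hq', h.mul hij hjl hil hp']
  exact h.comm_col hN hil hkl hik hp hq

/-- `⁅e i j p, e k l q⁆` commutes with `e i j r` and `e k l r`. -/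
theorem commute_commutator_left (h : WordSteinberg N e) (hN : 1 ≤ N) {i j k l : Fin 4} (hij : i ≠ j)
    (hik : i ≠ k) (hil : i ≠ l) (hjk : j ≠ k) (hjl : j ≠ l) (hkl : k ≠ l)
    {p q r : List X} (hp : p.length ≤ N) (hq : q.length ≤ N) (hr : r.length ≤ N) :
    Commute ⁅e i j p, e k l q⁆ (e i j r) := by
  -- With empty suffix the commutator becomes `⁅e k j q, e i l p⁆`; one entry shares its column with
  -- `e i j r`, the other its row, so both commute with it.
  rw [← List.append_nil q, h.commutator_suffix hN hij hil hik hjk hjl hkl (by simpa) (by simpa)]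
  exact Commute.commutator_left (h.comm_col hN hjk.symm hij hik.symm (by omega) hr)
    (h.comm_row hN hil hij hjl.symm (by simpa) hr)

theorem commute_commutator_right (h : WordSteinberg N e) (hN : 1 ≤ N) {i j k l : Fin 4}
    (hij : i ≠ j) (hik : i ≠ k) (hil : i ≠ l) (hjk : j ≠ k) (hjl : j ≠ l) (hkl : k ≠ l)
    {p q r : List X} (hp : p.length ≤ N) (hq : q.length ≤ N) (hr : r.length ≤ N) :
    Commute ⁅e i j p, e k l q⁆ (e k l r) := by
  rw [← List.append_nil q, h.commutator_suffix hN hij hil hik hjk hjl hkl (by simpa) (by simpa)]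
  exact Commute.commutator_left (h.comm_row hN hjk.symm hkl hjl (by omega) hr)
    (h.comm_col hN hil hkl hik (by simpa) hr)

theorem commutator_prefix (h : WordSteinberg N e) (hN : 1 ≤ N) {i j k l : Fin 4} (hij : i ≠ j)
    (hil : i ≠ l) (hik : i ≠ k) (hjk : j ≠ k) (hjl : j ≠ l) (hkl : k ≠ l)
    {p q r : List X} (hq : (r ++ q).length ≤ N) (hp : (r ++ p).length ≤ N) :
    ⁅e k l (r ++ q), e i j p⁆ = ⁅e k j (r ++ p), e i l q⁆ := by
  have hq' := hq
  have hp' := hp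
  rw [List.length_append] at hq' hp'
  -- `inv_commutator_commutator_swap` speaks of inverted first entries. Since each commutator here
  -- commutes with its own entries, these inverses can be moved outside.
  apply inv_injective
  rw [← commutator_inv_left (h.commute_commutator_left hN hkl hik.symm hjk.symm hil.symm hjl.symm hij
      hq (by omega) hq),
    ← commutator_inv_left (h.commute_commutator_left hN hjk.symm hik.symm hkl hij.symm hjl hil
      hp (by omega) hp), ← h.mul hik.symm hil hkl hq', ← h.mul hik.symm hij hjk.symm hp']
  refine inv_commutator_commutator_swap (h.comm_row hN hij hil hjl (by omega) (by omega)) ?_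
  rw [h.mul hik.symm hil hkl hq', h.mul hik.symm hij hjk.symm hp']
  exact h.comm_row hN hjk.symm hkl hjl hp hq

theorem disjointComm_suffix (h : WordSteinberg N e) (hN : 1 ≤ N) {p q r : List X}
    (hq : (q ++ r).length ≤ N) (hp : (p ++ r).length ≤ N) (hd : DisjointComm e q (p ++ r)) :
    DisjointComm e p (q ++ r) := fun _ _ _ _ hij hik hil hjk hjl hkl => by
  rw [← commutatorElement_eq_one_iff_commute,
    h.commutator_suffix hN hij hil hik hjk hjl hkl hq hp, commutatorElement_eq_one_iff_commute]
  exact hd _ _ _ _ hjk.symm hik.symm hkl hij.symm hjl hil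

theorem disjointComm_prefix (h : WordSteinberg N e) (hN : 1 ≤ N) {p q r : List X}
    (hq : (r ++ q).length ≤ N) (hp : (r ++ p).length ≤ N) (hd : DisjointComm e q (r ++ p)) :
    DisjointComm e p (r ++ q) := fun i j k l hij hik hil hjk hjl hkl => by
  rw [Commute.symm_iff, ← commutatorElement_eq_one_iff_commute,
    h.commutator_prefix hN hij hil hik hjk hjl hkl hq hp, commutatorElement_eq_one_iff_commute,
    Commute.symm_iff]
  exact hd _ _ _ _ hil hik hij hkl.symm hjl.symm hjk.symm

/-- Two words that overlap in a common subword `a`. -/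
theorem disjointComm_overlap (h : WordSteinberg N e) (hN : 1 ≤ N) {u a v : List X}
    (hl : u.length + a.length + v.length ≤ N) : DisjointComm e (u ++ a) (a ++ v) :=
  fun i k j l hik hij hil hjk' hkl hjl => by
  have hjk := hjk'.symm
  have h1 : ⁅e i j u, e j k a⁆ = e i k (u ++ a) := h.mul hij hjk hik (by omega)
  have h2 : ⁅e j k a, e k l v⁆ = e j l (a ++ v) := h.mul hjk hkl hjl (by omega)
  have h3 : ⁅e i j u, e j l (a ++ v)⁆ = e i l (u ++ a ++ v) := by
    rw [h.mul hij hjl hil (by simp; omega), List.append_assoc]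
  have h4 : ⁅e i k (u ++ a), e k l v⁆ = e i l (u ++ a ++ v) :=
    h.mul hik hkl hil (by simp; omega)
  -- Both mixed commutators in this relation equal `e i l (u ++ a ++ v)`; cancelling it leaves the
  -- claim. The subword `a` counts twice, so the two words may have total length `N + a.length`,
  -- which is beyond the range of `comm` once `a` has two letters.
  have key := commutator_conj_relation (g := e j k a)
    (h.comm hij hkl hjk hil (u := u) (v := v) (by omega) (by omega) (by omega))
  rw [h1, h2, h3, h4] at key
  have c1 : Commute (e i l (u ++ a ++ v)) (e j l (a ++ v)) :=
    h.comm_col hN hil hjl hij (by simp; omega) (by simp; omega)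
  rw [mul_assoc, c1.eq, ← mul_assoc] at key
  exact Commute.inv_left_iff.1 (mul_right_cancel key)

/-- `⁅e i k p, e j l q⁆` commutes with `e i j u` when `u ++ q` is short. -/
theorem commute_commutator_row (h : WordSteinberg N e) (hN : 1 ≤ N) {i j k l : Fin 4}
    (hij : i ≠ j) (hik : i ≠ k) (hil : i ≠ l) (hjk : j ≠ k) (hjl : j ≠ l) (hkl : k ≠ l)
    {p q u : List X} (hp : p.length ≤ N) (hq : u.length + q.length ≤ N) :
    Commute ⁅e i k p, e j l q⁆ (e i j u) := by
  have : e i j u * ⁅e i k p, e j l q⁆ * (e i j u)⁻¹ = ⁅e i k p, e j l q⁆ := by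
    rw [commutator_conj, (h.comm_row hN hij hik hjk (by omega) hp).mul_mul_inv_cancel,
      conj_eq_commutator_mul, h.mul hij hjl hil hq, commutator_mul_right',
      (h.comm_row hN hik hil hkl hp (by simpa)).commutator_eq, one_mul]
    refine Commute.mul_mul_inv_cancel (Commute.commutator_right ?_ ?_)
    · exact h.comm_row hN hil hik hkl.symm (by simpa) hp
    · exact h.comm_col hN hil hjl hij (by simpa) (by omega)
  exact (eq_mul_of_mul_inv_eq this).symm

/-- `⁅e i k p, e j l q⁆` commutes with `e k l x` when `p ++ x` is short. -/
theorem commute_commutator_col (h : WordSteinberg N e) (hN : 1 ≤ N) {i j k l : Fin 4}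
    (hij : i ≠ j) (hik : i ≠ k) (hil : i ≠ l) (hjl : j ≠ l) (hkl : k ≠ l) (hjk : j ≠ k)
    {p q x : List X} (hq : q.length ≤ N) (hp : p.length + x.length ≤ N) :
    Commute ⁅e i k p, e j l q⁆ (e k l x) := by
  have e1 : e k l x * e i k p * (e k l x)⁻¹ = (e i l (p ++ x))⁻¹ * e i k p := by
    rw [← h.mul hik hkl hil hp]
    simp [commutatorElement_def, mul_assoc]
  have : e k l x * ⁅e i k p, e j l q⁆ * (e k l x)⁻¹ = ⁅e i k p, e j l q⁆ := by
    rw [commutator_conj, (h.comm_col hN hkl hjl hjk.symm (by omega) hq).mul_mul_inv_cancel,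
      e1, commutator_mul_left',
      (h.comm_col hN hil hjl hij (by simpa) hq).inv_left.commutator_eq, mul_one]
    refine Commute.mul_mul_inv_cancel (Commute.inv_left (Commute.commutator_right ?_ ?_))
    · exact h.comm_row hN hil hik hkl.symm (by simpa) (by omega)
    · exact h.comm_col hN hil hjl hij (by simpa) hq
  exact (eq_mul_of_mul_inv_eq this).symm

/-- The commuting pair `e i j u`, `e k l x` is conjugated by `e j k [y]`, by `e j k [z]` and by
their product. Polarization gives `⁅e i k (u ++ [y]), e j l (z :: x)⁆ * ⁅e i k (u ++ [z]), e j l (y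
:: x)⁆ = 1`, so if one factor is trivial, so is the other. -/
theorem disjointComm_swap (h : WordSteinberg N e) (hN : 1 ≤ N) {u x : List X} {y z : X}
    (hu : 2 ≤ u.length) (hx : 2 ≤ x.length) (hux : u.length + x.length ≤ N)
    (hd : DisjointComm e (u ++ [y]) (z :: x)) : DisjointComm e (u ++ [z]) (y :: x) :=
  fun i k j l hik hij hil hjk' hkl hjl => by
  have hjk := hjk'.symm
  have m (y : X) : ⁅e i j u, e j k [y]⁆ = e i k (u ++ [y]) := h.mul hij hjk hik (by simp; omega)
  have d (y : X) : ⁅e j k [y], e k l x⁆ = e j l (y :: x) := by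
    rw [h.mul hjk hkl hjl (by simp; omega)]; rfl
  have ac : Commute (e i j u) (e k l x) := h.comm hij hkl hjk hil (by omega) (by omega) (by omega)
  have mm : Commute (e i k (u ++ [y])) (e i k (u ++ [z])) :=
    h.comm_root hN hik (by simp; omega) (by simp; omega)
  have dd : Commute (e j l (y :: x)) (e j l (z :: x)) :=
    h.comm_root hN hjl (by simp; omega) (by simp; omega)
  have am (y : X) : Commute (e i j u) (e i k (u ++ [y])) :=
    h.comm_row hN hij hik hjk (by omega) (by simp; omega)
  have cd (y : X) : Commute (e k l x) (e j l (y :: x)) :=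
    h.comm_col hN hkl hjl hjk.symm (by omega) (by simp; omega)
  have key (y : X) := commutator_conj_relation (g := e j k [y]) ac
  simp only [m, d] at key
  have gg : Commute (e j k [y]) (e j k [z]) := h.comm_root hN hjk (by simpa) (by simpa)
  have key2 := commutator_conj_relation (g := e j k [y] * e j k [z]) ac
  have m2 : ⁅e i j u, e j k [y] * e j k [z]⁆ = e i k (u ++ [y]) * e i k (u ++ [z]) := by
    rw [commutator_mul_right', m, m,
      (h.comm_col hN hjk hik hij.symm (by simpa) (by simp; omega)).mul_mul_inv_cancel]
  have d2 : ⁅e j k [y] * e j k [z], e k l x⁆ = e j l (y :: x) * e j l (z :: x) := by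
    rw [commutator_mul_left', d, d,
      (h.comm_row hN hjk hjl hkl (by simpa) (by simp; omega)).mul_mul_inv_cancel, dd.eq]
  rw [m2, d2] at key2
  obtain ⟨t, u', rfl⟩ : ∃ t u', u = t :: u' := List.exists_cons_of_length_pos (by omega)
  obtain ⟨x', s, rfl⟩ : ∃ x' s, x = x' ++ [s] :=
    ⟨_, _, (List.dropLast_append_getLast (List.ne_nil_of_length_pos (by omega))).symm⟩
  simp only [List.length_cons, List.length_append, List.length_nil] at hu hx hux
  -- Centrality of the mixed commutators. Commuting with `e i j u` or `e k l x` is seen after moving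
  -- the last letter `s` of `x` or the first letter `t` of `u` to the other word; that word stays
  -- within length `N` because `u` and `x` have at least two letters.
  have kk : ∀ w ∈ ({e i j (t :: u'), e k l (x' ++ [s]), e i k (t :: u' ++ [y]),
      e i k (t :: u' ++ [z]), e j l (y :: (x' ++ [s])), e j l (z :: (x' ++ [s]))} : Set P),
      ∀ y z, Commute ⁅e i k (t :: u' ++ [y]), e j l (z :: (x' ++ [s]))⁆ w := by
    rintro w (rfl | rfl | rfl | rfl | rfl | rfl) y z
    · have := h.commutator_suffix hN (p := t :: u' ++ [y]) (q := z :: x') (r := [s]) hik hil hij hjk.symm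
        hkl hjl (by simp; omega) (by simp; omega)
      rw [← List.cons_append, this, ← commutatorElement_inv]
      exact (h.commute_commutator_row hN hij hil hik hjl hjk hkl.symm (by simp; omega)
        (by simp; omega)).inv_left
    · have := h.commutator_prefix hN (p := z :: (x' ++ [s])) (q := u' ++ [y]) (r := [t])
        (i := j) (j := l) (k := i) (l := k) hjl hjk hij.symm hil.symm hkl.symm hik
        (by simp; omega) (by simp; omega)
      simp only [List.singleton_append, ← List.cons_append] at this
      rw [← List.cons_append (a := z), this, ← Commute.inv_left_iff, commutatorElement_inv]
      exact h.commute_commutator_col hN hij.symm hjk hjl hil hkl hik (by simp; omega)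
        (by simp; omega)
    · exact h.commute_commutator_left hN hik hij hil hjk.symm hkl hjl (by simp; omega)
        (by simp; omega) (by simp; omega)
    · exact h.commute_commutator_left hN hik hij hil hjk.symm hkl hjl (by simp; omega)
        (by simp; omega) (by simp; omega)
    · exact h.commute_commutator_right hN hik hij hil hjk.symm hkl hjl (by simp; omega)
        (by simp; omega) (by simp; omega)
    · exact h.commute_commutator_right hN hik hij hil hjk.symm hkl hjl (by simp; omega)
        (by simp; omega) (by simp; omega)
  have := commutator_mul_commutator_eq_one ac mm dd (am y) (am z) (cd y) (cd z) ?_ (key y) (key z)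
    key2
  · rw [commutatorElement_eq_one_iff_commute.2 (hd _ _ _ _ hik hij hil hjk.symm hkl hjl), one_mul] at this
    exact commutatorElement_eq_one_iff_commute.1 this
  · rintro _ (rfl | rfl) _ (rfl | rfl) w hw <;> exact kk w hw _ _

theorem disjointComm_shift_suffix (h : WordSteinberg N e) (hN : 1 ≤ N) {p q : List X} {r : X}
    (hp : p.length < N) (hq : q.length < N) :
    DisjointComm e (p ++ [r]) q ↔ DisjointComm e p (q ++ [r]) :=
  ⟨fun hd => h.disjointComm_suffix hN (by simpa) (by simpa) hd.symm,
    fun hd => (h.disjointComm_suffix hN (by simpa) (by simpa) hd).symm⟩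

theorem disjointComm_shift_prefix (h : WordSteinberg N e) (hN : 1 ≤ N) {p q : List X} {r : X}
    (hp : p.length < N) (hq : q.length < N) :
    DisjointComm e (r :: p) q ↔ DisjointComm e p (r :: q) :=
  ⟨fun hd => h.disjointComm_prefix hN (r := [r]) (by simpa) (by simpa) hd.symm,
    fun hd => (h.disjointComm_prefix hN (r := [r]) (by simpa) (by simpa) hd).symm⟩

/-- `DisjointComm` for the two parts of a cyclic word, the second one read backwards. -/
def CyclicComm (e : Fin 4 → Fin 4 → List X → P) (w : List X) : Prop :=
  DisjointComm e (w.take 3) (w.drop 3).reverse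

/-- One word is read forwards and the other backwards around a circle, and a letter may cross either
of the two seams. Hence the position of the cut is irrelevant, and cutting after three letters in
`CyclicComm` is only a normalization. -/
theorem cyclicComm_cons (h : WordSteinberg N e) (hN : 5 ≤ N) {a : X} {w : List X}
    (hw : w.length = N + 1) : CyclicComm e (a :: w) ↔ CyclicComm e (w ++ [a]) := by
  obtain ⟨b, c, d, r, rfl⟩ : ∃ b c d r, w = b :: c :: d :: r := by
    match w, hw with
    | [], hw | [_], hw | [_, _], hw => simp only [List.length] at hw; omega
    | b :: c :: d :: r, _ => exact ⟨b, c, d, r, rfl⟩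
  simp only [List.length_cons] at hw
  have h1 := h.disjointComm_shift_prefix (by omega) (r := a) (p := [b, c]) (q := r.reverse ++ [d])
    (by simp; omega) (by simp; lia)
  have h2 := h.disjointComm_shift_suffix (by omega) (r := d) (p := [b, c]) (q := a :: r.reverse)
    (by simp; omega) (by simp; omega)
  simp only [List.cons_append, List.nil_append] at h2
  simp only [CyclicComm, List.cons_append, List.take_succ_cons, List.take_zero,
    List.drop_succ_cons, List.drop_zero, List.reverse_cons, List.reverse_append,
    List.reverse_nil, List.nil_append]
  rw [h1, h2]

theorem cyclicComm_append (h : WordSteinberg N e) (hN : 5 ≤ N) {l₁ l₂ : List X}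
    (hl : l₁.length + l₂.length = N + 2) : CyclicComm e (l₁ ++ l₂) ↔ CyclicComm e (l₂ ++ l₁) := by
  induction l₁ generalizing l₂ with
  | nil => simp
  | cons a l ih =>
    simp only [List.length_cons] at hl
    rw [List.cons_append, h.cyclicComm_cons hN (by simp; omega), List.append_assoc,
      ih (by simp; omega), List.append_assoc, List.singleton_append]

theorem cyclicComm_swap_three (h : WordSteinberg N e) (hN : 5 ≤ N) {a b y z : X} {r : List X}
    (hr : r.length + 2 = N) (hc : CyclicComm e ([a, b, y] ++ r ++ [z])) :
    CyclicComm e ([a, b, z] ++ r ++ [y]) := by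
  simp only [CyclicComm, List.cons_append, List.take_succ_cons, List.take_zero,
    List.drop_succ_cons, List.drop_zero, List.reverse_append,
    List.reverse_cons, List.reverse_nil, List.nil_append] at hc ⊢
  exact h.disjointComm_swap (by omega) (u := [a, b]) (by simp) (by simp; omega)
    (by simp; omega) hc

theorem cyclicComm_swap_four (h : WordSteinberg N e) (hN : 5 ≤ N) {a b c y z : X} {r : List X}
    (hr : r.length + 3 = N) (hc : CyclicComm e ([a, b, c, y] ++ r ++ [z])) :
    CyclicComm e ([a, b, c, z] ++ r ++ [y]) := by
  simp only [CyclicComm, List.cons_append, List.take_succ_cons, List.take_zero,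
    List.drop_succ_cons, List.drop_zero, List.reverse_append,
    List.reverse_cons, List.reverse_nil, List.nil_append] at hc ⊢
  have e1 (y z : X) := h.disjointComm_shift_suffix (by omega) (r := y) (p := [a, b, c])
    (q := z :: r.reverse) (by simp; omega) (by simp; omega)
  simp only [List.cons_append, List.nil_append] at e1
  rw [← e1] at hc ⊢
  exact h.disjointComm_swap (by omega) (u := [a, b, c]) (by simp) (by simp; omega)
    (by simp; omega) hc

/-- `cyclicComm_swap_three` exchanges letters at cyclic distance three and `cyclicComm_swap_four` at
distance four. Conjugating the second transposition by the first gives a transposition of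
neighbours. -/
theorem cyclicComm_swap_adjacent (h : WordSteinberg N e) (hN : 5 ≤ N) {l₁ l₂ : List X} {y z : X}
    (hl : l₁.length + l₂.length = N) (hc : CyclicComm e (l₁ ++ y :: z :: l₂)) :
    CyclicComm e (l₁ ++ z :: y :: l₂) := by
  have e1 (y z : X) : CyclicComm e (l₁ ++ y :: z :: l₂) ↔ CyclicComm e (y :: z :: (l₂ ++ l₁)) :=
    h.cyclicComm_append hN (by simp; omega)
  rw [e1] at hc ⊢
  have hL : (l₂ ++ l₁).length = N := by simp; omega
  generalize l₂ ++ l₁ = L at hc hL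
  obtain ⟨r, x, a, b, rfl⟩ : ∃ r x a b, L = r ++ [x] ++ [a, b] := by
    have hL' : L.reverse.length = N := by simpa using hL
    rw [← List.reverse_reverse L]
    match L.reverse, hL' with
    | [], h | [_], h | [_, _], h => simp at h; omega
    | b :: a :: x :: r, _ => exact ⟨r.reverse, x, a, b, by simp⟩
  simp only [List.length_append, List.length_cons, List.length_nil] at hL
  have e2 (y z : X) : CyclicComm e (y :: z :: (r ++ [x] ++ [a, b])) ↔
      CyclicComm e ([a, b, y, z] ++ r ++ [x]) := by
    rw [← List.cons_append, ← List.cons_append, h.cyclicComm_append hN (by simp; omega)]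
    simp
  rw [e2] at hc ⊢
  have s1 := h.cyclicComm_swap_three hN (a := a) (b := b) (y := y) (z := x) (r := z :: r)
    (by simp; omega) (by simpa using hc)
  have s2 := h.cyclicComm_swap_four hN (a := a) (b := b) (c := x) (y := z) (z := y) (r := r)
    (by omega) (by simpa using s1)
  have s3 := h.cyclicComm_swap_three hN (a := a) (b := b) (y := x) (z := z) (r := y :: r)
    (by simp; omega) (by simpa using s2)
  simpa using s3

theorem cyclicComm_perm (h : WordSteinberg N e) (hN : 5 ≤ N) {w w' : List X} (hw : w.Perm w') :
    ∀ c : List X, c.length + w.length = N + 2 → CyclicComm e (c ++ w) → CyclicComm e (c ++ w') := by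
  induction hw with
  | nil => exact fun _ _ h => h
  | cons x _ ih =>
    intro c hl hc
    simpa using ih (c ++ [x]) (by simp at hl ⊢; omega) (by simpa using hc)
  | swap x y l => exact fun c hl hc => h.cyclicComm_swap_adjacent hN (by simp at hl; omega) hc
  | trans h₁ _ ih₁ ih₂ =>
    exact fun c hl hc => ih₂ c (by rw [← h₁.length_eq, hl]) (ih₁ c hl hc)

theorem exists_perm_cons_cons [Fintype X] {w : List X} (hw : Fintype.card X < w.length) :
    ∃ y r, w.Perm (y :: y :: r) := by
  classical
  have : ¬ w.Nodup := fun hn => by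
    have := hn.length_le_card
    omega
  obtain ⟨y, hy⟩ := List.exists_duplicate_iff_not_nodup.2 this
  obtain ⟨r, hr⟩ := (List.duplicate_iff_sublist.1 hy).exists_perm_append
  exact ⟨y, r, hr⟩

/-- Pigeonhole, used twice: some letter `y` is repeated, and the other `N` letters are still too
many to be distinct, so some `z` is repeated among them. Arranged as `s y z ⋯ z y`, the cyclic word
is cut into `[s, y, z]` and `y :: z :: ⋯`, which overlap in `[y, z]`. -/
theorem cyclicComm_of_length [Fintype X] (h : WordSteinberg N e) (hN : 5 ≤ N)
    (hX : Fintype.card X < N) {w : List X} (hw : w.length = N + 2) : CyclicComm e w := by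
  obtain ⟨y, r, hr⟩ := exists_perm_cons_cons (w := w) (by omega)
  have hrl : r.length = N := by have := hr.length_eq; simp at this; omega
  obtain ⟨z, t, ht⟩ := exists_perm_cons_cons (w := r) (by omega)
  have htl : t.length + 2 = N := by have := ht.length_eq; simp at this; omega
  obtain ⟨s, v, rfl⟩ : ∃ s v, t = s :: v := List.exists_cons_of_length_pos (by omega)
  simp only [List.length_cons] at htl
  have hp : (s :: y :: z :: (v ++ [z, y])).Perm w := by
    refine List.Perm.trans ?_ (hr.trans ((ht.cons y).cons y)).symm
    classical
    rw [List.perm_iff_count]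
    intro x
    simp only [List.count_cons, List.count_append, List.count_nil]
    omega
  refine h.cyclicComm_perm hN hp [] (by simp; omega) ?_
  simp only [CyclicComm, List.nil_append, List.take_succ_cons, List.take_zero,
    List.drop_succ_cons, List.drop_zero, List.reverse_append,
    List.reverse_cons, List.reverse_nil, List.cons_append]
  exact h.disjointComm_overlap (by omega) (u := [s]) (a := [y, z]) (v := v.reverse)
    (by simp; omega)

/-- Only total length `N + 2` is new, and moving letters across a seam brings the first word to
length three, the shape used by `CyclicComm`. -/
theorem disjointComm_of_length [Fintype X] (h : WordSteinberg N e) (hN : 5 ≤ N)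
    (hX : Fintype.card X < N) {p q : List X} (hp : p.length ≤ N) (hq : q.length ≤ N)
    (hpq : p.length + q.length ≤ N + 2) : DisjointComm e p q := by
  rcases Nat.lt_or_ge (p.length + q.length) (N + 2) with hlt | hge
  · exact fun _ _ _ _ hij hik hil hjk hjl hkl => h.comm hij hkl hjk hil hp hq (by omega)
  have three (a b c : X) (q : List X) (hq : q.length + 1 = N) : DisjointComm e [a, b, c] q := by
    simpa [CyclicComm] using h.cyclicComm_of_length hN hX (w := a :: b :: c :: q.reverse)
      (by simp; omega)
  match p with
  | [] | [_] => simp at hge; omega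
  | [a, b] =>
    simp only [List.length_cons, List.length_nil] at hge hpq
    obtain ⟨q, c, rfl⟩ : ∃ q' c, q = q' ++ [c] :=
      ⟨_, _, (List.dropLast_append_getLast (List.ne_nil_of_length_pos (by omega))).symm⟩
    simp only [List.length_append, List.length_cons, List.length_nil] at hge hpq
    exact (h.disjointComm_shift_suffix (p := [a, b]) (by omega) (by simp; omega) (by omega)).1
      (three a b c q (by omega))
  | a :: b :: c :: s =>
    induction s using List.reverseRecOn generalizing q with
    | nil =>
      simp only [List.length_cons, List.length_nil] at hge hpq
      exact three a b c q (by omega)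
    | append_singleton s x ih =>
      simp only [List.length_cons, List.length_append, List.length_nil] at hge hpq hp
      have := ih (q := q ++ [x]) (by simp; omega) (by simp; omega) (by simp; omega)
        (by simp; omega)
      exact (h.disjointComm_shift_suffix (by omega) (p := a :: b :: c :: s) (by simp; omega)
        (by omega)).2 this

/-- Associativity for `e i j u`, `e j k y`, `e k l x`. It needs `e i k (u ++ y)` and `e j l (y ++
x)` to commute; as the letter `y` occurs in both, their total length can be `N + 2`. This is the
reason for going one step beyond `comm`. -/
theorem commutator_eq_of_middle [Fintype X] (h : WordSteinberg N e) (hN : 5 ≤ N)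
    (hX : Fintype.card X < N) {i j k l : Fin 4} (hij : i ≠ j) (hik : i ≠ k) (hil : i ≠ l)
    (hjk : j ≠ k) (hjl : j ≠ l) (hkl : k ≠ l) {u y x : List X} (hu : u ≠ []) (hx : x ≠ [])
    (hy : y.length ≤ 1) (hl : u.length + y.length + x.length ≤ N + 1) :
    ⁅e i j u, e j l (y ++ x)⁆ = ⁅e i k (u ++ y), e k l x⁆ := by
  have hu' := List.length_pos_of_ne_nil hu
  have hx' := List.length_pos_of_ne_nil hx
  have h1 := h.mul hjk hkl hjl (u := y) (v := x) (by omega)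
  have h2 := h.mul hij hjk hik (u := u) (v := y) (by omega)
  rw [← h1, ← h2]
  refine commutator_assoc (h.comm hij hkl hjk hil (by omega) (by omega) (by omega)) ?_ ?_
  · rw [h1, h2]
    exact h.disjointComm_of_length hN hX (by simp; omega) (by simp; omega) (by simp; omega) _ _ _ _
      hik hij hil hjk.symm hkl hjl
  · rw [h1]
    exact h.comm_col (by omega) hkl hjl hjk.symm (by omega) (by simp; omega)

/-- The relations extend to words of length `N + 1`, if these are suitably defined. -/
theorem succ [Fintype X] (h : WordSteinberg N e) (hN : 5 ≤ N) (hX : Fintype.card X < N)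
    {m : Fin 4 → Fin 4 → Fin 4} (hm : ∀ i j, m i j ≠ i ∧ m i j ≠ j)
    (hdef : ∀ i j, i ≠ j → ∀ x w, (x :: w).length = N + 1 →
      e i j (x :: w) = ⁅e i (m i j) [x], e (m i j) j w⁆) : WordSteinberg (N + 1) e := by
  have D {p q : List X} (hp : p.length ≤ N) (hq : q.length ≤ N)
    (hpq : p.length + q.length ≤ N + 2) : DisjointComm e p q := h.disjointComm_of_length hN hX hp hq hpq
  -- Letters pass one at a time from the end of `u` to the front of `v`, with a change of the middle
  -- index each time, until `u` is a single letter and `hdef` applies.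
  have mul₀ (u : List X) (hu : u ≠ []) : ∀ {i j l : Fin 4}, i ≠ j → j ≠ l → i ≠ l →
      ∀ {v : List X}, v ≠ [] → u.length + v.length = N + 1 →
      ⁅e i j u, e j l v⁆ = e i l (u ++ v) := by
    induction u using List.reverseRecOn with
    | nil => exact absurd rfl hu
    | append_singleton u y ih =>
      intro i j l hij hjl hil v hv hl
      rcases eq_or_ne u [] with rfl | hu
      · rw [List.nil_append, List.singleton_append, hdef i l hil y v (by simpa [add_comm] using hl)]
        rcases eq_or_ne (m i l) j with hj | hj
        · rw [hj]
        · simpa using h.commutator_eq_of_middle hN hX (u := [y]) (y := []) hij (hm i l).1.symm hil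
            hj.symm hjl (hm i l).2 (by simp) hv (by simp) (by simp at hl ⊢; omega)
      · obtain ⟨k, hki, hkj, hkl⟩ := exists_fin_four_ne i j l
        simp only [List.length_append, List.length_cons, List.length_nil] at hl
        rw [← h.commutator_eq_of_middle hN hX (y := [y]) hki.symm hij hil hkj hkl hjl hu hv
          (by simp) (by simp; omega), ih hu hki.symm hkl hil (by simp) (by simp; omega)]
        simp
  -- A generator with a word of length `N + 1` is thus a commutator of generators with shorter
  -- words, for any cut and any middle index; the relations involving new words follow by choosing
  -- the cut.
  have split (k : ℕ) (hk : 1 ≤ k) (hk' : k ≤ N) (w : List X) (hw : w.length = N + 1) :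
      ∃ s r, s.length = k ∧ r.length = N + 1 - k ∧ ∀ {i j l : Fin 4}, i ≠ j → j ≠ l → i ≠ l →
        ⁅e i j s, e j l r⁆ = e i l w := by
    refine ⟨w.take k, w.drop k, by simp; omega, by simp; omega, fun hij hjl hil => ?_⟩
    rw [mul₀ _ _ hij hjl hil, List.take_append_drop]
    · apply List.ne_nil_of_length_pos; simp; omega
    · simp; omega
    · apply List.ne_nil_of_length_pos; simp; omega
  have Dnew {y w : List X} (hy : y.length ≤ 1) (hw : w.length = N + 1) : DisjointComm e y w := by
    intro i k j l hik hij hil hkj hkl hjl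
    -- With a cut after two letters, `s ++ y` and `r` have total length at most `N + 2`, exactly the
    -- range of `D`.
    obtain ⟨s, r, hs, hr, hsr⟩ := split 2 (by omega) (by omega) w hw
    rw [← hsr hij.symm hil hjl, Commute.symm_iff, ← Commute.inv_left_iff,
      ← commutatorElement_eq_one_iff_commute]
    have e1 : ⁅e j i s, e i k y⁆ = e j k (s ++ y) := h.mul hij.symm hik hkj.symm (by omega)
    have c1 : Commute (e j k (s ++ y)) (e i l r) :=
      D (by simp; omega) (by omega) (by simp; omega) _ _ _ _ hkj.symm hij.symm hjl hik.symm hkl hil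
    rw [inv_commutator_commutator_swap (h.comm_row (by omega) hik hil hkl (by omega) (by omega)),
      e1, commutatorElement_eq_one_iff_commute, Commute.inv_left_iff]
    · exact c1
    · rw [e1]
      exact Commute.commutator_right (h.comm_row (by omega) hkj.symm hij.symm hik.symm
        (by simp; omega) (by omega)) c1
  have Rnew {y w : List X} (hy : y.length ≤ 1) (hw : w.length = N + 1) {i j l : Fin 4}
      (hij : i ≠ j) (hil : i ≠ l) (hjl : j ≠ l) : Commute (e i j y) (e i l w) := by
    obtain ⟨s, r, hs, hr, hsr⟩ := split 1 le_rfl (by omega) w hw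
    obtain ⟨q, hqi, hqj, hql⟩ := exists_fin_four_ne i j l
    rw [← hsr hqi.symm hql hil]
    exact Commute.commutator_right
      (h.comm_row (by omega) hij hqi.symm hqj.symm (by omega) (by omega))
      (h.comm hij hql hqj.symm hil (by omega) (by omega) (by omega))
  have Cnew {c w : List X} (hc : c.length ≤ N) (hw : w.length = N + 1) {k j l : Fin 4}
      (hkl : k ≠ l) (hjl : j ≠ l) (hkj : k ≠ j) : Commute (e k l c) (e j l w) := by
    obtain ⟨s, r, hs, hr, hsr⟩ := split 1 le_rfl (by omega) w hw
    obtain ⟨i, hij, hik, hil⟩ := exists_fin_four_ne j k l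
    rw [← hsr hij.symm hil hjl]
    exact Commute.commutator_right
      (h.comm hkl hij.symm hjl.symm hik.symm hc (by omega) (by omega))
      (h.comm_col (by omega) hkl hil hik.symm (by omega) (by omega))
  have comm₁ {i j k l : Fin 4} (hij : i ≠ j) (hkl : k ≠ l) (hjk : j ≠ k) (hil : i ≠ l)
      {u v : List X} (hu : u.length ≤ 1) (hv : v.length = N + 1) : Commute (e i j u) (e k l v) := by
    rcases eq_or_ne i k with rfl | hik
    · rcases eq_or_ne j l with rfl | hjl
      · obtain ⟨s, r, hs, hr, hsr⟩ := split 1 le_rfl (by omega) v hv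
        obtain ⟨p, hpi, hpj, -⟩ := exists_fin_four_ne i j j
        rw [← hsr hpi.symm hpj hij]
        exact Commute.commutator_right
          (h.comm_row (by omega) hij hpi.symm hpj.symm (by omega) (by omega))
          (h.comm_col (by omega) hij hpj hpi.symm (by omega) (by omega))
      · exact Rnew hu hv hij hil hjl
    · rcases eq_or_ne j l with rfl | hjl
      · exact Cnew (by omega) hv hij hkl hik
      · exact Dnew hu hv _ _ _ _ hij hik hil hjk hjl hkl
  have mulL {i j l : Fin 4} (hij : i ≠ j) (hjl : j ≠ l) (hil : i ≠ l) {w : List X}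
      (hw : w.length = N + 1) : ⁅e i j [], e j l w⁆ = e i l w := by
    obtain ⟨y, w, rfl⟩ : ∃ y w', w = y :: w' := List.exists_cons_of_length_pos (by omega)
    have hw' : w.length = N := by simpa using hw
    have hne : w ≠ [] := List.ne_nil_of_length_pos (by omega)
    obtain ⟨k, hki, hkj, hkl⟩ := exists_fin_four_ne i j l
    have e1 := mul₀ [y] (by simp) hkj.symm hkl hjl hne (by simpa [add_comm] using hw)
    have e2 : ⁅e i j [], e j k [y]⁆ = e i k [y] := h.mul hij hkj.symm hki.symm (by simp; omega)
    rw [← List.singleton_append, ← e1, commutator_assoc, e2,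
      mul₀ [y] (by simp) hki.symm hkl hil hne (by simpa [add_comm] using hw)]
    · exact h.comm hij hkl hkj.symm hil (by simp) (by omega) (by simp; omega)
    · rw [e1, e2]
      exact Dnew (by simp) hw _ _ _ _ hki.symm hij hil hkj hkl hjl
    · rw [e1]
      exact Cnew (by omega) hw hkl hjl hkj
  have mulR {i j l : Fin 4} (hij : i ≠ j) (hjl : j ≠ l) (hil : i ≠ l) {w : List X}
      (hw : w.length = N + 1) : ⁅e i j w, e j l []⁆ = e i l w := by
    obtain ⟨w, y, rfl⟩ : ∃ w' y, w = w' ++ [y] :=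
      ⟨_, _, (List.dropLast_append_getLast (List.ne_nil_of_length_pos (by omega))).symm⟩
    have hw' : w.length = N := by simpa using hw
    have hne : w ≠ [] := List.ne_nil_of_length_pos (by omega)
    obtain ⟨k, hki, hkj, hkl⟩ := exists_fin_four_ne i j l
    have e1 := mul₀ w hne hki.symm hkj hij (v := [y]) (by simp) (by simpa using hw)
    have e2 : ⁅e k j [y], e j l []⁆ = e k l [y] := h.mul hkj hjl hkl (by simp; omega)
    rw [← e1, ← commutator_assoc, e2, mul₀ w hne hki.symm hkl hil (by simp) (by simpa using hw)]
    · exact h.comm hki.symm hjl hkj hil (by omega) (by simp) (by simp; omega)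
    · rw [e1, e2]
      exact (Dnew (by simp) hw _ _ _ _ hkl hki hkj hil.symm hjl.symm hij).symm
    · rw [e2]
      exact h.comm_col (by omega) hjl hkl hkj.symm (by simp) (by simp; omega)
  refine ⟨fun {i j l} hij hjl hil u v hl => ?_, fun {i j k l} hij hkl hjk hil u v hu hv huv => ?_⟩
  · rcases Nat.lt_or_ge (u.length + v.length) (N + 1) with hlt | hge
    · exact h.mul hij hjl hil (by omega)
    · rcases eq_or_ne u [] with rfl | hu
      · exact mulL hij hjl hil (by simp at hl hge; omega)
      · rcases eq_or_ne v [] with rfl | hv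
        · rw [List.append_nil]
          exact mulR hij hjl hil (by simp at hl hge; omega)
        · exact mul₀ u hu hij hjl hil hv (by omega)
  · rcases Nat.lt_or_ge N v.length with hv' | hv'
    · exact comm₁ hij hkl hjk hil (by omega) (by omega)
    rcases Nat.lt_or_ge N u.length with hu' | hu'
    · exact (comm₁ hkl hij hil.symm hjk.symm (by omega) (by omega)).symm
    rcases eq_or_ne i k with rfl | hik
    · rcases eq_or_ne j l with rfl | hjl
      · exact h.comm_root (by omega) hij hu' hv'
      · exact h.comm_row (by omega) hij hil hjl hu' hv'
    · rcases eq_or_ne j l with rfl | hjl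
      · exact h.comm_col (by omega) hij hkl hik hu' hv'
      · exact D hu' hv' huv _ _ _ _ hij hik hil hjk hjl hkl

end WordSteinberg

/-- Some index different from `i` and `j`. -/
def middle (i j : Fin 4) : Fin 4 := (exists_fin_four_ne i j j).choose

theorem middle_ne (i j : Fin 4) : middle i j ≠ i ∧ middle i j ≠ j :=
  ⟨(exists_fin_four_ne i j j).choose_spec.1, (exists_fin_four_ne i j j).choose_spec.2.1⟩

/-- Extension of `e` from words of length at most `N` to all words. -/
def extendWords (N : ℕ) (e : Fin 4 → Fin 4 → List X → P) : List X → Fin 4 → Fin 4 → P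
  | [], i, j => e i j []
  | x :: w, i, j => if w.length < N then e i j (x :: w) else
      ⁅e i (middle i j) [x], extendWords N e w (middle i j) j⁆

theorem extendWords_of_length_le {N : ℕ} (e : Fin 4 → Fin 4 → List X → P) {w : List X}
    (hw : w.length ≤ N) (i j : Fin 4) : extendWords N e w i j = e i j w := by
  cases w with
  | nil => rfl
  | cons x w => rw [extendWords, if_pos (by simpa using hw)]

theorem WordSteinberg.congr {N : ℕ} {e e' : Fin 4 → Fin 4 → List X → P} (h : WordSteinberg N e)
    (he : ∀ i j w, w.length ≤ N → e' i j w = e i j w) : WordSteinberg N e' where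
  mul hij hjk hik u v hl := by
    rw [he _ _ _ (by omega), he _ _ _ (by omega), he _ _ _ (by simpa using hl),
      h.mul hij hjk hik hl]
  comm hij hkl hjk hil u v hu hv hl := by
    rw [he _ _ _ hu, he _ _ _ hv]
    exact h.comm hij hkl hjk hil hu hv hl

theorem WordSteinberg.extendWords [Fintype X] {N : ℕ} {e : Fin 4 → Fin 4 → List X → P}
    (h : WordSteinberg N e) (hN : 5 ≤ N) (hX : Fintype.card X < N) (K : ℕ) :
    WordSteinberg (N + K) (fun i j w => extendWords N e w i j) := by
  induction K with
  | zero => exact h.congr fun i j w hw => extendWords_of_length_le e hw i j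
  | succ K ih =>
    refine ih.succ (by omega) (by omega) middle_ne fun i j _ x w hw => ?_
    simp only [List.length_cons] at hw
    rw [CrazyGroup.extendWords, if_neg (by omega), extendWords_of_length_le e (w := [x]) (by simp; omega)]

end CrazyGroup

end

noncomputable section

namespace CrazyGroup

/-! ### Basic properties of Steinberg groups -/

namespace Steinberg

open commutatorElement

variable {n : ℕ} {R : Type*} [Ring R] {P : Type*} [Group P]

theorem mk_eq_one {w : FreeGroup (SteinbergSymbol n R)} (h : SteinbergRel n R w) :
    PresentedGroup.mk {w | SteinbergRel n R w} w = 1 :=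
  PresentedGroup.one_of_mem h

theorem e_add (i j : Fin n) (hij : i ≠ j) (r r' : R) :
    e i j hij (r + r') = e i j hij r * e i j hij r' := by
  have := mk_eq_one (SteinbergRel.add i j hij r r')
  rw [map_mul, map_mul, map_inv] at this
  exact (mul_inv_eq_one.1 this).symm

theorem e_commutator {i j k : Fin n} (hij : i ≠ j) (hjk : j ≠ k) (hik : i ≠ k) (r r' : R) :
    ⁅e i j hij r, e j k hjk r'⁆ = e i k hik (r * r') := by
  have := mk_eq_one (SteinbergRel.mul i j k hij hjk hik r r')
  rw [map_mul, map_inv, map_commutatorElement] at this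
  exact mul_inv_eq_one.1 this

theorem e_commute {i j p q : Fin n} (hij : i ≠ j) (hpq : p ≠ q) (hjp : j ≠ p) (hiq : i ≠ q)
    (r r' : R) : Commute (e i j hij r) (e p q hpq r') := by
  have := mk_eq_one (SteinbergRel.comm i j p q hij hpq hjp hiq r r')
  rw [map_commutatorElement] at this
  exact commutatorElement_eq_one_iff_commute.1 this

@[simp] theorem e_zero (i j : Fin n) (hij : i ≠ j) : e i j hij (0 : R) = 1 := by
  have := e_add i j hij (0 : R) 0
  rw [add_zero] at this
  exact left_eq_mul.1 this

theorem e_neg (i j : Fin n) (hij : i ≠ j) (r : R) : e i j hij (-r) = (e i j hij r)⁻¹ :=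
  eq_inv_of_mul_eq_one_left (by rw [← e_add, neg_add_cancel, e_zero])

/-- The universal property of the Steinberg group. -/
def lift (E : Fin n → Fin n → R → P)
    (hadd : ∀ i j, i ≠ j → ∀ r r', E i j (r + r') = E i j r * E i j r')
    (hmul : ∀ i j k, i ≠ j → j ≠ k → i ≠ k → ∀ r r', ⁅E i j r, E j k r'⁆ = E i k (r * r'))
    (hcomm : ∀ i j p q, i ≠ j → p ≠ q → j ≠ p → i ≠ q → ∀ r r', Commute (E i j r) (E p q r')) :
    Steinberg n R →* P :=
  PresentedGroup.toGroup (f := fun s : SteinbergSymbol n R => E s.i s.j s.r) <| by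
    rintro _ (⟨i, j, hij, r, r'⟩ | ⟨i, j, k, hij, hjk, hik, r, r'⟩ |
      ⟨i, j, p, q, hij, hpq, hjp, hiq, r, r'⟩)
    · simp [SteinbergSymbol.w, hadd i j hij]
    · simp only [SteinbergSymbol.w, map_mul, map_commutatorElement, map_inv, FreeGroup.lift_apply_of]
      rw [hmul i j k hij hjk hik, mul_inv_cancel]
    · simp only [SteinbergSymbol.w, map_commutatorElement, FreeGroup.lift_apply_of]
      exact (hcomm i j p q hij hpq hjp hiq r r').commutator_eq

@[simp] theorem lift_e (E : Fin n → Fin n → R → P) (hadd hmul hcomm) (i j : Fin n) (hij : i ≠ j)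
    (r : R) : lift E hadd hmul hcomm (e i j hij r) = E i j r :=
  PresentedGroup.toGroup.of _

theorem closure_e : Subgroup.closure {x : Steinberg n R | ∃ i j hij r, x = e i j hij r} = ⊤ := by
  rw [← top_le_iff, ← PresentedGroup.closure_range_of, Subgroup.closure_le]
  rintro _ ⟨s, rfl⟩
  exact Subgroup.subset_closure ⟨s.i, s.j, s.ne, s.r, rfl⟩

end Steinberg

/-! ### Additive extension of Steinberg relations from words to the free ring -/

section FreeRing

open commutatorElement

variable {X P : Type*} [Group P] {e : Fin 4 → Fin 4 → List X → P}

/-- The free ring on `X`. -/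
abbrev FreeRing (X : Type*) : Type _ := MonoidAlgebra ℤ (FreeMonoid X)

/-- The Steinberg relations for all words. -/
structure AllWordSteinberg (e : Fin 4 → Fin 4 → List X → P) : Prop where
  mul : ∀ {i j k : Fin 4}, i ≠ j → j ≠ k → i ≠ k → ∀ {u v : List X},
    ⁅e i j u, e j k v⁆ = e i k (u ++ v)
  comm : ∀ {i j k l : Fin 4}, i ≠ j → k ≠ l → j ≠ k → i ≠ l → ∀ {u v : List X},
    Commute (e i j u) (e k l v)

theorem WordSteinberg.all [Fintype X] {N : ℕ} (h : WordSteinberg N e) (hN : 5 ≤ N)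
    (hX : Fintype.card X < N) : AllWordSteinberg fun i j w => CrazyGroup.extendWords N e w i j where
  mul {i j k} hij hjk hik u v :=
    (h.extendWords hN hX (u.length + v.length)).mul hij hjk hik (by omega)
  comm hij hkl hjk hil u v :=
    (h.extendWords hN hX (u.length + v.length)).comm hij hkl hjk hil (by omega) (by omega) (by omega)

/-- The additive extension of a commuting family of group elements. -/
theorem exists_additive_extension (f : List X → P) (hf : ∀ u v, Commute (f u) (f v)) :
    ∃ F : Multiplicative (FreeRing X) →* P, ∀ w : List X,
      F (Multiplicative.ofAdd (MonoidAlgebra.of ℤ (FreeMonoid X) (FreeMonoid.ofList w))) = f w := by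
  -- The subgroup generated by a commuting family is abelian, so the universal property of the free
  -- abelian group on words applies to it.
  have hc := Subgroup.isMulCommutative_closure (k := Set.range f) (by
    rintro _ ⟨u, rfl⟩ _ ⟨v, rfl⟩
    exact hf u v)
  let _ : CommGroup (Subgroup.closure (Set.range f)) :=
    { Subgroup.toGroup _ with mul_comm := hc.is_comm.comm }
  let g : (FreeMonoid X →₀ ℤ) →+ Additive (Subgroup.closure (Set.range f)) :=
    Finsupp.liftAddHom fun w => (zmultiplesHom _
      (Additive.ofMul ⟨f w.toList, Subgroup.subset_closure ⟨_, rfl⟩⟩))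
  refine ⟨(Subgroup.subtype _).comp (AddMonoidHom.toMultiplicativeLeft
    (g.comp MonoidAlgebra.coeffAddEquiv.toAddMonoidHom)), fun w => ?_⟩
  simp [g]

/-- The additive extension of `e i j` to the free ring. -/
def AllWordSteinberg.E (h : AllWordSteinberg e) (i j : Fin 4) (a : FreeRing X) : P :=
  if hij : i ≠ j then (exists_additive_extension (e i j) fun _ _ =>
    h.comm hij hij hij.symm hij).choose (Multiplicative.ofAdd a) else 1

namespace AllWordSteinberg

theorem E_of (h : AllWordSteinberg e) {i j : Fin 4} (hij : i ≠ j) (w : List X) :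
    h.E i j (MonoidAlgebra.of ℤ (FreeMonoid X) (FreeMonoid.ofList w)) = e i j w := by
  rw [E, dif_pos hij]
  exact (exists_additive_extension (e i j) fun _ _ =>
    h.comm hij hij hij.symm hij).choose_spec w

theorem E_add (h : AllWordSteinberg e) {i j : Fin 4} (a b : FreeRing X) :
    h.E i j (a + b) = h.E i j a * h.E i j b := by
  by_cases hij : i ≠ j
  · simp only [E, dif_pos hij, ofAdd_add, map_mul]
  · simp [E, dif_neg hij]

theorem E_zero (h : AllWordSteinberg e) {i j : Fin 4} : h.E i j (0 : FreeRing X) = 1 := by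
  have := h.E_add (i := i) (j := j) 0 0
  rw [add_zero] at this
  exact left_eq_mul.1 this

theorem E_neg (h : AllWordSteinberg e) {i j : Fin 4} (a : FreeRing X) :
    h.E i j (-a) = (h.E i j a)⁻¹ :=
  eq_inv_of_mul_eq_one_left (by rw [← h.E_add, neg_add_cancel, h.E_zero])

theorem freeRing_induction {p : FreeRing X → Prop} (hof : ∀ w : List X,
      p (MonoidAlgebra.of ℤ (FreeMonoid X) (FreeMonoid.ofList w)))
    (hzero : p 0) (hadd : ∀ a b, p a → p b → p (a + b)) (hneg : ∀ a, p a → p (-a))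
    (a : FreeRing X) : p a := by
  refine MonoidAlgebra.induction_on a (fun w => hof w.toList) hadd fun n a ha => ?_
  induction n using Int.induction_on with
  | zero => simpa using hzero
  | succ n ih => rw [add_smul, one_smul]; exact hadd _ _ ih ha
  | pred n ih => rw [sub_smul, one_smul, sub_eq_add_neg]; exact hadd _ _ ih (hneg _ ha)

theorem E_comm (h : AllWordSteinberg e) {i j k l : Fin 4} (hij : i ≠ j) (hkl : k ≠ l) (hjk : j ≠ k)
    (hil : i ≠ l) (a b : FreeRing X) : Commute (h.E i j a) (h.E k l b) := by
  induction a using freeRing_induction with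
  | hof u =>
    induction b using freeRing_induction with
    | hof v => rw [h.E_of hij, h.E_of hkl]; exact h.comm hij hkl hjk hil
    | hzero => rw [h.E_zero]; exact Commute.one_right _
    | hadd b b' hb hb' => rw [h.E_add]; exact hb.mul_right hb'
    | hneg b hb => rw [h.E_neg]; exact hb.inv_right
  | hzero => rw [h.E_zero]; exact Commute.one_left _
  | hadd a a' ha ha' => rw [h.E_add]; exact ha.mul_left ha'
  | hneg a ha => rw [h.E_neg]; exact ha.inv_left

theorem E_commutator (h : AllWordSteinberg e) {i j k : Fin 4} (hij : i ≠ j) (hjk : j ≠ k)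
    (hik : i ≠ k) (a b : FreeRing X) : ⁅h.E i j a, h.E j k b⁆ = h.E i k (a * b) := by
  induction a using freeRing_induction with
  | hof u =>
    induction b using freeRing_induction with
    | hof v =>
      rw [h.E_of hij, h.E_of hjk, ← map_mul, h.mul hij hjk hik, ← FreeMonoid.ofList_append,
        h.E_of hik]
    | hzero => simp [h.E_zero]
    | hadd b b' hb hb' =>
      rw [h.E_add, commutator_mul_right', hb, hb', mul_add, h.E_add,
        (h.E_comm hjk hik hik.symm hjk _ _).mul_mul_inv_cancel]
    | hneg b hb =>
      rw [h.E_neg, mul_neg, h.E_neg, ← commutatorElement_inv, commutator_inv_left,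
        commutatorElement_inv, hb]
      rw [← commutatorElement_inv, hb]
      exact (h.E_comm hik hjk hjk.symm.symm.symm hik _ _).inv_left
  | hzero => simp [h.E_zero]
  | hadd a a' ha ha' =>
    rw [h.E_add, commutator_mul_left', ha, ha', add_mul, h.E_add,
      (h.E_comm hij hik hij.symm hik _ _).mul_mul_inv_cancel]
    exact (h.E_comm hik hik hik.symm hik _ _).eq
  | hneg a ha =>
    rw [h.E_neg, neg_mul, h.E_neg, commutator_inv_left, ha]
    rw [ha]
    exact h.E_comm hik hij hik.symm hij _ _

end AllWordSteinberg

end FreeRing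

end CrazyGroup

end

noncomputable section

namespace CrazyGroup

/-! ### Finite presentability of `St_4` over a finitely presented ring -/

section FinitePresentation

open commutatorElement

variable (X : Type*) (N : ℕ)

/-- The symbols `e_{ij}(w)` for words `w` of length at most `N`. -/
abbrev WordSymbol : Type _ :=
  {s : (Fin 4 × Fin 4) × {w : List X // w.length ≤ N} // s.1.1 ≠ s.1.2}

variable {X}

instance [Finite X] : Finite {w : List X // w.length ≤ N} :=
  (List.finite_length_le X N).to_subtype

open Classical in
/-- The symbol `e_{ij}(w)` in the free group, trivial if `i = j` or if `w` is too long. -/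
def wordSymbol (i j : Fin 4) (w : List X) : FreeGroup (WordSymbol X N) :=
  if h : i ≠ j ∧ w.length ≤ N then FreeGroup.of ⟨⟨⟨i, j⟩, ⟨w, h.2⟩⟩, h.1⟩ else 1

variable (X) in
open Classical in
/-- The relators of `WordSteinberg N`. -/
def wordRelators : Set (FreeGroup (WordSymbol X N)) :=
  (Set.range fun s : (Fin 4 × Fin 4 × Fin 4) × {w : List X // w.length ≤ N} ×
      {w : List X // w.length ≤ N} =>
    if s.1.1 ≠ s.1.2.1 ∧ s.1.2.1 ≠ s.1.2.2 ∧ s.1.1 ≠ s.1.2.2 ∧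
        s.2.1.1.length + s.2.2.1.length ≤ N then
      ⁅wordSymbol N s.1.1 s.1.2.1 s.2.1.1, wordSymbol N s.1.2.1 s.1.2.2 s.2.2.1⁆ *
        (wordSymbol N s.1.1 s.1.2.2 (s.2.1.1 ++ s.2.2.1))⁻¹ else 1) ∪
  (Set.range fun s : ((Fin 4 × Fin 4) × (Fin 4 × Fin 4)) × {w : List X // w.length ≤ N} ×
      {w : List X // w.length ≤ N} =>
    if s.1.1.1 ≠ s.1.1.2 ∧ s.1.2.1 ≠ s.1.2.2 ∧ s.1.1.2 ≠ s.1.2.1 ∧ s.1.1.1 ≠ s.1.2.2 then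
      ⁅wordSymbol N s.1.1.1 s.1.1.2 s.2.1.1, wordSymbol N s.1.2.1 s.1.2.2 s.2.2.1⁆ else 1)

theorem finite_wordRelators [Finite X] : (wordRelators X N).Finite :=
  (Set.finite_range _).union (Set.finite_range _)

theorem wordSteinberg_mk : WordSteinberg N fun i j (w : List X) =>
    PresentedGroup.mk (wordRelators X N) (wordSymbol N i j w) where
  mul {i j k} hij hjk hik u v hl := by
    rw [← map_commutatorElement, ← mul_inv_eq_one, ← map_inv, ← map_mul]
    exact PresentedGroup.one_of_mem (Or.inl
      ⟨⟨⟨i, j, k⟩, ⟨u, by omega⟩, ⟨v, by omega⟩⟩, if_pos ⟨hij, hjk, hik, hl⟩⟩)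
  comm {i j k l} hij hkl hjk hil u v hu hv hl := by
    rw [← commutatorElement_eq_one_iff_commute, ← map_commutatorElement]
    exact PresentedGroup.one_of_mem (Or.inr
      ⟨⟨⟨⟨i, j⟩, k, l⟩, ⟨u, hu⟩, ⟨v, hv⟩⟩, if_pos ⟨hij, hkl, hjk, hil⟩⟩)

variable {R : Type*} [Ring R] {N}

/-- The map to the Steinberg group given by a map from the free ring. -/
def wordHom (π : FreeRing X →+* R) : PresentedGroup (wordRelators X N) →* Steinberg 4 R :=
  PresentedGroup.toGroup (f := fun s : WordSymbol X N => Steinberg.e s.1.1.1 s.1.1.2 s.2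
    (π (MonoidAlgebra.of ℤ _ (FreeMonoid.ofList s.1.2.1)))) <| by
    have key {i j : Fin 4} (hij : i ≠ j) {w : List X} (hw : w.length ≤ N) :
        FreeGroup.lift (fun s : WordSymbol X N => Steinberg.e s.1.1.1 s.1.1.2 s.2
          (π (MonoidAlgebra.of ℤ _ (FreeMonoid.ofList s.1.2.1)))) (wordSymbol N i j w) =
        Steinberg.e i j hij (π (MonoidAlgebra.of ℤ _ (FreeMonoid.ofList w))) := by
      rw [wordSymbol, dif_pos ⟨hij, hw⟩, FreeGroup.lift_apply_of]
    rintro _ (⟨⟨⟨i, j, k⟩, ⟨u, hu⟩, ⟨v, hv⟩⟩, rfl⟩ | ⟨⟨⟨⟨i, j⟩, k, l⟩, ⟨u, hu⟩, ⟨v, hv⟩⟩, rfl⟩)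
    · dsimp only
      split_ifs with h
      · obtain ⟨hij, hjk, hik, hl⟩ := h
        rw [map_mul, map_commutatorElement, map_inv, key hij hu, key hjk hv,
          key hik (by simpa using hl), Steinberg.e_commutator hij hjk hik, ← map_mul, ← map_mul,
          ← FreeMonoid.ofList_append, mul_inv_cancel]
      · exact map_one _
    · dsimp only
      split_ifs with h
      · obtain ⟨hij, hkl, hjk, hil⟩ := h
        rw [map_commutatorElement, key hij hu, key hkl hv]
        exact (Steinberg.e_commute hij hkl hjk hil _ _).commutator_eq
      · exact map_one _

theorem wordHom_mk (π : FreeRing X →+* R) {i j : Fin 4} (hij : i ≠ j) {w : List X}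
    (hw : w.length ≤ N) : wordHom π (PresentedGroup.mk (wordRelators X N) (wordSymbol N i j w)) =
      Steinberg.e i j hij (π (MonoidAlgebra.of ℤ _ (FreeMonoid.ofList w))) := by
  rw [wordSymbol, dif_pos ⟨hij, hw⟩]
  exact PresentedGroup.toGroup.of _

theorem wordHom_extendWords (hN : 1 ≤ N) (π : FreeRing X →+* R) (w : List X) {i j : Fin 4}
    (hij : i ≠ j) :
    wordHom π (extendWords N (fun i j (w : List X) =>
      PresentedGroup.mk (wordRelators X N) (wordSymbol N i j w)) w i j) =
      Steinberg.e i j hij (π (MonoidAlgebra.of ℤ _ (FreeMonoid.ofList w))) := by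
  induction w generalizing i j with
  | nil => exact wordHom_mk π hij (by simp)
  | cons x w ih =>
    rw [extendWords]
    split_ifs with h
    · exact wordHom_mk π hij (by simpa using h)
    · obtain ⟨hi, hj⟩ := middle_ne i j
      rw [map_commutatorElement, ih hj, wordHom_mk π hi.symm (by simpa using hN),
        Steinberg.e_commutator hi.symm hj hij, ← map_mul, ← map_mul, ← FreeMonoid.ofList_append,
        List.singleton_append]

/-- If `R` is a finitely presented ring, then `St_4(R)` is a finitely presented group. -/
theorem Steinberg.isFinitelyPresented [Finite X] (π : FreeRing X →+* R)
    (hπ : Function.Surjective π) (T : Set (FreeRing X)) (hT : T.Finite) (hTπ : ∀ t ∈ T, π t = 0)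
    (hker : ∀ J : TwoSidedIdeal (FreeRing X), (∀ t ∈ T, t ∈ J) → ∀ a, π a = 0 → a ∈ J) :
    Group.IsFinitelyPresented (Steinberg 4 R) := by
  have := Fintype.ofFinite X
  -- Both bounds required by `WordSteinberg.all` hold: `5 ≤ N` and more letters in a long word than
  -- elements of `X`.
  let N := Fintype.card X + 5
  have hN : 5 ≤ N := by omega
  have h := (wordSteinberg_mk (X := X) N).all hN (by omega)
  have : Finite (wordRelators X N) := finite_wordRelators N
  let f : PresentedGroup (wordRelators X N) →* Steinberg 4 R := wordHom π
  have fE {i j : Fin 4} (hij : i ≠ j) (a : FreeRing X) : f (h.E i j a) = e i j hij (π a) := by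
    induction a using AllWordSteinberg.freeRing_induction with
    | hof w => rw [h.E_of hij]; exact wordHom_extendWords (by omega) π w hij
    | hzero => simp [h.E_zero]
    | hadd a b ha hb => rw [h.E_add, map_mul, ha, hb, map_add, e_add]
    | hneg a ha => rw [h.E_neg, map_inv, ha, map_neg, e_neg]
  let T' : Set (PresentedGroup (wordRelators X N)) :=
    ⋃ ij : Fin 4 × Fin 4, if ij.1 ≠ ij.2 then h.E ij.1 ij.2 '' T else ∅
  have hT' : T'.Finite := Set.finite_iUnion fun ij => by
    split_ifs
    · exact hT.image _
    · exact Set.finite_empty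
  have memT' {i j : Fin 4} (hij : i ≠ j) {t : FreeRing X} (ht : t ∈ T) : h.E i j t ∈ T' :=
    Set.mem_iUnion.2 ⟨(i, j), by rw [if_pos hij]; exact ⟨t, ht, rfl⟩⟩
  let K := Subgroup.normalClosure T'
  let E (i j : Fin 4) (a : FreeRing X) : PresentedGroup (wordRelators X N) ⧸ K :=
    QuotientGroup.mk' K (h.E i j a)
  have Eadd (i j a b) : E i j (a + b) = E i j a * E i j b := by simp only [E, h.E_add, map_mul]
  have Eneg (i j a) : E i j (-a) = (E i j a)⁻¹ := by simp only [E, h.E_neg, map_inv]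
  have Ezero (i j) : E i j 0 = 1 := by simp only [E, h.E_zero, map_one]
  have Emul {i j k} (hij : i ≠ j) (hjk : j ≠ k) (hik : i ≠ k) (a b) :
      ⁅E i j a, E j k b⁆ = E i k (a * b) := by
    simp only [E]
    rw [← map_commutatorElement, h.E_commutator hij hjk hik]
  have Ecomm {i j k l} (hij : i ≠ j) (hkl : k ≠ l) (hjk : j ≠ k) (hil : i ≠ l) (a b) :
      Commute (E i j a) (E k l b) := (h.E_comm hij hkl hjk hil a b).map _
  -- The elements `a` for which all `E i j a` die modulo `K` form a two-sided ideal, by the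
  -- commutator relation through a middle index. It contains `T`, hence the kernel of `π`, so that
  -- `E i j` descends to `R` and defines the map `s` below.
  let J : TwoSidedIdeal (FreeRing X) := TwoSidedIdeal.mk' {a | ∀ i j, i ≠ j → E i j a = 1}
    (fun i j _ => Ezero i j)
    (fun {a b} ha hb i j hij => by rw [Eadd, ha i j hij, hb i j hij, one_mul])
    (fun {a} ha i j hij => by rw [Eneg, ha i j hij, inv_one])
    (fun {a b} hb i j hij => by
      obtain ⟨hi, hj⟩ := middle_ne i j
      rw [← Emul hi.symm hj hij, hb _ _ hj, commutatorElement_one_right])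
    (fun {a b} ha i j hij => by
      obtain ⟨hi, hj⟩ := middle_ne i j
      rw [← Emul hi.symm hj hij, ha _ _ hi.symm, commutatorElement_one_left])
  have memJ {a : FreeRing X} (ha : π a = 0) {i j : Fin 4} (hij : i ≠ j) : E i j a = 1 := by
    have := hker J (fun t ht => ?_) a ha
    · exact (TwoSidedIdeal.mem_mk' _ _ _ _ _ _ _).1 this i j hij
    · refine (TwoSidedIdeal.mem_mk' _ _ _ _ _ _ _).2 fun i j hij => ?_
      exact (QuotientGroup.eq_one_iff _).2 (Subgroup.subset_normalClosure (memT' hij ht))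
  have Econg {a b : FreeRing X} (hab : π a = π b) {i j : Fin 4} (hij : i ≠ j) :
      E i j a = E i j b := by
    have := memJ (a := a - b) (by rw [map_sub, hab, sub_self]) hij
    rw [sub_eq_add_neg, Eadd, Eneg] at this
    exact mul_inv_eq_one.1 this
  let σ := Function.surjInv hπ
  have hσ (r : R) : π (σ r) = r := Function.surjInv_eq hπ r
  let s : Steinberg 4 R →* PresentedGroup (wordRelators X N) ⧸ K :=
    Steinberg.lift (fun i j r => E i j (σ r))
      (fun i j hij r r' => by
        rw [← Eadd]; exact Econg (by rw [map_add, hσ, hσ, hσ]) hij)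
      (fun i j k hij hjk hik r r' => by
        rw [Emul hij hjk hik]; exact Econg (by rw [map_mul, hσ, hσ, hσ]) hik)
      (fun i j k l hij hkl hjk hil r r' => Ecomm hij hkl hjk hil _ _)
  -- This identity shows that the kernel of `f` lies in `K`, the nontrivial half of the claim that
  -- `f` has finitely normally generated kernel.
  have sf : s.comp f = QuotientGroup.mk' K := by
    refine PresentedGroup.ext fun ⟨⟨⟨i, j⟩, w, hw⟩, hij⟩ => ?_
    have h1 : (PresentedGroup.of ⟨⟨⟨i, j⟩, w, hw⟩, hij⟩ : PresentedGroup (wordRelators X N)) =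
        h.E i j (MonoidAlgebra.of ℤ _ (FreeMonoid.ofList w)) := by
      rw [h.E_of hij, extendWords_of_length_le _ hw, wordSymbol, dif_pos ⟨hij, hw⟩]
      rfl
    rw [h1, MonoidHom.comp_apply, fE hij]
    exact (Steinberg.lift_e _ _ _ _ i j hij _).trans (Econg (hσ _) hij)
  have fsurj : Function.Surjective f := by
    rw [← MonoidHom.range_eq_top, ← top_le_iff, ← Steinberg.closure_e, Subgroup.closure_le]
    rintro _ ⟨i, j, hij, r, rfl⟩
    exact ⟨h.E i j (σ r), by rw [fE hij, hσ]⟩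
  refine Group.IsFinitelyPresented.of_surjective f fsurj ⟨T', hT', le_antisymm ?_ ?_⟩
  · refine Subgroup.normalClosure_le_normal ?_
    intro x hx
    obtain ⟨⟨i, j⟩, hx⟩ := Set.mem_iUnion.1 hx
    dsimp only at hx
    split_ifs at hx with hij
    · obtain ⟨t, ht, rfl⟩ := hx
      rw [SetLike.mem_coe, MonoidHom.mem_ker, fE hij, hTπ t ht, e_zero]
    · exact hx.elim
  · intro x hx
    rw [MonoidHom.mem_ker] at hx
    have := DFunLike.congr_fun sf x
    rw [MonoidHom.comp_apply, hx, map_one] at this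
    exact (QuotientGroup.eq_one_iff x).1 this.symm

end FinitePresentation

end CrazyGroup

end

noncomputable section

namespace CrazyGroup

/-! ### Gluing maps along the two halves of the unit interval -/

/-- The affine map from `[0,1]` onto `[0,1/2]`. -/
def lo (t : unitInterval) : unitInterval :=
  ⟨t / 2, by have := t.2.1; positivity, by have := t.2.2; linarith⟩

/-- The affine map from `[0,1]` onto `[1/2,1]`. -/
def hi (t : unitInterval) : unitInterval :=
  ⟨(t + 1) / 2, by have := t.2.1; positivity, by have := t.2.2; linarith⟩

@[simp] theorem coe_lo (t : unitInterval) : (lo t : ℝ) = t / 2 := rfl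
@[simp] theorem coe_hi (t : unitInterval) : (hi t : ℝ) = (t + 1) / 2 := rfl

theorem strictMono_lo : StrictMono lo := fun s t h => by
  rw [← Subtype.coe_lt_coe] at h ⊢
  simp only [coe_lo]; linarith

theorem strictMono_hi : StrictMono hi := fun s t h => by
  rw [← Subtype.coe_lt_coe] at h ⊢
  simp only [coe_hi]; linarith

theorem lo_one : lo 1 = hi 0 := by ext; simp
theorem lo_zero : lo 0 = 0 := by ext; simp
theorem hi_one : hi 1 = 1 := by ext; simp

theorem lo_le_hi (s t : unitInterval) : lo s ≤ hi t := by
  rw [← Subtype.coe_le_coe]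
  have := s.2.2
  have := t.2.1
  simp only [coe_lo, coe_hi]; linarith

theorem exists_lo_or_hi (t : unitInterval) : (∃ s, t = lo s) ∨ ∃ s, t = hi s := by
  rcases le_total (t : ℝ) (1 / 2) with h | h
  · exact Or.inl ⟨⟨2 * t, by have := t.2.1; positivity, by linarith⟩, by ext; simp⟩
  · exact Or.inr ⟨⟨2 * t - 1, by linarith, by have := t.2.2; linarith⟩, by ext; simp⟩

theorem forall_lo_hi {p : unitInterval → Prop} (hlo : ∀ s, p (lo s)) (hhi : ∀ s, p (hi s))
    (t : unitInterval) : p t := by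
  rcases exists_lo_or_hi t with ⟨s, rfl⟩ | ⟨s, rfl⟩
  · exact hlo s
  · exact hhi s

open Classical in
/-- The map that is given by `a` on the lower and by `b` on the upper half. -/
def halves {β : Type*} (a b : unitInterval → β) (t : unitInterval) : β :=
  -- The value `0` is never reached, since a point outside the lower half is in the upper half. At
  -- `1/2` the map `a` wins, which is why `halves_hi` asks for `a 1 = b 0`.
  if h : ∃ s, t = lo s then a h.choose else b (if h : ∃ s, t = hi s then h.choose else 0)

section Halves

variable {β : Type*} {a b : unitInterval → β}

theorem halves_lo (s : unitInterval) : halves a b (lo s) = a s := by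
  have h : ∃ s', lo s = lo s' := ⟨s, rfl⟩
  rw [halves, dif_pos h, strictMono_lo.injective h.choose_spec.symm]

theorem halves_hi (hab : a 1 = b 0) (s : unitInterval) : halves a b (hi s) = b s := by
  by_cases h : ∃ s', hi s = lo s'
  · obtain ⟨s', hs'⟩ := h
    have h1 := congrArg Subtype.val hs'
    simp only [coe_hi, coe_lo] at h1
    have h2 := s.2.1
    have h3 := s'.2.2
    have e1 : s = 0 := Subtype.ext (show (s : ℝ) = 0 by linarith)
    have e2 : s' = 1 := Subtype.ext (show (s' : ℝ) = 1 by linarith)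
    rw [hs', halves_lo, e1, e2, hab]
  · have h' : ∃ s', hi s = hi s' := ⟨s, rfl⟩
    rw [halves, dif_neg h, dif_pos h', strictMono_hi.injective h'.choose_spec.symm]

theorem strictMono_halves [Preorder β] (hab : a 1 = b 0) (ha : StrictMono a) (hb : StrictMono b) :
    StrictMono (halves a b) := by
  intro s t
  induction s using forall_lo_hi with
  | hlo s =>
    induction t using forall_lo_hi with
    | hlo t => rw [halves_lo, halves_lo]; exact fun h => ha (strictMono_lo.lt_iff_lt.1 h)
    | hhi t =>
      rw [halves_lo, halves_hi hab]
      intro h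
      rcases eq_or_lt_of_le (show s ≤ 1 from le_top) with rfl | hs
      · rw [hab]
        rw [lo_one] at h
        exact hb (strictMono_hi.lt_iff_lt.1 h)
      · exact (ha hs).trans_le (hab ▸ hb.monotone bot_le)
  | hhi s =>
    induction t using forall_lo_hi with
    | hlo t => exact fun h => absurd h (lo_le_hi t s).not_gt
    | hhi t => rw [halves_hi hab, halves_hi hab]; exact fun h => hb (strictMono_hi.lt_iff_lt.1 h)

end Halves

/-- An order isomorphism of the unit interval acting on its two halves by `f` and `g`. -/
def glue (f g : unitInterval ≃o unitInterval) : unitInterval ≃o unitInterval :=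
  StrictMono.orderIsoOfSurjective (halves (fun s => lo (f s)) fun s => hi (g s))
    (strictMono_halves (by rw [show f 1 = 1 from map_top f, show g 0 = 0 from map_bot g, lo_one])
      (strictMono_lo.comp f.strictMono) (strictMono_hi.comp g.strictMono))
    (forall_lo_hi (fun s => ⟨lo (f.symm s), by simp [halves_lo]⟩) fun s =>
      ⟨hi (g.symm s), by
        rw [halves_hi (by rw [show f 1 = 1 from map_top f, show g 0 = 0 from map_bot g, lo_one])]
        simp⟩)

@[simp] theorem glue_lo (f g : unitInterval ≃o unitInterval) (s : unitInterval) :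
    glue f g (lo s) = lo (f s) :=
  halves_lo (a := fun s => lo (f s)) (b := fun s => hi (g s)) s

@[simp] theorem glue_hi (f g : unitInterval ≃o unitInterval) (s : unitInterval) :
    glue f g (hi s) = hi (g s) :=
  halves_hi (a := fun s => lo (f s)) (b := fun s => hi (g s))
    (by rw [show f 1 = 1 from map_top f, show g 0 = 0 from map_bot g, lo_one]) s

theorem halves_lo_hi_zero : lo (lo 1) = halves (fun s => lo (hi s)) hi 0 := by
  rw [lo_one, ← halves_lo (a := fun s => lo (hi s)) (b := hi), lo_zero]

/-- The first generator of Thompson's group. -/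
def rotation : unitInterval ≃o unitInterval :=
  StrictMono.orderIsoOfSurjective
    -- The intervals `[0,1/2]`, `[1/2,3/4]`, `[3/4,1]` go to `[0,1/4]`, `[1/4,1/2]`, `[1/2,1]` with
    -- slopes `1/2`, `1`, `2`.
    (halves (fun s => lo (lo s)) (halves (fun s => lo (hi s)) hi))
    (strictMono_halves halves_lo_hi_zero
      (strictMono_lo.comp strictMono_lo)
      (strictMono_halves (by rw [hi_one, lo_one]) (strictMono_lo.comp strictMono_hi) strictMono_hi))
    (by
      refine forall_lo_hi (fun s => ?_) fun s => ⟨hi (hi s), ?_⟩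
      · induction s using forall_lo_hi with
        | hlo s => exact ⟨lo s, halves_lo s⟩
        | hhi s =>
          exact ⟨hi (lo s), by
            rw [halves_hi halves_lo_hi_zero, halves_lo]⟩
      · rw [halves_hi halves_lo_hi_zero,
          halves_hi (by rw [hi_one, lo_one])])

theorem rotation_lo (s : unitInterval) : rotation (lo s) = lo (lo s) :=
  halves_lo (a := fun s => lo (lo s)) (b := halves (fun s => lo (hi s)) hi) s

theorem rotation_hi (s : unitInterval) :
    rotation (hi s) = halves (fun s => lo (hi s)) hi s :=
  halves_hi (a := fun s => lo (lo s)) (b := halves (fun s => lo (hi s)) hi) halves_lo_hi_zero s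

theorem rotation_hi_lo (s : unitInterval) : rotation (hi (lo s)) = lo (hi s) := by
  rw [rotation_hi, halves_lo]

theorem rotation_hi_hi (s : unitInterval) : rotation (hi (hi s)) = hi s := by
  rw [rotation_hi, halves_hi (by rw [hi_one, lo_one])]

theorem IsDyadic.lo {t : unitInterval} (h : IsDyadic t) : IsDyadic (lo t) := by
  have := h.zpow_mul (-1)
  rwa [coe_lo, div_eq_inv_mul, ← zpow_neg_one]

theorem IsDyadic.hi {t : unitInterval} (h : IsDyadic t) : IsDyadic (hi t) := by
  have := (h.add ⟨1, 0, by norm_num⟩ : IsDyadic ((t : ℝ) + 1)).zpow_mul (-1)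
  rwa [coe_hi, div_eq_inv_mul, ← zpow_neg_one]

theorem isDyadic_zero : IsDyadic ((0 : unitInterval) : ℝ) := ⟨0, 0, by simp⟩

/-- If the middle point does not separate `a` from `b`, then both lie in the same half. -/
theorem same_half {a b : unitInterval} (hab : a < b) (h : hi 0 ∉ Set.Ioo a b) :
    (∃ a' b', a = lo a' ∧ b = lo b' ∧ a' < b') ∨ ∃ a' b', a = hi a' ∧ b = hi b' ∧ a' < b' := by
  rcases exists_lo_or_hi a with ⟨a, rfl⟩ | ⟨a, rfl⟩ <;> rcases exists_lo_or_hi b with ⟨b, rfl⟩ | ⟨b, rfl⟩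
  · exact Or.inl ⟨a, b, rfl, rfl, strictMono_lo.lt_iff_lt.1 hab⟩
  · rw [Set.mem_Ioo, not_and_or, ← lo_one, strictMono_lo.lt_iff_lt, lo_one,
      strictMono_hi.lt_iff_lt] at h
    rcases h with h | h
    · obtain rfl : a = 1 := le_antisymm le_top (not_lt.1 h)
      rw [lo_one] at hab ⊢
      exact Or.inr ⟨0, b, rfl, rfl, strictMono_hi.lt_iff_lt.1 hab⟩
    · obtain rfl : b = 0 := le_antisymm (not_lt.1 h) bot_le
      rw [← lo_one] at hab ⊢
      exact Or.inl ⟨a, 1, rfl, rfl, strictMono_lo.lt_iff_lt.1 hab⟩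
  · exact absurd hab (lo_le_hi b a).not_gt
  · exact Or.inr ⟨a, b, rfl, rfl, strictMono_hi.lt_iff_lt.1 hab⟩

theorem exists_lo_of_le {a b x : unitInterval} (h1 : lo a ≤ x) (h2 : x ≤ lo b) :
    ∃ y, x = lo y ∧ a ≤ y ∧ y ≤ b := by
  have h3 := Subtype.coe_le_coe.2 h1
  have h4 := Subtype.coe_le_coe.2 h2
  have := a.2.1
  have := b.2.2
  simp only [coe_lo] at h3 h4
  refine ⟨⟨2 * x, by linarith, by linarith⟩, by ext; simp, ?_, ?_⟩ <;>
  · rw [← Subtype.coe_le_coe]; simp only; linarith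

theorem exists_hi_of_le {a b x : unitInterval} (h1 : hi a ≤ x) (h2 : x ≤ hi b) :
    ∃ y, x = hi y ∧ a ≤ y ∧ y ≤ b := by
  have h3 := Subtype.coe_le_coe.2 h1
  have h4 := Subtype.coe_le_coe.2 h2
  have := a.2.1
  have := b.2.2
  simp only [coe_hi] at h3 h4
  refine ⟨⟨2 * x - 1, by linarith, by linarith⟩, by ext; simp, ?_, ?_⟩ <;>
  · rw [← Subtype.coe_le_coe]; simp only; linarith

theorem IsThompson.glue {f g : unitInterval ≃o unitInterval} (hf : IsThompson f)
    (hg : IsThompson g) : IsThompson (glue f g) := by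
  obtain ⟨B, hB, hBd, h⟩ := hf
  obtain ⟨C, hC, hCd, h'⟩ := hg
  refine ⟨lo '' B ∪ hi '' C ∪ {hi 0}, ((hB.image _).union (hC.image _)).union
    (Set.finite_singleton _), ?_, fun a b hab hdis => ?_⟩
  · rintro _ ((⟨b, hb, rfl⟩ | ⟨b, hb, rfl⟩) | rfl)
    · exact (hBd b hb).lo
    · exact (hCd b hb).hi
    · exact isDyadic_zero.hi
  · rw [Set.disjoint_union_left, Set.disjoint_union_left, Set.disjoint_singleton_left] at hdis
    rcases same_half hab hdis.2 with ⟨a, b, rfl, rfl, hab'⟩ | ⟨a, b, rfl, rfl, hab'⟩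
    · obtain ⟨k, hk⟩ := h a b hab' (Set.disjoint_left.2 fun z hz hzab =>
        Set.disjoint_left.1 hdis.1.1 (Set.mem_image_of_mem lo hz)
          ⟨strictMono_lo hzab.1, strictMono_lo hzab.2⟩)
      refine ⟨k, fun x hx => ?_⟩
      obtain ⟨y, rfl, hy⟩ := exists_lo_of_le hx.1 hx.2
      rw [glue_lo, glue_lo, coe_lo, hk y hy, coe_lo, coe_lo, coe_lo]
      ring
    · obtain ⟨k, hk⟩ := h' a b hab' (Set.disjoint_left.2 fun z hz hzab =>
        Set.disjoint_left.1 hdis.1.2 (Set.mem_image_of_mem hi hz)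
          ⟨strictMono_hi hzab.1, strictMono_hi hzab.2⟩)
      refine ⟨k, fun x hx => ?_⟩
      obtain ⟨y, rfl, hy⟩ := exists_hi_of_le hx.1 hx.2
      rw [glue_hi, glue_hi, coe_hi, hk y hy, coe_hi, coe_hi, coe_hi]
      ring

theorem isThompson_rotation : IsThompson rotation := by
  refine ⟨{hi 0, hi (hi 0)}, by simp, ?_, fun a b hab hdis => ?_⟩
  · rintro _ (rfl | rfl)
    · exact isDyadic_zero.hi
    · exact isDyadic_zero.hi.hi
  · rw [Set.disjoint_insert_left, Set.disjoint_singleton_left] at hdis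
    rcases same_half hab hdis.1 with ⟨a, b, rfl, rfl, hab'⟩ | ⟨a, b, rfl, rfl, hab'⟩
    · refine ⟨-1, fun x hx => ?_⟩
      obtain ⟨y, rfl, hy⟩ := exists_lo_of_le hx.1 hx.2
      rw [rotation_lo, rotation_lo]
      simp only [coe_lo, zpow_neg_one]
      ring
    · have h2 : hi 0 ∉ Set.Ioo a b := fun h =>
        hdis.2 ⟨strictMono_hi h.1, strictMono_hi h.2⟩
      rcases same_half hab' h2 with ⟨a, b, rfl, rfl, -⟩ | ⟨a, b, rfl, rfl, -⟩
      · refine ⟨0, fun x hx => ?_⟩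
        obtain ⟨y, rfl, hy⟩ := exists_hi_of_le hx.1 hx.2
        obtain ⟨y, rfl, hy⟩ := exists_lo_of_le hy.1 hy.2
        rw [rotation_hi_lo, rotation_hi_lo]
        simp only [coe_lo, coe_hi, zpow_zero]
        ring
      · refine ⟨1, fun x hx => ?_⟩
        obtain ⟨y, rfl, hy⟩ := exists_hi_of_le hx.1 hx.2
        obtain ⟨y, rfl, hy⟩ := exists_hi_of_le hy.1 hy.2
        rw [rotation_hi_hi, rotation_hi_hi]
        simp only [coe_hi, zpow_one]
        ring

end CrazyGroup

end

noncomputable section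

namespace CrazyGroup

/-! ### Generators of Thompson's group -/

namespace ThompsonF

theorem ext_fun {f g : ThompsonF} (h : ∀ t, f.1 t = g.1 t) : f = g :=
  Subtype.ext (RelIso.ext h)

theorem ext_halves {f g : ThompsonF} (hlo : ∀ t, f.1 (lo t) = g.1 (lo t))
    (hhi : ∀ t, f.1 (hi t) = g.1 (hi t)) : f = g :=
  ext_fun (forall_lo_hi hlo hhi)

@[simp] theorem coe_mul_apply (f g : ThompsonF) (t : unitInterval) :
    (f * g).1 t = f.1 (g.1 t) := rfl

@[simp] theorem coe_one_apply (t : unitInterval) : (1 : ThompsonF).1 t = t := rfl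

theorem inv_apply_eq {f : ThompsonF} {s t : unitInterval} : (f⁻¹).1 s = t ↔ s = f.1 t := by
  constructor
  · rintro rfl
    rw [← coe_mul_apply, mul_inv_cancel, coe_one_apply]
  · rintro rfl
    rw [← coe_mul_apply, inv_mul_cancel, coe_one_apply]

theorem apply_zero (f : ThompsonF) : f.1 0 = 0 := map_bot f.1
theorem apply_one (f : ThompsonF) : f.1 1 = 1 := map_top f.1

/-- The elements acting separately on the two halves of the unit interval. -/
def join : ThompsonF × ThompsonF →* ThompsonF where
  toFun p := ⟨glue p.1.1 p.2.1, p.1.2.glue p.2.2⟩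
  map_one' := ext_halves (fun t => by simp) fun t => by simp
  map_mul' p q := ext_halves (fun t => by simp) fun t => by simp

@[simp] theorem join_lo (p : ThompsonF × ThompsonF) (t : unitInterval) :
    (join p).1 (lo t) = lo (p.1.1 t) := glue_lo _ _ _

@[simp] theorem join_hi (p : ThompsonF × ThompsonF) (t : unitInterval) :
    (join p).1 (hi t) = hi (p.2.1 t) := glue_hi _ _ _

theorem join_injective : Function.Injective join := fun p q h => by
  refine Prod.ext (ext_fun fun t => strictMono_lo.injective ?_)
    (ext_fun fun t => strictMono_hi.injective ?_)
  · rw [← join_lo, h, join_lo]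
  · rw [← join_hi, h, join_hi]

/-- The first generator of Thompson's group. -/
def rot : ThompsonF := ⟨rotation, isThompson_rotation⟩

@[simp] theorem rot_lo (t : unitInterval) : rot.1 (lo t) = lo (lo t) := rotation_lo t
@[simp] theorem rot_hi_lo (t : unitInterval) : rot.1 (hi (lo t)) = lo (hi t) := rotation_hi_lo t
@[simp] theorem rot_hi_hi (t : unitInterval) : rot.1 (hi (hi t)) = hi t := rotation_hi_hi t

theorem rot_inv_lo_lo (t : unitInterval) : (rot⁻¹).1 (lo (lo t)) = lo t := by
  rw [inv_apply_eq, rot_lo]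

theorem rot_inv_lo_hi (t : unitInterval) : (rot⁻¹).1 (lo (hi t)) = hi (lo t) := by
  rw [inv_apply_eq, rot_hi_lo]

theorem rot_inv_hi (t : unitInterval) : (rot⁻¹).1 (hi t) = hi (hi t) := by
  rw [inv_apply_eq, rot_hi_hi]

/-- `rot` re-brackets the interval from one piece followed by two to two pieces followed by one;
this is the naturality of the associator. -/
theorem rot_mul_join (f g h : ThompsonF) :
    rot * join (f, join (g, h)) = join (join (f, g), h) * rot := by
  refine ext_halves (fun t => by simp) fun t => ?_
  induction t using forall_lo_hi <;> simp

/-- The pentagon identity for re-bracketing four pieces. -/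
theorem rot_mul_rot : rot * rot = join (rot, 1) * rot * join (1, rot) := by
  refine ext_halves (fun t => by simp) fun t => ?_
  induction t using forall_lo_hi with
  | hlo t => simp
  | hhi t => induction t using forall_lo_hi <;> simp

/-- The generators of the infinite presentation of Thompson's group. -/
def X : ℕ → ThompsonF
  | 0 => rot
  | n + 1 => join (1, X n)

theorem X_zero : X 0 = rot := rfl
theorem X_succ (n : ℕ) : X (n + 1) = join (1, X n) := rfl

/-- For `i = 0` this is the naturality of `rot`; larger indices reduce to that case inside the upper
half. -/
theorem X_mul_X : ∀ {i j : ℕ}, i < j → X j * X i = X i * X (j + 1)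
  | 0, 0, h => absurd h (lt_irrefl 0)
  | 0, j + 1, _ => by
    rw [X_succ, X_succ, X_succ, X_zero, rot_mul_join, ← Prod.one_eq_mk, map_one]
  | i + 1, 0, h => absurd h (Nat.not_lt_zero _)
  | i + 1, j + 1, h => by
    rw [X_succ, X_succ, X_succ (j + 1), ← map_mul, ← map_mul, Prod.mk_mul_mk, Prod.mk_mul_mk,
      X_mul_X (Nat.lt_of_succ_lt_succ h)]

theorem join_rot_one : join (rot, 1) = X 0 * X 0 * (X 1)⁻¹ * (X 0)⁻¹ := by
  rw [X_zero, rot_mul_rot, X_succ, X_zero]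
  group

theorem join_X_succ_one (n : ℕ) :
    join (X (n + 1), 1) = X 0 * join (1, join (X n, 1)) * (X 0)⁻¹ := by
  rw [X_zero, rot_mul_join, X_succ]
  group

/-- The subgroup generated by the elements `X n`. -/
def genX : Subgroup ThompsonF := Subgroup.closure (Set.range X)

theorem X_mem_genX (n : ℕ) : X n ∈ genX := Subgroup.subset_closure ⟨n, rfl⟩

theorem join_one_mem_genX {f : ThompsonF} (hf : f ∈ genX) : join (1, f) ∈ genX := by
  have : genX ≤ genX.comap (join.comp (MonoidHom.inr _ _)) := by
    refine (Subgroup.closure_le _).2 ?_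
    rintro _ ⟨n, rfl⟩
    exact X_mem_genX (n + 1)
  exact this hf

/-- The generators `X n` with `n > 0` live in the upper half, so the lower half needs an argument.
The pentagon expresses `join (rot, 1)` by `X 0` and `X 1`, and conjugation by `X 0` carries `join
(1, join (X n, 1))` to `join (X (n + 1), 1)`. -/
theorem join_mem_genX_one {f : ThompsonF} (hf : f ∈ genX) : join (f, 1) ∈ genX := by
  have : genX ≤ genX.comap (join.comp (MonoidHom.inl _ _)) := by
    refine (Subgroup.closure_le _).2 ?_
    rintro _ ⟨n, rfl⟩
    show join (X n, 1) ∈ genX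
    induction n with
    | zero =>
      rw [X_zero, join_rot_one]
      exact mul_mem (mul_mem (mul_mem (X_mem_genX 0) (X_mem_genX 0)) (inv_mem (X_mem_genX 1)))
        (inv_mem (X_mem_genX 0))
    | succ n ih =>
      rw [join_X_succ_one]
      exact mul_mem (mul_mem (X_mem_genX 0) (join_one_mem_genX ih)) (inv_mem (X_mem_genX 0))
  exact this hf

theorem join_mem_genX {f g : ThompsonF} (hf : f ∈ genX) (hg : g ∈ genX) : join (f, g) ∈ genX := by
  have : ((f, g) : ThompsonF × ThompsonF) = (f, 1) * (1, g) := by simp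
  rw [this, map_mul]
  exact mul_mem (join_mem_genX_one hf) (join_one_mem_genX hg)

end ThompsonF

/-! ### Standard dyadic intervals -/

/-- The affine bijection from `[0,1]` onto a standard dyadic interval. -/
def std : List Bool → unitInterval → unitInterval
  | [], t => t
  | false :: w, t => lo (std w t)
  | true :: w, t => hi (std w t)

@[simp] theorem std_nil (t : unitInterval) : std [] t = t := rfl
@[simp] theorem std_false (w : List Bool) (t : unitInterval) :
    std (false :: w) t = lo (std w t) := rfl
@[simp] theorem std_true (w : List Bool) (t : unitInterval) :
    std (true :: w) t = hi (std w t) := rfl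

theorem strictMono_std : ∀ w, StrictMono (std w)
  | [] => strictMono_id
  | false :: w => strictMono_lo.comp (strictMono_std w)
  | true :: w => strictMono_hi.comp (strictMono_std w)

theorem std_append (w w' : List Bool) (t : unitInterval) :
    std (w ++ w') t = std w (std w' t) := by
  induction w with
  | nil => rfl
  | cons b w ih => cases b <;> simp [ih]

theorem hi_zero_pos : (0 : unitInterval) < hi 0 := by
  rw [← Subtype.coe_lt_coe, coe_hi]; simp

theorem hi_zero_lt_one : hi 0 < (1 : unitInterval) := by
  rw [← Subtype.coe_lt_coe, coe_hi]; norm_num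

theorem zero_lt_hi (t : unitInterval) : 0 < hi t :=
  hi_zero_pos.trans_le (strictMono_hi.monotone bot_le)

theorem lo_lt_one (t : unitInterval) : lo t < 1 :=
  (strictMono_lo.monotone le_top).trans_lt (lo_one ▸ hi_zero_lt_one)

theorem eq_nil_of_std_zero_one : ∀ {w : List Bool}, std w 0 = 0 → std w 1 = 1 → w = []
  | [], _, _ => rfl
  | false :: _, _, h => absurd h (lo_lt_one _).ne
  | true :: _, h, _ => absurd h (zero_lt_hi _).ne'

theorem std_hi_zero_pos (w : List Bool) : 0 < std w (hi 0) :=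
  lt_of_le_of_lt (show 0 ≤ std w 0 from bot_le) (strictMono_std w hi_zero_pos)

theorem std_hi_zero_lt_one (w : List Bool) : std w (hi 0) < 1 :=
  lt_of_lt_of_le (strictMono_std w hi_zero_lt_one) (show std w 1 ≤ 1 from le_top)

theorem exists_std_eq_div (n : ℕ) : ∀ j : ℕ, j < 2 ^ n →
    ∃ w, ∀ t : unitInterval, (std w t : ℝ) = (j + t) / 2 ^ n := by
  induction n with
  | zero =>
    intro j hj
    obtain rfl : j = 0 := by simpa using hj
    exact ⟨[], fun t => by simp⟩
  | succ n ih =>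
    intro j hj
    rcases lt_or_ge j (2 ^ n) with h | h
    · obtain ⟨w, hw⟩ := ih j h
      exact ⟨false :: w, fun t => by rw [std_false, coe_lo, hw, pow_succ]; field_simp⟩
    · obtain ⟨j, rfl⟩ := Nat.exists_eq_add_of_le h
      obtain ⟨w, hw⟩ := ih j (by rw [pow_succ] at hj; omega)
      exact ⟨true :: w, fun t => by
        rw [std_true, coe_hi, hw, pow_succ]; push_cast; field_simp; ring⟩

theorem exists_std_eq (c : unitInterval) (h0 : 0 < c) (h1 : c < 1) (hc : IsDyadic c) :
    ∃ w, c = std w (hi 0) := by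
  obtain ⟨a, k, hk⟩ := hc
  induction k generalizing a c with
  | zero =>
    rw [← Subtype.coe_lt_coe] at h0 h1
    simp only [pow_zero, div_one] at hk
    rw [hk] at h0 h1
    have h0' : (0 : ℤ) < a := by exact_mod_cast (show (0 : ℝ) < a from h0)
    have h1' : a < (1 : ℤ) := by exact_mod_cast (show (a : ℝ) < 1 from h1)
    omega
  | succ k ih =>
    rcases exists_lo_or_hi c with ⟨c, rfl⟩ | ⟨c, rfl⟩
    · rw [← lo_zero, strictMono_lo.lt_iff_lt] at h0
      rcases eq_or_lt_of_le (show c ≤ 1 from le_top) with rfl | h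
      · exact ⟨[], by rw [lo_one]; rfl⟩
      · obtain ⟨w, hw⟩ := ih c h0 h a (by
          rw [coe_lo, pow_succ] at hk; field_simp at hk ⊢; linarith)
        exact ⟨false :: w, by rw [hw, std_false]⟩
    · rw [← hi_one, strictMono_hi.lt_iff_lt] at h1
      rcases eq_or_lt_of_le (show 0 ≤ c from bot_le) with rfl | h
      · exact ⟨[], rfl⟩
      · obtain ⟨w, hw⟩ := ih c h h1 (a - 2 ^ k) (by
          rw [coe_hi, pow_succ] at hk; push_cast; field_simp at hk ⊢; linarith)
        exact ⟨true :: w, by rw [hw, std_true]⟩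

namespace ThompsonF

/-- The midpoint of a standard interval is moved to `1/2` by induction: glueing the inductive
element with the identity moves it to the midpoint of its half, and `rot` or its inverse then moves
it to `1/2`. The only standard intervals that this last factor does not map to standard ones are
`[0,1]` and that half, and they contain the point in their interior. -/
theorem exists_mem_genX_moving (v : List Bool) : ∃ h ∈ genX, h.1 (std v (hi 0)) = hi 0 ∧
    ∀ w, (∀ t, 0 < t → t < 1 → std w t ≠ std v (hi 0)) → ∃ w', ∀ t, h.1 (std w t) = std w' t := by
  induction v with
  | nil => exact ⟨1, one_mem _, rfl, fun w _ => ⟨w, fun t => rfl⟩⟩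
  | cons b v ih =>
    obtain ⟨h, hh, hv, hw⟩ := ih
    -- An interval avoiding the point is not carried onto all of `[0,1]`. So `w'` has a first
    -- letter, which selects the piece on which `rot` or its inverse is affine.
    have key {w w' : List Bool} (hw' : ∀ t, h.1 (std w t) = std w' t)
        (hne : ∀ t, 0 < t → t < 1 → std w t ≠ std v (hi 0)) : w' ≠ [] := by
      rintro rfl
      refine hne _ hi_zero_pos hi_zero_lt_one (h.1.injective ?_)
      rw [hv]
      exact hw' (hi 0)
    cases b with
    | false =>
      refine ⟨rot⁻¹ * join (h, 1), mul_mem (inv_mem (X_mem_genX 0)) (join_mem_genX_one hh), ?_,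
        fun w hne => ?_⟩
      · rw [std_false, coe_mul_apply, join_lo, hv, rot_inv_lo_hi, lo_zero]
      · match w with
        | [] => exact absurd rfl (hne _ (std_hi_zero_pos (false :: v))
            (std_hi_zero_lt_one (false :: v)))
        | true :: w =>
          exact ⟨true :: true :: w, fun t => by
            rw [std_true, coe_mul_apply, join_hi, rot_inv_hi]; rfl⟩
        | false :: w =>
          have hne' : ∀ t, 0 < t → t < 1 → std w t ≠ std v (hi 0) := fun t h0 h1 he =>
            hne t h0 h1 (by simp [he])
          obtain ⟨w', hw'⟩ := hw w hne'
          match w', key hw' hne' with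
          | false :: w', _ => exact ⟨false :: w', fun t => by
            rw [std_false, coe_mul_apply, join_lo, hw', std_false, rot_inv_lo_lo]⟩
          | true :: w', _ => exact ⟨true :: false :: w', fun t => by
            rw [std_false, coe_mul_apply, join_lo, hw', std_true, rot_inv_lo_hi]; rfl⟩
    | true =>
      refine ⟨rot * join (1, h), mul_mem (X_mem_genX 0) (join_one_mem_genX hh), ?_,
        fun w hne => ?_⟩
      · rw [std_true, coe_mul_apply, join_hi, hv, rot_hi_hi]
      · match w with
        | [] => exact absurd rfl (hne _ (std_hi_zero_pos (true :: v))
            (std_hi_zero_lt_one (true :: v)))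
        | false :: w =>
          exact ⟨false :: false :: w, fun t => by simp⟩
        | true :: w =>
          have hne' : ∀ t, 0 < t → t < 1 → std w t ≠ std v (hi 0) := fun t h0 h1 he =>
            hne t h0 h1 (by simp [he])
          obtain ⟨w', hw'⟩ := hw w hne'
          match w', key hw' hne' with
          | false :: w', _ => exact ⟨false :: true :: w', fun t => by simp [hw']⟩
          | true :: w', _ => exact ⟨true :: w', fun t => by simp [hw']⟩

end ThompsonF

/-- `u` maps each of the standard dyadic intervals of length `2 ^ (-n)` affinely onto a standard
dyadic interval. -/
def IsStdMap : ℕ → (unitInterval → unitInterval) → Prop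
  | 0, u => ∃ w, ∀ t, u t = std w t
  | n + 1, u => IsStdMap n (fun t => u (lo t)) ∧ IsStdMap n fun t => u (hi t)

theorem IsStdMap.succ {n : ℕ} {u : unitInterval → unitInterval} (h : IsStdMap n u) :
    IsStdMap (n + 1) u := by
  induction n generalizing u with
  | zero =>
    obtain ⟨w, hw⟩ := h
    exact ⟨⟨w ++ [false], fun t => by simp [hw, std_append]⟩,
      ⟨w ++ [true], fun t => by simp [hw, std_append]⟩⟩
  | succ n ih => exact ⟨ih h.1, ih h.2⟩

theorem IsStdMap.mono {m n : ℕ} (hmn : m ≤ n) {u : unitInterval → unitInterval}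
    (h : IsStdMap m u) : IsStdMap n u := by
  induction hmn with
  | refl => exact h
  | step _ ih => exact ih.succ

/-- The slope is `2 ^ (d - m)`, and each halving of the domain lowers `d` by one. For `d = 0` the
image has length `2 ^ (-m)` and starts at a multiple of it, so it is a standard interval. -/
theorem isStdMap_of_affine (m d : ℕ) (u : unitInterval → unitInterval) (a : ℤ)
    (hu : ∀ t : unitInterval, (u t : ℝ) = a / 2 ^ m + 2 ^ d / 2 ^ m * t) : IsStdMap d u := by
  induction d generalizing u a with
  | zero =>
    have h0 := (u 0).2.1
    have h1 := (u 1).2.2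
    rw [hu] at h0 h1
    have ha : 0 ≤ a := by
      by_contra! h
      have : (a : ℝ) < 0 := by exact_mod_cast h
      have : (a : ℝ) / 2 ^ m < 0 := div_neg_of_neg_of_pos this (by positivity)
      simp at h0
      linarith
    lift a to ℕ using ha
    have ha : a < 2 ^ m := by
      have : ((a : ℝ) + 1) / 2 ^ m ≤ 1 := by
        simpa [add_div] using h1
      rw [div_le_one (by positivity)] at this
      exact_mod_cast this
    obtain ⟨w, hw⟩ := exists_std_eq_div m a ha
    refine ⟨w, fun t => Subtype.ext ?_⟩
    rw [hu, hw]
    push_cast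
    ring
  | succ d ih =>
    refine ⟨ih _ a fun t => ?_, ih _ (a + 2 ^ d) fun t => ?_⟩
    · rw [hu, coe_lo, pow_succ]; ring
    · rw [hu, coe_hi, pow_succ]; push_cast; ring

/-- `2 ^ N` is a common denominator of the break points, and each halving of the domain lowers `N`
by one. For `N = 0` no break point lies inside, and the map is affine. -/
theorem exists_isStdMap (N : ℕ) (u : unitInterval → unitInterval) (B : Set unitInterval)
    (hB : ∀ b ∈ B, ∃ a : ℤ, (b : ℝ) = a / 2 ^ N)
    (hd : ∀ t : unitInterval, IsDyadic t → IsDyadic (u t))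
    (hu : ∀ a b : unitInterval, a < b → Disjoint B (Set.Ioo a b) →
      ∃ k : ℤ, ∀ x ∈ Set.Icc a b, (u x : ℝ) = u a + 2 ^ k * ((x : ℝ) - a)) :
    ∃ n, IsStdMap n u := by
  induction N generalizing u B with
  | zero =>
    obtain ⟨k, hk⟩ := hu 0 1 zero_lt_one (Set.disjoint_left.2 fun b hb hb' => by
      obtain ⟨a, ha⟩ := hB b hb
      have h0 := Subtype.coe_lt_coe.2 hb'.1
      have h1 := Subtype.coe_lt_coe.2 hb'.2
      simp only [pow_zero, div_one] at ha
      rw [ha] at h0 h1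
      have h0' : (0 : ℤ) < a := by exact_mod_cast (show (0 : ℝ) < a from h0)
      have h1' : a < (1 : ℤ) := by exact_mod_cast (show (a : ℝ) < 1 from h1)
      omega)
    obtain ⟨a, m, ha⟩ := hd 0 isDyadic_zero
    obtain ⟨p, q, rfl⟩ : ∃ p q : ℕ, k = p - q := ⟨k.toNat, (-k).toNat, by omega⟩
    refine ⟨p + m, isStdMap_of_affine (q + m) (p + m) u (a * 2 ^ q) fun t => ?_⟩
    rw [hk t ⟨bot_le, le_top⟩, ha, zpow_sub₀ two_ne_zero]
    push_cast
    rw [pow_add, pow_add]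
    simp only [zpow_natCast, sub_zero]
    field_simp
  | succ N ih =>
    obtain ⟨m, hm⟩ := ih (fun t => u (lo t)) (lo ⁻¹' B)
      (fun b hb => by
        obtain ⟨a, ha⟩ := hB _ hb
        exact ⟨a, by rw [coe_lo, pow_succ] at ha; field_simp at ha ⊢; linarith⟩)
      (fun t ht => hd _ ht.lo)
      (fun a b hab hdis => by
        obtain ⟨k, hk⟩ := hu (lo a) (lo b) (strictMono_lo hab) (Set.disjoint_left.2 fun z hz h => by
          obtain ⟨y, rfl, -⟩ := exists_lo_of_le h.1.le h.2.le
          exact Set.disjoint_left.1 hdis hz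
            ⟨strictMono_lo.lt_iff_lt.1 h.1, strictMono_lo.lt_iff_lt.1 h.2⟩)
        refine ⟨k - 1, fun x hx => ?_⟩
        rw [hk (lo x) ⟨strictMono_lo.monotone hx.1, strictMono_lo.monotone hx.2⟩,
          zpow_sub_one₀ two_ne_zero, coe_lo, coe_lo]
        ring)
    obtain ⟨n, hn⟩ := ih (fun t => u (hi t)) (hi ⁻¹' B)
      (fun b hb => by
        obtain ⟨a, ha⟩ := hB _ hb
        exact ⟨a - 2 ^ N, by
          rw [coe_hi, pow_succ] at ha; push_cast; field_simp at ha ⊢; linarith⟩)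
      (fun t ht => hd _ ht.hi)
      (fun a b hab hdis => by
        obtain ⟨k, hk⟩ := hu (hi a) (hi b) (strictMono_hi hab) (Set.disjoint_left.2 fun z hz h => by
          obtain ⟨y, rfl, -⟩ := exists_hi_of_le h.1.le h.2.le
          exact Set.disjoint_left.1 hdis hz
            ⟨strictMono_hi.lt_iff_lt.1 h.1, strictMono_hi.lt_iff_lt.1 h.2⟩)
        refine ⟨k - 1, fun x hx => ?_⟩
        rw [hk (hi x) ⟨strictMono_hi.monotone hx.1, strictMono_hi.monotone hx.2⟩,
          zpow_sub_one₀ two_ne_zero, coe_hi, coe_hi]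
        ring)
    exact ⟨max m n + 1, hm.mono (le_max_left _ _), hn.mono (le_max_right _ _)⟩

theorem exists_common_denominator {B : Set unitInterval} (hB : B.Finite)
    (hd : ∀ b ∈ B, IsDyadic b) : ∃ N : ℕ, ∀ b ∈ B, ∃ a : ℤ, (b : ℝ) = a / 2 ^ N := by
  induction B, hB using Set.Finite.induction_on with
  | empty => exact ⟨0, by simp⟩
  | @insert c B _ _ ih =>
    obtain ⟨N, hN⟩ := ih fun b hb => hd b (Set.mem_insert_of_mem _ hb)
    obtain ⟨a, k, hk⟩ := hd c (Set.mem_insert _ _)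
    refine ⟨N + k, ?_⟩
    rintro b (rfl | hb)
    · exact ⟨a * 2 ^ N, by rw [hk, pow_add]; push_cast; field_simp⟩
    · obtain ⟨a, ha⟩ := hN b hb
      exact ⟨a * 2 ^ k, by rw [ha, pow_add]; push_cast; field_simp⟩

namespace ThompsonF

theorem exists_isStdMap (f : ThompsonF) : ∃ n, IsStdMap n f.1 := by
  obtain ⟨B, hB, hBd, h⟩ := id f.2
  obtain ⟨N, hN⟩ := exists_common_denominator hB hBd
  exact CrazyGroup.exists_isStdMap N f.1 B hN (fun t ht => IsThompson.isDyadic f.2 ht) h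

end ThompsonF

end CrazyGroup

end

noncomputable section

namespace CrazyGroup

/-! ### Splitting at `1/2` and generation of Thompson's group -/

namespace ThompsonF

theorem isThompson_of_join_lo {f : ThompsonF} {u : unitInterval ≃o unitInterval}
    (h : ∀ t, f.1 (lo t) = lo (u t)) : IsThompson u := by
  obtain ⟨B, hB, hBd, hf⟩ := id f.2
  refine ⟨lo ⁻¹' B, hB.preimage strictMono_lo.injective.injOn, fun b hb => ?_, fun a b hab hdis => ?_⟩
  · have := (hBd _ hb).zpow_mul 1
    rwa [coe_lo, zpow_one, mul_div_cancel₀ _ two_ne_zero] at this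
  · obtain ⟨k, hk⟩ := hf (lo a) (lo b) (strictMono_lo hab) (Set.disjoint_left.2 fun z hz h => by
      obtain ⟨y, rfl, -⟩ := exists_lo_of_le h.1.le h.2.le
      exact Set.disjoint_left.1 hdis hz
        ⟨strictMono_lo.lt_iff_lt.1 h.1, strictMono_lo.lt_iff_lt.1 h.2⟩)
    refine ⟨k, fun x hx => ?_⟩
    have := hk (lo x) ⟨strictMono_lo.monotone hx.1, strictMono_lo.monotone hx.2⟩
    rw [h, h, coe_lo, coe_lo, coe_lo, coe_lo] at this
    linarith

theorem isThompson_of_join_hi {f : ThompsonF} {u : unitInterval ≃o unitInterval}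
    (h : ∀ t, f.1 (hi t) = hi (u t)) : IsThompson u := by
  obtain ⟨B, hB, hBd, hf⟩ := id f.2
  refine ⟨hi ⁻¹' B, hB.preimage strictMono_hi.injective.injOn, fun b hb => ?_, fun a b hab hdis => ?_⟩
  · have := ((hBd _ hb).zpow_mul 1).add (y := -1) ⟨-1, 0, by norm_num⟩
    rwa [coe_hi, zpow_one, mul_div_cancel₀ _ two_ne_zero, add_neg_cancel_right] at this
  · obtain ⟨k, hk⟩ := hf (hi a) (hi b) (strictMono_hi hab) (Set.disjoint_left.2 fun z hz h => by
      obtain ⟨y, rfl, -⟩ := exists_hi_of_le h.1.le h.2.le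
      exact Set.disjoint_left.1 hdis hz
        ⟨strictMono_hi.lt_iff_lt.1 h.1, strictMono_hi.lt_iff_lt.1 h.2⟩)
    refine ⟨k, fun x hx => ?_⟩
    have := hk (hi x) ⟨strictMono_hi.monotone hx.1, strictMono_hi.monotone hx.2⟩
    rw [h, h, coe_hi, coe_hi, coe_hi, coe_hi] at this
    linarith

theorem exists_apply_lo {f : ThompsonF} (hf : f.1 (hi 0) = hi 0) (t : unitInterval) :
    ∃ s, f.1 (lo t) = lo s := by
  obtain ⟨s, hs, -⟩ := exists_lo_of_le (a := 0) (b := 1) (x := f.1 (lo t))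
    (by rw [lo_zero]; exact bot_le)
    (by rw [lo_one, ← hf, ← lo_one]; exact f.1.monotone (strictMono_lo.monotone le_top))
  exact ⟨s, hs⟩

theorem exists_apply_hi {f : ThompsonF} (hf : f.1 (hi 0) = hi 0) (t : unitInterval) :
    ∃ s, f.1 (hi t) = hi s := by
  obtain ⟨s, hs, -⟩ := exists_hi_of_le (a := 0) (b := 1) (x := f.1 (hi t))
    (by rw [← hf]; exact f.1.monotone (strictMono_hi.monotone bot_le))
    (by rw [hi_one]; exact le_top)
  exact ⟨s, hs⟩

/-- An element fixing `1/2` and its inverse preserve both halves. Rescaling these gives two order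
isomorphisms of `[0,1]`, and the conditions on break points and slopes survive the rescaling. -/
theorem exists_eq_join {f : ThompsonF} (hf : f.1 (hi 0) = hi 0) : ∃ p, f = join p := by
  have hf' : (f⁻¹).1 (hi 0) = hi 0 := inv_apply_eq.2 hf.symm
  choose a ha using exists_apply_lo hf
  choose a' ha' using exists_apply_lo hf'
  choose b hb using exists_apply_hi hf
  choose b' hb' using exists_apply_hi hf'
  have mono_a : StrictMono a := fun s t h => strictMono_lo.lt_iff_lt.1 <| by
    rw [← ha, ← ha]; exact f.1.strictMono (strictMono_lo h)
  have mono_b : StrictMono b := fun s t h => strictMono_hi.lt_iff_lt.1 <| by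
    rw [← hb, ← hb]; exact f.1.strictMono (strictMono_hi h)
  let u := mono_a.orderIsoOfSurjective a fun t => ⟨a' t, strictMono_lo.injective <| by
    rw [← ha]; exact (inv_apply_eq.1 (ha' t)).symm⟩
  let v := mono_b.orderIsoOfSurjective b fun t => ⟨b' t, strictMono_hi.injective <| by
    rw [← hb]; exact (inv_apply_eq.1 (hb' t)).symm⟩
  have hu : ∀ t, f.1 (lo t) = lo (u t) := ha
  have hv : ∀ t, f.1 (hi t) = hi (v t) := hb
  refine ⟨(⟨u, isThompson_of_join_lo hu⟩, ⟨v, isThompson_of_join_hi hv⟩), ext_halves ?_ ?_⟩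
  · intro t; rw [hu, join_lo]
  · intro t; rw [hv, join_hi]

theorem isDyadic_apply (f : ThompsonF) {t : unitInterval} (ht : IsDyadic t) : IsDyadic (f.1 t) :=
  IsThompson.isDyadic f.2 ht

theorem apply_pos (f : ThompsonF) {t : unitInterval} (ht : 0 < t) : 0 < f.1 t := by
  have := f.1.strictMono ht
  rwa [apply_zero] at this

theorem apply_lt_one (f : ThompsonF) {t : unitInterval} (ht : t < 1) : f.1 t < 1 := by
  have := f.1.strictMono ht
  rwa [apply_one] at this

end ThompsonF

theorem IsStdMap.comp {n : ℕ} {u h : unitInterval → unitInterval} (hu : IsStdMap n u)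
    (hh : ∀ w w', w.length = n → (∀ t, u (std w t) = std w' t) →
      ∃ w'', ∀ t, h (std w' t) = std w'' t) : IsStdMap n (fun t => h (u t)) := by
  induction n generalizing u with
  | zero =>
    obtain ⟨w, hw⟩ := hu
    obtain ⟨w', hw'⟩ := hh [] w rfl hw
    exact ⟨w', fun t => by simp only [hw, hw']⟩
  | succ n ih =>
    exact ⟨ih hu.1 fun w w' hl hw => hh (false :: w) w' (by simp [hl]) hw,
      ih hu.2 fun w w' hl hw => hh (true :: w) w' (by simp [hl]) hw⟩

theorem IsStdMap.of_lo {n : ℕ} {u : unitInterval → unitInterval}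
    (h : IsStdMap n fun t => lo (u t)) : IsStdMap n u := by
  induction n generalizing u with
  | zero =>
    obtain ⟨w, hw⟩ := h
    match w with
    | [] => exact absurd (hw 1) (lo_lt_one _).ne
    | false :: w => exact ⟨w, fun t => strictMono_lo.injective (hw t)⟩
    | true :: w =>
      have h1 := (hw 1).symm.trans_le (lo_le_hi (u 1) 0)
      rw [std_true, strictMono_hi.le_iff_le] at h1
      exact absurd ((strictMono_std w zero_lt_one).trans_le h1) (not_lt_of_ge bot_le)
  | succ n ih => exact ⟨ih h.1, ih h.2⟩

theorem IsStdMap.of_hi {n : ℕ} {u : unitInterval → unitInterval}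
    (h : IsStdMap n fun t => hi (u t)) : IsStdMap n u := by
  induction n generalizing u with
  | zero =>
    obtain ⟨w, hw⟩ := h
    match w with
    | [] => exact absurd (hw 0) (zero_lt_hi _).ne'
    | true :: w => exact ⟨w, fun t => strictMono_hi.injective (hw t)⟩
    | false :: w =>
      have h1 := (lo_le_hi 1 (u 0)).trans_eq (hw 0)
      rw [std_false, strictMono_lo.le_iff_le] at h1
      exact absurd (h1.trans_lt (strictMono_std w zero_lt_one)) (not_lt_of_ge le_top)
  | succ n ih => exact ⟨ih h.1, ih h.2⟩

namespace ThompsonF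

/-- A generated element moves `f(1/2)` back to `1/2` while keeping the images of the small intervals
standard; the composite is glued from two maps of depth `n`. At depth zero `f` is the identity,
since no other standard interval contains both end points. -/
theorem mem_genX_of_isStdMap {n : ℕ} {f : ThompsonF} (hf : IsStdMap n f.1) : f ∈ genX := by
  induction n generalizing f with
  | zero =>
    obtain ⟨w, hw⟩ := hf
    obtain rfl : w = [] := eq_nil_of_std_zero_one (by rw [← hw, apply_zero]) (by rw [← hw, apply_one])
    rw [show f = 1 from ext_fun hw]
    exact one_mem _
  | succ n ih =>
    obtain ⟨v, hv⟩ := exists_std_eq (f.1 (hi 0)) (apply_pos f hi_zero_pos)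
      (apply_lt_one f hi_zero_lt_one) (isDyadic_apply f isDyadic_zero.hi)
    obtain ⟨h, hh, hhv, hstd⟩ := exists_mem_genX_moving v
    have hfix : (h * f).1 (hi 0) = hi 0 := by rw [coe_mul_apply, hv, hhv]
    obtain ⟨p, hp⟩ := exists_eq_join hfix
    have hgood : IsStdMap (n + 1) (h * f).1 := by
      -- An interval of positive depth does not have `1/2` in its interior, so its image under `f`
      -- does not have `f(1/2)` in its interior and remains standard under `h`.
      refine IsStdMap.comp (h := h.1) hf fun w w' hl hw => hstd w' fun t h0 h1 he => ?_
      rw [← hv, ← hw] at he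
      have := f.1.injective he
      match w with
      | false :: w =>
        rw [std_false, ← lo_one] at this
        exact ((strictMono_std w h1).trans_le le_top).ne (strictMono_lo.injective this)
      | true :: w =>
        rw [std_true] at this
        exact (lt_of_le_of_lt bot_le (strictMono_std w h0)).ne' (strictMono_hi.injective this)
    rw [hp] at hgood
    have h1 : p.1 ∈ genX := ih (IsStdMap.of_lo (by simpa using hgood.1))
    have h2 : p.2 ∈ genX := ih (IsStdMap.of_hi (by simpa using hgood.2))
    have : f = h⁻¹ * join (p.1, p.2) := by rw [← hp]; group
    rw [this]
    exact mul_mem (inv_mem hh) (join_mem_genX h1 h2)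

theorem genX_eq_top : genX = ⊤ :=
  eq_top_iff.2 fun f _ => mem_genX_of_isStdMap (exists_isStdMap f).choose_spec

theorem X_succ_succ (n : ℕ) : X (n + 2) = (X 0)⁻¹ * X (n + 1) * X 0 := by
  rw [mul_assoc, X_mul_X n.succ_pos]
  group

theorem closure_X_zero_one : Subgroup.closure {X 0, X 1} = ⊤ := by
  rw [← genX_eq_top, genX]
  refine le_antisymm (Subgroup.closure_mono ?_) ((Subgroup.closure_le _).2 ?_)
  · rintro _ (rfl | rfl) <;> exact ⟨_, rfl⟩
  · have h0 : X 0 ∈ Subgroup.closure {X 0, X 1} := Subgroup.subset_closure (by simp)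
    rintro _ ⟨n, rfl⟩
    match n with
    | 0 => exact h0
    | n + 1 =>
      show X (n + 1) ∈ Subgroup.closure {X 0, X 1}
      induction n with
      | zero => exact Subgroup.subset_closure (by simp)
      | succ n ih =>
        rw [X_succ_succ]
        exact mul_mem (mul_mem (inv_mem h0) ih) h0

end ThompsonF

/-! ### Sequences satisfying the relations of Thompson's group -/

/-- The relations of the infinite presentation of Thompson's group. -/
def IsThompsonSeq {G : Type*} [Group G] (z : ℕ → G) : Prop :=
  ∀ ⦃i j : ℕ⦄, i < j → z j * z i = z i * z (j + 1)

namespace IsThompsonSeq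

variable {G : Type*} [Group G] {z : ℕ → G}

theorem shift (hz : IsThompsonSeq z) : IsThompsonSeq fun n => z (n + 1) :=
  fun _ _ h => hz (Nat.succ_lt_succ h)

theorem mul_pow (hz : IsThompsonSeq z) (n a : ℕ) :
    z (n + 1) * z 0 ^ a = z 0 ^ a * z (n + a + 1) := by
  induction a with
  | zero => simp
  | succ a ih => rw [pow_succ, ← mul_assoc, ih, mul_assoc, hz (Nat.succ_pos _), ← mul_assoc]; rfl

/-- All letters `z 0` are moved to the front, raising the indices of the letters they pass. If there
are none, every index drops by one on passing to `m`; the second clause records this drop, which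
drives the induction in `prod_eq_of_prod_X_eq`. -/
theorem exists_pow_mul (hz : IsThompsonSeq z) (l : List ℕ) : ∃ (a : ℕ) (m : List ℕ),
    a + m.length = l.length ∧ (a = 0 → m.sum + l.length = l.sum) ∧
    (l.map z).prod = z 0 ^ a * (m.map fun n => z (n + 1)).prod := by
  induction l with
  | nil => exact ⟨0, [], by simp⟩
  | cons n l ih =>
    obtain ⟨a, m, hlen, hsum, hl⟩ := ih
    match n with
    | 0 =>
      refine ⟨a + 1, m, by simp; omega, by simp, ?_⟩
      rw [List.map_cons, List.prod_cons, hl, pow_succ', mul_assoc]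
    | n + 1 =>
      refine ⟨a, (n + a) :: m, by simp; omega, fun h => ?_, ?_⟩
      · have := hsum h
        simp
        omega
      · rw [List.map_cons, List.prod_cons, hl, ← mul_assoc, hz.mul_pow, List.map_cons,
          List.prod_cons, mul_assoc]

/-- An inverse letter passes a positive letter of different index at the cost of raising the larger
index, and cancels against a letter of equal index. So it either disappears or arrives at the right
end. -/
theorem inv_mul_prod (hz : IsThompsonSeq z) (l : List ℕ) (n : ℕ) : ∃ l' : List ℕ,
    (z n)⁻¹ * (l.map z).prod = (l'.map z).prod ∨
    ∃ m, (z n)⁻¹ * (l.map z).prod = (l'.map z).prod * (z m)⁻¹ := by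
  induction l generalizing n with
  | nil => exact ⟨[], Or.inr ⟨n, by simp⟩⟩
  | cons k l ih =>
    rw [List.map_cons, List.prod_cons]
    rcases lt_trichotomy k n with h | rfl | h
    · have e : (z n)⁻¹ * z k = z k * (z (n + 1))⁻¹ := by
        rw [inv_mul_eq_iff_eq_mul, ← mul_assoc, hz h]; group
      obtain ⟨l', h | ⟨m, h⟩⟩ := ih (n + 1)
      · exact ⟨k :: l', Or.inl (by
          rw [← mul_assoc, e, mul_assoc, h, List.map_cons, List.prod_cons])⟩
      · exact ⟨k :: l', Or.inr ⟨m, by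
          rw [← mul_assoc, e, mul_assoc, h, List.map_cons, List.prod_cons, mul_assoc]⟩⟩
    · exact ⟨l, Or.inl (by group)⟩
    · have e : (z n)⁻¹ * z k = z (k + 1) * (z n)⁻¹ := by
        rw [inv_mul_eq_iff_eq_mul, ← mul_assoc, ← hz h]; group
      obtain ⟨l', h | ⟨m, h⟩⟩ := ih n
      · exact ⟨(k + 1) :: l', Or.inl (by
          rw [← mul_assoc, e, mul_assoc, h, List.map_cons, List.prod_cons])⟩
      · exact ⟨(k + 1) :: l', Or.inr ⟨m, by
          rw [← mul_assoc, e, mul_assoc, h, List.map_cons, List.prod_cons, mul_assoc]⟩⟩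

theorem exists_mul_inv (hz : IsThompsonSeq z) {g : G}
    (hg : g ∈ Subgroup.closure (Set.range z)) :
    ∃ l l' : List ℕ, g = (l.map z).prod * ((l'.map z).prod)⁻¹ := by
  induction hg using Subgroup.closure_induction_left with
  | one => exact ⟨[], [], by simp⟩
  | mul_left x hx y _ ih =>
    obtain ⟨n, rfl⟩ := hx
    obtain ⟨l, l', rfl⟩ := ih
    exact ⟨n :: l, l', by simp [mul_assoc]⟩
  | inv_mul_cancel x hx y _ ih =>
    obtain ⟨n, rfl⟩ := hx
    obtain ⟨l, l', rfl⟩ := ih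
    obtain ⟨m, h | ⟨k, h⟩⟩ := hz.inv_mul_prod l n
    · exact ⟨m, l', by rw [← mul_assoc, h]⟩
    · refine ⟨m, l' ++ [k], ?_⟩
      rw [← mul_assoc, h]
      simp [mul_assoc]

end IsThompsonSeq

namespace ThompsonF

theorem prod_X_succ (l : List ℕ) : (l.map fun n => X (n + 1)).prod = join (1, (l.map X).prod) := by
  induction l with
  | nil => rw [List.map_nil, List.map_nil, List.prod_nil]; exact (map_one join).symm
  | cons n l ih =>
    rw [List.map_cons, List.map_cons, List.prod_cons, List.prod_cons, ih, X_succ, ← map_mul,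
      Prod.mk_mul_mk, one_mul]

theorem rot_pow_apply (a : ℕ) : (((rot ^ a).1 (hi 0) : unitInterval) : ℝ) = 1 / 2 ^ (a + 1) := by
  have (a : ℕ) : (rot ^ a).1 (lo 1) = std (List.replicate (a + 1) false) 1 := by
    induction a with
    | zero => rfl
    | succ a ih => rw [pow_succ', coe_mul_apply, ih, List.replicate_succ, std_false, rot_lo]; rfl
  rw [← lo_one, this]
  induction a with
  | zero => simp
  | succ a ih => rw [List.replicate_succ, std_false, coe_lo, ih, pow_succ _ (a + 1)]; field_simp

theorem rot_pow_injective {a b : ℕ} (h : (rot ^ a).1 (hi 0) = (rot ^ b).1 (hi 0)) : a = b := by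
  have := congrArg Subtype.val h
  rw [rot_pow_apply, rot_pow_apply, one_div, one_div, inv_inj] at this
  have := pow_right_injective₀ (M₀ := ℝ) (by norm_num) (by norm_num) this
  omega

/-- Once the letters `X 0` are collected in front, a positive word has the form `X 0 ^ a * join (1,
f)`. It maps `1/2` to `2 ^ (-(a + 1))`, so `a` is determined, and `f` is determined because `join`
is injective. What remains is an identity of shorter words if `a > 0`, and of words with smaller
index sum otherwise, to be applied to the shifted sequence. -/
theorem prod_eq_of_prod_X_eq {G : Type*} [Group G] (n s : ℕ) (l l' : List ℕ)
    (hn : l.length + l'.length ≤ n) (hs : l.sum + l'.sum ≤ s)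
    (h : (l.map X).prod = (l'.map X).prod) (z : ℕ → G) (hz : IsThompsonSeq z) :
    (l.map z).prod = (l'.map z).prod := by
  induction n generalizing s l l' z with
  | zero =>
    obtain rfl : l = [] := List.length_eq_zero_iff.1 (by omega)
    obtain rfl : l' = [] := List.length_eq_zero_iff.1 (by omega)
    rfl
  | succ n ihn =>
    induction s using Nat.strong_induction_on generalizing l l' z with
    | _ s ihs =>
      -- Rewriting in the product group performs the same steps on both sequences at once.
      have hy : IsThompsonSeq fun n => (X n, z n) := fun i j hij =>
        Prod.ext (X_mul_X hij) (hz hij)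
      have fst (m : List ℕ) (y : ℕ → ThompsonF × G) :
          (m.map y).prod.1 = (m.map fun n => (y n).1).prod := by
        simpa [Function.comp_def] using map_list_prod (MonoidHom.fst ThompsonF G) (m.map y)
      have snd (m : List ℕ) (y : ℕ → ThompsonF × G) :
          (m.map y).prod.2 = (m.map fun n => (y n).2).prod := by
        simpa [Function.comp_def] using map_list_prod (MonoidHom.snd ThompsonF G) (m.map y)
      obtain ⟨a, m, hlen, hsum, e⟩ := hy.exists_pow_mul l
      obtain ⟨a', m', hlen', hsum', e'⟩ := hy.exists_pow_mul l'
      have e1 := congrArg Prod.fst e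
      have e2 := congrArg Prod.snd e
      have e1' := congrArg Prod.fst e'
      have e2' := congrArg Prod.snd e'
      simp only [fst, snd, Prod.fst_mul, Prod.snd_mul, Prod.pow_fst, Prod.pow_snd,
        prod_X_succ] at e1 e2 e1' e2'
      rw [e1, e1'] at h
      have ha : a = a' := by
        have := congrArg (fun f : ThompsonF => f.1 (hi 0)) h
        simp only [coe_mul_apply, join_hi, apply_zero, X_zero] at this
        exact rot_pow_injective this
      subst ha
      have hm : (m.map X).prod = (m'.map X).prod :=
        congrArg Prod.snd (join_injective (mul_left_cancel h))
      rw [e2, e2']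
      congr 1
      rcases Nat.eq_zero_or_pos a with rfl | ha
      · have h1 := hsum rfl
        have h2 := hsum' rfl
        by_cases h0 : l.length + l'.length = 0
        · obtain rfl : m = [] := List.length_eq_zero_iff.1 (by omega)
          obtain rfl : m' = [] := List.length_eq_zero_iff.1 (by omega)
          rfl
        · exact ihs (m.sum + m'.sum) (by omega) m m' (by omega) le_rfl hm _ hz.shift
      · exact ihn _ m m' (by omega) le_rfl hm _ hz.shift

/-- Thompson's group is presented by the elements `X n` and the relations `X_mul_X`. -/
theorem exists_hom {G : Type*} [Group G] {z : ℕ → G} (hz : IsThompsonSeq z) :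
    ∃ φ : ThompsonF →* G, ∀ n, φ (X n) = z n := by
  have hy : IsThompsonSeq fun n => (X n, z n) := fun i j hij => Prod.ext (X_mul_X hij) (hz hij)
  -- This subgroup is the graph of the required homomorphism: its elements are fractions of positive
  -- words, so `prod_eq_of_prod_X_eq` makes the projection to `ThompsonF` injective.
  let K := Subgroup.closure (Set.range fun n => (X n, z n))
  let p : K →* ThompsonF := (MonoidHom.fst _ _).comp K.subtype
  have hp : Function.Bijective p := by
    constructor
    · rw [injective_iff_map_eq_one]
      rintro ⟨g, hg⟩ h
      obtain ⟨l, l', rfl⟩ := hy.exists_mul_inv hg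
      have fst (m : List ℕ) : (m.map fun n => (X n, z n)).prod.1 = (m.map X).prod := by
        simpa [Function.comp_def] using
          map_list_prod (MonoidHom.fst ThompsonF G) (m.map fun n => (X n, z n))
      have snd (m : List ℕ) : (m.map fun n => (X n, z n)).prod.2 = (m.map z).prod := by
        simpa [Function.comp_def] using
          map_list_prod (MonoidHom.snd ThompsonF G) (m.map fun n => (X n, z n))
      have h' : (l.map X).prod * ((l'.map X).prod)⁻¹ = 1 := by rw [← fst, ← fst]; exact h
      have := prod_eq_of_prod_X_eq _ _ l l' le_rfl le_rfl (mul_inv_eq_one.1 h') z hz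
      refine Subtype.ext (Prod.ext h ?_)
      show _ * _ = (1 : G)
      rw [Prod.snd_inv, snd, snd, this, mul_inv_cancel]
    · rw [← MonoidHom.range_eq_top, ← top_le_iff, ← genX_eq_top, genX, Subgroup.closure_le]
      rintro _ ⟨n, rfl⟩
      exact ⟨⟨(X n, z n), Subgroup.subset_closure ⟨n, rfl⟩⟩, rfl⟩
  let e := MulEquiv.ofBijective p hp
  refine ⟨((MonoidHom.snd _ _).comp K.subtype).comp e.symm.toMonoidHom, fun n => ?_⟩
  have : e.symm (X n) = ⟨(X n, z n), Subgroup.subset_closure ⟨n, rfl⟩⟩ :=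
    e.symm_apply_eq.2 rfl
  simp [this]

end ThompsonF

/-! ### The finite presentation of Thompson's group -/

/-- The sequence `a, b, a⁻¹ b a, a⁻² b a², …`. -/
def conjSeq {G : Type*} [Group G] (a b : G) : ℕ → G
  | 0 => a
  | n + 1 => (a ^ n)⁻¹ * b * a ^ n

section conjSeq

variable {G : Type*} [Group G] {a b : G}

theorem conjSeq_succ_succ (n : ℕ) : conjSeq a b (n + 2) = a⁻¹ * conjSeq a b (n + 1) * a := by
  simp only [conjSeq, pow_succ, mul_inv_rev]
  group

theorem conjSeq_one : conjSeq a b 1 = b := by simp [conjSeq]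

theorem conjSeq_shift {i j : ℕ} (h : conjSeq a b (j + 1) * conjSeq a b (i + 1) =
    conjSeq a b (i + 1) * conjSeq a b (j + 2)) (k : ℕ) :
    conjSeq a b (j + k + 1) * conjSeq a b (i + k + 1) =
    conjSeq a b (i + k + 1) * conjSeq a b (j + k + 2) := by
  induction k with
  | zero => exact h
  | succ k ih =>
    have := congrArg (fun g => a⁻¹ * g * a) ih
    simp only [show j + (k + 1) + 1 = j + k + 2 by omega, show i + (k + 1) + 1 = i + k + 2 by omega,
      show j + (k + 1) + 2 = (j + k + 1) + 2 by omega, conjSeq_succ_succ] at this ⊢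
    calc _ = a⁻¹ * (conjSeq a b (j + k + 1) * conjSeq a b (i + k + 1)) * a := by group
      _ = _ := this
      _ = _ := by group

/-- Relations with `i = 0` hold by construction, and conjugation by `a` shifts both indices, so only
`i = 1` matters. There each relation follows from the two preceding ones and their shifts, so two of
them suffice. -/
theorem isThompsonSeq_conjSeq
    (h2 : conjSeq a b 2 * conjSeq a b 1 = conjSeq a b 1 * conjSeq a b 3)
    (h3 : conjSeq a b 3 * conjSeq a b 1 = conjSeq a b 1 * conjSeq a b 4) :
    IsThompsonSeq (conjSeq a b) := by
  have key (j : ℕ) : conjSeq a b (j + 2) * conjSeq a b 1 = conjSeq a b 1 * conjSeq a b (j + 3) := by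
    induction j using Nat.strong_induction_on with
    | _ j ih =>
      match j with
      | 0 => exact h2
      | 1 => exact h3
      | j + 2 =>
        have e1 := ih j (by omega)
        have e2 : conjSeq a b (j + 3) * conjSeq a b 1 = conjSeq a b 1 * conjSeq a b (j + 4) :=
          ih (j + 1) (by omega)
        have f1 : conjSeq a b (j + 3) * conjSeq a b 2 = conjSeq a b 2 * conjSeq a b (j + 4) :=
          conjSeq_shift (i := 0) (j := j + 1) e1 1
        have f2 : conjSeq a b (j + 4) * conjSeq a b 3 = conjSeq a b 3 * conjSeq a b (j + 5) :=
          conjSeq_shift (i := 0) (j := j + 1) e1 2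
        change conjSeq a b (j + 4) * conjSeq a b 1 = conjSeq a b 1 * conjSeq a b (j + 5)
        generalize conjSeq a b 1 = z1 at *
        generalize conjSeq a b 2 = z2 at *
        generalize conjSeq a b 3 = z3 at *
        generalize conjSeq a b (j + 3) = u at *
        generalize conjSeq a b (j + 4) = v at *
        generalize conjSeq a b (j + 5) = w at *
        -- The element `v` is both `z2⁻¹ * u * z2` and `z1⁻¹ * u * z1`. Using the second form inside
        -- `w` and the first on the left makes both sides of `v * z1 = z1 * w` equal to `z2⁻¹ * u *
        -- z2 * z1`.
        have hz3 : z3 = z1⁻¹ * z2 * z1 := by rw [mul_assoc, h2]; group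
        have hv : v = z2⁻¹ * u * z2 := by rw [mul_assoc, f1]; group
        have hw : w = z3⁻¹ * v * z3 := by rw [mul_assoc, f2]; group
        have hv' : v = z1⁻¹ * u * z1 := by rw [mul_assoc, e2]; group
        rw [hw]
        nth_rw 2 [hv']
        rw [hv, hz3]
        group
  intro i j hij
  match i, j, hij with
  | 0, j + 1, _ => rw [conjSeq_succ_succ, show conjSeq a b 0 = a from rfl]; group
  | i + 1, j + 1, h =>
    obtain ⟨k, rfl⟩ := Nat.exists_eq_add_of_lt (Nat.lt_of_succ_lt_succ h)
    have := conjSeq_shift (i := 0) (j := k + 1) (key k) i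
    simpa only [show k + 1 + i + 1 = i + k + 1 + 1 by omega, show 0 + i + 1 = i + 1 by omega,
      show k + 1 + i + 2 = i + k + 1 + 1 + 1 by omega] using this

end conjSeq

end CrazyGroup

end

noncomputable section

namespace CrazyGroup

/-! ### Additive and multiplicative structure of `ℤ[G] ⋉ Mat⁰_S(ℤ)` -/

namespace RCMatrix

variable {S : Type*}

open Classical in
theorem toEnd_E (s t j : S) :
    (E s t).toEnd (Finsupp.single j 1) = if j = t then Finsupp.single s 1 else 0 := by
  ext i
  rw [toEnd_single]
  by_cases hj : j = t
  · simp [E, hj, Finsupp.single_apply, eq_comm]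
  · simp [E, hj]

theorem E_mul_E (s t v : S) : E s t * E t v = E s v := by
  classical
  refine toEnd_injective (end_ext fun i j => ?_)
  rw [toEnd_mul, Module.End.mul_apply, toEnd_E, toEnd_E]
  split_ifs <;> simp [toEnd_E]

theorem E_mul_E_of_ne {t u : S} (h : t ≠ u) (s v : S) : E s t * E u v = 0 := by
  classical
  refine toEnd_injective (end_ext fun i j => ?_)
  rw [toEnd_mul, Module.End.mul_apply, toEnd_E, toEnd_single]
  split_ifs <;> simp [toEnd_E, h.symm]

variable {G : Type*} [Group G] [MulAction G S]

theorem perm_mul_E (g : G) (s t : S) : perm g * E s t = E (g • s) t := by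
  classical
  refine toEnd_injective (end_ext fun i j => ?_)
  rw [toEnd_mul, Module.End.mul_apply, toEnd_E, toEnd_E]
  split_ifs <;> simp [toEnd_perm]

theorem E_mul_perm (g : G) (s t : S) : E s t * perm g = E s (g⁻¹ • t) := by
  classical
  refine toEnd_injective (end_ext fun i j => ?_)
  rw [toEnd_mul, Module.End.mul_apply, toEnd_perm, toEnd_E, toEnd_E]
  simp only [eq_inv_smul_iff]

theorem phi_of (g : G) : phi G S (MonoidAlgebra.of ℤ G g) = perm g := by
  simp [phi, permHom]

end RCMatrix

namespace CrazyRing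

variable {G S : Type*} [Group G] [MulAction G S]

variable (G S) in
/-- The inclusion of `G` in `ℤ[G] ⋉ Mat⁰_S(ℤ)`. -/
def of : G →* CrazyRing G S where
  toFun g := ⟨MonoidAlgebra.of ℤ G g, 0, zero_mem _⟩
  map_one' := CrazyRing.ext (map_one _) rfl
  map_mul' g h := by ext1 <;> simp

@[simp] theorem of_grp (g : G) : (of G S g).grp = MonoidAlgebra.of ℤ G g := rfl
@[simp] theorem of_mat (g : G) : (of G S g).mat = 0 := rfl
@[simp] theorem E_grp (s t : S) : (E G s t).grp = 0 := rfl
@[simp] theorem E_mat (s t : S) : (E G s t).mat = RCMatrix.E s t := rfl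

theorem E_mul_E (s t v : S) : E G s t * E G t v = E G s v := by
  ext1
  · simp
  · simp [RCMatrix.E_mul_E]

theorem E_mul_E_of_ne {t u : S} (h : t ≠ u) (s v : S) : E G s t * E G u v = 0 := by
  ext1
  · simp
  · simp [RCMatrix.E_mul_E_of_ne h]

theorem of_mul_E (g : G) (s t : S) : of G S g * E G s t = E G (g • s) t := by
  ext1
  · simp
  · rw [mul_mat, of_grp, RCMatrix.phi_of, E_mat, RCMatrix.perm_mul_E]; simp

theorem E_mul_of (g : G) (s t : S) : E G s t * of G S g = E G s (g⁻¹ • t) := by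
  ext1
  · simp
  · rw [mul_mat, of_grp, RCMatrix.phi_of, E_mat, RCMatrix.E_mul_perm]; simp

/-- The entries of the matrix part. -/
def entries : CrazyRing G S →+ (S × S →₀ ℤ) where
  toFun x := Finsupp.ofSupportFinite (fun p => x.mat.entry p.1 p.2) (RCMatrix.mem_finitary.1 x.mat_mem)
  map_zero' := by ext; rfl
  map_add' x y := by ext; rfl

theorem entries_apply (x : CrazyRing G S) (s t : S) : entries x (s, t) = x.mat.entry s t := rfl

theorem entries_of (g : G) : entries (of G S g) = 0 := by ext; rfl

theorem entries_E (s t : S) : entries (E G s t) = Finsupp.single (s, t) 1 := by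
  classical
  ext ⟨i, j⟩
  rw [entries_apply, E_mat]
  simp [RCMatrix.E, Finsupp.single_apply, eq_comm]

variable (G S) in
/-- The projection to the group ring. -/
def grpHom : CrazyRing G S →+ MonoidAlgebra ℤ G where
  toFun x := x.grp
  map_zero' := rfl
  map_add' _ _ := rfl

theorem ext_entries {x y : CrazyRing G S} (h : x.grp = y.grp) (h' : entries x = entries y) :
    x = y := by
  ext i j
  · rw [h]
  · rw [← entries_apply, h', entries_apply]

theorem finitary_induction {p : CrazyRing G S → Prop} (hE : ∀ s t, p (E G s t)) (hzero : p 0)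
    (hadd : ∀ x y, p x → p y → p (x + y)) (hneg : ∀ x, p x → p (-x)) (x : CrazyRing G S)
    (hx : x.grp = 0) : p x := by
  let K : AddSubgroup (CrazyRing G S) :=
    { carrier := {x | p x}, zero_mem' := hzero, add_mem' := fun {x y} => hadd x y,
      neg_mem' := fun {x} => hneg x }
  have key : ∀ w : S × S →₀ ℤ, ∃ y ∈ K, y.grp = 0 ∧ entries y = w := by
    intro w
    induction w using Finsupp.induction_linear with
    | zero => exact ⟨0, zero_mem _, rfl, map_zero _⟩
    | add v w hv hw =>
      obtain ⟨y, hy, hy', rfl⟩ := hv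
      obtain ⟨z, hz, hz', rfl⟩ := hw
      exact ⟨y + z, add_mem hy hz, by simp [hy', hz'], map_add _ _ _⟩
    | single q n =>
      refine ⟨n • E G q.1 q.2, zsmul_mem (hE q.1 q.2 : E G q.1 q.2 ∈ K) n, ?_, ?_⟩
      · exact (map_zsmul (grpHom G S) n _).trans (by simp [grpHom])
      · rw [map_zsmul, entries_E]; simp
  obtain ⟨y, hy, hy', hxy⟩ := key (entries x)
  have : x = y := ext_entries (by rw [hx, hy']) hxy.symm
  rw [this]
  exact hy

theorem induction {p : CrazyRing G S → Prop} (hof : ∀ g, p (of G S g)) (hE : ∀ s t, p (E G s t))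
    (hadd : ∀ x y, p x → p y → p (x + y)) (hneg : ∀ x, p x → p (-x)) (x : CrazyRing G S) :
    p x := by
  have hzero : p 0 := by
    have := hadd _ _ (hof 1) (hneg _ (hof 1))
    rwa [add_neg_cancel] at this
  let K : AddSubgroup (CrazyRing G S) :=
    { carrier := {x | p x}, zero_mem' := hzero, add_mem' := fun {x y} => hadd x y,
      neg_mem' := fun {x} => hneg x }
  have key : ∀ a : MonoidAlgebra ℤ G, ∃ y ∈ K, y.grp = a := by
    intro a
    induction a using MonoidAlgebra.induction_on with
    | of g => exact ⟨of G S g, hof g, rfl⟩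
    | add a b ha hb =>
      obtain ⟨y, hy, rfl⟩ := ha
      obtain ⟨z, hz, rfl⟩ := hb
      exact ⟨y + z, add_mem hy hz, rfl⟩
    | smul n a ha =>
      obtain ⟨y, hy, rfl⟩ := ha
      exact ⟨n • y, zsmul_mem hy n, map_zsmul (grpHom G S) n y⟩
  obtain ⟨y, hy, hxy⟩ := key x.grp
  have h : p (x - y) := finitary_induction hE hzero hadd hneg _ (by
    rw [sub_eq_add_neg, add_grp, neg_grp, hxy, add_neg_cancel])
  have := hadd _ _ h hy
  rwa [sub_add_cancel] at this

/-- The universal property of `ℤ[G] ⋉ Mat⁰_S(ℤ)` for a transitive action. -/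
theorem exists_hom {B : Type*} [Ring B] (φ : G →* B) (s₀ : S) (hS : ∀ s, ∃ g : G, g • s₀ = s)
    (e : B) (he : e * e = e) (hl : ∀ g : G, g • s₀ = s₀ → φ g * e = e)
    (hr : ∀ g : G, g • s₀ = s₀ → e * φ g = e) (h0 : ∀ g : G, g • s₀ ≠ s₀ → e * φ g * e = 0) :
    ∃ Φ : CrazyRing G S →+* B, (∀ g, Φ (of G S g) = φ g) ∧ Φ (E G s₀ s₀) = e := by
  choose c hc using hS
  -- The image of `E_{s,t}`, where `c s` carries `s₀` to `s`. Because stabilizer elements are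
  -- absorbed by `e` on both sides, it does not depend on the choice of `c`.
  let ε (p : S × S) : B := φ (c p.1) * e * φ (c p.2)⁻¹
  have hlε (g : G) (s t : S) : φ g * ε (s, t) = ε (g • s, t) := by
    have : φ ((c (g • s))⁻¹ * g * c s) * e = e := hl _ (by
      rw [mul_smul, mul_smul, hc, inv_smul_eq_iff, hc])
    calc φ g * ε (s, t) = φ (c (g • s)) * (φ ((c (g • s))⁻¹ * g * c s) * e) * φ (c t)⁻¹ := by
          simp only [ε, ← mul_assoc, ← map_mul, mul_inv_cancel, one_mul]
      _ = _ := by rw [this]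
  have hrε (g : G) (s t : S) : ε (s, t) * φ g = ε (s, g⁻¹ • t) := by
    have : e * φ ((c t)⁻¹ * g * c (g⁻¹ • t)) = e := hr _ (by
      rw [mul_smul, mul_smul, hc, smul_inv_smul, inv_smul_eq_iff, hc])
    calc ε (s, t) * φ g = φ (c s) * (e * φ ((c t)⁻¹ * g * c (g⁻¹ • t))) * φ (c (g⁻¹ • t))⁻¹ := by
          simp only [ε, mul_assoc, ← map_mul, mul_inv_cancel, mul_one]
      _ = _ := by rw [this]
  have hε (s t v : S) : ε (s, t) * ε (t, v) = ε (s, v) := by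
    have : φ (c t)⁻¹ * φ (c t) = 1 := by rw [← map_mul, inv_mul_cancel, map_one]
    calc ε (s, t) * ε (t, v) = φ (c s) * e * (φ (c t)⁻¹ * φ (c t)) * e * φ (c v)⁻¹ := by
          simp only [ε, mul_assoc]
      _ = φ (c s) * (e * e) * φ (c v)⁻¹ := by rw [this, mul_one]; simp only [mul_assoc]
      _ = _ := by rw [he]
  have hε0 {t u : S} (htu : t ≠ u) (s v : S) : ε (s, t) * ε (u, v) = 0 := by
    have : e * φ ((c t)⁻¹ * c u) * e = 0 := h0 _ fun h => htu (by
      rw [mul_smul, hc, inv_smul_eq_iff, hc] at h; exact h.symm)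
    calc ε (s, t) * ε (u, v) = φ (c s) * (e * φ ((c t)⁻¹ * c u) * e) * φ (c v)⁻¹ := by
          simp only [ε, mul_assoc, map_mul]
      _ = _ := by rw [this]; simp
  -- The map is first defined additively, from the coefficients in the group ring and the matrix
  -- entries; multiplicativity is then only a check on group elements and elementary matrices.
  let Ψ : CrazyRing G S →+ B :=
    ((MonoidAlgebra.liftNCRingHom (Int.castRingHom B) φ
      fun n _ => Int.cast_commute n _).toAddMonoidHom.comp (grpHom G S)) +
      (Finsupp.liftAddHom fun p => zmultiplesHom B (ε p)).comp entries
  have Ψof (g : G) : Ψ (of G S g) = φ g := by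
    simp [Ψ, grpHom, entries_of]
  have ΨE (s t : S) : Ψ (E G s t) = ε (s, t) := by
    simp [Ψ, grpHom, entries_E]
  have Ψmul (x y : CrazyRing G S) : Ψ (x * y) = Ψ x * Ψ y := by
    induction x using induction with
    | hof g =>
      induction y using induction with
      | hof h => rw [← map_mul, Ψof, Ψof, Ψof, map_mul]
      | hE s t => rw [of_mul_E, ΨE, Ψof, ΨE, hlε]
      | hadd y z hy hz => rw [mul_add, map_add, hy, hz, map_add, mul_add]
      | hneg y hy => rw [mul_neg, map_neg, hy, map_neg, mul_neg]
    | hE s t =>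
      induction y using induction with
      | hof h => rw [E_mul_of, ΨE, Ψof, ΨE, hrε]
      | hE u v =>
        by_cases h : t = u
        · rw [h, E_mul_E, ΨE, ΨE, ΨE, hε]
        · rw [E_mul_E_of_ne h, map_zero, ΨE, ΨE, hε0 h]
      | hadd y z hy hz => rw [mul_add, map_add, hy, hz, map_add, mul_add]
      | hneg y hy => rw [mul_neg, map_neg, hy, map_neg, mul_neg]
    | hadd x z hx hz => rw [add_mul, map_add, hx, hz, map_add, add_mul]
    | hneg x hx => rw [neg_mul, map_neg, hx, map_neg, neg_mul]
  refine ⟨{ Ψ with map_one' := ?_, map_mul' := Ψmul }, Ψof, ?_⟩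
  · have := Ψof 1
    rwa [map_one (of G S), map_one φ] at this
  · show Ψ _ = e
    have h1 : φ (c s₀) * e = e := hl _ (hc s₀)
    have h2 : e * φ (c s₀)⁻¹ = e := hr _ (inv_smul_eq_iff.2 (hc s₀).symm)
    rw [ΨE]
    show φ (c s₀) * e * φ (c s₀)⁻¹ = e
    rw [h1, h2]

end CrazyRing

end CrazyGroup

end

noncomputable section

namespace CrazyGroup

/-! ### The action of Thompson's group on dyadic points -/

/-- The point `1/2`. -/
def half : DyadicPoint := ⟨hi 0, hi_zero_pos, hi_zero_lt_one, isDyadic_zero.hi⟩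

namespace ThompsonF

theorem smul_val (f : ThompsonF) (s : DyadicPoint) : (f • s).1 = f.1 s.1 := rfl

theorem exists_smul_half (s : DyadicPoint) : ∃ f : ThompsonF, f • half = s := by
  obtain ⟨v, hv⟩ := exists_std_eq s.1 s.2.1 s.2.2.1 s.2.2.2
  obtain ⟨h, -, hh, -⟩ := exists_mem_genX_moving v
  refine ⟨h⁻¹, Subtype.ext ?_⟩
  rw [smul_val, inv_apply_eq, hv, hh]
  rfl

theorem smul_half_iff {f : ThompsonF} : f • half = half ↔ ∃ p, f = join p := by
  constructor
  · exact fun h => exists_eq_join (congrArg Subtype.val h)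
  · rintro ⟨p, rfl⟩
    refine Subtype.ext ?_
    rw [smul_val]
    exact (join_hi p 0).trans (by rw [apply_zero]; rfl)

/-- Points below and above `1/2` form single orbits under the stabilizer of `1/2`. -/
theorem exists_double_coset {f : ThompsonF} (hf : f • half ≠ half) :
    ∃ p q, f = join p * rot * join q ∨ f = join p * rot⁻¹ * join q := by
  have hne : f.1 (hi 0) ≠ hi 0 := fun h => hf (Subtype.ext h)
  have hpos := apply_pos f hi_zero_pos
  have hlt := apply_lt_one f hi_zero_lt_one
  have hdy := isDyadic_apply f isDyadic_zero.hi
  -- It is enough to move `f(1/2)` to `r(1/2)` by some `p`, since then `r⁻¹ * p * f` fixes `1/2` and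
  -- is a `join`.
  have finish {r p : ThompsonF} (hr : r.1 (hi 0) = p.1 (f.1 (hi 0))) :
      ∃ q, f = p⁻¹ * r * join q := by
    obtain ⟨q, hq⟩ := exists_eq_join (f := r⁻¹ * (p * f)) (by
      rw [coe_mul_apply, inv_apply_eq, hr, coe_mul_apply])
    exact ⟨q, by rw [← hq]; group⟩
  rcases exists_lo_or_hi (f.1 (hi 0)) with ⟨c, hc⟩ | ⟨c, hc⟩
  · have hc0 : 0 < c := by rwa [hc, ← lo_zero, strictMono_lo.lt_iff_lt] at hpos
    have hc1 : c < 1 := lt_of_le_of_ne le_top fun h => hne (by rw [hc, h, lo_one])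
    have hcd : IsDyadic c := by
      have := hdy.zpow_mul 1
      rwa [hc, coe_lo, zpow_one, mul_div_cancel₀ _ two_ne_zero] at this
    obtain ⟨k, hk⟩ := exists_smul_half ⟨c, hc0, hc1, hcd⟩
    have hk' : (k⁻¹).1 c = hi 0 := inv_apply_eq.2 (congrArg Subtype.val hk).symm
    obtain ⟨q, hq⟩ := finish (r := rot) (p := join (k⁻¹, 1)) (by
      rw [hc, join_lo, hk', ← lo_one, rot_lo])
    exact ⟨(k⁻¹, 1)⁻¹, q, Or.inl (by rw [map_inv]; exact hq)⟩
  · have hc0 : 0 < c := lt_of_le_of_ne bot_le fun h => hne (by rw [hc, ← h])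
    have hc1 : c < 1 := by rwa [hc, ← hi_one, strictMono_hi.lt_iff_lt] at hlt
    have hcd : IsDyadic c := by
      have := (hdy.zpow_mul 1).add (y := -1) ⟨-1, 0, by norm_num⟩
      rwa [hc, coe_hi, zpow_one, mul_div_cancel₀ _ two_ne_zero, add_neg_cancel_right] at this
    obtain ⟨k, hk⟩ := exists_smul_half ⟨c, hc0, hc1, hcd⟩
    have hk' : (k⁻¹).1 c = hi 0 := inv_apply_eq.2 (congrArg Subtype.val hk).symm
    obtain ⟨q, hq⟩ := finish (r := rot⁻¹) (p := join (1, k⁻¹)) (by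
      rw [hc, join_hi, hk', rot_inv_hi])
    exact ⟨(1, k⁻¹)⁻¹, q, Or.inr (by rw [map_inv]; exact hq)⟩

theorem join_one_rot : join (1, X 0) = X 1 := rfl

theorem join_one_X_one : join (1, X 1) = (X 0)⁻¹ * X 1 * X 0 := by
  rw [← X_succ, X_succ_succ]

theorem join_X_one_one : join (X 1, 1) =
    X 0 * (X 1 * X 1 * ((X 0)⁻¹ * X 1 * X 0)⁻¹ * (X 1)⁻¹) * (X 0)⁻¹ := by
  rw [← join_one_X_one, join_X_succ_one, X_zero, join_rot_one, ← X_zero]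
  have h (f g : ThompsonF) : join (1, f * g) = join (1, f) * join (1, g) :=
    map_mul (join.comp (MonoidHom.inr ThompsonF ThompsonF)) f g
  have h' (f : ThompsonF) : join (1, f⁻¹) = (join (1, f))⁻¹ :=
    map_inv (join.comp (MonoidHom.inr ThompsonF ThompsonF)) f
  simp only [h, h', join_one_rot]

/-- A subgroup containing four generators of the stabilizer of `1/2` contains the stabilizer. -/
theorem join_mem_of_generators {K : Subgroup ThompsonF} (h00 : join (X 0, 1) ∈ K)
    (h01 : join (X 1, 1) ∈ K) (h10 : join (1, X 0) ∈ K) (h11 : join (1, X 1) ∈ K)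
    (p : ThompsonF × ThompsonF) : join p ∈ K := by
  have h1 : (⊤ : Subgroup ThompsonF) ≤ K.comap (join.comp (MonoidHom.inl _ _)) := by
    rw [← closure_X_zero_one, Subgroup.closure_le]
    rintro _ (rfl | rfl)
    exacts [h00, h01]
  have h2 : (⊤ : Subgroup ThompsonF) ≤ K.comap (join.comp (MonoidHom.inr _ _)) := by
    rw [← closure_X_zero_one, Subgroup.closure_le]
    rintro _ (rfl | rfl)
    exacts [h10, h11]
  have : p = (p.1, 1) * (1, p.2) := by simp
  rw [this, map_mul]
  exact mul_mem (h1 (Subgroup.mem_top p.1)) (h2 (Subgroup.mem_top p.2))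

end ThompsonF

/-! ### A finite presentation of the ring -/

/-- Defining relations of `ℤ[F] ⋉ Mat⁰_S(ℤ)` in terms of `a, a⁻¹, b, b⁻¹` and `e`, where `a` and `b`
are the standard generators of Thompson's group and `e = E_{1/2,1/2}`. -/
def ringRelators {B : Type*} [Ring B] (a a' b b' e : B) : List B :=
  -- In order: `a` and `b` are invertible; the two relations of Thompson's group; `e` is idempotent;
  -- the generators `join (X 0, 1)`, `join (X 1, 1)`, `join (1, X 0)`, `join (1, X 1)` of the
  -- stabilizer of `1/2` are absorbed by `e` on both sides; `e * f * e = 0` for the double coset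
  -- representatives `rot` and `rot⁻¹`.
  [a * a' - 1, a' * a - 1, b * b' - 1, b' * b - 1,
    a' * b * a * b - b * (a' * (a' * b * a) * a),
    a' * (a' * b * a) * a * b - b * (a' * (a' * (a' * b * a) * a) * a),
    e * e - e,
    a * a * b' * a' * e - e, e * (a * a * b' * a') - e,
    a * (b * b * (a' * b' * a) * b') * a' * e - e, e * (a * (b * b * (a' * b' * a) * b') * a') - e,
    b * e - e, e * b - e,
    a' * b * a * e - e, e * (a' * b * a) - e,
    e * a * e, e * a' * e]

theorem map_ringRelators {B C : Type*} [Ring B] [Ring C] (f : B →+* C) (a a' b b' e : B) :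
    (ringRelators a a' b b' e).map f = ringRelators (f a) (f a') (f b) (f b') (f e) := by
  simp [ringRelators]

namespace ThompsonRing

open ThompsonF

theorem of_mul_E_of_join (p : ThompsonF × ThompsonF) :
    CrazyRing.of ThompsonF DyadicPoint (join p) * CrazyRing.E ThompsonF half half =
      CrazyRing.E ThompsonF half half := by
  rw [CrazyRing.of_mul_E, smul_half_iff.2 ⟨p, rfl⟩]

theorem E_mul_of_join (p : ThompsonF × ThompsonF) :
    CrazyRing.E ThompsonF half half * CrazyRing.of ThompsonF DyadicPoint (join p) =
      CrazyRing.E ThompsonF half half := by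
  rw [CrazyRing.E_mul_of, ← map_inv, smul_half_iff.2 ⟨p⁻¹, rfl⟩]

theorem rot_smul_half_ne : rot • half ≠ half := fun h => by
  have := congrArg Subtype.val h
  rw [smul_val, show half.1 = lo 1 from lo_one.symm, rot_lo] at this
  exact (lo_lt_one 1).ne (strictMono_lo.injective this)

theorem E_of_E {f : ThompsonF} (hf : f • half ≠ half) :
    CrazyRing.E ThompsonF half half * CrazyRing.of ThompsonF DyadicPoint f *
      CrazyRing.E ThompsonF half half = 0 := by
  rw [mul_assoc, CrazyRing.of_mul_E, CrazyRing.E_mul_E_of_ne hf.symm]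

theorem eq_zero_of_mem_ringRelators (t : CrazyRing ThompsonF DyadicPoint)
    (ht : t ∈ ringRelators (CrazyRing.of _ _ (X 0)) (CrazyRing.of _ _ (X 0)⁻¹)
      (CrazyRing.of _ _ (X 1)) (CrazyRing.of _ _ (X 1)⁻¹) (CrazyRing.E ThompsonF half half)) :
    t = 0 := by
  have r2 : (X 0)⁻¹ * X 1 * X 0 = X 2 := (X_succ_succ 0).symm
  have r3 : (X 0)⁻¹ * X 2 * X 0 = X 3 := (X_succ_succ 1).symm
  have r4 : (X 0)⁻¹ * X 3 * X 0 = X 4 := (X_succ_succ 2).symm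
  have s1 : X 0 * X 0 * (X 1)⁻¹ * (X 0)⁻¹ = join (X 0, 1) := join_rot_one.symm
  have s2 : X 0 * (X 1 * X 1 * ((X 0)⁻¹ * (X 1)⁻¹ * X 0) * (X 1)⁻¹) * (X 0)⁻¹ = join (X 1, 1) := by
    rw [join_X_one_one]; group
  have s3 : X 1 = join (1, X 0) := rfl
  have s4 : (X 0)⁻¹ * X 1 * X 0 = join (1, X 1) := r2
  have e2 : X 2 * X 1 = X 1 * X 3 := X_mul_X (by omega)
  have e3 : X 3 * X 1 = X 1 * X 4 := X_mul_X (by omega)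
  simp only [ringRelators, List.mem_cons, List.not_mem_nil, or_false] at ht
  rcases ht with rfl | rfl | rfl | rfl | rfl | rfl | rfl | rfl | rfl | rfl | rfl | rfl | rfl | rfl |
    rfl | rfl | rfl
  · rw [← map_mul, mul_inv_cancel, map_one, sub_self]
  · rw [← map_mul, inv_mul_cancel, map_one, sub_self]
  · rw [← map_mul, mul_inv_cancel, map_one, sub_self]
  · rw [← map_mul, inv_mul_cancel, map_one, sub_self]
  · simp only [← map_mul, r2, r3, e2, sub_self]
  · simp only [← map_mul, r2, r3, r4, e3, sub_self]
  · rw [CrazyRing.E_mul_E, sub_self]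
  · simp only [← map_mul, s1, of_mul_E_of_join, sub_self]
  · simp only [← map_mul, s1, E_mul_of_join, sub_self]
  · simp only [← map_mul, s2, of_mul_E_of_join, sub_self]
  · simp only [← map_mul, s2, E_mul_of_join, sub_self]
  · rw [s3, of_mul_E_of_join, sub_self]
  · rw [s3, E_mul_of_join, sub_self]
  · simp only [← map_mul, s4, of_mul_E_of_join, sub_self]
  · simp only [← map_mul, s4, E_mul_of_join, sub_self]
  · exact E_of_E rot_smul_half_ne
  · refine E_of_E fun h => rot_smul_half_ne ?_
    rw [X_zero, inv_smul_eq_iff] at h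
    exact h.symm

/-- The units `a`, `b` define a homomorphism from Thompson's group to `Bˣ`. The elements absorbed by
`e` on a given side form a subgroup, so four generators settle the whole stabilizer of `1/2`; by
`exists_double_coset` the vanishing of `e * f * e` for `f` outside it needs to be known only for
`rot` and its inverse. -/
theorem exists_hom_of_ringRelators {B : Type*} [Ring B] {a a' b b' e : B}
    (h : ∀ t ∈ ringRelators a a' b b' e, t = 0) :
    ∃ Φ : CrazyRing ThompsonF DyadicPoint →+* B,
      Φ (CrazyRing.of _ _ (X 0)) = a ∧ Φ (CrazyRing.of _ _ (X 0)⁻¹) = a' ∧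
      Φ (CrazyRing.of _ _ (X 1)) = b ∧ Φ (CrazyRing.of _ _ (X 1)⁻¹) = b' ∧
      Φ (CrazyRing.E ThompsonF half half) = e := by
  simp only [ringRelators, List.forall_mem_cons, sub_eq_zero] at h
  obtain ⟨haa', ha'a, hbb', hb'b, h2, h3, hee, hs1, hs1', hs2, hs2', hs3, hs3', hs4, hs4', hz, hz',
    -⟩ := h
  let u : Bˣ := ⟨a, a', haa', ha'a⟩
  let v : Bˣ := ⟨b, b', hbb', hb'b⟩
  have c1 : conjSeq u v 1 = v := conjSeq_one
  have c2 : conjSeq u v 2 = u⁻¹ * v * u := by rw [conjSeq_succ_succ, conjSeq_one]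
  have c3 : conjSeq u v 3 = u⁻¹ * (u⁻¹ * v * u) * u := by rw [conjSeq_succ_succ, c2]
  have c4 : conjSeq u v 4 = u⁻¹ * (u⁻¹ * (u⁻¹ * v * u) * u) * u := by rw [conjSeq_succ_succ, c3]
  obtain ⟨φ, hφ⟩ := ThompsonF.exists_hom (isThompsonSeq_conjSeq (a := u) (b := v)
    (by rw [c1, c2, c3]; exact Units.ext h2) (by rw [c1, c3, c4]; exact Units.ext h3))
  have φ0 : φ (X 0) = u := hφ 0
  have φ1 : φ (X 1) = v := (hφ 1).trans c1
  let ψ : ThompsonF →* B := (Units.coeHom B).comp φ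
  have ψu (f g : ThompsonF) : ψ (f * g) = ψ f * ψ g := map_mul ψ f g
  have ψinv (f : ThompsonF) : ψ f⁻¹ * ψ f = 1 := by rw [← map_mul, inv_mul_cancel, map_one]
  have ψinv' (f : ThompsonF) : ψ f * ψ f⁻¹ = 1 := by rw [← map_mul, mul_inv_cancel, map_one]
  have ψ0 : ψ (X 0) = a := congrArg Units.val φ0
  have ψ0' : ψ (X 0)⁻¹ = a' := by
    show ((φ (X 0)⁻¹ : Bˣ) : B) = a'
    rw [map_inv, φ0]; rfl
  have ψ1 : ψ (X 1) = b := congrArg Units.val φ1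
  have ψ1' : ψ (X 1)⁻¹ = b' := by
    show ((φ (X 1)⁻¹ : Bˣ) : B) = b'
    rw [map_inv, φ1]; rfl
  have j00 : ψ (join (X 0, 1)) = a * a * b' * a' := by
    rw [X_zero, join_rot_one]; simp only [ψu, ψ0, ψ0', ψ1']
  have j01 : ψ (join (X 1, 1)) = a * (b * b * (a' * b' * a) * b') * a' := by
    rw [join_X_one_one, show ((X 0)⁻¹ * X 1 * X 0)⁻¹ = (X 0)⁻¹ * (X 1)⁻¹ * X 0 by group]
    simp only [ψu, ψ0, ψ0', ψ1, ψ1']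
  have j10 : ψ (join (1, X 0)) = b := ψ1
  have j11 : ψ (join (1, X 1)) = a' * b * a := by
    rw [join_one_X_one]; simp only [ψu, ψ0, ψ0', ψ1]
  let Kl : Subgroup ThompsonF :=
    { carrier := {f | ψ f * e = e}
      one_mem' := by simp
      mul_mem' := fun {f g} hf hg => by
        rw [Set.mem_ofPred_eq] at *
        rw [ψu, mul_assoc, hg, hf]
      inv_mem' := fun {f} hf => by
        rw [Set.mem_ofPred_eq] at *
        nth_rw 1 [← hf]
        rw [← mul_assoc, ψinv, one_mul] }
  let Kr : Subgroup ThompsonF :=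
    { carrier := {f | e * ψ f = e}
      one_mem' := by simp
      mul_mem' := fun {f g} hf hg => by
        rw [Set.mem_ofPred_eq] at *
        rw [ψu, ← mul_assoc, hf, hg]
      inv_mem' := fun {f} hf => by
        rw [Set.mem_ofPred_eq] at *
        nth_rw 1 [← hf]
        rw [mul_assoc, ψinv', mul_one] }
  have hl (p) : ψ (join p) * e = e := join_mem_of_generators (K := Kl)
    (by show ψ _ * e = e; rw [j00, hs1]) (by show ψ _ * e = e; rw [j01, hs2])
    (by show ψ _ * e = e; rw [j10, hs3]) (by show ψ _ * e = e; rw [j11, hs4]) p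
  have hr (p) : e * ψ (join p) = e := join_mem_of_generators (K := Kr)
    (by show e * ψ _ = e; rw [j00, hs1']) (by show e * ψ _ = e; rw [j01, hs2'])
    (by show e * ψ _ = e; rw [j10, hs3']) (by show e * ψ _ = e; rw [j11, hs4']) p
  obtain ⟨Φ, hΦ, hΦe⟩ := CrazyRing.exists_hom ψ half exists_smul_half e hee
    (fun f hf => by obtain ⟨p, rfl⟩ := smul_half_iff.1 hf; exact hl p)
    (fun f hf => by obtain ⟨p, rfl⟩ := smul_half_iff.1 hf; exact hr p)
    (fun f hf => by
      obtain ⟨p, q, rfl | rfl⟩ := exists_double_coset hf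
      · rw [ψu, ψu, ← mul_assoc, ← mul_assoc, hr, mul_assoc, hl, ← X_zero, ψ0, hz]
      · rw [ψu, ψu, ← mul_assoc, ← mul_assoc, hr, mul_assoc, hl, ← X_zero, ψ0', hz'])
  exact ⟨Φ, by rw [hΦ, ψ0], by rw [hΦ, ψ0'], by rw [hΦ, ψ1], by rw [hΦ, ψ1'], hΦe⟩

/-- Generators of `ℤ[F] ⋉ Mat⁰_S(ℤ)`. -/
def ringGenerators : Fin 5 → CrazyRing ThompsonF DyadicPoint :=
  ![CrazyRing.of _ _ (X 0), CrazyRing.of _ _ (X 0)⁻¹, CrazyRing.of _ _ (X 1),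
    CrazyRing.of _ _ (X 1)⁻¹, CrazyRing.E ThompsonF half half]

theorem eq_top_of_ringGenerators (A : Subring (CrazyRing ThompsonF DyadicPoint))
    (hA : ∀ i, ringGenerators i ∈ A) : A = ⊤ := by
  have hof (f : ThompsonF) : CrazyRing.of ThompsonF DyadicPoint f ∈ A := by
    have hf : f ∈ Subgroup.closure {X 0, X 1} := closure_X_zero_one ▸ Subgroup.mem_top f
    induction hf using Subgroup.closure_induction_left with
    | one => rw [map_one]; exact one_mem _
    | mul_left x hx y _ ih =>
      rw [map_mul]
      rcases hx with rfl | rfl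
      exacts [mul_mem (hA 0) ih, mul_mem (hA 2) ih]
    | inv_mul_cancel x hx y _ ih =>
      rw [map_mul]
      rcases hx with rfl | rfl
      exacts [mul_mem (hA 1) ih, mul_mem (hA 3) ih]
  refine eq_top_iff.2 fun x _ => ?_
  induction x using CrazyRing.induction with
  | hof f => exact hof f
  | hE s t =>
    obtain ⟨f, rfl⟩ := exists_smul_half s
    obtain ⟨g, rfl⟩ := exists_smul_half t
    have := CrazyRing.E_mul_of (S := DyadicPoint) g⁻¹ (f • half) half
    rw [inv_inv, ← CrazyRing.of_mul_E] at this
    rw [← this]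
    exact mul_mem (mul_mem (hof f) (hA 4)) (hof _)
  | hadd x y hx hy => exact add_mem (hx trivial) (hy trivial)
  | hneg x hx => exact neg_mem (hx trivial)

end ThompsonRing

open ThompsonRing in
theorem isFinitelyPresented_steinberg_thompson :
    Group.IsFinitelyPresented (Steinberg 4 (CrazyRing ThompsonF DyadicPoint)) := by
  let letter (i : Fin 5) : FreeRing (Fin 5) := MonoidAlgebra.of ℤ _ (FreeMonoid.of i)
  let π : FreeRing (Fin 5) →+* CrazyRing ThompsonF DyadicPoint :=
    (MonoidAlgebra.lift ℤ _ (FreeMonoid (Fin 5)) (FreeMonoid.lift ringGenerators)).toRingHom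
  have hπ (i : Fin 5) : π (letter i) = ringGenerators i := by
    simp [π, letter]
  let T := ringRelators (letter 0) (letter 1) (letter 2) (letter 3) (letter 4)
  refine Steinberg.isFinitelyPresented π ?_ {t | t ∈ T} T.finite_toSet (fun t ht => ?_)
    fun J hJ a ha => ?_
  · rw [← RingHom.range_eq_top]
    exact eq_top_of_ringGenerators _ fun i => ⟨letter i, hπ i⟩
  · have := List.mem_map_of_mem (f := π) ht
    rw [map_ringRelators] at this
    simp only [hπ] at this
    exact eq_zero_of_mem_ringRelators _ this
  -- Modulo an ideal `J` containing the relators, the universal property yields `Φ` with `Φ ∘ π`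
  -- equal to the quotient map, so that the kernel of `π` lies in `J`.
  · let q : FreeRing (Fin 5) →+* J.ringCon.Quotient := J.ringCon.mk'
    have hq (a : FreeRing (Fin 5)) : q a = 0 ↔ a ∈ J := by
      rw [TwoSidedIdeal.mem_iff, ← map_zero q]
      exact RingCon.eq J.ringCon
    obtain ⟨Φ, h0, h1, h2, h3, h4⟩ := exists_hom_of_ringRelators
      (a := q (letter 0)) (a' := q (letter 1)) (b := q (letter 2)) (b' := q (letter 3))
      (e := q (letter 4)) (by
        rw [← map_ringRelators]
        intro t ht
        obtain ⟨s, hs, rfl⟩ := List.mem_map.1 ht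
        exact (hq s).2 (hJ s hs))
    have hΦ : Φ.comp π = q := by
      refine MonoidAlgebra.ringHom_ext' (Subsingleton.elim _ _) (FreeMonoid.hom_eq fun i => ?_)
      show Φ (π (letter i)) = q (letter i)
      rw [hπ]
      fin_cases i
      exacts [h0, h1, h2, h3, h4]
    rw [← hq, ← hΦ, RingHom.comp_apply, ha, map_zero]

end CrazyGroup

end

noncomputable section

namespace CrazyGroup

/-! ### Integral Steinberg relations and peak reduction -/

open commutatorElement

section PeakReduction

variable {I G : Type*} [Group G]

/-- The element `x_ij x_ji⁻¹ x_ij`. -/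
def weyl (x : I → I → G) (i j : I) : G := x i j * (x j i)⁻¹ * x i j

/-- The Steinberg relations between elementary matrices. -/
structure ElementaryRelations (x : I → I → G) : Prop where
  commutator : ∀ {i j k}, i ≠ j → j ≠ k → i ≠ k → ⁅x i j, x j k⁆ = x i k
  comm : ∀ {i j k l}, i ≠ j → k ≠ l → j ≠ k → i ≠ l → Commute (x i j) (x k l)

open Classical in
/-- The elements `x_ij` act as elementary matrices. -/
structure ElementaryAction [MulAction G (I →₀ ℤ)] (x : I → I → G) : Prop where
  smul_apply : ∀ {i j}, i ≠ j → ∀ (v : I →₀ ℤ) k, (x i j • v) k = if k = i then v i + v j else v k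

/-- Elements satisfying the relations of elementary matrices over `ℤ` and acting as such. -/
structure IntSteinberg [MulAction G (I →₀ ℤ)] (x : I → I → G) : Prop
    extends ElementaryRelations x, ElementaryAction x where
  braid : ∀ {i j}, i ≠ j → x i j * (x j i)⁻¹ * x i j = (x j i)⁻¹ * x i j * (x j i)⁻¹
  pow_four : ∀ {i j}, i ≠ j → weyl x i j ^ 4 = 1

/-- The `ℓ¹`-norm over the coordinates in `J`. -/
def norm1 (J : Finset I) (v : I →₀ ℤ) : ℕ := ∑ k ∈ J, (v k).natAbs

/-- The vector `v` is supported in `J`, and its coordinates are coprime. -/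
structure IsPrim (J : Finset I) (v : I →₀ ℤ) : Prop where
  apply_eq_zero : ∀ k ∉ J, v k = 0
  isUnit : ∀ d : ℤ, (∀ k, d ∣ v k) → IsUnit d

/-- The operation `v_i ↦ v_i + ε v_j` decreases the absolute value of `v_i` by that of `v_j`. -/
structure Reduces (J : Finset I) (i j : I) (ε : ℤ) (v : I →₀ ℤ) : Prop where
  ne : i ≠ j
  left_mem : i ∈ J
  right_mem : j ∈ J
  sign : ε = 1 ∨ ε = -1
  ne_zero : v j ≠ 0
  natAbs : (v i + ε * v j).natAbs + (v j).natAbs = (v i).natAbs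

variable {x : I → I → G} {J : Finset I} {i j k l : I} {v : I →₀ ℤ}

namespace ElementaryRelations

variable (h : ElementaryRelations x)
include h

theorem semiconj_row (hij : i ≠ j) (hjk : j ≠ k) (hik : i ≠ k) :
    SemiconjBy (x i j) (x j k) (x i k * x j k) := by
  rw [SemiconjBy, ← h.commutator hij hjk hik, commutatorElement_def]; group

theorem semiconj_inv_row (hij : i ≠ j) (hjk : j ≠ k) (hik : i ≠ k) :
    SemiconjBy (x i j)⁻¹ (x j k) ((x i k)⁻¹ * x j k) := by
  have h1 : SemiconjBy (x i j) (x i k) (x i k) := h.comm hij hik hij.symm hik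
  have h2 := (h1.inv_right.mul_right (h.semiconj_row hij hjk hik)).inv_symm_left
  rwa [inv_mul_cancel_left] at h2

theorem semiconj_col (hij : i ≠ j) (hki : k ≠ i) (hkj : k ≠ j) :
    SemiconjBy (x i j) (x k i) ((x k j)⁻¹ * x k i) := by
  rw [SemiconjBy, ← h.commutator hki hij hkj, commutatorElement_def]; group

theorem semiconj_inv_col (hij : i ≠ j) (hki : k ≠ i) (hkj : k ≠ j) :
    SemiconjBy (x i j)⁻¹ (x k i) (x k j * x k i) := by
  have h1 : SemiconjBy (x i j) (x k j) (x k j) := h.comm hij hkj hkj.symm hij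
  have h2 := (h1.mul_right (h.semiconj_col hij hki hkj)).inv_symm_left
  rwa [mul_inv_cancel_left] at h2

/-- Here and below, `weyl x i j` conjugates the generators as a signed permutation matrix would:
index `j` becomes `i`, index `i` becomes `j` with a sign, and other indices are fixed. -/
theorem weyl_row (hij : i ≠ j) (hjk : j ≠ k) (hik : i ≠ k) :
    SemiconjBy (weyl x i j) (x j k) (x i k) := by
  have c : Commute (x i k) (x j k) := h.comm hik hjk hjk.symm hik
  have a1 := h.semiconj_row hij hjk hik
  have a2 : SemiconjBy (x j i)⁻¹ (x j k) (x j k) :=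
    (h.comm hij.symm hjk hij hjk : SemiconjBy (x j i) (x j k) (x j k)).inv_symm_left
  have a3 := (h.semiconj_inv_row hij.symm hik hjk).mul_right a2
  rw [mul_assoc, c.eq, inv_mul_cancel_left, ← c.eq] at a3
  have a4 : SemiconjBy (x i j) (x i k) (x i k) := h.comm hij hik hij.symm hik
  exact (a4.mul_left a3).mul_left a1

theorem weyl_row' (hij : i ≠ j) (hjk : j ≠ k) (hik : i ≠ k) :
    SemiconjBy (weyl x i j) (x i k) (x j k)⁻¹ := by
  have a1 : SemiconjBy (x i j) (x i k) (x i k) := h.comm hij hik hij.symm hik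
  have a2 := h.semiconj_inv_row hij.symm hik hjk
  have a3 := (h.semiconj_row hij hjk hik).inv_right.mul_right a1
  rw [mul_inv_rev, inv_mul_cancel_right] at a3
  exact (a3.mul_left a2).mul_left a1

theorem weyl_col (hij : i ≠ j) (hki : k ≠ i) (hkj : k ≠ j) :
    SemiconjBy (weyl x i j) (x k j) (x k i) := by
  have c : Commute (x k i) (x k j) := h.comm hki hkj hki.symm hkj
  have a1 : SemiconjBy (x i j) (x k j) (x k j) := h.comm hij hkj hkj.symm hij
  have a2 := h.semiconj_inv_col hij.symm hkj hki
  have a3 := (h.semiconj_col hij hki hkj).mul_right a1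
  rw [mul_assoc, c.eq, inv_mul_cancel_left, ← c.eq] at a3
  exact (a3.mul_left a2).mul_left a1

theorem weyl_col' (hij : i ≠ j) (hki : k ≠ i) (hkj : k ≠ j) :
    SemiconjBy (weyl x i j) (x k i) (x k j)⁻¹ := by
  have a1 := h.semiconj_col hij hki hkj
  have a2 : SemiconjBy (x j i)⁻¹ (x k i) (x k i) :=
    (h.comm hij.symm hki hki.symm hij.symm : SemiconjBy (x j i) (x k i) (x k i)).inv_symm_left
  have a3 := (h.semiconj_inv_col hij.symm hkj hki).inv_right.mul_right a2
  rw [mul_inv_rev, inv_mul_cancel_right] at a3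
  have a4 : SemiconjBy (x i j) (x k j) (x k j) := h.comm hij hkj hkj.symm hij
  exact (a4.inv_right.mul_left a3).mul_left a1

theorem weyl_disjoint (hij : i ≠ j) (hkl : k ≠ l) (hki : k ≠ i) (hkj : k ≠ j) (hli : l ≠ i)
    (hlj : l ≠ j) : SemiconjBy (weyl x i j) (x k l) (x k l) := by
  have a1 : Commute (x i j) (x k l) := h.comm hij hkl hkj.symm hli.symm
  have a2 : Commute (x j i) (x k l) := h.comm hij.symm hkl hki.symm hlj.symm
  exact (a1.mul_left a2.inv_left).mul_left a1

theorem weyl_weyl_right (hij : i ≠ j) (hjk : j ≠ k) (hik : i ≠ k) :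
    SemiconjBy (weyl x i j) (weyl x j k) (weyl x i k) := by
  have a := h.weyl_row hij hjk hik
  have b := h.weyl_col hij hik.symm hjk.symm
  exact (a.mul_right b.inv_right).mul_right a

theorem weyl_weyl_left (hij : i ≠ j) (hjk : j ≠ k) (hik : i ≠ k) :
    SemiconjBy (weyl x i j) (weyl x i k) (weyl x j k)⁻¹ := by
  have a := h.weyl_row' hij hjk hik
  have b := h.weyl_col' hij hik.symm hjk.symm
  have c := (a.mul_right b.inv_right).mul_right a
  rw [show (weyl x j k)⁻¹ = (x j k)⁻¹ * (x k j)⁻¹⁻¹ * (x j k)⁻¹ by rw [weyl]; group]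
  exact c

theorem weyl_weyl_disjoint (hij : i ≠ j) (hkl : k ≠ l) (hki : k ≠ i) (hkj : k ≠ j) (hli : l ≠ i)
    (hlj : l ≠ j) : SemiconjBy (weyl x i j) (weyl x k l) (weyl x k l) := by
  have a := h.weyl_disjoint hij hkl hki hkj hli hlj
  have b := h.weyl_disjoint hij hkl.symm hli hlj hki hkj
  exact (a.mul_right b.inv_right).mul_right a

/-- The braid relation holds as soon as there is a third index. -/
theorem braid (hij : i ≠ j) (hik : i ≠ k) (hjk : j ≠ k) :
    x i j * (x j i)⁻¹ * x i j = (x j i)⁻¹ * x i j * (x j i)⁻¹ := by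
  have a := h.weyl_row' hij hjk hik
  have b := h.weyl_col hij hik.symm hjk.symm
  -- Write `x i j` as `⁅x i k, x k j⁆` and conjugate the entries; the resulting commutator `⁅(x j
  -- k)⁻¹, x k i⁆` is `(x j i)⁻¹`.
  have c : SemiconjBy (weyl x i j) (x i j) ⁅(x j k)⁻¹, x k i⁆ := by
    rw [← h.commutator hik hjk.symm hij, commutatorElement_def, commutatorElement_def]
    exact ((a.mul_right b).mul_right a.inv_right).mul_right b.inv_right
  have d := (h.semiconj_inv_row hjk hik.symm hij.symm).eq
  have e : ⁅(x j k)⁻¹, x k i⁆ = (x j i)⁻¹ := by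
    rw [commutatorElement_def, d]; group
  rw [e] at c
  have := c.eq
  rw [weyl] at this
  apply mul_right_cancel (b := x i j)
  rw [this]
  group

end ElementaryRelations

variable [MulAction G (I →₀ ℤ)]

namespace ElementaryAction

variable (h : ElementaryAction x)
include h

theorem smul_self (hij : i ≠ j) (v : I →₀ ℤ) : (x i j • v) i = v i + v j := by
  rw [h.smul_apply hij, if_pos rfl]

theorem smul_ne (hij : i ≠ j) (hk : k ≠ i) (v : I →₀ ℤ) : (x i j • v) k = v k := by
  rw [h.smul_apply hij, if_neg hk]

theorem inv_smul_ne (hij : i ≠ j) (hk : k ≠ i) (v : I →₀ ℤ) : ((x i j)⁻¹ • v) k = v k := by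
  have := h.smul_ne hij hk ((x i j)⁻¹ • v)
  rw [smul_inv_smul] at this
  exact this.symm

theorem inv_smul_self (hij : i ≠ j) (v : I →₀ ℤ) : ((x i j)⁻¹ • v) i = v i - v j := by
  have := h.smul_self hij ((x i j)⁻¹ • v)
  rw [smul_inv_smul, h.inv_smul_ne hij hij.symm] at this
  omega

theorem zpow_smul_ne (hij : i ≠ j) {ε : ℤ} (hε : ε = 1 ∨ ε = -1) (hk : k ≠ i) (v : I →₀ ℤ) :
    (x i j ^ ε • v) k = v k := by
  rcases hε with rfl | rfl
  · rw [zpow_one, h.smul_ne hij hk]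
  · rw [zpow_neg_one, h.inv_smul_ne hij hk]

theorem zpow_smul_self (hij : i ≠ j) {ε : ℤ} (hε : ε = 1 ∨ ε = -1) (v : I →₀ ℤ) :
    (x i j ^ ε • v) i = v i + ε * v j := by
  rcases hε with rfl | rfl
  · rw [zpow_one, h.smul_self hij, one_mul]
  · rw [zpow_neg_one, h.inv_smul_self hij]; ring

theorem norm1_zpow_smul (hij : i ≠ j) (hi : i ∈ J) {ε : ℤ} (hε : ε = 1 ∨ ε = -1) (v : I →₀ ℤ) :
    norm1 J (x i j ^ ε • v) + (v i).natAbs = norm1 J v + (v i + ε * v j).natAbs := by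
  classical
  have e : ∑ k ∈ J.erase i, ((x i j ^ ε • v) k).natAbs = ∑ k ∈ J.erase i, (v k).natAbs :=
    Finset.sum_congr rfl fun k hk => by rw [h.zpow_smul_ne hij hε (Finset.ne_of_mem_erase hk)]
  rw [norm1, norm1, ← Finset.add_sum_erase _ _ hi, ← Finset.add_sum_erase _ _ hi, e,
    h.zpow_smul_self hij hε]
  omega

theorem norm1_add_of_reduces {ε : ℤ} (hr : Reduces J i j ε v) :
    norm1 J (x i j ^ ε • v) + (v j).natAbs = norm1 J v := by
  have := h.norm1_zpow_smul hr.ne hr.left_mem hr.sign v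
  have := hr.natAbs
  omega

theorem norm1_lt_of_reduces {ε : ℤ} (hr : Reduces J i j ε v) :
    norm1 J (x i j ^ ε • v) < norm1 J v := by
  have := h.norm1_add_of_reduces hr
  have := hr.ne_zero
  omega

theorem isPrim_zpow_smul (hij : i ≠ j) (hi : i ∈ J) {ε : ℤ} (hε : ε = 1 ∨ ε = -1)
    (hv : IsPrim J v) : IsPrim J (x i j ^ ε • v) where
  apply_eq_zero k hk := by
    rw [h.zpow_smul_ne hij hε (ne_of_mem_of_not_mem hi hk).symm, hv.apply_eq_zero k hk]
  isUnit d hd := hv.isUnit d fun k => by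
    have hj := hd j
    rw [h.zpow_smul_ne hij hε hij.symm] at hj
    by_cases hk : k = i
    · have hi := hd i
      rw [h.zpow_smul_self hij hε] at hi
      rw [hk]
      exact (Int.dvd_add_left (hj.mul_left ε)).1 hi
    · have := hd k
      rwa [h.zpow_smul_ne hij hε hk] at this

theorem weyl_smul_left (hij : i ≠ j) (v : I →₀ ℤ) : (weyl x i j • v) i = v j := by
  rw [weyl, mul_smul, mul_smul, h.smul_self hij, h.inv_smul_ne hij.symm hij,
    h.inv_smul_self hij.symm, h.smul_self hij, h.smul_ne hij hij.symm]
  ring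

theorem weyl_smul_right (hij : i ≠ j) (v : I →₀ ℤ) : (weyl x i j • v) j = -v i := by
  rw [weyl, mul_smul, mul_smul, h.smul_ne hij hij.symm, h.inv_smul_self hij.symm,
    h.smul_self hij, h.smul_ne hij hij.symm]
  ring

theorem weyl_smul_ne (hij : i ≠ j) (hki : k ≠ i) (hkj : k ≠ j) (v : I →₀ ℤ) :
    (weyl x i j • v) k = v k := by
  rw [weyl, mul_smul, mul_smul, h.smul_ne hij hki, h.inv_smul_ne hij.symm hkj, h.smul_ne hij hki]

theorem isPrim_weyl_smul (hij : i ≠ j) (hi : i ∈ J) (hj : j ∈ J) (hv : IsPrim J v) :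
    IsPrim J (weyl x i j • v) := by
  rw [weyl, mul_smul, mul_smul, ← zpow_neg_one, ← zpow_one (x i j)]
  exact h.isPrim_zpow_smul hij hi (Or.inl rfl) (h.isPrim_zpow_smul hij.symm hj (Or.inr rfl)
    (h.isPrim_zpow_smul hij hi (Or.inl rfl) hv))

theorem norm1_weyl_smul (hij : i ≠ j) (hi : i ∈ J) (hj : j ∈ J) (v : I →₀ ℤ) :
    norm1 J (weyl x i j • v) = norm1 J v := by
  classical
  have hj' : j ∈ J.erase i := Finset.mem_erase.2 ⟨hij.symm, hj⟩
  have e : ∑ k ∈ (J.erase i).erase j, ((weyl x i j • v) k).natAbs =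
      ∑ k ∈ (J.erase i).erase j, (v k).natAbs :=
    Finset.sum_congr rfl fun k hk => by
      have hk' := Finset.mem_of_mem_erase hk
      rw [h.weyl_smul_ne hij (Finset.ne_of_mem_erase hk') (Finset.ne_of_mem_erase hk)]
  rw [norm1, norm1, ← Finset.add_sum_erase _ _ hi, ← Finset.add_sum_erase _ _ hj',
    ← Finset.add_sum_erase J _ hi, ← Finset.add_sum_erase (J.erase i) _ hj', e,
    h.weyl_smul_left hij, h.weyl_smul_right hij]
  omega

end ElementaryAction

namespace IntSteinberg

variable (h : IntSteinberg x)
include h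

theorem weyl_self (hij : i ≠ j) : SemiconjBy (weyl x i j) (x i j) (x j i)⁻¹ := by
  have := h.braid hij
  rw [SemiconjBy, weyl]
  nth_rw 1 [this]
  group

theorem weyl_self' (hij : i ≠ j) : SemiconjBy (weyl x i j) (x j i) (x i j)⁻¹ := by
  have := h.braid hij
  rw [SemiconjBy, weyl]
  nth_rw 1 [this]
  group

theorem weyl_inv (hij : i ≠ j) : (weyl x i j)⁻¹ = weyl x j i := by
  rw [weyl, h.braid hij, weyl]
  group

/-- `k'` and `l'` are the images of `k` and `l` under the signed permutation, and `c`, `c'` the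
signs they acquire. The same signs occur for generators and for coordinates, so reducing operations
are carried to reducing operations. -/
theorem exists_weyl_conj (hij : i ≠ j) (hi : i ∈ J) (hj : j ∈ J) (hkl : k ≠ l) (hk : k ∈ J)
    (hl : l ∈ J) : ∃ k' l', ∃ c c' : ℤ, k' ≠ l' ∧ k' ∈ J ∧ l' ∈ J ∧ (c = 1 ∨ c = -1) ∧
      (c' = 1 ∨ c' = -1) ∧ SemiconjBy (weyl x i j) (x k l) (x k' l' ^ (c * c')) ∧
      ∀ v : I →₀ ℤ, (weyl x i j • v) k' = c * v k ∧ (weyl x i j • v) l' = c' * v l := by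
  by_cases hki : k = i
  · subst hki
    by_cases hlj : l = j
    · subst hlj
      exact ⟨l, k, -1, 1, hkl.symm, hl, hk, by simp, by simp, by simpa using h.weyl_self hij,
        fun v => by simp [h.weyl_smul_left hij, h.weyl_smul_right hij]⟩
    · exact ⟨j, l, -1, 1, Ne.symm hlj, hj, hl, by simp, by simp,
        by simpa using h.weyl_row' hij (Ne.symm hlj) hkl,
        fun v => by simp [h.weyl_smul_ne hij hkl.symm hlj, h.weyl_smul_right hij]⟩
  by_cases hkj : k = j
  · subst hkj
    by_cases hli : l = i
    · subst hli
      exact ⟨l, k, 1, -1, hkl.symm, hl, hk, by simp, by simp, by simpa using h.weyl_self' hij,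
        fun v => by simp [h.weyl_smul_left hij, h.weyl_smul_right hij]⟩
    · exact ⟨i, l, 1, 1, Ne.symm hli, hi, hl, by simp, by simp,
        by simpa using h.weyl_row hij hkl (Ne.symm hli),
        fun v => by simp [h.weyl_smul_ne hij hli hkl.symm, h.weyl_smul_left hij]⟩
  by_cases hli : l = i
  · subst hli
    exact ⟨k, j, 1, -1, hkj, hk, hj, by simp, by simp, by simpa using h.weyl_col' hij hki hkj,
      fun v => by simp [h.weyl_smul_ne hij hki hkj, h.weyl_smul_right hij]⟩
  by_cases hlj : l = j
  · subst hlj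
    exact ⟨k, i, 1, 1, hki, hk, hi, by simp, by simp, by simpa using h.weyl_col hij hki hkj,
      fun v => by simp [h.weyl_smul_ne hij hki hkj, h.weyl_smul_left hij]⟩
  · exact ⟨k, l, 1, 1, hkl, hk, hl, by simp, by simp,
      by simpa using h.weyl_disjoint hij hkl hki hkj hli hlj,
      fun v => by simp [h.weyl_smul_ne hij hki hkj, h.weyl_smul_ne hij hli hlj]⟩

theorem exists_reduces_weyl {ε : ℤ} (hij : i ≠ j) (hi : i ∈ J) (hj : j ∈ J)
    (hr : Reduces J k l ε v) : ∃ k' l', ∃ δ : ℤ, Reduces J k' l' δ (weyl x i j • v) ∧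
      SemiconjBy (weyl x i j) (x k l ^ ε) (x k' l' ^ δ) := by
  obtain ⟨k', l', c, c', hkl, hk, hl, hc, hc', hs, hv⟩ :=
    h.exists_weyl_conj hij hi hj hr.ne hr.left_mem hr.right_mem
  have hε := hr.sign
  have h0 := hr.ne_zero
  have h1 := hr.natAbs
  refine ⟨k', l', c * c' * ε, ⟨hkl, hk, hl, ?_, ?_, ?_⟩, ?_⟩
  · rcases hc with rfl | rfl <;> rcases hc' with rfl | rfl <;> omega
  · rw [(hv v).2]
    rcases hc' with rfl | rfl <;> omega
  · rw [(hv v).1, (hv v).2]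
    rcases hc with rfl | rfl <;> rcases hc' with rfl | rfl <;> rcases hε with rfl | rfl <;> omega
  · rw [zpow_mul]
    exact hs.zpow_right ε

end IntSteinberg

/-- The Euclidean step: a primitive vector with one nonzero coordinate is a signed basis vector, and
of two nonzero coordinates the smaller one reduces the larger. -/
theorem exists_reduces (hv : IsPrim J v) (h1 : ∀ k ∈ J, ∀ c : ℤ, c = 1 ∨ c = -1 →
    v ≠ Finsupp.single k c) : ∃ i j ε, Reduces J i j ε v := by
  have mem {k : I} (hk : v k ≠ 0) : k ∈ J := by
    by_contra h
    exact hk (hv.apply_eq_zero k h)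
  obtain ⟨k, hk⟩ : ∃ k, v k ≠ 0 := by
    by_contra! h
    simpa using hv.isUnit 0 fun k => by rw [h k]
  obtain ⟨l, hlk, hl⟩ : ∃ l, l ≠ k ∧ v l ≠ 0 := by
    by_contra! h
    have e : v = Finsupp.single k (v k) := by
      ext l
      by_cases hl : l = k
      · rw [hl, Finsupp.single_eq_same]
      · rw [Finsupp.single_eq_of_ne hl, h l hl]
    refine h1 k (mem hk) (v k) (Int.isUnit_iff.1 (hv.isUnit _ fun l => ?_)) e
    by_cases hl : l = k
    · rw [hl]
    · rw [h l hl]; exact dvd_zero _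
  have key {i j : I} (hij : i ≠ j) (hi : v i ≠ 0) (hj : v j ≠ 0)
      (hle : (v j).natAbs ≤ (v i).natAbs) : ∃ i j ε, Reduces J i j ε v := by
    by_cases hs : (v i + v j).natAbs < (v i - v j).natAbs
    · exact ⟨i, j, 1, hij, mem hi, mem hj, Or.inl rfl, hj, by omega⟩
    · exact ⟨i, j, -1, hij, mem hi, mem hj, Or.inr rfl, hj, by omega⟩
  rcases le_total (v k).natAbs (v l).natAbs with h | h
  · exact key hlk hl hk h
  · exact key hlk.symm hk hl h

theorem not_reduces_single {c : ℤ} {i j : I} {ε : ℤ} : ¬ Reduces J i j ε (Finsupp.single k c) :=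
  fun hr => by
    have h1 := hr.ne_zero
    have h2 := hr.natAbs
    by_cases hk : j = k
    · rw [hk, Finsupp.single_eq_same] at h1 h2
      rw [Finsupp.single_eq_of_ne (hk ▸ hr.ne)] at h2
      rcases hr.sign with rfl | rfl <;> omega
    · exact h1 (Finsupp.single_eq_of_ne hk)

theorem Reduces.sign_unique {ε δ : ℤ} (h : Reduces J i j ε v) (h' : Reduces J i j δ v) : ε = δ := by
  have h1 := h.natAbs
  have h2 := h'.natAbs
  have h3 := h.ne_zero
  rcases h.sign with rfl | rfl <;> rcases h'.sign with rfl | rfl <;> omega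

end PeakReduction

end CrazyGroup

end

noncomputable section

namespace CrazyGroup

/-! ### Peak reduction: sections over the primitive vectors -/

section PeakReduction

variable {I G Y : Type*} [Group G] {x : I → I → G} {J : Finset I} {i j k l : I} {v : I →₀ ℤ}

theorem zpow_smul_eq_self [MulAction G Y] {g : G} {y : Y} {ε : ℤ} (hε : ε = 1 ∨ ε = -1) (hg : g • y = y) :
    g ^ ε • y = y := by
  rcases hε with rfl | rfl
  · rwa [zpow_one]
  · rw [zpow_neg_one, inv_smul_eq_iff, hg]

theorem ElementaryRelations.semiconj_zpow_row (h : ElementaryRelations x) (hij : i ≠ j)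
    (hjk : j ≠ k) (hik : i ≠ k) {ε : ℤ} (hε : ε = 1 ∨ ε = -1) (δ : ℤ) :
    SemiconjBy (x i j ^ ε) (x j k ^ δ) (x i k ^ (ε * δ) * x j k ^ δ) := by
  have c : Commute (x i k) (x j k) := h.comm hik hjk hjk.symm hik
  rw [zpow_mul, ← (c.zpow_left ε).mul_zpow]
  refine SemiconjBy.zpow_right ?_ δ
  rcases hε with rfl | rfl
  · rw [zpow_one, zpow_one]
    exact h.semiconj_row hij hjk hik
  · rw [zpow_neg_one, zpow_neg_one]
    exact h.semiconj_inv_row hij hjk hik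

variable [MulAction G (I →₀ ℤ)] [MulAction G Y]

namespace ElementaryAction

theorem weyl_smul_single_left (h : ElementaryAction x) (hij : i ≠ j) (c : ℤ) :
    weyl x i j • Finsupp.single i c = Finsupp.single j (-c) := by
  ext k
  by_cases hki : k = i
  · rw [hki, h.weyl_smul_left hij, Finsupp.single_eq_of_ne hij.symm, Finsupp.single_eq_of_ne hij]
  by_cases hkj : k = j
  · rw [hkj, h.weyl_smul_right hij, Finsupp.single_eq_same, Finsupp.single_eq_same]
  · rw [h.weyl_smul_ne hij hki hkj, Finsupp.single_eq_of_ne hki, Finsupp.single_eq_of_ne hkj]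

theorem weyl_smul_single_right (h : ElementaryAction x) (hij : i ≠ j) (c : ℤ) :
    weyl x i j • Finsupp.single j c = Finsupp.single i c := by
  ext k
  by_cases hki : k = i
  · rw [hki, h.weyl_smul_left hij, Finsupp.single_eq_same, Finsupp.single_eq_same]
  by_cases hkj : k = j
  · rw [hkj, h.weyl_smul_right hij, Finsupp.single_eq_of_ne hij, Finsupp.single_eq_of_ne hij.symm,
      neg_zero]
  · rw [h.weyl_smul_ne hij hki hkj, Finsupp.single_eq_of_ne hki, Finsupp.single_eq_of_ne hkj]

theorem weyl_smul_single_ne (h : ElementaryAction x) (hij : i ≠ j) (hki : k ≠ i) (hkj : k ≠ j)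
    (c : ℤ) : weyl x i j • Finsupp.single k c = Finsupp.single k c := by
  ext l
  by_cases hli : l = i
  · rw [hli, h.weyl_smul_left hij, Finsupp.single_eq_of_ne hkj.symm,
      Finsupp.single_eq_of_ne hki.symm]
  by_cases hlj : l = j
  · rw [hlj, h.weyl_smul_right hij, Finsupp.single_eq_of_ne hki.symm,
      Finsupp.single_eq_of_ne hkj.symm, neg_zero]
  · rw [h.weyl_smul_ne hij hli hlj]

end ElementaryAction

/-- A map on primitive vectors that is equivariant on vectors of norm one, and at each other vector
for at least one reducing operation. -/
structure IsPeakSection (x : I → I → G) (J : Finset I) (σ : (I →₀ ℤ) → Y) : Prop where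
  smul_single : ∀ {i j k : I} {c : ℤ}, i ≠ j → i ∈ J → j ∈ J → k ∈ J → j ≠ k → (c = 1 ∨ c = -1) →
    x i j • σ (Finsupp.single k c) = σ (Finsupp.single k c)
  weyl_single : ∀ {i j k : I} {c : ℤ}, i ≠ j → i ∈ J → j ∈ J → k ∈ J → (c = 1 ∨ c = -1) →
    σ (weyl x i j • Finsupp.single k c) = weyl x i j • σ (Finsupp.single k c)
  exists_step : ∀ {v : I →₀ ℤ}, (∃ i j ε, Reduces J i j ε v) →
    ∃ i j ε, Reduces J i j ε v ∧ σ (x i j ^ ε • v) = x i j ^ ε • σ v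

/-- The map `σ` is compatible with all reducing operations at `v`. -/
def IsConfluent (x : I → I → G) (J : Finset I) (σ : (I →₀ ℤ) → Y) (v : I →₀ ℤ) : Prop :=
  ∀ i j ε, Reduces J i j ε v → σ (x i j ^ ε • v) = x i j ^ ε • σ v

namespace IsPeakSection

variable {σ : (I →₀ ℤ) → Y} {N : ℕ}

/-- A reduction of `v` by `x k l` leaves the coordinate `j` equal to zero, and it commutes with `x i
j` up to a power of `x k j`, which by induction also fixes the value at the reduced vector. This and
the next lemmas assume confluence below norm `N`. -/
theorem smul_eq_of_apply_eq_zero (hσ : IsPeakSection x J σ) (h : IntSteinberg x)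
    (hD : ∀ v, IsPrim J v → norm1 J v < N → IsConfluent x J σ v)
    (hv : IsPrim J v) (hN : norm1 J v < N) (hij : i ≠ j) (hi : i ∈ J) (hj : j ∈ J)
    (h0 : v j = 0) : x i j • σ v = σ v := by
  induction hn : norm1 J v using Nat.strong_induction_on generalizing v i with
  | _ n ih =>
    by_cases hs : ∃ k ∈ J, ∃ c : ℤ, (c = 1 ∨ c = -1) ∧ v = Finsupp.single k c
    · obtain ⟨k, hk, c, hc, rfl⟩ := hs
      refine hσ.smul_single hij hi hj hk (fun e => ?_) hc
      rw [e, Finsupp.single_eq_same] at h0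
      omega
    · obtain ⟨k, l, ε, hr⟩ := exists_reduces hv fun k hk c hc e => hs ⟨k, hk, c, hc, e⟩
      have hlj : l ≠ j := fun e => hr.ne_zero (e ▸ h0)
      have hkj : k ≠ j := by
        rintro rfl
        have := hr.natAbs
        have := hr.ne_zero
        omega
      have hlt := h.norm1_lt_of_reduces hr
      have hu := h.isPrim_zpow_smul hr.ne hr.left_mem hr.sign hv
      have hu0 : (x k l ^ ε • v) j = 0 := by rw [h.zpow_smul_ne hr.ne hr.sign hkj.symm, h0]
      have key {i' : I} (hi'j : i' ≠ j) (hi' : i' ∈ J) :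
          x i' j • σ (x k l ^ ε • v) = σ (x k l ^ ε • v) :=
        ih _ (hn ▸ hlt) hu (hlt.trans hN) hi'j hi' hu0 rfl
      have e := hD v hv hN k l ε hr
      apply smul_left_cancel (x k l ^ ε)
      by_cases hli : l = i
      · subst hli
        have := h.semiconj_zpow_row hr.ne hij hkj hr.sign 1
        rw [zpow_one, mul_one] at this
        rw [← mul_smul, this.eq, mul_smul, mul_smul, ← e, key hij hi,
          zpow_smul_eq_self hr.sign (key hkj hr.left_mem)]
      · have : Commute (x k l ^ ε) (x i j) := (h.comm hr.ne hij hli hkj).zpow_left ε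
        rw [← mul_smul, this.eq, mul_smul, ← e, key hij hi]

/-- Weyl elements preserve the norm and carry reductions to reductions, so equivariance descends
along a reduction to vectors of norm one. -/
theorem weyl_smul (hσ : IsPeakSection x J σ) (h : IntSteinberg x)
    (hD : ∀ v, IsPrim J v → norm1 J v < N → IsConfluent x J σ v)
    (hv : IsPrim J v) (hN : norm1 J v < N) (hij : i ≠ j) (hi : i ∈ J) (hj : j ∈ J) :
    σ (weyl x i j • v) = weyl x i j • σ v := by
  induction hn : norm1 J v using Nat.strong_induction_on generalizing v with
  | _ n ih =>
    by_cases hs : ∃ k ∈ J, ∃ c : ℤ, (c = 1 ∨ c = -1) ∧ v = Finsupp.single k c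
    · obtain ⟨k, hk, c, hc, rfl⟩ := hs
      exact hσ.weyl_single hij hi hj hk hc
    · obtain ⟨k, l, ε, hr⟩ := exists_reduces hv fun k hk c hc e => hs ⟨k, hk, c, hc, e⟩
      obtain ⟨k', l', δ, hr', hw⟩ := h.exists_reduces_weyl hij hi hj hr
      have hlt := h.norm1_lt_of_reduces hr
      have e := hD v hv hN k l ε hr
      have e' := hD _ (h.isPrim_weyl_smul hij hi hj hv)
        (by rw [h.norm1_weyl_smul hij hi hj]; exact hN) k' l' δ hr'
      have := ih _ (hn ▸ hlt) (h.isPrim_zpow_smul hr.ne hr.left_mem hr.sign hv) (hlt.trans hN) rfl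
      apply smul_left_cancel (x k' l' ^ δ)
      rw [← e', ← mul_smul, ← mul_smul, ← hw.eq, mul_smul, mul_smul, this, e]

/-- If the operation neither fixes nor reduces `v`, then `v i` reduces `v j`. In this case `x i j ^
ε` is a Weyl element times `x i j ^ (-ε) * x j i ^ ε`: a reduction, the inverse of a reduction from
a vector `u` of norm below `N`, and a Weyl element, for all of which equivariance is known. -/
theorem smul_of_le (hσ : IsPeakSection x J σ) (h : IntSteinberg x)
    (hD : ∀ v, IsPrim J v → norm1 J v < N → IsConfluent x J σ v)
    (hv : IsPrim J v) (hN : norm1 J v < N) (hij : i ≠ j) (hi : i ∈ J) (hj : j ∈ J) {ε : ℤ}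
    (hε : ε = 1 ∨ ε = -1) (hle : norm1 J (x i j ^ ε • v) ≤ norm1 J v) :
    σ (x i j ^ ε • v) = x i j ^ ε • σ v := by
  have hnorm := h.norm1_zpow_smul hij hi hε v
  by_cases h0 : v j = 0
  · have e : x i j ^ ε • v = v := by
      ext k
      by_cases hk : k = i
      · rw [hk, h.zpow_smul_self hij hε, h0, mul_zero, add_zero]
      · rw [h.zpow_smul_ne hij hε hk]
    rw [e, zpow_smul_eq_self hε (hσ.smul_eq_of_apply_eq_zero h hD hv hN hij hi hj h0)]
  by_cases hvij : (v j).natAbs ≤ (v i).natAbs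
  · refine hD v hv hN i j ε ⟨hij, hi, hj, hε, h0, ?_⟩
    rcases hε with rfl | rfl <;> omega
  · have hr : Reduces J j i ε v := by
      refine ⟨hij.symm, hj, hi, hε, ?_, ?_⟩ <;> rcases hε with rfl | rfl <;> omega
    have hy := h.isPrim_zpow_smul hij.symm hj hε hv
    have hyn := h.norm1_add_of_reduces hr
    have hε' : -ε = 1 ∨ -ε = -1 := by omega
    set u := x i j ^ (-ε) • x j i ^ ε • v with hu_def
    have hxu : x i j ^ ε • u = x j i ^ ε • v := by rw [hu_def, zpow_neg, smul_inv_smul]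
    have hu := h.isPrim_zpow_smul hij hi hε' hy
    have ui : u i = v i + -ε * (v j + ε * v i) := by
      rw [hu_def, h.zpow_smul_self hij hε', h.zpow_smul_self hij.symm hε,
        h.zpow_smul_ne hij.symm hε hij]
    have uj : u j = v j + ε * v i := by
      rw [hu_def, h.zpow_smul_ne hij hε' hij.symm, h.zpow_smul_self hij.symm hε]
    have hru : Reduces J i j ε u := by
      refine ⟨hij, hi, hj, hε, ?_, ?_⟩
      · rw [uj]
        rcases hε with rfl | rfl <;> omega
      · rw [ui, uj]
        rcases hε with rfl | rfl <;> omega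
    have hun := h.norm1_add_of_reduces hru
    rw [hxu, uj] at hun
    have huN : norm1 J u < N := by
      rcases hε with rfl | rfl <;> omega
    obtain ⟨w, hw, hwu⟩ : ∃ w : G, w * x i j ^ (-ε) * x j i ^ ε = x i j ^ ε ∧
        σ (w • u) = w • σ u := by
      rcases hε with rfl | rfl
      · exact ⟨weyl x i j, by rw [weyl]; group, hσ.weyl_smul h hD hu huN hij hi hj⟩
      · refine ⟨weyl x j i, ?_, hσ.weyl_smul h hD hu huN hij.symm hj hi⟩
        rw [← h.weyl_inv hij, weyl]; group
    have e1 := hD v hv hN j i ε hr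
    have e2 := hD u hu huN i j ε hru
    rw [hxu, e1] at e2
    have e3 : σ u = x i j ^ (-ε) • x j i ^ ε • σ v := by rw [e2, zpow_neg, inv_smul_smul]
    rw [← hw, mul_smul, mul_smul, ← hu_def, hwu, e3, mul_smul, mul_smul]

theorem smul_of_lt (hσ : IsPeakSection x J σ) (h : IntSteinberg x)
    (hD : ∀ v, IsPrim J v → norm1 J v < N → IsConfluent x J σ v)
    (hv : IsPrim J v) (hN : norm1 J v < N) (hij : i ≠ j) (hi : i ∈ J) (hj : j ∈ J) {ε : ℤ}
    (hε : ε = 1 ∨ ε = -1) (hlt : norm1 J (x i j ^ ε • v) < N) :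
    σ (x i j ^ ε • v) = x i j ^ ε • σ v := by
  rcases le_total (norm1 J (x i j ^ ε • v)) (norm1 J v) with hle | hle
  · exact hσ.smul_of_le h hD hv hN hij hi hj hε hle
  · have e : x i j ^ (-ε) • x i j ^ ε • v = v := by rw [zpow_neg, inv_smul_smul]
    have := hσ.smul_of_le h hD (h.isPrim_zpow_smul hij hi hε hv) hlt hij hi hj (ε := -ε)
      (by omega) (by rwa [e])
    rw [e] at this
    rw [this, zpow_neg, smul_inv_smul]

theorem smul_of_commute {P Q : G} (hPQ : Commute P Q) (h1 : σ (Q • P • v) = Q • σ (P • v))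
    (h2 : σ (P • Q • v) = P • σ (Q • v)) (heq : σ (Q • v) = Q • σ v) : σ (P • v) = P • σ v := by
  apply smul_left_cancel Q
  rw [← h1, ← mul_smul, ← hPQ.eq, mul_smul, h2, heq, ← mul_smul, hPQ.eq, mul_smul]

/-- The two operations commute, and usually the fourth corner of the square lies below the peak. The
exception is that each of them already cancels `v i`. Then both lead to the same vector `u`, and `x
i j ^ ε * x i l ^ (-δ)` has to fix the value at `u`. -/
theorem confluent_same_row (hσ : IsPeakSection x J σ) (h : IntSteinberg x)
    (hD : ∀ v, IsPrim J v → norm1 J v < N → IsConfluent x J σ v)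
    (hv : IsPrim J v) (hN : norm1 J v ≤ N) {ε δ : ℤ} (hr : Reduces J i j ε v)
    (hs : Reduces J i l δ v) (hjl : j ≠ l) (heq : σ (x i l ^ δ • v) = x i l ^ δ • σ v) :
    σ (x i j ^ ε • v) = x i j ^ ε • σ v := by
  have hP := h.isPrim_zpow_smul hr.ne hr.left_mem hr.sign hv
  have hQ := h.isPrim_zpow_smul hs.ne hs.left_mem hs.sign hv
  have hPN := (h.norm1_lt_of_reduces hr).trans_le hN
  have hQN := (h.norm1_lt_of_reduces hs).trans_le hN
  have c : Commute (x i j ^ ε) (x i l ^ δ) :=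
    ((h.comm hr.ne hs.ne hr.ne.symm hs.ne).zpow_left ε).zpow_right δ
  have nP := h.norm1_zpow_smul hr.ne hr.left_mem hr.sign v
  have nQ := h.norm1_zpow_smul hs.ne hs.left_mem hs.sign v
  have nPQ := h.norm1_zpow_smul hr.ne hr.left_mem hr.sign (x i l ^ δ • v)
  rw [h.zpow_smul_self hs.ne hs.sign, h.zpow_smul_ne hs.ne hs.sign hr.ne.symm] at nPQ
  have aP := hr.natAbs
  have aQ := hs.natAbs
  have zP := hr.ne_zero
  have zQ := hs.ne_zero
  by_cases hlt : (v i + δ * v l + ε * v j).natAbs < (v i).natAbs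
  · have hPQN : norm1 J (x i j ^ ε • x i l ^ δ • v) < N := by omega
    refine smul_of_commute c (hσ.smul_of_lt h hD hP hPN hs.ne hs.left_mem hs.right_mem hs.sign ?_)
      (hσ.smul_of_lt h hD hQ hQN hr.ne hr.left_mem hr.right_mem hr.sign hPQN) heq
    rwa [← mul_smul, ← c.eq, mul_smul]
  · have e1 : v i + ε * v j = 0 ∧ v i + δ * v l = 0 := by
      rcases hr.sign with rfl | rfl <;> rcases hs.sign with rfl | rfl <;> omega
    have eu : x i l ^ δ • v = x i j ^ ε • v := by
      ext k
      by_cases hk : k = i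
      · rw [hk, h.zpow_smul_self hr.ne hr.sign, h.zpow_smul_self hs.ne hs.sign, e1.1, e1.2]
      · rw [h.zpow_smul_ne hr.ne hr.sign hk, h.zpow_smul_ne hs.ne hs.sign hk]
    have hη : -(δ * ε) = 1 ∨ -(δ * ε) = -1 := by
      rcases hr.sign with rfl | rfl <;> rcases hs.sign with rfl | rfl <;> omega
    have hδ : -δ = 1 ∨ -δ = -1 := by have := hs.sign; omega
    rw [eu] at heq
    set u := x i j ^ ε • v with hu_def
    have uj : u j = v j := h.zpow_smul_ne hr.ne hr.sign hr.ne.symm v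
    have ul : u l = v l := h.zpow_smul_ne hr.ne hr.sign hs.ne.symm v
    have hz : Reduces J l j (-(δ * ε)) u := by
      refine ⟨hjl.symm, hs.right_mem, hr.right_mem, hη, by rwa [uj], ?_⟩
      rw [uj, ul]
      rcases hr.sign with rfl | rfl <;> rcases hs.sign with rfl | rfl <;> omega
    have hzu := hD u hP hPN l j _ hz
    have hzu0 : (x l j ^ (-(δ * ε)) • u) l = 0 := by
      rw [h.zpow_smul_self hjl.symm hη, uj, ul]
      rcases hr.sign with rfl | rfl <;> rcases hs.sign with rfl | rfl <;> omega
    have fix := hσ.smul_eq_of_apply_eq_zero h hD (h.isPrim_zpow_smul hjl.symm hs.right_mem hη hP)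
      ((h.norm1_lt_of_reduces hz).trans hPN) hs.ne hs.left_mem hs.right_mem hzu0
    have sc := h.semiconj_zpow_row hs.ne hjl.symm hr.ne hδ (-(δ * ε))
    rw [show -δ * -(δ * ε) = ε by rcases hs.sign with rfl | rfl <;> ring] at sc
    have c' : Commute (x l j ^ (-(δ * ε))) (x i j ^ ε) :=
      ((h.comm hjl.symm hr.ne hr.ne.symm hjl.symm).zpow_left _).zpow_right _
    -- The reduction `x l j ^ (-(δ * ε))` of `u` makes the coordinate `l` zero and conjugates the
    -- element in question into `x i l ^ (-δ)`, which fixes the value there.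
    have t : (x i j ^ ε * x i l ^ (-δ)) • σ u = σ u := by
      apply smul_left_cancel (x l j ^ (-(δ * ε)))
      rw [← mul_smul, ← mul_assoc, c'.eq, ← sc.eq, mul_smul, ← hzu, zpow_smul_eq_self hδ fix]
    nth_rw 2 [heq] at t
    rw [mul_smul, heq, ← mul_smul (x i l ^ (-δ)), ← zpow_add, neg_add_cancel, zpow_zero,
      one_smul] at t
    rw [heq, t]

/-- Here `|v i| = |v j|` and each operation makes a coordinate zero. Up to a Weyl element they
differ by `x i j ^ (-δ)`, which fixes the value at the second result because its coordinate `j`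
vanishes. -/
theorem confluent_opposite (hσ : IsPeakSection x J σ) (h : IntSteinberg x)
    (hD : ∀ v, IsPrim J v → norm1 J v < N → IsConfluent x J σ v)
    (hv : IsPrim J v) (hN : norm1 J v ≤ N) {ε δ : ℤ} (hr : Reduces J i j ε v)
    (hs : Reduces J j i δ v) (heq : σ (x j i ^ δ • v) = x j i ^ δ • σ v) :
    σ (x i j ^ ε • v) = x i j ^ ε • σ v := by
  have hij := hr.ne
  have hi := hr.left_mem
  have hj := hr.right_mem
  have hε := hr.sign
  have hP := h.isPrim_zpow_smul hr.ne hr.left_mem hr.sign hv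
  have hQ := h.isPrim_zpow_smul hs.ne hs.left_mem hs.sign hv
  have hPN := (h.norm1_lt_of_reduces hr).trans_le hN
  have hQN := (h.norm1_lt_of_reduces hs).trans_le hN
  have aP := hr.natAbs
  have aQ := hs.natAbs
  have zP := hr.ne_zero
  have e0 : δ = ε ∧ v j + δ * v i = 0 := by
    rcases hr.sign with rfl | rfl <;> rcases hs.sign with rfl | rfl <;> omega
  obtain ⟨rfl, e0⟩ := e0
  have hδ : -δ = 1 ∨ -δ = -1 := by omega
  have q0 : (x j i ^ δ • v) j = 0 := by rw [h.zpow_smul_self hij.symm hε, e0]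
  have fixV : x i j ^ (-δ) • x j i ^ δ • v = x j i ^ δ • v := by
    ext k
    by_cases hk : k = i
    · rw [hk, h.zpow_smul_self hij hδ, q0, mul_zero, add_zero]
    · rw [h.zpow_smul_ne hij hδ hk]
  have fix := zpow_smul_eq_self hδ (hσ.smul_eq_of_apply_eq_zero h hD hQ hQN hij hi hj q0)
  obtain ⟨w, hw, hwu⟩ : ∃ w : G, w * x i j ^ δ = x i j ^ (-δ) * x j i ^ δ ∧
      σ (w • x i j ^ δ • v) = w • σ (x i j ^ δ • v) := by
    rcases hε with rfl | rfl
    · refine ⟨weyl x j i, ?_, hσ.weyl_smul h hD hP hPN hij.symm hj hi⟩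
      rw [← h.weyl_inv hij, weyl]; group
    · exact ⟨weyl x i j, by rw [weyl]; group, hσ.weyl_smul h hD hP hPN hij hi hj⟩
  apply smul_left_cancel w
  rw [← hwu, ← mul_smul, ← mul_smul, hw, mul_smul, mul_smul, fixV, ← heq, fix]

/-- The operations do not commute, and the commutator relation replaces the square by a pentagon
with an additional edge `x k j`. All its vertices except `v` lie below the peak, so it can be used
in both directions. -/
theorem confluent_chain (hσ : IsPeakSection x J σ) (h : IntSteinberg x)
    (hD : ∀ v, IsPrim J v → norm1 J v < N → IsConfluent x J σ v)
    (hv : IsPrim J v) (hN : norm1 J v ≤ N) {ε δ : ℤ} (hr : Reduces J i j ε v)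
    (hs : Reduces J k i δ v) (hkj : k ≠ j) :
    (σ (x i j ^ ε • v) = x i j ^ ε • σ v ↔ σ (x k i ^ δ • v) = x k i ^ δ • σ v) := by
  have hP := h.isPrim_zpow_smul hr.ne hr.left_mem hr.sign hv
  have hQ := h.isPrim_zpow_smul hs.ne hs.left_mem hs.sign hv
  have hPN := (h.norm1_lt_of_reduces hr).trans_le hN
  have hQN := (h.norm1_lt_of_reduces hs).trans_le hN
  have aP := hr.natAbs
  have aQ := hs.natAbs
  have zQ := hs.ne_zero
  have nP := h.norm1_zpow_smul hr.ne hr.left_mem hr.sign v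
  have nQ := h.norm1_zpow_smul hs.ne hs.left_mem hs.sign v
  have nPQ := h.norm1_zpow_smul hr.ne hr.left_mem hr.sign (x k i ^ δ • v)
  rw [h.zpow_smul_ne hs.ne hs.sign hs.ne.symm, h.zpow_smul_ne hs.ne hs.sign hkj.symm] at nPQ
  have nQP := h.norm1_zpow_smul hs.ne hs.left_mem hs.sign (x i j ^ ε • v)
  rw [h.zpow_smul_ne hr.ne hr.sign hs.ne, h.zpow_smul_self hr.ne hr.sign] at nQP
  have hPQN : norm1 J (x i j ^ ε • x k i ^ δ • v) < N := by omega
  have hQPN : norm1 J (x k i ^ δ • x i j ^ ε • v) < N := by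
    rcases hr.sign with rfl | rfl <;> rcases hs.sign with rfl | rfl <;> omega
  have hδε : δ * ε = 1 ∨ δ * ε = -1 := by
    rcases hr.sign with rfl | rfl <;> rcases hs.sign with rfl | rfl <;> omega
  have sc := (h.semiconj_zpow_row hs.ne hr.ne hkj hs.sign ε).eq
  have eV : x k j ^ (δ * ε) • x i j ^ ε • x k i ^ δ • v = x k i ^ δ • x i j ^ ε • v := by
    rw [← mul_smul, ← mul_smul, ← mul_smul, sc]
  have e1 := hσ.smul_of_lt h hD hP hPN hs.ne hs.left_mem hs.right_mem hs.sign hQPN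
  have e2 := hσ.smul_of_lt h hD hQ hQN hr.ne hr.left_mem hr.right_mem hr.sign hPQN
  have e3 := hσ.smul_of_lt h hD (h.isPrim_zpow_smul hr.ne hr.left_mem hr.sign hQ) hPQN hkj
    hs.left_mem hr.right_mem hδε (by rwa [eV])
  rw [eV, e1, e2] at e3
  constructor
  · intro heq
    rw [heq, ← mul_smul, ← mul_smul, sc, mul_smul] at e3
    exact (smul_left_cancel _ e3).symm
  · intro heq
    rw [heq, ← mul_smul (x i j ^ ε), ← mul_smul (x k j ^ (δ * ε)), ← mul_assoc, ← sc,
      mul_smul] at e3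
    exact smul_left_cancel _ e3

theorem confluent (hσ : IsPeakSection x J σ) (h : IntSteinberg x)
    (hD : ∀ v, IsPrim J v → norm1 J v < N → IsConfluent x J σ v)
    (hv : IsPrim J v) (hN : norm1 J v ≤ N) {ε δ : ℤ} (hr : Reduces J i j ε v)
    (hs : Reduces J k l δ v) (heq : σ (x k l ^ δ • v) = x k l ^ δ • σ v) :
    σ (x i j ^ ε • v) = x i j ^ ε • σ v := by
  by_cases hik : i = k
  · subst hik
    by_cases hjl : j = l
    · subst hjl
      rwa [hr.sign_unique hs]
    · exact hσ.confluent_same_row h hD hv hN hr hs hjl heq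
  by_cases hli : l = i
  · subst hli
    by_cases hjk : j = k
    · subst hjk
      exact hσ.confluent_opposite h hD hv hN hr hs heq
    · exact (hσ.confluent_chain h hD hv hN hr hs (Ne.symm hjk)).2 heq
  by_cases hjk : j = k
  · subst hjk
    exact (hσ.confluent_chain h hD hv hN hs hr (Ne.symm hli)).1 heq
  have hP := h.isPrim_zpow_smul hr.ne hr.left_mem hr.sign hv
  have hQ := h.isPrim_zpow_smul hs.ne hs.left_mem hs.sign hv
  have hPN := (h.norm1_lt_of_reduces hr).trans_le hN
  have hQN := (h.norm1_lt_of_reduces hs).trans_le hN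
  have hPQ : Reduces J i j ε (x k l ^ δ • v) := by
    refine ⟨hr.ne, hr.left_mem, hr.right_mem, hr.sign, ?_, ?_⟩
    · rw [h.zpow_smul_ne hs.ne hs.sign hjk]; exact hr.ne_zero
    · rw [h.zpow_smul_ne hs.ne hs.sign hjk, h.zpow_smul_ne hs.ne hs.sign hik]; exact hr.natAbs
  have hQP : Reduces J k l δ (x i j ^ ε • v) := by
    refine ⟨hs.ne, hs.left_mem, hs.right_mem, hs.sign, ?_, ?_⟩
    · rw [h.zpow_smul_ne hr.ne hr.sign hli]; exact hs.ne_zero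
    · rw [h.zpow_smul_ne hr.ne hr.sign hli, h.zpow_smul_ne hr.ne hr.sign (Ne.symm hik)]
      exact hs.natAbs
  exact smul_of_commute (((h.comm hr.ne hs.ne hjk (Ne.symm hli)).zpow_left ε).zpow_right δ)
    (hD _ hP hPN _ _ _ hQP) (hD _ hQ hQN _ _ _ hPQ) heq

theorem isConfluent (hσ : IsPeakSection x J σ) (h : IntSteinberg x) (hv : IsPrim J v) :
    IsConfluent x J σ v := by
  induction hn : norm1 J v using Nat.strong_induction_on generalizing v with
  | _ n ih =>
    intro i j ε hr
    obtain ⟨k, l, δ, hs, heq⟩ := hσ.exists_step ⟨i, j, ε, hr⟩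
    exact hσ.confluent h (fun v hv hlt => ih _ (hn ▸ hlt) hv rfl) hv le_rfl hr hs heq

theorem smul_eq (hσ : IsPeakSection x J σ) (h : IntSteinberg x) (hv : IsPrim J v) (hij : i ≠ j)
    (hi : i ∈ J) (hj : j ∈ J) : σ (x i j • v) = x i j • σ v := by
  have := hσ.smul_of_lt h (N := norm1 J v + norm1 J (x i j ^ (1 : ℤ) • v) + 1)
    (fun v hv _ => hσ.isConfluent h hv) hv (by omega) hij hi hj (Or.inl rfl) (by omega)
  rwa [zpow_one] at this

end IsPeakSection

open Classical in
/-- Extension of a map on vectors of norm one along reducing operations. -/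
def peakSection (h : IntSteinberg x) (J : Finset I) (b : (I →₀ ℤ) → Y) (v : I →₀ ℤ) : Y :=
  if hr : ∃ p : I × I × ℤ, Reduces J p.1 p.2.1 p.2.2 v then
    (x hr.choose.1 hr.choose.2.1 ^ hr.choose.2.2)⁻¹ •
      peakSection h J b (x hr.choose.1 hr.choose.2.1 ^ hr.choose.2.2 • v)
  else b v
termination_by norm1 J v
decreasing_by exact h.norm1_lt_of_reduces hr.choose_spec

theorem peakSection_single (h : IntSteinberg x) (b : (I →₀ ℤ) → Y) (k : I) (c : ℤ) :
    peakSection h J b (Finsupp.single k c) = b (Finsupp.single k c) := by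
  rw [peakSection, dif_neg]
  rintro ⟨p, hp⟩
  exact not_reduces_single hp

theorem isPeakSection_peakSection (h : IntSteinberg x) (b : (I →₀ ℤ) → Y)
    (hfix : ∀ {i j k : I} {c : ℤ}, i ≠ j → i ∈ J → j ∈ J → k ∈ J → j ≠ k → (c = 1 ∨ c = -1) →
      x i j • b (Finsupp.single k c) = b (Finsupp.single k c))
    (hweyl : ∀ {i j k : I} {c : ℤ}, i ≠ j → i ∈ J → j ∈ J → k ∈ J → (c = 1 ∨ c = -1) →
      b (weyl x i j • Finsupp.single k c) = weyl x i j • b (Finsupp.single k c)) :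
    IsPeakSection x J (peakSection h J b) where
  smul_single hij hi hj hk hjk hc := by
    rw [peakSection_single]
    exact hfix hij hi hj hk hjk hc
  weyl_single {i j k c} hij hi hj hk hc := by
    have := hweyl hij hi hj hk hc
    rw [peakSection_single]
    by_cases hki : k = i
    · subst hki
      rwa [h.weyl_smul_single_left hij, peakSection_single, ← h.weyl_smul_single_left hij]
    by_cases hkj : k = j
    · subst hkj
      rwa [h.weyl_smul_single_right hij, peakSection_single, ← h.weyl_smul_single_right hij]
    · rw [h.weyl_smul_single_ne hij hki hkj] at this ⊢
      rwa [peakSection_single]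
  exists_step {v} hr := by
    obtain ⟨i, j, ε, hr⟩ := hr
    have hr : ∃ p : I × I × ℤ, Reduces J p.1 p.2.1 p.2.2 v := ⟨(i, j, ε), hr⟩
    refine ⟨hr.choose.1, hr.choose.2.1, hr.choose.2.2, hr.choose_spec, ?_⟩
    conv_rhs => rw [peakSection, dif_pos hr, smul_inv_smul]

end PeakReduction

end CrazyGroup

end

noncomputable section

namespace CrazyGroup

/-! ### Stabilizers of basis vectors and faithfulness of the action -/

section PeakReduction

variable {I G : Type*} [Group G] {x : I → I → G} {J : Finset I} {i j k l o : I}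

/-- The subgroup generated by the `x_ij` with `i, j ∈ J`. -/
def elemSubgroup (x : I → I → G) (J : Finset I) : Subgroup G :=
  Subgroup.closure {g | ∃ i ∈ J, ∃ j ∈ J, i ≠ j ∧ g = x i j}

/-- The subgroup generated by the `x_ij` with `i, j ∈ J` and `j ≠ o`. -/
def stabSubgroup (x : I → I → G) (J : Finset I) (o : I) : Subgroup G :=
  Subgroup.closure {g | ∃ i ∈ J, ∃ j ∈ J, i ≠ j ∧ j ≠ o ∧ g = x i j}

theorem mem_elemSubgroup (hij : i ≠ j) (hi : i ∈ J) (hj : j ∈ J) : x i j ∈ elemSubgroup x J :=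
  Subgroup.subset_closure ⟨i, hi, j, hj, hij, rfl⟩

theorem mem_stabSubgroup (hij : i ≠ j) (hi : i ∈ J) (hj : j ∈ J) (hjo : j ≠ o) :
    x i j ∈ stabSubgroup x J o :=
  Subgroup.subset_closure ⟨i, hi, j, hj, hij, hjo, rfl⟩

theorem weyl_mem_stabSubgroup (hij : i ≠ j) (hi : i ∈ J) (hj : j ∈ J) (hio : i ≠ o) (hjo : j ≠ o) :
    weyl x i j ∈ stabSubgroup x J o :=
  mul_mem (mul_mem (mem_stabSubgroup hij hi hj hjo)
    (inv_mem (mem_stabSubgroup hij.symm hj hi hio))) (mem_stabSubgroup hij hi hj hjo)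

/-- The subgroup generated by the `x_oj` with `j ∈ J`. -/
def rowSubgroup (x : I → I → G) (J : Finset I) (o : I) : Subgroup G :=
  Subgroup.closure {g | ∃ j ∈ J, g = x o j}

theorem mem_rowSubgroup (hj : j ∈ J) : x o j ∈ rowSubgroup x J o :=
  Subgroup.subset_closure ⟨j, hj, rfl⟩

theorem smul_mk_eq {H : Subgroup G} {z m y : G} (h : z * m = m * y) (hy : y ∈ H) :
    z • (m : G ⧸ H) = m := by
  show ((z * m : G) : G ⧸ H) = m
  rw [h, QuotientGroup.eq]
  simpa using hy

theorem mk_mul_of_mem {H : Subgroup G} (m : G) {y : G} (hy : y ∈ H) :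
    ((m * y : G) : G ⧸ H) = m := by
  rw [QuotientGroup.eq]
  simpa using hy

open Classical in
/-- The cosets over the vectors of norm one. -/
def baseCoset (x : I → I → G) (J : Finset I) (o : I) (v : I →₀ ℤ) : G ⧸ stabSubgroup x J o :=
  -- Over a signed basis vector in `J` different from `e_o`, the representative is a Weyl element,
  -- its inverse or its square, carrying `e_o` to that vector. The trivial cosets in the last branch
  -- and in the branch without `l` are defaults.
  if v o = 1 then ((1 : G) : G ⧸ stabSubgroup x J o)
  else if v o = -1 then
    if h : ∃ l ∈ J, l ≠ o then ((weyl x h.choose o ^ 2 : G) : G ⧸ stabSubgroup x J o)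
    else ((1 : G) : G ⧸ stabSubgroup x J o)
  else if h : ∃ k, v k = 1 then ((weyl x h.choose o : G) : G ⧸ stabSubgroup x J o)
  else if h : ∃ k, v k = -1 then (((weyl x h.choose o)⁻¹ : G) : G ⧸ stabSubgroup x J o)
  else ((1 : G) : G ⧸ stabSubgroup x J o)

theorem baseCoset_one : baseCoset x J o (Finsupp.single o 1) = ((1 : G) : G ⧸ stabSubgroup x J o) := by
  rw [baseCoset, if_pos Finsupp.single_eq_same]

theorem baseCoset_single (hko : k ≠ o) :
    baseCoset x J o (Finsupp.single k 1) = ((weyl x k o : G) : G ⧸ stabSubgroup x J o) := by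
  have hex : ∃ l, Finsupp.single k (1 : ℤ) l = 1 := ⟨k, Finsupp.single_eq_same⟩
  have e : hex.choose = k := by
    by_contra hne
    have := hex.choose_spec
    rw [Finsupp.single_eq_of_ne hne] at this
    simp at this
  rw [baseCoset, Finsupp.single_eq_of_ne hko.symm, if_neg (by simp), if_neg (by simp),
    dif_pos hex, e]

theorem baseCoset_single_neg (hko : k ≠ o) :
    baseCoset x J o (Finsupp.single k (-1)) =
      (((weyl x k o)⁻¹ : G) : G ⧸ stabSubgroup x J o) := by
  have hne : ¬ ∃ l, Finsupp.single k (-1 : ℤ) l = 1 := by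
    rintro ⟨l, hl⟩
    by_cases hlk : l = k
    · rw [hlk, Finsupp.single_eq_same] at hl; simp at hl
    · rw [Finsupp.single_eq_of_ne hlk] at hl; simp at hl
  have hex : ∃ l, Finsupp.single k (-1 : ℤ) l = -1 := ⟨k, Finsupp.single_eq_same⟩
  have e : hex.choose = k := by
    by_contra hne
    have := hex.choose_spec
    rw [Finsupp.single_eq_of_ne hne] at this
    simp at this
  rw [baseCoset, Finsupp.single_eq_of_ne hko.symm, if_neg (by simp), if_neg (by simp),
    dif_neg hne, dif_pos hex, e]

variable [MulAction G (I →₀ ℤ)]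

namespace IntSteinberg

/-- The coset over `-e_o` does not depend on the auxiliary index: the two squares are conjugate by
`weyl x k l`, which lies in the subgroup and is inverted by conjugation with `weyl x l o ^ 2`. -/
theorem mk_weyl_sq_eq (h : IntSteinberg x) (hk : k ∈ J) (hl : l ∈ J) (hko : k ≠ o)
    (hlo : l ≠ o) : ((weyl x k o ^ 2 : G) : G ⧸ stabSubgroup x J o) = (weyl x l o ^ 2 : G) := by
  by_cases hkl : k = l
  · rw [hkl]
  have hw := weyl_mem_stabSubgroup (x := x) hkl hk hl hko hlo
  have e1 := ((h.weyl_weyl_right hkl hlo hko).pow_right 2).eq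
  have e2 : weyl x k o ^ 2 = weyl x k l * weyl x l o ^ 2 * (weyl x k l)⁻¹ := by
    rw [e1, mul_inv_cancel_right]
  rw [e2, mk_mul_of_mem _ (inv_mem hw)]
  refine smul_mk_eq (y := (weyl x k l)⁻¹) ?_ (inv_mem hw)
  have f1 := h.weyl_weyl_right hlo.symm (Ne.symm hkl) hko.symm
  have f2 := h.weyl_weyl_left hlo.symm (Ne.symm hkl) hko.symm
  rw [← h.weyl_inv hlo, ← h.weyl_inv hkl, ← h.weyl_inv hko] at f1
  rw [← h.weyl_inv hlo, ← h.weyl_inv hkl, inv_inv, ← h.weyl_inv hko] at f2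
  have g1 := f1.inv_right
  rw [inv_inv, inv_inv] at g1
  have g2 := f2.inv_right
  rw [inv_inv] at g2
  have g3 := (g1.inv_symm_left).eq
  have g4 := (g2.inv_symm_left).eq
  rw [inv_inv] at g3 g4
  rw [pow_two, ← mul_assoc, ← g3, mul_assoc, ← g4, mul_assoc]

theorem baseCoset_neg_one (h : IntSteinberg x) (hl : l ∈ J) (hlo : l ≠ o) :
    baseCoset x J o (Finsupp.single o (-1)) =
      ((weyl x l o ^ 2 : G) : G ⧸ stabSubgroup x J o) := by
  have hex : ∃ l ∈ J, l ≠ o := ⟨l, hl, hlo⟩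
  rw [baseCoset, if_neg (by simp), if_pos Finsupp.single_eq_same, dif_pos hex]
  exact h.mk_weyl_sq_eq hex.choose_spec.1 hl hex.choose_spec.2 hlo

/-- Conjugation by `w = m⁻¹` turns `x i j` into a power of some `x i' j'`. If `j'` were `o`, the
coordinate `o` of `w • v` would be `±v j` rather than `c * v k`. -/
theorem exists_conj_mem_stabSubgroup (h : IntSteinberg x) {w m : G} (hw : w * m = 1)
    {a b : I} (hab : a ≠ b) (ha : a ∈ J) (hb : b ∈ J) (hweyl : w = weyl x a b) (hij : i ≠ j)
    (hi : i ∈ J) (hj : j ∈ J) {c : ℤ} (hc : ∀ v : I →₀ ℤ, (w • v) o = c * v k) (hc0 : c ≠ 0)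
    (hjk : j ≠ k) : x i j • (m : G ⧸ stabSubgroup x J o) = m := by
  obtain ⟨i', j', d, d', hij', hi', hj', hd, hd', hs, hv⟩ :=
    h.exists_weyl_conj hab ha hb hij hi hj
  have hjo : j' ≠ o := by
    rintro rfl
    have h1 := (hv (Finsupp.single k 1)).2
    rw [← hweyl, hc, Finsupp.single_eq_same, Finsupp.single_eq_of_ne hjk] at h1
    omega
  refine smul_mk_eq (y := x i' j' ^ (d * d')) ?_ (zpow_mem (mem_stabSubgroup hij' hi' hj' hjo) _)
  have hm : m = w⁻¹ := eq_inv_of_mul_eq_one_right hw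
  have := hs.eq
  rw [← hweyl] at this
  rw [hm, eq_inv_mul_iff_mul_eq, ← mul_assoc, this, mul_inv_cancel_right]

theorem smul_baseCoset (h : IntSteinberg x) (ho : o ∈ J) (hij : i ≠ j) (hi : i ∈ J) (hj : j ∈ J)
    (hk : k ∈ J) (hjk : j ≠ k) {c : ℤ} (hc : c = 1 ∨ c = -1) :
    x i j • baseCoset x J o (Finsupp.single k c) = baseCoset x J o (Finsupp.single k c) := by
  by_cases hko : k = o
  · subst hko
    rcases hc with rfl | rfl
    · rw [baseCoset_one]
      exact smul_mk_eq (by rw [mul_one, one_mul]) (mem_stabSubgroup hij hi hj hjk)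
    · rw [h.baseCoset_neg_one hj hjk]
      by_cases hik : i = k
      · subst hik
        refine smul_mk_eq (y := x i j) ?_ (mem_stabSubgroup hij hi hj hjk)
        have e1 := (h.weyl_self' hjk).eq
        have e2 := (h.weyl_self hjk).inv_right.eq
        rw [inv_inv] at e2
        rw [pow_two, ← mul_assoc, ← e2, mul_assoc, ← e1, mul_assoc]
      · refine smul_mk_eq (y := (x i j)⁻¹) ?_ (inv_mem (mem_stabSubgroup hij hi hj hjk))
        have e1 := (h.weyl_col hjk hij hik).eq
        have e2 := (h.weyl_col' hjk hij hik).inv_right.eq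
        rw [inv_inv] at e2
        rw [pow_two, ← mul_assoc, ← e1, mul_assoc, ← e2, mul_assoc]
  · rcases hc with rfl | rfl
    · rw [baseCoset_single hko]
      refine h.exists_conj_mem_stabSubgroup (w := weyl x o k) (c := 1) ?_ (Ne.symm hko) ho hk rfl
        hij hi hj ?_ one_ne_zero hjk
      · rw [← h.weyl_inv hko, inv_mul_cancel]
      · intro v
        rw [h.weyl_smul_left (Ne.symm hko), one_mul]
    · rw [baseCoset_single_neg hko]
      refine h.exists_conj_mem_stabSubgroup (w := weyl x k o) (c := -1) (mul_inv_cancel _) hko hk ho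
        rfl hij hi hj ?_ (by simp) hjk
      intro v
      rw [h.weyl_smul_right hko, neg_one_mul]

theorem weyl_base_smul_baseCoset (h : IntSteinberg x) (ho : o ∈ J) (hi : i ∈ J) (hio : i ≠ o)
    (hk : k ∈ J) {c : ℤ} (hc : c = 1 ∨ c = -1) :
    baseCoset x J o (weyl x i o • Finsupp.single k c) =
      weyl x i o • baseCoset x J o (Finsupp.single k c) := by
  have h4 := h.pow_four hio
  by_cases hko : k = o
  · subst hko
    rw [h.weyl_smul_single_right hio]
    rcases hc with rfl | rfl
    · rw [baseCoset_single hio, baseCoset_one]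
      show _ = ((_ * 1 : G) : G ⧸ stabSubgroup x J k)
      rw [mul_one]
    · rw [baseCoset_single_neg hio, h.baseCoset_neg_one hi hio]
      show _ = ((_ * _ : G) : G ⧸ stabSubgroup x J k)
      -- The cube of a Weyl element is its inverse, by `pow_four`; this matches the cosets over
      -- `-e_o` and `-e_i`.
      congr 1
      rw [inv_eq_iff_mul_eq_one, ← h4]
      group
  by_cases hki : k = i
  · subst hki
    rw [h.weyl_smul_single_left hio]
    rcases hc with rfl | rfl
    · rw [h.baseCoset_neg_one hi hio, baseCoset_single hio, pow_two]
      rfl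
    · rw [neg_neg, baseCoset_one, baseCoset_single_neg hio]
      show _ = ((_ * _ : G) : G ⧸ stabSubgroup x J o)
      rw [mul_inv_cancel]
  · rw [h.weyl_smul_single_ne hio hki hko]
    have hw := weyl_mem_stabSubgroup (x := x) (Ne.symm hki) hi hk hio hko
    symm
    rcases hc with rfl | rfl
    · rw [baseCoset_single hko]
      refine smul_mk_eq (y := (weyl x i k)⁻¹) ?_ (inv_mem hw)
      have f2 := (h.weyl_weyl_left (Ne.symm hko) hki hio.symm).inv_right
      rw [h.weyl_inv hio.symm, inv_inv, ← h.weyl_inv (Ne.symm hki), ← h.weyl_inv hko] at f2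
      have := f2.inv_symm_left.eq
      rw [inv_inv] at this
      exact this.symm
    · rw [baseCoset_single_neg hko]
      refine smul_mk_eq (y := weyl x i k) ?_ hw
      have f1 := (h.weyl_weyl_right hko hio.symm hki).inv_right
      rw [h.weyl_inv hio.symm, h.weyl_inv hki] at f1
      exact f1.inv_symm_left.eq.symm

theorem weyl_smul_baseCoset_of_ne (h : IntSteinberg x) (hij : i ≠ j) (hi : i ∈ J)
    (hj : j ∈ J) (hio : i ≠ o) (hjo : j ≠ o) {c : ℤ} (hc : c = 1 ∨ c = -1) :
    baseCoset x J o (weyl x i j • Finsupp.single k c) =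
      weyl x i j • baseCoset x J o (Finsupp.single k c) := by
  have hw := weyl_mem_stabSubgroup (x := x) hij hi hj hio hjo
  have move {m m' : G} (hm : SemiconjBy (weyl x i j) m m') :
      (m' : G ⧸ stabSubgroup x J o) = weyl x i j • (m : G ⧸ stabSubgroup x J o) := by
    show _ = ((_ * _ : G) : G ⧸ stabSubgroup x J o)
    rw [hm.eq, mk_mul_of_mem _ hw]
  have left := h.weyl_weyl_left hij hjo hio
  have right := h.weyl_weyl_right hij hjo hio
  by_cases hki : k = i
  · subst hki
    rw [h.weyl_smul_single_left hij]
    rcases hc with rfl | rfl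
    · rw [baseCoset_single hio, baseCoset_single_neg hjo]
      exact move left
    · rw [neg_neg, baseCoset_single hjo, baseCoset_single_neg hio]
      have := left.inv_right
      rw [inv_inv] at this
      exact move this
  by_cases hkj : k = j
  · subst hkj
    rw [h.weyl_smul_single_right hij]
    rcases hc with rfl | rfl
    · rw [baseCoset_single hio, baseCoset_single hjo]
      exact move right
    · rw [baseCoset_single_neg hio, baseCoset_single_neg hjo]
      exact move right.inv_right
  rw [h.weyl_smul_single_ne hij hki hkj]
  by_cases hko : k = o
  · subst hko
    rcases hc with rfl | rfl
    · rw [baseCoset_one]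
      exact move (SemiconjBy.one_right _)
    · have e : ((weyl x j k)⁻¹) ^ 2 = weyl x j k ^ 2 := by
        rw [inv_pow, inv_eq_iff_mul_eq_one, ← pow_add]
        exact h.pow_four hjo
      have := left.pow_right 2
      rw [e] at this
      have e1 := move this
      rw [← h.baseCoset_neg_one hi hio, ← h.baseCoset_neg_one hj hjo] at e1
      exact e1
  · have d := h.weyl_weyl_disjoint hij hko hki hkj hio.symm hjo.symm
    rcases hc with rfl | rfl
    · rw [baseCoset_single hko]
      exact move d
    · rw [baseCoset_single_neg hko]
      exact move d.inv_right

theorem weyl_smul_baseCoset (h : IntSteinberg x) (ho : o ∈ J) (hij : i ≠ j) (hi : i ∈ J)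
    (hj : j ∈ J) (hk : k ∈ J) {c : ℤ} (hc : c = 1 ∨ c = -1) :
    baseCoset x J o (weyl x i j • Finsupp.single k c) =
      weyl x i j • baseCoset x J o (Finsupp.single k c) := by
  by_cases hjo : j = o
  · subst hjo
    exact h.weyl_base_smul_baseCoset ho hi hij hk hc
  by_cases hio : i = o
  · subst hio
    have key {k : I} (hk : k ∈ J) {c : ℤ} (hc : c = 1 ∨ c = -1) :=
      h.weyl_base_smul_baseCoset (k := k) ho hj hjo hk hc
    obtain ⟨k', hk', c', hc', e⟩ : ∃ k' ∈ J, ∃ c' : ℤ, (c' = 1 ∨ c' = -1) ∧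
        weyl x i j • Finsupp.single k c = Finsupp.single k' c' := by
      by_cases hki : k = i
      · exact ⟨j, hj, -c, by omega, by rw [hki, h.weyl_smul_single_left hij]⟩
      by_cases hkj : k = j
      · exact ⟨i, hi, c, hc, by rw [hkj, h.weyl_smul_single_right hij]⟩
      · exact ⟨k, hk, c, hc, by rw [h.weyl_smul_single_ne hij hki hkj]⟩
    have := key hk' hc'
    rw [← e, ← h.weyl_inv hij, inv_smul_smul, eq_inv_smul_iff] at this
    exact this.symm
  · exact h.weyl_smul_baseCoset_of_ne hij hi hj hio hjo hc

theorem isPrim_single {k : I} (hk : k ∈ J) : IsPrim J (Finsupp.single k 1) where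
  apply_eq_zero l hl := Finsupp.single_eq_of_ne (ne_of_mem_of_not_mem hk hl).symm
  isUnit d hd := by
    have := hd k
    rw [Finsupp.single_eq_same] at this
    exact isUnit_of_dvd_one this

/-- The stabilizer of a basis vector in the group generated by the `x_ij`. -/
theorem mem_stabSubgroup_of_smul_eq (h : IntSteinberg x) (ho : o ∈ J) {g : G}
    (hg : g ∈ elemSubgroup x J) (hgo : g • Finsupp.single o (1 : ℤ) = Finsupp.single o 1) :
    g ∈ stabSubgroup x J o := by
  -- The map extending `baseCoset` is equivariant on primitive vectors. If `g` fixes `e_o`, then it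
  -- fixes the trivial coset lying over it.
  have hσ := isPeakSection_peakSection (J := J) h (baseCoset x J o)
    (fun hij hi hj hk hjk hc => h.smul_baseCoset ho hij hi hj hk hjk hc)
    (fun hij hi hj hk hc => h.weyl_smul_baseCoset ho hij hi hj hk hc)
  have key (hg : g ∈ elemSubgroup x J) : ∀ v, IsPrim J v → IsPrim J (g • v) ∧
      peakSection h J (baseCoset x J o) (g • v) = g • peakSection h J (baseCoset x J o) v := by
    clear hgo
    induction hg using Subgroup.closure_induction_left with
    | one => exact fun v hv => by simpa using hv
    | mul_left y hy g _ ih =>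
      obtain ⟨i, hi, j, hj, hij, rfl⟩ := hy
      intro v hv
      obtain ⟨h1, h2⟩ := ih ‹_› v hv
      have := h.isPrim_zpow_smul hij hi (Or.inl rfl) h1
      rw [zpow_one] at this
      rw [mul_smul, mul_smul, ← h2]
      exact ⟨this, hσ.smul_eq h h1 hij hi hj⟩
    | inv_mul_cancel y hy g _ ih =>
      obtain ⟨i, hi, j, hj, hij, rfl⟩ := hy
      intro v hv
      obtain ⟨h1, h2⟩ := ih ‹_› v hv
      have := h.isPrim_zpow_smul hij hi (Or.inr rfl) h1
      rw [zpow_neg_one] at this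
      have e := hσ.smul_eq h this hij hi hj
      rw [smul_inv_smul, ← inv_smul_eq_iff] at e
      rw [mul_smul, mul_smul, ← h2]
      exact ⟨this, e.symm⟩
  have := (key hg _ (isPrim_single ho)).2
  rw [hgo, peakSection_single, baseCoset_one] at this
  have := QuotientGroup.eq.1 this
  simpa using this

theorem _root_.CrazyGroup.ElementaryAction.elemSubgroup_smul_apply_of_notMem
    (h : ElementaryAction x) {g : G} (hg : g ∈ elemSubgroup x J) (hk : k ∉ J) (v : I →₀ ℤ) : (g • v) k = v k := by
  induction hg using Subgroup.closure_induction_left generalizing v with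
  | one => rw [one_smul]
  | mul_left y hy g _ ih =>
    obtain ⟨i, hi, j, hj, hij, rfl⟩ := hy
    rw [mul_smul, h.smul_ne hij (ne_of_mem_of_not_mem hi hk).symm, ih]
  | inv_mul_cancel y hy g _ ih =>
    obtain ⟨i, hi, j, hj, hij, rfl⟩ := hy
    rw [mul_smul, h.inv_smul_ne hij (ne_of_mem_of_not_mem hi hk).symm, ih]

theorem _root_.CrazyGroup.ElementaryAction.rowSubgroup_smul_apply (h : ElementaryAction x)
    (ho : o ∉ J) {g : G} (hg : g ∈ rowSubgroup x J o) (hk : k ≠ o) (v : I →₀ ℤ) : (g • v) k = v k := by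
  induction hg using Subgroup.closure_induction_left generalizing v with
  | one => rw [one_smul]
  | mul_left y hy g _ ih =>
    obtain ⟨j, hj, rfl⟩ := hy
    rw [mul_smul, h.smul_ne (ne_of_mem_of_not_mem hj ho).symm hk, ih]
  | inv_mul_cancel y hy g _ ih =>
    obtain ⟨j, hj, rfl⟩ := hy
    rw [mul_smul, h.inv_smul_ne (ne_of_mem_of_not_mem hj ho).symm hk, ih]

theorem _root_.CrazyGroup.ElementaryAction.rowSubgroup_smul_single (h : ElementaryAction x)
    (ho : o ∉ J) {g : G} (hg : g ∈ rowSubgroup x J o) (hk : k ∉ J) (c : ℤ) :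
    g • Finsupp.single k c = Finsupp.single k c := by
  induction hg using Subgroup.closure_induction_left with
  | one => rw [one_smul]
  | mul_left y hy g _ ih =>
    obtain ⟨j, hj, rfl⟩ := hy
    have hoj := (ne_of_mem_of_not_mem hj ho).symm
    rw [mul_smul, ih]
    ext l
    by_cases hl : l = o
    · rw [hl, h.smul_self hoj, Finsupp.single_eq_of_ne (ne_of_mem_of_not_mem hj hk), add_zero]
    · rw [h.smul_ne hoj hl]
  | inv_mul_cancel y hy g _ ih =>
    obtain ⟨j, hj, rfl⟩ := hy
    have hoj := (ne_of_mem_of_not_mem hj ho).symm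
    rw [mul_smul, ih]
    ext l
    by_cases hl : l = o
    · rw [hl, h.inv_smul_self hoj, Finsupp.single_eq_of_ne (ne_of_mem_of_not_mem hj hk), sub_zero]
    · rw [h.inv_smul_ne hoj hl]

theorem _root_.CrazyGroup.ElementaryAction.zpow_smul_single_apply (h : ElementaryAction x)
    (hij : i ≠ j) (n : ℤ) :
    (x i j ^ n • Finsupp.single j (1 : ℤ)) i = n := by
  have key (m : ℤ) : x i j • (Finsupp.single j (1 : ℤ) + Finsupp.single i m) =
      Finsupp.single j 1 + Finsupp.single i (m + 1) := by
    ext l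
    by_cases hl : l = i
    · rw [hl, h.smul_self hij]
      simp [hij, hij.symm]
    · rw [h.smul_ne hij hl]
      simp [Finsupp.single_eq_of_ne hl]
  have : ∀ n : ℤ, x i j ^ n • Finsupp.single j (1 : ℤ) =
      Finsupp.single j 1 + Finsupp.single i n := by
    intro n
    induction n using Int.induction_on with
    | zero => simp
    | succ n ih => rw [add_comm, zpow_add, zpow_one, mul_smul, ih, key, add_comm 1]
    | pred n ih =>
      rw [sub_eq_neg_add, zpow_add, zpow_neg_one, mul_smul, ih, inv_smul_eq_iff, key]
      congr 2
      ring
  rw [this]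
  simp [hij]

/-- The generators of a row commute, so powers of one `x o k` can be split off; the exponent is the
coordinate `o` of `g • e_k`. -/
theorem eq_one_of_mem_rowSubgroup (h : IntSteinberg x) (ho : o ∉ J) {g : G}
    (hg : g ∈ rowSubgroup x J o) (hgv : ∀ v : I →₀ ℤ, g • v = v) : g = 1 := by
  classical
  induction J using Finset.induction_on generalizing g with
  | empty =>
    have : {g | ∃ j ∈ (∅ : Finset I), g = x o j} = ∅ := by simp
    rwa [rowSubgroup, this, Subgroup.closure_empty, Subgroup.mem_bot] at hg
  | @insert k J hk ih =>
    have hok : o ≠ k := fun e => ho (e ▸ Finset.mem_insert_self _ _)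
    have hoJ : o ∉ J := fun e => ho (Finset.mem_insert_of_mem e)
    have split : ∃ n : ℤ, ∃ u ∈ rowSubgroup x J o, g = x o k ^ n * u := by
      clear hgv ih
      have step {y : G} {j : I} (hj : j ∈ insert k J)
          (hy : ∃ n : ℤ, ∃ u ∈ rowSubgroup x J o, y = x o k ^ n * u) (ε : ℤ) :
          ∃ n : ℤ, ∃ u ∈ rowSubgroup x J o, x o j ^ ε * y = x o k ^ n * u := by
        obtain ⟨n, u, hu, rfl⟩ := hy
        rcases Finset.mem_insert.1 hj with rfl | hj'
        · exact ⟨ε + n, u, hu, by rw [zpow_add, mul_assoc]⟩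
        · have hoj : o ≠ j := fun e => hoJ (e ▸ hj')
          have c : Commute (x o j ^ ε) (x o k ^ n) :=
            ((h.comm hoj hok hoj.symm hok).zpow_left ε).zpow_right n
          exact ⟨n, x o j ^ ε * u, mul_mem (zpow_mem (mem_rowSubgroup hj') ε) hu,
            by rw [← mul_assoc, c.eq, mul_assoc]⟩
      induction hg using Subgroup.closure_induction_left with
      | one => exact ⟨0, 1, one_mem _, by simp⟩
      | mul_left y hy g _ ih =>
        obtain ⟨j, hj, rfl⟩ := hy
        simpa using step hj ih 1
      | inv_mul_cancel y hy g _ ih =>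
        obtain ⟨j, hj, rfl⟩ := hy
        simpa using step hj ih (-1)
    obtain ⟨n, u, hu, rfl⟩ := split
    have hn : n = 0 := by
      have := hgv (Finsupp.single k 1)
      rw [mul_smul, h.rowSubgroup_smul_single hoJ hu hk] at this
      have := congrArg (fun v => v o) this
      simp only [h.zpow_smul_single_apply hok] at this
      rwa [Finsupp.single_eq_of_ne hok] at this
    rw [hn, zpow_zero, one_mul] at hgv ⊢
    exact ih hoJ hu hgv

/-- Conjugation by the `x i j` with `i, j ∈ J` preserves the row of `o`, so the stabilizer splits
into a row part and a part with indices in `J`, as for an affine group. -/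
theorem exists_row_mul_elem (h : IntSteinberg x) [DecidableEq I] (ho : o ∉ J) {g : G}
    (hg : g ∈ stabSubgroup x (insert o J) o) :
    ∃ u ∈ rowSubgroup x J o, ∃ y ∈ elemSubgroup x J, g = u * y := by
  have normal {i j : I} (hij : i ≠ j) (hi : i ∈ J) (hj : j ∈ J) {ε : ℤ} (hε : ε = 1 ∨ ε = -1)
      {u : G} (hu : u ∈ rowSubgroup x J o) :
      ∃ u' ∈ rowSubgroup x J o, x i j ^ ε * u = u' * x i j ^ ε := by
    have hoi := (ne_of_mem_of_not_mem hi ho).symm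
    have hoj := (ne_of_mem_of_not_mem hj ho).symm
    have mem {k : I} (hk : k ∈ J) : x o k ∈ rowSubgroup x J o := mem_rowSubgroup hk
    have base {k : I} (hk : k ∈ J) : ∃ u' ∈ rowSubgroup x J o, SemiconjBy (x i j ^ ε) (x o k) u' := by
      by_cases hki : k = i
      · subst hki
        rcases hε with rfl | rfl
        · exact ⟨_, mul_mem (inv_mem (mem hj)) (mem hk), by
            rw [zpow_one]; exact h.semiconj_col hij hoi hoj⟩
        · exact ⟨_, mul_mem (mem hj) (mem hk), by
            rw [zpow_neg_one]; exact h.semiconj_inv_col hij hoi hoj⟩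
      · have hok := (ne_of_mem_of_not_mem hk ho).symm
        exact ⟨_, mem hk, (h.comm hij hok hoj.symm (Ne.symm hki)).zpow_left ε⟩
    induction hu using Subgroup.closure_induction_left with
    | one => exact ⟨1, one_mem _, by simp⟩
    | mul_left y hy u _ ih =>
      obtain ⟨k, hk, rfl⟩ := hy
      obtain ⟨a, ha, hs⟩ := base hk
      obtain ⟨b, hb, hs'⟩ := ih
      exact ⟨a * b, mul_mem ha hb, hs.mul_right hs'⟩
    | inv_mul_cancel y hy u _ ih =>
      obtain ⟨k, hk, rfl⟩ := hy
      obtain ⟨a, ha, hs⟩ := base hk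
      obtain ⟨b, hb, hs'⟩ := ih
      exact ⟨a⁻¹ * b, mul_mem (inv_mem ha) hb, hs.inv_right.mul_right hs'⟩
  have step {i j : I} (hi : i ∈ insert o J) (hj : j ∈ insert o J) (hij : i ≠ j) (hjo : j ≠ o)
      {ε : ℤ} (hε : ε = 1 ∨ ε = -1) {g : G}
      (hg : ∃ u ∈ rowSubgroup x J o, ∃ y ∈ elemSubgroup x J, g = u * y) :
      ∃ u ∈ rowSubgroup x J o, ∃ y ∈ elemSubgroup x J, x i j ^ ε * g = u * y := by
    obtain ⟨u, hu, y, hy, rfl⟩ := hg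
    have hj' := (Finset.mem_insert.1 hj).resolve_left hjo
    rcases Finset.mem_insert.1 hi with rfl | hi'
    · exact ⟨x i j ^ ε * u, mul_mem (zpow_mem (mem_rowSubgroup hj') ε) hu, y, hy,
        by rw [mul_assoc]⟩
    · obtain ⟨u', hu', e⟩ := normal hij hi' hj' hε hu
      exact ⟨u', hu', x i j ^ ε * y, mul_mem (zpow_mem (mem_elemSubgroup hij hi' hj') ε) hy, by
        rw [← mul_assoc, e, mul_assoc]⟩
  induction hg using Subgroup.closure_induction_left with
  | one => exact ⟨1, one_mem _, 1, one_mem _, by simp⟩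
  | mul_left y hy u _ ih =>
    obtain ⟨i, hi, j, hj, hij, hjo, rfl⟩ := hy
    have := step hi hj hij hjo (Or.inl rfl) ih
    rwa [zpow_one] at this
  | inv_mul_cancel y hy u _ ih =>
    obtain ⟨i, hi, j, hj, hij, hjo, rfl⟩ := hy
    have := step hi hj hij hjo (Or.inr rfl) ih
    rwa [zpow_neg_one] at this

/-- An element acting trivially fixes `e_o`, so it is `u * y` with `u` in the row of `o` and `y`
over the smaller index set. Since `u` changes only the coordinate `o` and `y` never does, `y` acts
trivially, and induction applies; then `u` acts trivially too. -/
theorem eq_one_of_mem_elemSubgroup (h : IntSteinberg x) {g : G} (hg : g ∈ elemSubgroup x J)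
    (hgv : ∀ v : I →₀ ℤ, g • v = v) : g = 1 := by
  classical
  induction J using Finset.induction_on generalizing g with
  | empty =>
    have : {g | ∃ i ∈ (∅ : Finset I), ∃ j ∈ (∅ : Finset I), i ≠ j ∧ g = x i j} = ∅ := by simp
    rwa [elemSubgroup, this, Subgroup.closure_empty, Subgroup.mem_bot] at hg
  | @insert o J ho ih =>
    obtain ⟨u, hu, y, hy, rfl⟩ := h.exists_row_mul_elem ho
      (h.mem_stabSubgroup_of_smul_eq (Finset.mem_insert_self o J) hg (hgv _))
    have hy1 : y = 1 := ih hy fun v => by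
      ext k
      by_cases hk : k = o
      · rw [hk, h.elemSubgroup_smul_apply_of_notMem hy ho]
      · have := congrArg (fun w => w k) (hgv v)
        simp only [mul_smul, h.rowSubgroup_smul_apply ho hu hk] at this
        exact this
    subst hy1
    rw [mul_one] at hgv ⊢
    exact h.eq_one_of_mem_rowSubgroup ho hu hgv

/-- The group generated by the elements `x_ij` acts faithfully. -/
theorem eq_one_of_smul_eq (h : IntSteinberg x) {g : G}
    (hg : g ∈ Subgroup.closure {g | ∃ i j, i ≠ j ∧ g = x i j})
    (hgv : ∀ v : I →₀ ℤ, g • v = v) : g = 1 := by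
  classical
  have mono {J J' : Finset I} (hJ : J ⊆ J') : elemSubgroup x J ≤ elemSubgroup x J' :=
    Subgroup.closure_mono fun _ ⟨i, hi, j, hj, hij, e⟩ => ⟨i, hJ hi, j, hJ hj, hij, e⟩
  have key : ∃ J, g ∈ elemSubgroup x J := by
    clear hgv
    induction hg using Subgroup.closure_induction with
    | mem y hy =>
      obtain ⟨i, j, hij, rfl⟩ := hy
      exact ⟨{i, j}, mem_elemSubgroup hij (by simp) (by simp)⟩
    | one => exact ⟨∅, one_mem _⟩
    | mul a b _ _ iha ihb =>
      obtain ⟨J, hJ⟩ := iha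
      obtain ⟨J', hJ'⟩ := ihb
      exact ⟨J ∪ J', mul_mem (mono Finset.subset_union_left hJ) (mono Finset.subset_union_right hJ')⟩
    | inv a _ ih =>
      obtain ⟨J, hJ⟩ := ih
      exact ⟨J, inv_mem hJ⟩
  obtain ⟨J, hJ⟩ := key
  exact h.eq_one_of_mem_elemSubgroup hJ hgv

end IntSteinberg

end PeakReduction

end CrazyGroup

end

noncomputable section

namespace CrazyGroup

/-! ### Refining a block decomposition -/

open commutatorElement

section Blocks

variable {I G : Type*} [Group G] {β : I → Fin 4} {σ : Fin 4 → I} {x : I → I → G} {a b c d m : I}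

/-- The Steinberg relations between elements `x_ab` for which `a` and `b` lie in different
blocks. -/
structure BlockRelations (β : I → Fin 4) (x : I → I → G) : Prop where
  commutator : ∀ {a b c}, β a ≠ β b → β b ≠ β c → β a ≠ β c → ⁅x a b, x b c⁆ = x a c
  comm : ∀ {a b c d}, β a ≠ β b → β c ≠ β d → b ≠ c → a ≠ d → Commute (x a b) (x c d)

/-- The extension of the family `x_ab` to pairs of indices in the same block. -/
def blockExtend (β : I → Fin 4) (σ : Fin 4 → I) (x : I → I → G) (a b : I) : G :=
  if β a = β b then ⁅x a (σ (β a + 1)), x (σ (β a + 1)) b⁆ else x a b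

theorem blockExtend_of_ne (h : β a ≠ β b) : blockExtend β σ x a b = x a b := if_neg h

namespace BlockRelations

/-- Associativity applied to `x a m`, `x m n`, `x n b`: passing through `m` or through `n` gives the
same product. -/
theorem commutator_eq (h : BlockRelations β x) {n : I} (hab : a ≠ b) (hma : β m ≠ β a)
    (hmb : β m ≠ β b) (hna : β n ≠ β a) (hnb : β n ≠ β b) (hmn : β m ≠ β n) :
    ⁅x a m, x m b⁆ = ⁅x a n, x n b⁆ := by
  have e1 := h.commutator hma.symm hmn hna.symm
  have e2 := h.commutator hmn hnb hmb
  have := commutator_assoc (a := x a m) (b := x m n) (c := x n b)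
    (h.comm hma.symm hnb (ne_of_apply_ne β hmn) hab)
    (by rw [e1, e2]; exact h.comm hna.symm hmb (ne_of_apply_ne β hmn.symm) hab)
    (by rw [e2]; exact h.comm hnb hmb (ne_of_apply_ne β hmb.symm) (ne_of_apply_ne β hnb))
  rwa [e1, e2] at this

variable (hσ : ∀ k, β (σ k) = k)
include hσ

theorem blockExtend_eq (h : BlockRelations β x) (hab : a ≠ b) (hma : β m ≠ β a)
    (hmb : β m ≠ β b) : blockExtend β σ x a b = ⁅x a m, x m b⁆ := by
  by_cases e : β a = β b
  · have h0 : β (σ (β a + 1)) ≠ β a := by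
      rw [hσ]; generalize β a = k; revert k; decide
    -- `m` may lie in the block of the default middle index, where `commutator_eq` does not apply
    -- directly; both are therefore compared with an index in a further block.
    obtain ⟨n, n1, n2, n3⟩ := exists_fin_four_ne (β a) (β m) (β (σ (β a + 1)))
    rw [← hσ n] at n1 n2 n3
    rw [blockExtend, if_pos e, h.commutator_eq hab h0 (e ▸ h0) n1 (e ▸ n1) n3.symm,
      h.commutator_eq hab hma hmb n1 (e ▸ n1) n2.symm]
  · rw [blockExtend_of_ne e, h.commutator hma.symm hmb e]

theorem commute_blockExtend (h : BlockRelations β x) (hab : a ≠ b) (hcd : β c ≠ β d) (hbc : b ≠ c)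
    (had : a ≠ d) : Commute (blockExtend β σ x a b) (x c d) := by
  by_cases e : β a = β b
  · obtain ⟨n, n1, n2, n3⟩ := exists_fin_four_ne (β a) (β c) (β d)
    rw [← hσ n] at n1 n2 n3
    rw [h.blockExtend_eq hσ hab n1 (e ▸ n1)]
    exact Commute.commutator_left (h.comm n1.symm hcd (ne_of_apply_ne β n2) had)
      (h.comm (e ▸ n1) hcd hbc (ne_of_apply_ne β n3))
  · rw [blockExtend_of_ne e]
    exact h.comm e hcd hbc had

/-- A generator inside a block is written as a commutator through a block that avoids the blocks of
the other indices. At most three blocks have to be avoided, so four are enough. -/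
theorem elementaryRelations (h : BlockRelations β x) :
    ElementaryRelations (blockExtend β σ x) := by
  have comm {a b c d : I} (hab : a ≠ b) (hcd : c ≠ d) (hbc : b ≠ c) (had : a ≠ d) :
      Commute (blockExtend β σ x a b) (blockExtend β σ x c d) := by
    obtain ⟨n, n1, n2, n3⟩ := exists_fin_four_ne (β a) (β b) (β c)
    rw [← hσ n] at n1 n2 n3
    by_cases e : β c = β d
    · rw [h.blockExtend_eq hσ hcd n3 (e ▸ n3)]
      exact Commute.commutator_right
        (h.commute_blockExtend hσ hab n3.symm hbc (ne_of_apply_ne β n1.symm))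
        (h.commute_blockExtend hσ hab (e ▸ n3) (ne_of_apply_ne β n2.symm) had)
    · rw [blockExtend_of_ne e]
      exact h.commute_blockExtend hσ hab e hbc had
  have key {a b m : I} (hab : a ≠ b) (hma : β m ≠ β a) (hmb : β m ≠ β b) :
      ⁅blockExtend β σ x a b, x b m⁆ = x a m := by
    by_cases e : β a = β b
    · obtain ⟨n, n1, n2, -⟩ := exists_fin_four_ne (β a) (β m) (β m)
      rw [← hσ n] at n1 n2
      have e1 := h.blockExtend_eq hσ hab n1 (e ▸ n1)
      have e2 := h.commutator (e ▸ n1) hmb.symm n2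
      have := commutator_assoc (a := x a (σ n)) (b := x (σ n) b) (c := x b m)
        (h.comm n1.symm hmb.symm (ne_of_apply_ne β (e ▸ n1)) (ne_of_apply_ne β hma.symm))
        (by
          rw [← e1, e2]
          exact h.commute_blockExtend hσ hab n2 (ne_of_apply_ne β (e ▸ n1.symm))
            (ne_of_apply_ne β hma.symm))
        (by
          rw [e2]
          exact h.comm hmb.symm n2 (ne_of_apply_ne β n2.symm) (ne_of_apply_ne β hmb.symm))
      rw [e1, ← this, e2, h.commutator n1.symm n2 hma.symm]
    · rw [blockExtend_of_ne e, h.commutator e hmb.symm hma.symm]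
  refine ⟨fun {a b c} hab hbc hac => ?_, comm⟩
  obtain ⟨n, n1, n2, n3⟩ := exists_fin_four_ne (β a) (β b) (β c)
  rw [← hσ n] at n1 n2 n3
  have e2 := h.blockExtend_eq hσ hbc n2 n3
  have e1 := key hab n1 n2
  have := commutator_assoc (a := blockExtend β σ x a b) (b := x b (σ n)) (c := x (σ n) c)
    (h.commute_blockExtend hσ hab n3 (ne_of_apply_ne β n2.symm) hac)
    (by
      rw [e1, ← e2]
      exact (h.commute_blockExtend hσ hbc n1.symm hac.symm (ne_of_apply_ne β n2.symm)).symm)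
    (by
      rw [← e2]
      exact (h.commute_blockExtend hσ hbc n3 (ne_of_apply_ne β n3.symm) hbc).symm)
  rw [e2, this, e1, h.blockExtend_eq hσ hac n1 n3]

end BlockRelations

/-- Weyl elements are conjugate to each other up to inversion, so the relation for one pair of
indices spreads to all pairs. -/
theorem ElementaryRelations.weyl_pow_four (h : ElementaryRelations x) (hab : a ≠ b)
    (hw : weyl x a b ^ 4 = 1) {i j : I} (hm : ∀ i j : I, ∃ k, i ≠ k ∧ j ≠ k) (hij : i ≠ j) :
    weyl x i j ^ 4 = 1 := by
  have symm {i j : I} (hij : i ≠ j) (hw : weyl x i j ^ 4 = 1) : weyl x j i ^ 4 = 1 := by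
    obtain ⟨k, hik, hjk⟩ := hm i j
    have : weyl x j i = (weyl x i j)⁻¹ := by
      rw [weyl, weyl, h.braid hij hik hjk]; group
    rw [this, inv_pow, hw, inv_one]
  have first {i j k : I} (hij : i ≠ j) (hjk : j ≠ k) (hw : weyl x j k ^ 4 = 1) (hik : i ≠ k) :
      weyl x i k ^ 4 = 1 := by
    have := (h.weyl_weyl_right hij hjk hik).pow_right 4
    rw [hw] at this
    exact mul_right_cancel (b := weyl x i j) (by rw [← this.eq, mul_one, one_mul])
  have second {i j k : I} (hij : i ≠ j) (hik : i ≠ k) (hw : weyl x i j ^ 4 = 1) :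
      weyl x i k ^ 4 = 1 := by
    by_cases hjk : j = k
    · exact hjk ▸ hw
    · exact symm hik.symm (first (Ne.symm hjk) hij.symm (symm hij hw) hik.symm)
  by_cases haj : a = j
  · subst haj
    exact symm hij.symm (second hab hij.symm hw)
  · by_cases hia : i = a
    · subst hia
      exact second hab hij hw
    · exact first hia haj (second hab haj hw) hij

end Blocks

/-! ### The generators of `Γ₀` -/

namespace Gamma0

variable {G S : Type*} [Group G] [MulAction G S] {s₀ : S}

theorem e_add (i j : Fin 4) (hij : i ≠ j) (r r' : CrazyRing G S) :
    e G s₀ i j hij (r + r') = e G s₀ i j hij r * e G s₀ i j hij r' :=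
  congrArg (QuotientGroup.mk' _) (Steinberg.e_add i j hij r r')

theorem e_commutator {i j k : Fin 4} (hij : i ≠ j) (hjk : j ≠ k) (hik : i ≠ k)
    (r r' : CrazyRing G S) :
    ⁅e G s₀ i j hij r, e G s₀ j k hjk r'⁆ = e G s₀ i k hik (r * r') :=
  (map_commutatorElement (QuotientGroup.mk' _) _ _).symm.trans
    (congrArg (QuotientGroup.mk' _) (Steinberg.e_commutator hij hjk hik r r'))

theorem e_commute {i j p q : Fin 4} (hij : i ≠ j) (hpq : p ≠ q) (hjp : j ≠ p) (hiq : i ≠ q)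
    (r r' : CrazyRing G S) : Commute (e G s₀ i j hij r) (e G s₀ p q hpq r') :=
  (Steinberg.e_commute hij hpq hjp hiq r r').map (QuotientGroup.mk' _)

theorem e_zero (i j : Fin 4) (hij : i ≠ j) : e G s₀ i j hij (0 : CrazyRing G S) = 1 :=
  congrArg (QuotientGroup.mk' _) (Steinberg.e_zero i j hij)

theorem e_neg (i j : Fin 4) (hij : i ≠ j) (r : CrazyRing G S) :
    e G s₀ i j hij (-r) = (e G s₀ i j hij r)⁻¹ :=
  congrArg (QuotientGroup.mk' _) (Steinberg.e_neg i j hij r)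

theorem closure_e : Subgroup.closure {y | ∃ i j hij r, y = e G s₀ i j hij r} = ⊤ := by
  have := congrArg (Subgroup.map (QuotientGroup.mk' (Subgroup.normalClosure
    {Steinberg.rTilde (CrazyRing.E G s₀ s₀)}))) (Steinberg.closure_e (n := 4) (R := CrazyRing G S))
  rw [MonoidHom.map_closure, Subgroup.map_top_of_surjective _ (QuotientGroup.mk'_surjective _)]
    at this
  rw [← top_le_iff, ← this]
  refine Subgroup.closure_mono ?_
  rintro _ ⟨_, ⟨i, j, hij, r, rfl⟩, rfl⟩
  exact ⟨i, j, hij, r, rfl⟩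

/-- The elements `e_ij(E_st)`. -/
def blockUnit (s₀ : S) (a b : S × Fin 4) : Gamma0 G s₀ :=
  if h : a.2 ≠ b.2 then e G s₀ a.2 b.2 h (CrazyRing.E G a.1 b.1) else 1

theorem blockUnit_of_ne {a b : S × Fin 4} (h : a.2 ≠ b.2) :
    blockUnit s₀ a b = e G s₀ a.2 b.2 h (CrazyRing.E G a.1 b.1) := dif_pos h

theorem blockRelations : BlockRelations Prod.snd (blockUnit (G := G) s₀) := by
  have commutator {a b c : S × Fin 4} (hab : a.2 ≠ b.2) (hbc : b.2 ≠ c.2) (hac : a.2 ≠ c.2) :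
      ⁅blockUnit (G := G) s₀ a b, blockUnit (G := G) s₀ b c⁆ = blockUnit s₀ a c := by
    rw [blockUnit_of_ne hab, blockUnit_of_ne hbc, blockUnit_of_ne hac, e_commutator hab hbc hac,
      CrazyRing.E_mul_E]
  have comm {a b c d : S × Fin 4} (hab : a.2 ≠ b.2) (hcd : c.2 ≠ d.2) (hbc : b ≠ c)
      (had : a.2 ≠ d.2) : Commute (blockUnit (G := G) s₀ a b) (blockUnit s₀ c d) := by
    by_cases e : b.2 = c.2
    · have h1 : b.1 ≠ c.1 := fun h => hbc (Prod.ext h e)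
      obtain ⟨u, i⟩ := c
      dsimp only at e hcd h1
      subst e
      rw [blockUnit_of_ne hab, blockUnit_of_ne (a := (u, b.2)) hcd,
        ← commutatorElement_eq_one_iff_commute, e_commutator hab hcd had, CrazyRing.E_mul_E_of_ne h1, e_zero]
    · rw [blockUnit_of_ne hab, blockUnit_of_ne hcd]
      exact e_commute hab hcd e had _ _
  refine ⟨commutator, fun {a b c d} hab hcd hbc had => ?_⟩
  by_cases h1 : a.2 = d.2
  · by_cases h2 : b.2 = c.2
    -- The two block positions are opposite to each other and no Steinberg relation applies. The
    -- second generator is written as a commutator through a third block.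
    · obtain ⟨n, n1, n2, -⟩ := exists_fin_four_ne a.2 b.2 b.2
      rw [← commutator (a := c) (b := (c.1, n)) (c := d) (h2 ▸ n2.symm) (h1 ▸ n1) hcd]
      refine Commute.commutator_right (comm hab (h2 ▸ n2.symm) hbc n1.symm) (Commute.symm ?_)
      exact comm (h1 ▸ n1) hab had.symm n2
    · exact (comm hcd hab had.symm (Ne.symm h2)).symm
  · exact comm hab hcd hbc h1

/-- The elements `x_ab` which play the role of elementary matrices over `ℤ` with indices in
`S × {1, 2, 3, 4}`. -/
def x (s₀ : S) : S × Fin 4 → S × Fin 4 → Gamma0 G s₀ :=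
  blockExtend Prod.snd (fun k => (s₀, k)) (blockUnit s₀)

theorem x_of_ne {a b : S × Fin 4} (h : a.2 ≠ b.2) :
    x s₀ a b = e G s₀ a.2 b.2 h (CrazyRing.E G a.1 b.1) := by
  rw [x, blockExtend_of_ne h, blockUnit_of_ne h]

theorem elementaryRelations : ElementaryRelations (x (G := G) s₀) :=
  blockRelations.elementaryRelations fun _ => rfl

theorem exists_index_ne (a b : S × Fin 4) : ∃ c, a ≠ c ∧ b ≠ c := by
  obtain ⟨n, n1, n2, -⟩ := exists_fin_four_ne a.2 b.2 b.2
  exact ⟨(a.1, n), fun h => n1 (congrArg Prod.snd h).symm, fun h => n2 (congrArg Prod.snd h).symm⟩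

theorem weyl_pow_four {a b : S × Fin 4} (hab : a ≠ b) : weyl (x (G := G) s₀) a b ^ 4 = 1 := by
  have h01 : ((s₀, 0) : S × Fin 4) ≠ (s₀, 1) := by simp
  refine elementaryRelations.weyl_pow_four h01 ?_ exists_index_ne hab
  have h1 := x_of_ne (G := G) (s₀ := s₀) (a := (s₀, 0)) (b := (s₀, 1)) (by simp)
  have h2 := x_of_ne (G := G) (s₀ := s₀) (a := (s₀, 1)) (b := (s₀, 0)) (by simp)
  have h3 : (QuotientGroup.mk (Steinberg.rTilde (CrazyRing.E G s₀ s₀)) : Gamma0 G s₀) = 1 :=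
    (QuotientGroup.eq_one_iff _).2 (Subgroup.subset_normalClosure rfl)
  have h4 : ((e G s₀ 0 1 (by decide) (CrazyRing.E G s₀ s₀))⁻¹
      * e G s₀ 1 0 (by decide) (CrazyRing.E G s₀ s₀)
      * (e G s₀ 0 1 (by decide) (CrazyRing.E G s₀ s₀))⁻¹) ^ 4 = 1 := by
    rw [← h3, ← e_neg]
    rfl
  -- The word `r̃(E)` is the fourth power of the inverse of this Weyl element.
  rw [weyl, h1, h2, ← inv_eq_one, ← inv_pow, ← h4]
  group

theorem delta0_eq : Delta0 G s₀ = Subgroup.closure {y | ∃ a b, a ≠ b ∧ y = x s₀ a b} := by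
  apply le_antisymm
  · rw [Delta0, Subgroup.closure_le]
    rintro _ ⟨i, j, hij, r, hr, rfl⟩
    refine CrazyRing.finitary_induction (p := fun r => e G s₀ i j hij r ∈ _) ?_ ?_ ?_ ?_ r hr
    · intro s t
      refine Subgroup.subset_closure ⟨(s, i), (t, j), fun h => hij (congrArg Prod.snd h), ?_⟩
      rw [x_of_ne]
    · rw [e_zero]; exact one_mem _
    · intro r r' h h'
      rw [e_add]; exact mul_mem h h'
    · intro r h
      rw [e_neg]; exact inv_mem h
  · rw [Subgroup.closure_le]
    rintro _ ⟨a, b, hab, rfl⟩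
    have key {a b : S × Fin 4} (h : a.2 ≠ b.2) : x (G := G) s₀ a b ∈ Delta0 G s₀ := by
      rw [x_of_ne h]
      exact Subgroup.subset_closure ⟨_, _, _, _, CrazyRing.E_grp _ _, rfl⟩
    obtain ⟨n, n1, n2, -⟩ := exists_fin_four_ne a.2 b.2 b.2
    have h1 := key (a := a) (b := (a.1, n)) n1.symm
    have h2 := key (a := (a.1, n)) (b := b) n2
    rw [← elementaryRelations.commutator (j := (a.1, n)) (ne_of_apply_ne Prod.snd n1.symm)
      (ne_of_apply_ne Prod.snd n2) hab, commutatorElement_def]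
    exact mul_mem (mul_mem (mul_mem h1 h2) (inv_mem h1)) (inv_mem h2)

end Gamma0

end CrazyGroup

end

noncomputable section

namespace CrazyGroup

open commutatorElement

/-! ### Unipotent units -/

section OneAdd

variable {A : Type*} [Ring A] {a b : A}

/-- The unit `1 + a`, for an element `a` of square zero. -/
def oneAdd (a : A) (h : a * a = 0) : Aˣ where
  val := 1 + a
  inv := 1 - a
  val_inv := by rw [mul_sub, mul_one, add_mul, one_mul, h]; abel
  inv_val := by rw [sub_mul, mul_add, one_mul, mul_add, h]; simp

theorem oneAdd_mul (ha : a * a = 0) (hb : b * b = 0) (hab : a * b = 0) (h) :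
    oneAdd (a + b) h = oneAdd a ha * oneAdd b hb := by
  ext
  simp only [oneAdd, Units.val_mul]
  rw [mul_add, mul_one, add_mul 1 a b, one_mul, hab]
  abel

theorem val_oneAdd_zpow (ha : a * a = 0) (n : ℤ) :
    ((oneAdd a ha ^ n : Aˣ) : A) = 1 + n • a := by
  have mul (m : ℤ) : (1 + m • a) * (1 + a) = 1 + (m + 1) • a := by
    rw [mul_add, mul_one, add_mul, one_mul, smul_mul_assoc, ha, smul_zero, add_smul, one_smul]
    abel
  induction n using Int.induction_on with
  | zero => simp
  | succ n ih => rw [zpow_add, zpow_one, Units.val_mul, ih, ← mul]; rfl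
  | pred n ih =>
    rw [zpow_sub, zpow_one, Units.val_mul, ih, Units.mul_inv_eq_iff_eq_mul,
      show (oneAdd a ha : A) = 1 + a from rfl, mul, sub_add_cancel]

theorem oneAdd_commute (ha : a * a = 0) (hb : b * b = 0) (hab : a * b = 0) (hba : b * a = 0) :
    Commute (oneAdd a ha) (oneAdd b hb) := by
  ext
  simp only [oneAdd, Units.val_mul]
  rw [mul_add, mul_one, add_mul 1 a b, one_mul, hab, mul_add, mul_one, add_mul 1 b a, one_mul, hba]
  abel

theorem oneAdd_commutator (ha : a * a = 0) (hb : b * b = 0) (hba : b * a = 0) (h) :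
    ⁅oneAdd a ha, oneAdd b hb⁆ = oneAdd (a * b) h := by
  have key : oneAdd a ha * oneAdd b hb = oneAdd (a * b) h * (oneAdd b hb * oneAdd a ha) := by
    ext
    simp only [oneAdd, Units.val_mul]
    have h1 : a * b * b = 0 := by rw [mul_assoc, hb, mul_zero]
    have h2 : a * b * a = 0 := by rw [mul_assoc, hba, mul_zero]
    simp only [mul_add, add_mul, mul_one, one_mul, h1, h2, hba, add_zero]
    abel
  rw [commutatorElement_def, key]
  group

/-- With the idempotent `p = a * b + b * a`, the element is `(1 - p) + (b - a)` and its square is `1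
- 2 * p`: it is a quarter turn on the image of `p`. -/
theorem oneAdd_weyl_pow_four (ha : a * a = 0) (hb : b * b = 0) (haba : a * b * a = a)
    (hbab : b * a * b = b) : ((oneAdd a ha)⁻¹ * oneAdd b hb * (oneAdd a ha)⁻¹) ^ 4 = 1 := by
  have h1 : (1 - a) * (1 + b) * (1 - a) = 1 - (a * b + b * a) + (b - a) := by
    simp only [mul_add, add_mul, mul_one, one_mul, mul_sub, sub_mul, ha, haba]
    abel
  have h2 : ((1 - (a * b + b * a)) + (b - a)) * ((1 - (a * b + b * a)) + (b - a))
      = 1 - 2 * (a * b + b * a) := by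
    have e3 : a * b * b = 0 := by rw [mul_assoc, hb, mul_zero]
    have e4 : b * a * a = 0 := by rw [mul_assoc, ha, mul_zero]
    simp only [mul_add, add_mul, mul_one, one_mul, mul_sub, sub_mul, ha, hb, haba, hbab,
      ← mul_assoc, two_mul, e3, e4, zero_mul]
    abel
  have h3 : (1 - 2 * (a * b + b * a)) * (1 - 2 * (a * b + b * a)) = 1 := by
    have e3 : a * b * b = 0 := by rw [mul_assoc, hb, mul_zero]
    have e4 : b * a * a = 0 := by rw [mul_assoc, ha, mul_zero]
    simp only [mul_add, add_mul, mul_one, one_mul, mul_sub, sub_mul, haba, hbab,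
      ← mul_assoc, two_mul, e3, e4, zero_mul]
    abel
  ext
  have h4 : (((oneAdd a ha)⁻¹ * oneAdd b hb * (oneAdd a ha)⁻¹ : Aˣ) : A)
      = 1 - (a * b + b * a) + (b - a) := h1
  rw [Units.val_pow_eq_pow_val, h4, show (4 : ℕ) = 2 * 2 from rfl, pow_mul, sq, sq, h2, h3,
    Units.val_one]

end OneAdd

/-! ### Elementary matrices -/

namespace RCMatrix

variable {I : Type*} {a b c d : I}

variable (I) in
/-- The natural representation as a ring homomorphism. -/
def toEndHom : RCMatrix I →+* Module.End ℤ (I →₀ ℤ) where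
  toFun := toEnd
  map_one' := toEnd_one
  map_mul' := toEnd_mul
  map_zero' := end_ext fun i j => by simp [toEnd_single]
  map_add' := toEnd_add

theorem toEndHom_apply (A : RCMatrix I) : toEndHom I A = A.toEnd := rfl

open Classical in
theorem toEnd_E_apply (a b : I) (v : I →₀ ℤ) (k : I) :
    (E a b).toEnd v k = if k = a then v b else 0 := by
  induction v using Finsupp.induction_linear with
  | zero => simp
  | add v w hv hw => rw [map_add, Finsupp.add_apply, hv, hw]; split_ifs <;> simp
  | single j n =>
    rw [← mul_one n, ← smul_eq_mul, ← Finsupp.smul_single, map_smul, toEnd_E]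
    by_cases hj : j = b <;> by_cases hk : k = a <;> simp [hj, hk, Ne.symm]

theorem E_sq (h : a ≠ b) : (E a b : RCMatrix I) * E a b = 0 := E_mul_E_of_ne h.symm a b

open Classical in
/-- The elementary matrix `1 + E_{a,b}`. -/
def elemUnit (a b : I) : (RCMatrix I)ˣ := if h : a ≠ b then oneAdd (E a b) (E_sq h) else 1

theorem elemUnit_of_ne (h : a ≠ b) : elemUnit a b = oneAdd (E a b) (E_sq h) := dif_pos h

theorem val_elemUnit (h : a ≠ b) : (elemUnit a b : RCMatrix I) = 1 + E a b := by
  rw [elemUnit_of_ne h, oneAdd]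

theorem elemUnit_commutator (hab : a ≠ b) (hbc : b ≠ c) (hac : a ≠ c) :
    ⁅elemUnit a b, elemUnit b c⁆ = elemUnit a c := by
  have e : E a b * E b c = E a c := E_mul_E a b c
  rw [elemUnit_of_ne hab, elemUnit_of_ne hbc, elemUnit_of_ne hac,
    oneAdd_commutator _ _ (E_mul_E_of_ne hac.symm b b) (by rw [e]; exact E_sq hac)]
  simp only [e]

variable (I) in
/-- The natural representation of the group of invertible matrices. -/
def unitsHom : (RCMatrix I)ˣ →* (Module.End ℤ (I →₀ ℤ))ˣ :=
  Units.map (toEndHom I : RCMatrix I →* Module.End ℤ (I →₀ ℤ))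

theorem val_unitsHom (u : (RCMatrix I)ˣ) :
    (unitsHom I u : Module.End ℤ (I →₀ ℤ)) = (u : RCMatrix I).toEnd := rfl

/-- Invertible matrices act on `ℤ^{⊕I}`. -/
instance : MulAction (RCMatrix I)ˣ (I →₀ ℤ) := MulAction.compHom _ (unitsHom I)

theorem units_smul (u : (RCMatrix I)ˣ) (v : I →₀ ℤ) : u • v = (u : RCMatrix I).toEnd v := rfl

theorem elemUnit_smul_apply (hab : a ≠ b) (v : I →₀ ℤ) (k : I) [Decidable (k = a)] :
    (elemUnit a b • v) k = if k = a then v a + v b else v k := by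
  rw [units_smul, val_elemUnit hab, toEnd_add, toEnd_one, LinearMap.add_apply, Finsupp.add_apply,
    toEnd_E_apply, Module.End.one_apply]
  by_cases h : k = a
  · simp [h]
  · simp [h]

theorem elementaryAction : ElementaryAction (elemUnit (I := I)) :=
  ⟨fun {a b} hij v k => by classical rw [elemUnit_smul_apply hij v k]⟩

end RCMatrix

/-! ### Block matrices -/

section BlockMatrices

variable {S : Type*} {i j k l : Fin 4}

/-- The endomorphism of `ℤ^{⊕ S × {1, 2, 3, 4}}` with block `f` in position `(i, j)`. -/
def blockEnd (i j : Fin 4) (f : Module.End ℤ (S →₀ ℤ)) : Module.End ℤ (S × Fin 4 →₀ ℤ) :=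
  Finsupp.lmapDomain ℤ ℤ (fun s => (s, i)) ∘ₗ f ∘ₗ
    Finsupp.lcomapDomain (M := ℤ) (R := ℤ) (fun s => (s, j)) (Prod.mk_left_injective j)

theorem lcomapDomain_lmapDomain (i j : Fin 4) (v : S →₀ ℤ) :
    Finsupp.lcomapDomain (M := ℤ) (R := ℤ) (fun s => (s, j)) (Prod.mk_left_injective j)
      (Finsupp.lmapDomain ℤ ℤ (fun s => (s, i)) v) = if i = j then v else 0 := by
  ext s
  split_ifs with h
  · subst h
    simp [Finsupp.mapDomain_apply (Prod.mk_left_injective i)]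
  · simp [Finsupp.mapDomain_of_notMem_range, h]

theorem blockEnd_add (f g : Module.End ℤ (S →₀ ℤ)) :
    blockEnd i j (f + g) = blockEnd i j f + blockEnd i j g := by
  rw [blockEnd, LinearMap.add_comp, LinearMap.comp_add]; rfl

theorem blockEnd_mul (f g : Module.End ℤ (S →₀ ℤ)) :
    blockEnd i j f * blockEnd j k g = blockEnd i k (f * g) := by
  refine LinearMap.ext fun v => ?_
  simp only [blockEnd, Module.End.mul_apply, LinearMap.comp_apply, lcomapDomain_lmapDomain, if_true]

theorem blockEnd_mul_of_ne (h : j ≠ k) (f g : Module.End ℤ (S →₀ ℤ)) :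
    blockEnd i j f * blockEnd k l g = 0 := by
  refine LinearMap.ext fun v => ?_
  simp only [blockEnd, Module.End.mul_apply, LinearMap.comp_apply, lcomapDomain_lmapDomain,
    if_neg h.symm, map_zero, LinearMap.zero_apply]

theorem blockEnd_apply (f : Module.End ℤ (S →₀ ℤ)) (s t : S) :
    blockEnd i j f (Finsupp.single (t, j) 1) (s, i) = f (Finsupp.single t 1) s := by
  have := lcomapDomain_lmapDomain j j (Finsupp.single t (1 : ℤ))
  rw [if_pos rfl, Finsupp.lmapDomain_apply, Finsupp.mapDomain_single] at this
  rw [blockEnd, LinearMap.comp_apply, LinearMap.comp_apply, this, Finsupp.lmapDomain_apply,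
    Finsupp.mapDomain_apply (Prod.mk_left_injective i)]

theorem blockEnd_apply_of_ne (h : k ≠ i) (f : Module.End ℤ (S →₀ ℤ)) (v : S × Fin 4 →₀ ℤ) (s : S) :
    blockEnd i j f v (s, k) = 0 := by
  simp [blockEnd, Finsupp.mapDomain_of_notMem_range, h.symm]

theorem blockEnd_E (s t : S) :
    blockEnd i j (RCMatrix.E s t).toEnd = (RCMatrix.E (s, i) (t, j)).toEnd := by
  classical
  refine LinearMap.ext fun v => Finsupp.ext fun ⟨u, k⟩ => ?_
  rw [RCMatrix.toEnd_E_apply]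
  by_cases hk : k = i
  · subst hk
    rw [blockEnd, LinearMap.comp_apply, LinearMap.comp_apply, Finsupp.lmapDomain_apply,
      Finsupp.mapDomain_apply (Prod.mk_left_injective k), RCMatrix.toEnd_E_apply]
    simp [Prod.ext_iff]
  · rw [blockEnd_apply_of_ne hk, if_neg fun h => hk (congrArg Prod.snd h)]

theorem blockEnd_sq (h : i ≠ j) (f : Module.End ℤ (S →₀ ℤ)) :
    blockEnd i j f * blockEnd i j f = 0 := blockEnd_mul_of_ne h.symm f f

/-- The elementary block matrix. -/
def blockElem (i j : Fin 4) (f : Module.End ℤ (S →₀ ℤ)) : (Module.End ℤ (S × Fin 4 →₀ ℤ))ˣ :=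
  if h : i ≠ j then oneAdd (blockEnd i j f) (blockEnd_sq h f) else 1

theorem blockElem_of_ne (h : i ≠ j) (f : Module.End ℤ (S →₀ ℤ)) :
    blockElem i j f = oneAdd (blockEnd i j f) (blockEnd_sq h f) := dif_pos h

theorem val_blockElem (h : i ≠ j) (f : Module.End ℤ (S →₀ ℤ)) :
    (blockElem i j f : Module.End ℤ (S × Fin 4 →₀ ℤ)) = 1 + blockEnd i j f := by
  rw [blockElem_of_ne h, oneAdd]

theorem blockElem_add (h : i ≠ j) (f g : Module.End ℤ (S →₀ ℤ)) :
    blockElem i j (f + g) = blockElem i j f * blockElem i j g := by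
  rw [blockElem_of_ne h, blockElem_of_ne h, blockElem_of_ne h, ← oneAdd_mul (h := by
    rw [← blockEnd_add]; exact blockEnd_sq h _)]
  · simp only [blockEnd_add]
  · exact blockEnd_mul_of_ne h.symm f g

theorem blockElem_commutator (hij : i ≠ j) (hjk : j ≠ k) (hik : i ≠ k)
    (f g : Module.End ℤ (S →₀ ℤ)) : ⁅blockElem i j f, blockElem j k g⁆ = blockElem i k (f * g) := by
  rw [blockElem_of_ne hij, blockElem_of_ne hjk, blockElem_of_ne hik,
    oneAdd_commutator _ _ (blockEnd_mul_of_ne hik.symm g f)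
      (by rw [blockEnd_mul]; exact blockEnd_sq hik _)]
  simp only [blockEnd_mul]

theorem blockElem_commute (hij : i ≠ j) (hkl : k ≠ l) (hjk : j ≠ k) (hil : i ≠ l)
    (f g : Module.End ℤ (S →₀ ℤ)) : Commute (blockElem i j f) (blockElem k l g) := by
  rw [blockElem_of_ne hij, blockElem_of_ne hkl]
  exact oneAdd_commute _ _ (blockEnd_mul_of_ne hjk f g) (blockEnd_mul_of_ne hil.symm g f)

end BlockMatrices

/-! ### The natural representation of `Γ₀` -/

namespace CrazyRing

variable (G S : Type*) [Group G] [MulAction G S]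

/-- The natural representation `(a, m) ↦ φ₀(a) + m`. -/
def rep : CrazyRing G S →+* Module.End ℤ (S →₀ ℤ) :=
  (RCMatrix.toEndHom S).comp
    { toFun := fun r => RCMatrix.phi G S r.grp + r.mat
      map_one' := by simp
      map_mul' := fun r r' => by
        simp only [mul_grp, mul_mat, map_mul]
        noncomm_ring
      map_zero' := by simp
      map_add' := fun r r' => by
        simp only [add_grp, add_mat, map_add]
        abel }

variable {G S} in
theorem rep_E (s t : S) : rep G S (E G s t) = (RCMatrix.E s t).toEnd := by
  simp [rep, RCMatrix.toEndHom_apply]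

end CrazyRing

namespace Gamma0

variable {G S : Type*} [Group G] [MulAction G S] {s₀ : S}

variable (G S) in
/-- The natural representation of the Steinberg group. -/
def steinbergRep : Steinberg 4 (CrazyRing G S) →* (Module.End ℤ (S × Fin 4 →₀ ℤ))ˣ :=
  Steinberg.lift (fun i j r => blockElem i j (CrazyRing.rep G S r))
    (fun i j h r r' => by rw [map_add, blockElem_add h])
    (fun i j k hij hjk hik r r' => by rw [blockElem_commutator hij hjk hik, map_mul])
    (fun i j p q hij hpq hjp hiq r r' => blockElem_commute hij hpq hjp hiq _ _)

theorem steinbergRep_rTilde :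
    steinbergRep G S (Steinberg.rTilde (CrazyRing.E G s₀ s₀)) = 1 := by
  have h01 : (0 : Fin 4) ≠ 1 := by decide
  rw [Steinberg.rTilde, map_pow, map_mul, map_mul, Steinberg.e_neg, map_inv, steinbergRep,
    Steinberg.lift_e, Steinberg.lift_e, CrazyRing.rep_E, blockElem_of_ne h01,
    blockElem_of_ne h01.symm]
  refine oneAdd_weyl_pow_four _ _ ?_ ?_ <;>
  · simp only [blockEnd_E, ← RCMatrix.toEnd_mul, RCMatrix.E_mul_E]

variable (G) in
/-- The natural representation of `Γ₀`. -/
def rep (s₀ : S) : Gamma0 G s₀ →* (Module.End ℤ (S × Fin 4 →₀ ℤ))ˣ :=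
  QuotientGroup.lift _ (steinbergRep G S) (Subgroup.normalClosure_le_normal
    (by rintro _ rfl; exact steinbergRep_rTilde))

theorem rep_e (i j : Fin 4) (hij : i ≠ j) (r : CrazyRing G S) :
    rep G s₀ (e G s₀ i j hij r) = blockElem i j (CrazyRing.rep G S r) := by
  rw [rep, e, QuotientGroup.lift_mk, steinbergRep, Steinberg.lift_e]

theorem rep_x {a b : S × Fin 4} (hab : a ≠ b) :
    rep G s₀ (x s₀ a b) = RCMatrix.unitsHom (S × Fin 4)
      (RCMatrix.elemUnit a b) := by
  have key {a b : S × Fin 4} (h : a.2 ≠ b.2) : rep G s₀ (x s₀ a b)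
      = RCMatrix.unitsHom (S × Fin 4) (RCMatrix.elemUnit a b) := by
    ext1
    rw [x_of_ne h, rep_e, CrazyRing.rep_E, val_blockElem h, blockEnd_E, RCMatrix.val_unitsHom,
      RCMatrix.val_elemUnit (ne_of_apply_ne Prod.snd h)]
    exact (RCMatrix.toEnd_one.symm ▸ RCMatrix.toEnd_add 1 (RCMatrix.E a b)).symm
  obtain ⟨n, n1, n2, -⟩ := exists_fin_four_ne a.2 b.2 b.2
  have h1 : a ≠ (a.1, n) := ne_of_apply_ne Prod.snd n1.symm
  have h2 : (a.1, n) ≠ b := ne_of_apply_ne Prod.snd n2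
  rw [← elementaryRelations.commutator h1 h2 hab, map_commutatorElement, key n1.symm,
    key (a := (a.1, n)) n2, ← map_commutatorElement, RCMatrix.elemUnit_commutator h1 h2 hab]

variable (G) in
/-- The action of `Γ₀` on `ℤ^{⊕ S × {1, 2, 3, 4}}`. -/
abbrev mulAction (s₀ : S) : MulAction (Gamma0 G s₀) (S × Fin 4 →₀ ℤ) :=
  MulAction.compHom _ (rep G s₀)

/-- On `Δ₀` the representation is the action of elementary integer matrices, so this is the
faithfulness obtained from peak reduction, applied to `y * z⁻¹`. -/
theorem rep_injOn : Set.InjOn (rep G s₀) (Delta0 G s₀) := by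
  let _ := mulAction G s₀
  have h : IntSteinberg (x (G := G) s₀) :=
    { elementaryRelations with
      smul_apply := fun {a b} hab v k => by
        have : x (G := G) s₀ a b • v = RCMatrix.elemUnit a b • v := by
          change (rep G s₀ (x s₀ a b)) • v = _
          rw [rep_x hab]; rfl
        rw [this, RCMatrix.elementaryAction.smul_apply hab]
      braid := fun {a b} hab => by
        obtain ⟨c, h1, h2⟩ := exists_index_ne a b
        exact elementaryRelations.braid hab h1 h2
      pow_four := weyl_pow_four }
  intro y hy z hz hyz
  rw [← mul_inv_eq_one]
  refine h.eq_one_of_smul_eq ?_ fun v => ?_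
  · rw [← delta0_eq]
    exact mul_mem hy (inv_mem hz)
  · change (rep G s₀ (y * z⁻¹)) • v = v
    rw [map_mul, map_inv, hyz, mul_inv_cancel, one_smul]

theorem map_rep_delta0 : (Delta0 G s₀).map (rep G s₀) = Subgroup.closure
    {u | ∃ a b, a ≠ b ∧ u = RCMatrix.unitsHom (S × Fin 4)
      (RCMatrix.elemUnit a b)} := by
  rw [delta0_eq, MonoidHom.map_closure]
  congr 1
  ext u
  constructor
  · rintro ⟨_, ⟨a, b, hab, rfl⟩, rfl⟩
    exact ⟨a, b, hab, rep_x hab⟩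
  · rintro ⟨a, b, hab, rfl⟩
    exact ⟨_, ⟨a, b, hab, rfl⟩, rep_x hab⟩

end Gamma0

end CrazyGroup

end

noncomputable section

namespace CrazyGroup

/-! ### Generation of `SL_∞(ℤ)` by elementary matrices -/

section Transitivity

variable {I G : Type*} [Group G] {x : I → I → G} {J : Finset I}

theorem weyl_mem_elemSubgroup {i j : I} (hij : i ≠ j) (hi : i ∈ J) (hj : j ∈ J) :
    weyl x i j ∈ elemSubgroup x J :=
  mul_mem (mul_mem (mem_elemSubgroup hij hi hj) (inv_mem (mem_elemSubgroup hij.symm hj hi)))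
    (mem_elemSubgroup hij hi hj)

/-- The Euclidean algorithm ends at a signed basis vector, which Weyl elements move to `e_o`. The
second index `l` is needed to change the sign of `-e_o`. -/
theorem ElementaryAction.exists_smul_eq_single [MulAction G (I →₀ ℤ)] (h : ElementaryAction x)
    {o l : I} (ho : o ∈ J) (hl : l ∈ J) (hol : o ≠ l) {v : I →₀ ℤ} (hv : IsPrim J v) :
    ∃ g ∈ elemSubgroup x J, g • v = Finsupp.single o 1 := by
  induction hn : norm1 J v using Nat.strong_induction_on generalizing v with
  | _ n ih =>
    by_cases h1 : ∃ k ∈ J, ∃ c : ℤ, (c = 1 ∨ c = -1) ∧ v = Finsupp.single k c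
    · obtain ⟨k, hk, c, hc, rfl⟩ := h1
      by_cases hko : k = o
      · subst hko
        obtain rfl | rfl := hc
        · exact ⟨1, one_mem _, one_smul _ _⟩
        · have hw := weyl_mem_elemSubgroup (x := x) hol ho hl
          refine ⟨_, mul_mem hw hw, ?_⟩
          rw [mul_smul, h.weyl_smul_single_left hol, h.weyl_smul_single_right hol, neg_neg]
      · obtain rfl | rfl := hc
        · exact ⟨_, weyl_mem_elemSubgroup (Ne.symm hko) ho hk,
            h.weyl_smul_single_right (Ne.symm hko) 1⟩
        · exact ⟨_, weyl_mem_elemSubgroup hko hk ho, h.weyl_smul_single_left hko (-1)⟩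
    · push Not at h1
      obtain ⟨i, j, ε, hr⟩ := exists_reduces hv h1
      obtain ⟨g, hg, hgv⟩ := ih _ (hn ▸ h.norm1_lt_of_reduces hr)
        (h.isPrim_zpow_smul hr.ne hr.left_mem hr.sign hv) rfl
      exact ⟨g * x i j ^ ε, mul_mem hg
        (zpow_mem (mem_elemSubgroup hr.ne hr.left_mem hr.right_mem) ε), by rw [mul_smul, hgv]⟩

end Transitivity

namespace RCMatrix

theorem zsmul_entry {I : Type*} (n : ℤ) (A : RCMatrix I) (i j : I) :
    (n • A).entry i j = n * A.entry i j :=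
  map_zsmul (⟨⟨fun A => A.entry i j, rfl⟩, fun _ _ => rfl⟩ : RCMatrix I →+ ℤ) n A

theorem elemUnit_zpow_entry {I : Type*} [DecidableEq I] {a b : I} (hab : a ≠ b) (A : RCMatrix I)
    (n : ℤ) (i k : I) : (A * (elemUnit a b ^ n : (RCMatrix I)ˣ)).entry i k
      = A.entry i k + if k = b then n * A.entry i a else 0 := by
  have hE : (A * E a b).entry i k = if k = b then A.entry i a else 0 := by
    rw [mul_entry, finsum_eq_single _ a]
    · simp [E]
    · intro j hj
      simp [E, hj]
  rw [elemUnit_of_ne hab, val_oneAdd_zpow, mul_add, mul_one, mul_smul_comm, add_entry, zsmul_entry, hE]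
  split_ifs <;> simp

end RCMatrix

open RCMatrix

theorem isOneOutside_elemUnit {m n N : ℕ} (hmn : m ≠ n) (hm : m < N) (hn : n < N) :
    IsOneOutside N (elemUnit m n : RCMatrix ℕ) := by
  intro i j hij
  rw [val_elemUnit hmn, add_entry, add_eq_left]
  simp only [E]
  rw [if_neg]
  rintro ⟨rfl, rfl⟩
  omega

theorem isOneOutside_of_mem_elemSubgroup {N : ℕ} {u : (RCMatrix ℕ)ˣ}
    (hu : u ∈ elemSubgroup elemUnit (Finset.range N)) : IsOneOutside N (u : RCMatrix ℕ) := by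
  induction hu using Subgroup.closure_induction with
  | mem u hu =>
    obtain ⟨i, hi, j, hj, hij, rfl⟩ := hu
    exact isOneOutside_elemUnit hij (Finset.mem_range.1 hi) (Finset.mem_range.1 hj)
  | one => exact fun _ _ _ => rfl
  | mul u v _ _ hu hv => exact hu.mul hv
  | inv u _ hu => exact hu.inv

theorem elemUnit_mem_SLInf {m n : ℕ} (hmn : m ≠ n) : elemUnit m n ∈ SLInf := by
  refine ⟨⟨m + n + 1, isOneOutside_elemUnit hmn (by omega) (by omega)⟩, ?_⟩
  filter_upwards [Filter.eventually_ge_atTop (m + n + 1)] with k hk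
  have : block k (elemUnit m n : RCMatrix ℕ)
      = Matrix.transvection (⟨m, by omega⟩ : Fin k) ⟨n, by omega⟩ (1 : ℤ) := by
    ext i j
    rw [block, Matrix.of_apply, val_elemUnit hmn, add_entry, one_entry, Matrix.transvection,
      Matrix.add_apply, Matrix.one_apply, Matrix.single_apply]
    simp only [E, Fin.ext_iff, eq_comm]
    congr
  rw [this, Matrix.det_transvection_of_ne _ _ (by simpa [Fin.ext_iff] using hmn)]

/-- If `d` divides the column `u • e_N = d • w`, then `e_N = d • (u⁻¹ • w)`, so `d` divides `1`. -/
theorem isPrim_col {N : ℕ} {u : (RCMatrix ℕ)ˣ} (hu : IsOneOutside (N + 1) (u : RCMatrix ℕ)) :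
    IsPrim (Finset.range (N + 1)) (u • Finsupp.single N (1 : ℤ)) where
  apply_eq_zero k hk := by
    rw [units_smul, toEnd_single, hu k N (Or.inl (by simpa using hk)), one_entry, if_neg]
    simp at hk
    omega
  isUnit d hd := by
    obtain ⟨w, hw⟩ : ∃ w : ℕ →₀ ℤ, u • Finsupp.single N (1 : ℤ) = d • w := by
      refine ⟨(u • Finsupp.single N (1 : ℤ)).mapRange (· / d) (Int.zero_ediv d), ?_⟩
      ext k
      simp [Int.mul_ediv_cancel' (hd k)]
    have : Finsupp.single N (1 : ℤ) = d • (u⁻¹ • w) := by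
      rw [units_smul u⁻¹ w, ← map_smul, ← hw, ← units_smul, inv_smul_smul]
    have := DFunLike.congr_fun this N
    rw [Finsupp.single_eq_same, Finsupp.smul_apply, smul_eq_mul] at this
    exact IsUnit.of_mul_eq_one _ this.symm

/-- The column `N` is already that of the identity, so subtracting its multiples from the other
columns clears the row `N` and disturbs nothing else. -/
theorem exists_clear_row {N : ℕ} {u : (RCMatrix ℕ)ˣ}
    (hu : ∀ i, (u : RCMatrix ℕ).entry i N = (1 : RCMatrix ℕ).entry i N) (K : Finset ℕ)
    (hK : K ⊆ Finset.range N) : ∃ c ∈ elemSubgroup elemUnit (Finset.range (N + 1)),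
      (∀ i, (u * c : RCMatrix ℕ).entry i N = (1 : RCMatrix ℕ).entry i N) ∧
      ∀ j ∈ K, (u * c : RCMatrix ℕ).entry N j = 0 := by
  induction K using Finset.induction_on with
  | empty => exact ⟨1, one_mem _, by simpa using hu, by simp⟩
  | insert j K hj ih =>
    obtain ⟨c, hc, h1, h2⟩ := ih ((Finset.subset_insert j K).trans hK)
    have hjN : j < N := Finset.mem_range.1 (hK (Finset.mem_insert_self j K))
    have hNj : N ≠ j := by omega
    refine ⟨c * elemUnit N j ^ (-(u * c : RCMatrix ℕ).entry N j), mul_mem hc (zpow_mem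
      (mem_elemSubgroup hNj (by simp) (by simp; omega)) _), fun i => ?_, fun k hk => ?_⟩
    · rw [Units.val_mul, ← mul_assoc, elemUnit_zpow_entry hNj, if_neg hNj, add_zero, h1]
    · rw [Units.val_mul, ← mul_assoc, elemUnit_zpow_entry hNj]
      by_cases hkj : k = j
      · rw [if_pos hkj, h1 N, one_entry, if_pos rfl, hkj]
        ring
      · rw [if_neg hkj, add_zero, h2 k ((Finset.mem_insert.1 hk).resolve_left hkj)]

theorem eq_one_of_isOneOutside_one {u : (RCMatrix ℕ)ˣ} (hu : u ∈ SLInf)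
    (h : IsOneOutside 1 (u : RCMatrix ℕ)) : u = 1 := by
  obtain ⟨k, hk, hk1⟩ := (hu.2.and (Filter.eventually_ge_atTop 1)).exists
  have hb : block k (u : RCMatrix ℕ) = Matrix.diagonal
      (fun i : Fin k => if i = ⟨0, hk1⟩ then (u : RCMatrix ℕ).entry 0 0 else 1) := by
    ext i j
    rw [block, Matrix.of_apply, Matrix.diagonal_apply]
    by_cases hi : (i : ℕ) = 0
    · by_cases hj : (j : ℕ) = 0
      · simp [Fin.ext_iff, hi, hj]
      · rw [h _ _ (Or.inr (by omega)), one_entry]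
        simp [Fin.ext_iff, hi, Ne.symm hj]
    · rw [h _ _ (Or.inl (by omega)), one_entry]
      simp [Fin.ext_iff, hi]
  rw [hb, Matrix.det_diagonal, Finset.prod_ite_eq' _ _ (fun _ => (u : RCMatrix ℕ).entry 0 0)] at hk
  simp only [Finset.mem_univ, if_true] at hk
  ext i j
  by_cases hij : i = 0 ∧ j = 0
  · rw [hij.1, hij.2, hk, Units.val_one, one_entry, if_pos rfl]
  · exact h i j (by omega)

/-- Gaussian elimination on the size of the block: multiplication from the left turns the last
column into a basis vector, multiplication from the right clears the last row. At size one the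
determinant condition leaves only the identity. -/
theorem SLInf_eq_closure : SLInf = Subgroup.closure {u | ∃ m n, m ≠ n ∧ u = elemUnit m n} := by
  refine le_antisymm ?_ ((Subgroup.closure_le _).2 ?_)
  swap
  · rintro _ ⟨m, n, hmn, rfl⟩
    exact elemUnit_mem_SLInf hmn
  have hle (J : Finset ℕ) : elemSubgroup elemUnit J
      ≤ Subgroup.closure {u : (RCMatrix ℕ)ˣ | ∃ m n, m ≠ n ∧ u = elemUnit m n} :=
    Subgroup.closure_mono fun _ ⟨i, _, j, _, hij, e⟩ => ⟨i, j, hij, e⟩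
  have hSL : Subgroup.closure {u : (RCMatrix ℕ)ˣ | ∃ m n, m ≠ n ∧ u = elemUnit m n} ≤ SLInf :=
    (Subgroup.closure_le _).2 (by rintro _ ⟨m, n, hmn, rfl⟩; exact elemUnit_mem_SLInf hmn)
  have key (N : ℕ) : ∀ u ∈ SLInf, IsOneOutside (N + 1) (u : RCMatrix ℕ) →
      u ∈ Subgroup.closure {u : (RCMatrix ℕ)ˣ | ∃ m n, m ≠ n ∧ u = elemUnit m n} := by
    induction N with
    | zero =>
      intro u hu h
      rw [eq_one_of_isOneOutside_one hu h]
      exact one_mem _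
    | succ N ih =>
      intro u hu h
      obtain ⟨g, hg, hgu⟩ := elementaryAction.exists_smul_eq_single (o := N + 1) (l := 0)
        (J := Finset.range (N + 2)) (by simp) (by simp) (by simp) (isPrim_col h)
      have hcol (i : ℕ) : ((g * u : (RCMatrix ℕ)ˣ) : RCMatrix ℕ).entry i (N + 1)
          = (1 : RCMatrix ℕ).entry i (N + 1) := by
        rw [← toEnd_single, ← units_smul, mul_smul, hgu, ← toEnd_single, toEnd_one]
        rfl
      obtain ⟨c, hc, h1, h2⟩ := exists_clear_row hcol (Finset.range (N + 1)) subset_rfl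
      have hout : IsOneOutside (N + 2) ((g * u * c : (RCMatrix ℕ)ˣ) : RCMatrix ℕ) :=
        ((isOneOutside_of_mem_elemSubgroup hg).mul h).mul (isOneOutside_of_mem_elemSubgroup hc)
      have := ih (g * u * c) (mul_mem (mul_mem (hSL (hle _ hg)) hu) (hSL (hle _ hc))) (by
        intro i j hij
        by_cases h3 : N + 2 ≤ i ∨ N + 2 ≤ j
        · exact hout i j h3
        · by_cases hj : j = N + 1
          · rw [hj]
            exact h1 i
          · have hi : i = N + 1 := by omega
            rw [hi, one_entry, if_neg (Ne.symm hj)]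
            exact h2 j (by simp; omega))
      have h4 : u = g⁻¹ * (g * u * c) * c⁻¹ := by group
      rw [h4]
      exact mul_mem (mul_mem (inv_mem (hle _ hg)) this) (inv_mem (hle _ hc))
  intro u hu
  obtain ⟨N, hN⟩ := hu.1
  exact key N u hu (hN.mono (Nat.le_succ N))

end CrazyGroup

end

noncomputable section

namespace CrazyGroup

/-! ### The isomorphism between `Δ₀` and `SL_∞(ℤ)` -/

instance : Countable DyadicPoint := by
  choose a k h using fun x : DyadicPoint => x.2.2.2
  refine Function.Injective.countable (f := fun x => (a x, k x)) fun x y hxy => ?_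
  rw [Prod.mk.injEq] at hxy
  exact Subtype.ext (Subtype.ext (by rw [h x, h y, hxy.1, hxy.2]))

instance : Infinite DyadicPoint := by
  have h0 (n : ℕ) : (0 : ℝ) < 1 / 2 ^ (n + 1) := by positivity
  have h1 (n : ℕ) : (1 : ℝ) / 2 ^ (n + 1) < 1 := by
    rw [div_lt_one (by positivity)]
    exact one_lt_pow₀ one_lt_two n.succ_ne_zero
  refine Infinite.of_injective (fun n : ℕ => (⟨⟨1 / 2 ^ (n + 1), (h0 n).le, (h1 n).le⟩, h0 n, h1 n,
    1, n + 1, by simp⟩ : DyadicPoint)) fun m n h => ?_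
  have h : (1 : ℝ) / 2 ^ (m + 1) = 1 / 2 ^ (n + 1) :=
    congrArg (fun x : DyadicPoint => (x.1 : ℝ)) h
  rw [div_eq_div_iff (by positivity) (by positivity), one_mul, one_mul] at h
  have := pow_right_injective₀ (M₀ := ℝ) two_pos (by norm_num) h
  omega

namespace RCMatrix

/-- The representation of invertible `ℕ × ℕ` matrices on `ℤ^{⊕I}` given by an enumeration
of `I`. -/
def reindexHom {I : Type*} (ε : ℕ ≃ I) : (RCMatrix ℕ)ˣ →* (Module.End ℤ (I →₀ ℤ))ˣ :=
  (Units.map ((Finsupp.domLCongr ε : (ℕ →₀ ℤ) ≃ₗ[ℤ] (I →₀ ℤ)).conjRingEquiv : _ →* _)).comp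
    (unitsHom ℕ)

theorem val_reindexHom {I : Type*} (ε : ℕ ≃ I) (u : (RCMatrix ℕ)ˣ) :
    (reindexHom ε u : Module.End ℤ (I →₀ ℤ))
      = (Finsupp.domLCongr ε : (ℕ →₀ ℤ) ≃ₗ[ℤ] (I →₀ ℤ)).conjRingEquiv (u : RCMatrix ℕ).toEnd := rfl

theorem reindexHom_injective {I : Type*} (ε : ℕ ≃ I) : Function.Injective (reindexHom ε) :=
  fun u v h => by
    have := congrArg Units.val h
    rw [val_reindexHom, val_reindexHom, EmbeddingLike.apply_eq_iff_eq] at this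
    exact Units.ext (toEnd_injective this)

theorem reindexHom_elemUnit {I : Type*} (ε : ℕ ≃ I) {m n : ℕ} (hmn : m ≠ n) :
    reindexHom ε (elemUnit m n) = unitsHom I (elemUnit (ε m) (ε n)) := by
  classical
  ext1
  refine end_ext fun i j => ?_
  rw [val_reindexHom, val_unitsHom, val_elemUnit hmn, val_elemUnit (ε.injective.ne hmn), toEnd_add,
    toEnd_add, toEnd_one, toEnd_one, map_add, map_one, LinearMap.add_apply, LinearMap.add_apply,
    Finsupp.add_apply, Finsupp.add_apply, toEnd_E_apply]
  congr 1
  simp only [LinearEquiv.conjRingEquiv_apply_apply, Finsupp.domLCongr_apply]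
  simp [toEnd_E_apply, Finsupp.single_apply, Equiv.eq_symm_apply, eq_comm]

end RCMatrix

/-- Groups with faithful representations of the same image are isomorphic. -/
theorem exists_mulEquiv_of_range_eq {A B H : Type*} [Group A] [Group B] [Group H] {f : A →* H}
    {g : B →* H} (hf : Function.Injective f) (hg : Function.Injective g) (h : f.range = g.range) :
    Nonempty (A ≃* B) :=
  ⟨(MonoidHom.ofInjective hf).trans
    ((MulEquiv.subgroupCongr h).trans (MonoidHom.ofInjective hg).symm)⟩

/-- After an enumeration of `S × Fin 4`, both groups act faithfully on the same free abelian group,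
and both images are generated by the same elementary matrices. -/
theorem exists_SLInf_hom {G S : Type*} [Group G] [MulAction G S] [Countable S] [Infinite S]
    (s₀ : S) : ∃ ψ : SLInf →* Gamma0 G s₀, Function.Injective ψ ∧ ψ.range = Delta0 G s₀ := by
  obtain ⟨ε⟩ := nonempty_equiv_of_countable (α := ℕ) (β := S × Fin 4)
  have h1 : Function.Injective ((RCMatrix.reindexHom ε).comp SLInf.subtype) :=
    (RCMatrix.reindexHom_injective ε).comp Subtype.val_injective
  have h2 : Function.Injective ((Gamma0.rep G s₀).comp (Delta0 G s₀).subtype) := fun y z h =>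
    Subtype.ext (Gamma0.rep_injOn y.2 z.2 h)
  have h3 : ((RCMatrix.reindexHom ε).comp SLInf.subtype).range
      = ((Gamma0.rep G s₀).comp (Delta0 G s₀).subtype).range := by
    rw [MonoidHom.range_comp, MonoidHom.range_comp, Subgroup.range_subtype, Subgroup.range_subtype,
      Gamma0.map_rep_delta0, SLInf_eq_closure, MonoidHom.map_closure]
    congr 1
    ext u
    constructor
    · rintro ⟨_, ⟨m, n, hmn, rfl⟩, rfl⟩
      exact ⟨ε m, ε n, ε.injective.ne hmn, RCMatrix.reindexHom_elemUnit ε hmn⟩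
    · rintro ⟨a, b, hab, rfl⟩
      refine ⟨_, ⟨ε.symm a, ε.symm b, ε.symm.injective.ne hab, rfl⟩, ?_⟩
      rw [RCMatrix.reindexHom_elemUnit ε (ε.symm.injective.ne hab), ε.apply_symm_apply,
        ε.apply_symm_apply]
  obtain ⟨e⟩ := exists_mulEquiv_of_range_eq h1 h2 h3
  refine ⟨(Delta0 G s₀).subtype.comp e.toMonoidHom, Subtype.val_injective.comp e.injective, ?_⟩
  rw [MonoidHom.range_comp, MonoidHom.range_eq_top.2 e.surjective, ← MonoidHom.range_eq_map,
    Subgroup.range_subtype]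

/-! ### The amalgam -/

section Amalgam

variable {K : Type*} [Group K] {g h : K}

/-- The homomorphism from `ℤ²` defined by a pair of commuting elements. -/
def intSqHom (hc : Commute g h) : Multiplicative ℤ × Multiplicative ℤ →* K where
  toFun z := g ^ z.1.toAdd * h ^ z.2.toAdd
  map_one' := by simp
  map_mul' z w := by
    simp only [Prod.fst_mul, Prod.snd_mul, toAdd_mul, zpow_add]
    exact Commute.mul_mul_mul_comm ((hc.zpow_right z.2.toAdd).zpow_left w.1.toAdd) _ _

theorem intSqHom_apply (hc : Commute g h) (z : Multiplicative ℤ × Multiplicative ℤ) :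
    intSqHom hc z = g ^ z.1.toAdd * h ^ z.2.toAdd := rfl

theorem intSqHom_injective (hc : Commute g h)
    (hi : ∀ a b : ℤ, g ^ a * h ^ b = 1 → a = 0 ∧ b = 0) : Function.Injective (intSqHom hc) := by
  refine (injective_iff_map_eq_one _).2 fun z hz => ?_
  obtain ⟨h1, h2⟩ := hi _ _ hz
  exact Prod.ext h1 h2

/-- The relators of the amalgam of two copies of a group over `ℤ²`. -/
abbrev amalgamRel (g h : K) : Set (Monoid.Coprod K K) :=
  {Monoid.Coprod.inl g * (Monoid.Coprod.inr h)⁻¹, Monoid.Coprod.inr g * (Monoid.Coprod.inl h)⁻¹}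

-- To identify the two embeddings of `ℤ²` it is enough to identify the images of the two basis
-- elements, and these are the two defining relators.
open Monoid in
theorem exists_mulEquiv_pushout (hc : Commute g h) :
    ∃ e : Coprod K K ⧸ Subgroup.normalClosure (amalgamRel g h) ≃*
        PushoutI (ι := Fin 2) (G := fun _ => K) ![intSqHom hc, intSqHom hc.symm],
      (∀ x, e (QuotientGroup.mk' _ (Coprod.inl x)) = PushoutI.of 0 x) ∧
      (∀ x, e (QuotientGroup.mk' _ (Coprod.inr x)) = PushoutI.of 1 x) := by
  set φ : Fin 2 → (Multiplicative ℤ × Multiplicative ℤ →* K) :=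
    ![intSqHom hc, intSqHom hc.symm] with hφ
  have rel (z : Multiplicative ℤ × Multiplicative ℤ) :
      (PushoutI.of 0 (intSqHom hc z) : PushoutI (G := fun _ => K) φ)
        = PushoutI.of 1 (intSqHom hc.symm z) :=
    (PushoutI.of_apply_eq_base φ 0 z).trans (PushoutI.of_apply_eq_base φ 1 z).symm
  have r1 : (PushoutI.of 0 g : PushoutI (G := fun _ => K) φ) = PushoutI.of 1 h := by
    simpa [intSqHom_apply] using rel (Multiplicative.ofAdd 1, 1)
  have r2 : (PushoutI.of 0 h : PushoutI (G := fun _ => K) φ) = PushoutI.of 1 g := by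
    simpa [intSqHom_apply] using rel (1, Multiplicative.ofAdd 1)
  let N := Subgroup.normalClosure (amalgamRel g h)
  let f : Coprod K K ⧸ N →* PushoutI (G := fun _ => K) φ :=
    QuotientGroup.lift N (Coprod.lift (PushoutI.of (G := fun _ => K) (φ := φ) 0)
      (PushoutI.of (G := fun _ => K) (φ := φ) 1))
      (Subgroup.normalClosure_le_normal (by
        rintro _ (rfl | rfl)
        · simp [MonoidHom.mem_ker, r1]
        · simp [MonoidHom.mem_ker, r2]))
  let ρ₁ : K →* Coprod K K ⧸ N := (QuotientGroup.mk' N).comp Coprod.inl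
  let ρ₂ : K →* Coprod K K ⧸ N := (QuotientGroup.mk' N).comp Coprod.inr
  have q1 : ρ₁ g = ρ₂ h := by
    rw [← mul_inv_eq_one, ← map_inv]
    exact (QuotientGroup.eq_one_iff _).2 (Subgroup.subset_normalClosure (by simp [amalgamRel]))
  have q2 : ρ₂ g = ρ₁ h := by
    rw [← mul_inv_eq_one, ← map_inv]
    exact (QuotientGroup.eq_one_iff _).2 (Subgroup.subset_normalClosure (by simp [amalgamRel]))
  let f' : PushoutI (G := fun _ => K) φ →* Coprod K K ⧸ N :=
    PushoutI.lift ![ρ₁, ρ₂] (ρ₁.comp (intSqHom hc)) (by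
      intro i
      fin_cases i
      · rfl
      · ext1 z
        change ρ₂ (intSqHom hc.symm z) = ρ₁ (intSqHom hc z)
        simp only [intSqHom_apply, map_mul, map_zpow, q1, q2])
  have h1 : f'.comp f = MonoidHom.id _ := by
    refine QuotientGroup.monoidHom_ext _ (Coprod.hom_ext ?_ ?_) <;> ext x
    · simp [f, f', ρ₁]
    · simp [f, f', ρ₂]
  have h2 : f.comp f' = MonoidHom.id _ := by
    refine PushoutI.hom_ext_nonempty fun i => ?_
    ext x
    fin_cases i
    · simp [f, f', ρ₁]
    · simp [f, f', ρ₂]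
  refine ⟨MonoidHom.toMulEquiv f f' h1 h2, fun x => ?_, fun x => ?_⟩
  · simp [f]
  · simp [f]

end Amalgam

/-! ### The elements `g` and `h` -/

open commutatorElement

namespace Gamma0

variable {G S : Type*} [Group G] [MulAction G S] {s₀ s : S}

theorem commute_g_h : Commute (g G s₀) (h G s₀ s) :=
  e_commute _ _ (by decide) (by decide) _ _

/-- In the natural representation `g` and `h` are unipotent in the disjoint block positions `(0, 1)`
and `(2, 3)`, so `a` and `b` can be read off as matrix entries. -/
theorem zpow_mul_zpow_eq_one {a b : ℤ} (hab : g G s₀ ^ a * h G s₀ s ^ b = 1) : a = 0 ∧ b = 0 := by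
  have h01 : (0 : Fin 4) ≠ 1 := by decide
  have h23 : (2 : Fin 4) ≠ 3 := by decide
  have key := congrArg (fun y => (rep G s₀ y : Module.End ℤ (S × Fin 4 →₀ ℤ))) hab
  simp only [map_mul, map_zpow, map_one, Units.val_mul, Units.val_one, g, h, rep_e,
    blockElem_of_ne h01, blockElem_of_ne h23, val_oneAdd_zpow] at key
  rw [mul_add, mul_one, add_mul, one_mul, smul_mul_smul_comm,
    blockEnd_mul_of_ne (by decide), smul_zero, add_zero, CrazyRing.rep_E] at key
  have k1 := DFunLike.congr_fun (LinearMap.congr_fun key (Finsupp.single (s, 1) 1)) (s, 0)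
  have k2 := DFunLike.congr_fun (LinearMap.congr_fun key (Finsupp.single (s, 3) 1)) (s, 2)
  simp only [LinearMap.add_apply, LinearMap.smul_apply, Finsupp.add_apply, Finsupp.smul_apply,
    blockEnd_apply, Module.End.one_apply] at k1 k2
  rw [blockEnd_apply_of_ne (by decide)] at k1 k2
  classical
  constructor
  · simpa [Finsupp.single_apply] using k1
  · simpa [Finsupp.single_apply, RCMatrix.toEnd_E] using k2

/-- Commutators with a generator of coefficient `1` produce every coefficient in the other positions
of the same row or column, and from there all positions are reached. -/
theorem eq_top_of_g_mem {N : Subgroup (Gamma0 G s₀)} [hN : N.Normal] (hg : g G s₀ ∈ N) :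
    N = ⊤ := by
  have left {y : Gamma0 G s₀} (z : Gamma0 G s₀) (hy : y ∈ N) : ⁅y, z⁆ ∈ N := by
    rw [commutatorElement_def, mul_assoc, mul_assoc, ← mul_assoc z]
    exact mul_mem hy (hN.conj_mem _ (inv_mem hy) z)
  have right {y : Gamma0 G s₀} (z : Gamma0 G s₀) (hy : y ∈ N) : ⁅z, y⁆ ∈ N := by
    rw [← commutatorElement_inv]
    exact inv_mem (left z hy)
  have row {i j k : Fin 4} (hij : i ≠ j) (hik : i ≠ k) (hjk : j ≠ k) (r : CrazyRing G S)
      (h1 : e G s₀ i j hij 1 ∈ N) : e G s₀ i k hik r ∈ N := by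
    have := left (e G s₀ j k hjk r) h1
    rwa [e_commutator hij hjk hik, one_mul] at this
  have column {i j k : Fin 4} (hij : i ≠ j) (hkj : k ≠ j) (hki : k ≠ i) (r : CrazyRing G S)
      (h1 : e G s₀ i j hij 1 ∈ N) : e G s₀ k j hkj r ∈ N := by
    have := right (e G s₀ k i hki r) h1
    rwa [e_commutator hki hij hkj, mul_one] at this
  let P (i j : Fin 4) : Prop := ∀ (hij : i ≠ j) (r : CrazyRing G S), e G s₀ i j hij r ∈ N
  have prow {i j : Fin 4} (hij : i ≠ j) (h1 : P i j) (k : Fin 4) : P i k := fun hik r => by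
    by_cases hjk : j = k
    · subst hjk
      exact h1 hik r
    · exact row hij hik hjk r (h1 hij 1)
  have pcol {i j : Fin 4} (hij : i ≠ j) (h1 : P i j) (k : Fin 4) : P k j := fun hkj r => by
    by_cases hki : k = i
    · subst hki
      exact h1 hkj r
    · exact column hij hkj hki r (h1 hij 1)
  -- The hypothesis gives only the coefficient `1` in position `(0, 1)`; position `(0, 2)` is the
  -- first one with arbitrary coefficients.
  have h02 : P 0 2 := fun h r => row (by decide) h (by decide) r hg
  have all (i j : Fin 4) : P i j := by
    by_cases hi : i = 2
    · subst hi
      exact prow (by decide) (pcol (by decide) (prow (by decide) h02 1) 2) j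
    · exact prow hi (pcol (by decide) h02 i) j
  rw [← top_le_iff, ← closure_e, Subgroup.closure_le]
  rintro _ ⟨i, j, hij, r, rfl⟩
  exact all i j hij r

end Gamma0

end CrazyGroup

end

noncomputable section

namespace CrazyGroup

/-! ### Properties of `Γ` -/

theorem isFinitelyPresented_quotient_normalClosure {G : Type*} [Group G]
    [Group.IsFinitelyPresented G] {s : Set G} (hs : s.Finite) :
    Group.IsFinitelyPresented (G ⧸ Subgroup.normalClosure s) :=
  Group.IsFinitelyPresented.quotient _ ⟨s, hs, rfl⟩

theorem isFinitelyPresented_gamma (s₀ s : DyadicPoint) :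
    Group.IsFinitelyPresented (Gamma ThompsonF s₀ s) := by
  have := isFinitelyPresented_steinberg_thompson
  have : Group.IsFinitelyPresented (Gamma0 ThompsonF s₀) :=
    isFinitelyPresented_quotient_normalClosure (Set.finite_singleton _)
  exact isFinitelyPresented_quotient_normalClosure (Set.toFinite _)

variable {G S : Type*} [Group G] [MulAction G S] (s₀ s : S)

theorem rho₁_g : rho₁ G s₀ s (Gamma0.g G s₀) = rho₂ G s₀ s (Gamma0.h G s₀ s) := by
  refine mul_inv_eq_one.1 ?_
  exact (QuotientGroup.eq_one_iff _).2 (Subgroup.subset_normalClosure (Or.inl rfl))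

theorem rho₂_g : rho₂ G s₀ s (Gamma0.g G s₀) = rho₁ G s₀ s (Gamma0.h G s₀ s) := by
  refine mul_inv_eq_one.1 ?_
  exact (QuotientGroup.eq_one_iff _).2 (Subgroup.subset_normalClosure (Or.inr rfl))

/-- The element `h` lies in `Δ₀`, and `ρ₁(h) = ρ₂(g)`. So the normal closure contains the second
copy of `Γ₀`, in particular `ρ₂(h) = ρ₁(g)`, and hence the first copy as well. -/
theorem normalClosure_map_delta0 : Subgroup.normalClosure
    ((Delta0 G s₀).map (rho₁ G s₀ s) : Set (Gamma G s₀ s)) = ⊤ := by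
  set N := Subgroup.normalClosure ((Delta0 G s₀).map (rho₁ G s₀ s) : Set (Gamma G s₀ s))
  have h1 : rho₁ G s₀ s (Gamma0.h G s₀ s) ∈ N :=
    Subgroup.subset_normalClosure ⟨_, Subgroup.subset_closure
      ⟨2, 3, by decide, CrazyRing.E G s s, CrazyRing.E_grp s s, rfl⟩, rfl⟩
  have h2 : N.comap (rho₂ G s₀ s) = ⊤ :=
    Gamma0.eq_top_of_g_mem (by rw [Subgroup.mem_comap, rho₂_g]; exact h1)
  have h3 : N.comap (rho₁ G s₀ s) = ⊤ := Gamma0.eq_top_of_g_mem (by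
    rw [Subgroup.mem_comap, rho₁_g, ← Subgroup.mem_comap, h2]; exact Subgroup.mem_top _)
  have h4 : N.comap (QuotientGroup.mk' _) = ⊤ := by
    rw [← top_le_iff, ← Monoid.Coprod.range_inl_sup_range_inr, sup_le_iff]
    refine ⟨?_, ?_⟩
    · rintro _ ⟨y, rfl⟩
      exact (h3 ▸ Subgroup.mem_top y : y ∈ N.comap (rho₁ G s₀ s))
    · rintro _ ⟨y, rfl⟩
      exact (h2 ▸ Subgroup.mem_top y : y ∈ N.comap (rho₂ G s₀ s))
  rw [← Subgroup.map_comap_eq_self_of_surjective (QuotientGroup.mk'_surjective _) N, h4,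
    Subgroup.map_top_of_surjective _ (QuotientGroup.mk'_surjective _)]

theorem exists_amalgam : ∃ φ : Fin 2 → (Multiplicative ℤ × Multiplicative ℤ →* Gamma0 G s₀),
    (∀ i, Function.Injective (φ i)) ∧
    φ 0 (Multiplicative.ofAdd 1, 1) = Gamma0.g G s₀ ∧
    φ 0 (1, Multiplicative.ofAdd 1) = Gamma0.h G s₀ s ∧
    φ 1 (Multiplicative.ofAdd 1, 1) = Gamma0.h G s₀ s ∧
    φ 1 (1, Multiplicative.ofAdd 1) = Gamma0.g G s₀ ∧
    ∃ e : Gamma G s₀ s ≃* Monoid.PushoutI φ,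
      (∀ x, e (rho₁ G s₀ s x) = Monoid.PushoutI.of 0 x) ∧
      (∀ x, e (rho₂ G s₀ s x) = Monoid.PushoutI.of 1 x) := by
  have hc := Gamma0.commute_g_h (G := G) (s₀ := s₀) (s := s)
  refine ⟨![intSqHom hc, intSqHom hc.symm], ?_, ?_, ?_, ?_, ?_, exists_mulEquiv_pushout hc⟩
  · intro i
    fin_cases i
    · exact intSqHom_injective hc fun a b => Gamma0.zpow_mul_zpow_eq_one
    · refine intSqHom_injective hc.symm fun a b hab => ?_
      rw [((hc.zpow_left b).zpow_right a).symm.eq] at hab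
      exact (Gamma0.zpow_mul_zpow_eq_one hab).symm
  all_goals simp [intSqHom_apply]

theorem rho_injective :
    Function.Injective (rho₁ G s₀ s) ∧ Function.Injective (rho₂ G s₀ s) := by
  obtain ⟨φ, hφ, -, -, -, -, e, he₁, he₂⟩ := exists_amalgam (G := G) s₀ s
  exact ⟨fun x y h => Monoid.PushoutI.of_injective hφ 0 (by rw [← he₁, h, he₁]),
    fun x y h => Monoid.PushoutI.of_injective hφ 1 (by rw [← he₂, h, he₂])⟩

theorem exists_SLInf_hom_gamma [Countable S] [Infinite S] : ∃ ι : SLInf →* Gamma G s₀ s,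
    Function.Injective ι ∧
    ι.range = (Delta0 G s₀).map (rho₁ G s₀ s) ∧
    Subgroup.normalClosure (ι.range : Set (Gamma G s₀ s)) = ⊤ := by
  obtain ⟨ψ, hψ, hr⟩ := exists_SLInf_hom (G := G) s₀
  have hrange : ((rho₁ G s₀ s).comp ψ).range = (Delta0 G s₀).map (rho₁ G s₀ s) := by
    rw [MonoidHom.range_comp, hr]
  refine ⟨(rho₁ G s₀ s).comp ψ, (rho_injective s₀ s).1.comp hψ, hrange, ?_⟩
  rw [hrange]
  exact normalClosure_map_delta0 s₀ s

end CrazyGroup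

end

open CrazyGroup in
theorem theorem2 (s₀ s : DyadicPoint) :
    -- `Γ` is finitely presented
    Group.IsFinitelyPresented (Gamma ThompsonF s₀ s) ∧
    -- `Γ` is the amalgam of two copies of `Γ₀` over `ℤ²`, embedded by sending its basis
    -- to `(g, h)` in the first copy and to `(h, g)` in the second
    (∃ φ : Fin 2 → (Multiplicative ℤ × Multiplicative ℤ →* Gamma0 ThompsonF s₀),
      (∀ i, Function.Injective (φ i)) ∧
      φ 0 (Multiplicative.ofAdd 1, 1) = Gamma0.g ThompsonF s₀ ∧
      φ 0 (1, Multiplicative.ofAdd 1) = Gamma0.h ThompsonF s₀ s ∧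
      φ 1 (Multiplicative.ofAdd 1, 1) = Gamma0.h ThompsonF s₀ s ∧
      φ 1 (1, Multiplicative.ofAdd 1) = Gamma0.g ThompsonF s₀ ∧
      ∃ e : Gamma ThompsonF s₀ s ≃* Monoid.PushoutI φ,
        (∀ x, e (rho₁ ThompsonF s₀ s x) = Monoid.PushoutI.of 0 x) ∧
        (∀ x, e (rho₂ ThompsonF s₀ s x) = Monoid.PushoutI.of 1 x)) ∧
    Function.Injective (rho₁ ThompsonF s₀ s) ∧
    Function.Injective (rho₂ ThompsonF s₀ s) ∧
    -- `Γ` contains `SL_∞(ℤ)`, as `ρ₁(Δ₀)`, and is normally generated by it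
    ∃ ι : SLInf →* Gamma ThompsonF s₀ s,
      Function.Injective ι ∧
      ι.range = (Delta0 ThompsonF s₀).map (rho₁ ThompsonF s₀ s) ∧
      Subgroup.normalClosure (ι.range : Set (Gamma ThompsonF s₀ s)) = ⊤ := by
  exact ⟨isFinitelyPresented_gamma s₀ s, exists_amalgam s₀ s, (rho_injective s₀ s).1,
    (rho_injective s₀ s).2, exists_SLInf_hom_gamma s₀ s⟩
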